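/- Use coordinates $(t,z_1,z_2,z_3)$, $z_k=x_k+iy_k$, on $\mathbb R^7=\mathbb R\times\mathbb C^3$. Let $\Gamma$ be the group of transformations of $\mathbb R^7$ generated by the translations $z\mapsto z+n$, $n\in\mathbb Z[i]^3$, by $(t,z)\mapsto(t+1,iz_1,iz_2,-z_3)$, and by $$\iota_1(t,z)=(t,-z_1,-z_2,z_3+\tfrac12),\quad \iota_2(t,z)=(t,-z_1,-z_2,z_3+\tfrac i2),\quad \kappa(t,z)=(1-t,\bar z_1,\bar z_2,\bar z_3),$$ and let $X=\mathbb R^7/\Gamma$, a compact flat orbifold (that is, $X=M/\langle\iota_1,\iota_2,\kappa\rangle$, where $M$ is the mapping torus of $[z]\mapsto[iz_1,iz_2,-z_3]$ on $T^6=\mathbb C^3/\mathbb Z[i]^3$). Its singular locus has ten components $N_1,\dots,N_{10}$, the images of the following subspaces: * $N_1$: $t=0$, $z=(a(1-i),\,b(1-i),\,is)$; $\quad N_2$: $t=0$, $z=(a(1+i),\,b(1+i),\,-\tfrac14+is)$; * $N_3,\dots,N_6$: $t=\tfrac12$, $z=(a+i\varepsilon_1,\,b+i\varepsilon_2,\,s)$;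 $\quad N_7,\dots,N_{10}$: $t=\tfrac12$, $z=(\varepsilon_1+ia,\,\varepsilon_2+ib,\,s-\tfrac i4)$; here $a,b,s\in\mathbb R$, and $(\varepsilon_1,\varepsilon_2)$ runs through $(0,0),(0,\frac12),(\frac12,0),(\frac12,\frac12)$ in this order. The normal spaces of $N_j$ carry the complex structure $I$ with $\langle Iu,v\rangle=\varphi(\chi_j,u,v)$, where $\varphi=dt\wedge\sum_k dx_k\wedge dy_k+\mathrm{Re}(dz_1\wedge dz_2\wedge dz_3)$, $\chi_j=\partial_{y_3}$ for $j\le2$ and $\chi_j=\partial_{x_3}$ for $j\ge3$; a neighbourhood of $N_j$ in $X$ is a bundle of balls in $\mathbb C^2/\{\pm1\}$. Let $\rho:\widetilde M\to X$ be the resolution which replaces each of these fibres $\mathbb C^2/\{\pm1\}$ by $Y=\{(w,\ell): \ell\subset\mathbb C^2 \text{ a complex line},\ w\in\ell\}/\{\pm1\}$; thus $\widetilde M$ is a smooth compact $7$-manifold. Let $E_j=\rho^{-1}(N_j)$ be the exceptional divisors, and let $O_j$ be small disjoint tubular neighbourhoods of the $N_j$. A Thom form of $E_j$ is a closed $2$-form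 $\tau_j$ on $\widetilde M$ with compact support in $\rho^{-1}(O_j)$ whose integral over every fibre of the normal bundle of $E_j$ (with its complex orientation) is $1$; its class is the Thom class of $E_j$. **Theorem.** Every $E_j$ has a Thom form. If $\tau_1,\tau_2,\tau_3,\tau_7$ are Thom forms of $E_1,E_2,E_3,E_7$, then the triple Massey product $$\langle[\tau_1+\tau_2],\,[\tau_7+\tau_3],\,[\tau_7-\tau_3]\rangle$$ in $H^*(\widetilde M;\mathbb R)$ is defined, that is, $(\tau_1+\tau_2)\wedge(\tau_7+\tau_3)$ and $(\tau_7+\tau_3)\wedge(\tau_7-\tau_3)$ are exact, and it does not vanish: for all $3$-forms $\xi_{12},\xi_{23}$ with $d\xi_{12}=(\tau_1+\tau_2)\wedge(\tau_7+\tau_3)$ and $d\xi_{23}=(\tau_7+\tau_3)\wedge(\tau_7-\tau_3)$, the class of $\xi_{12}\wedge(\tau_7-\tau_3)-(\tau_1+\tau_2)\wedge\xi_{23}$ is not in the ideal of $H^*(\widetilde M;\mathbb R)$ generated by $[\tau_1+\tau_2]$ and $[\tau_7-\tau_3]$. Consequently $\widetilde M$ is not formal: its de Rham algebra is not connected by quasi-isomorphisms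 of commutative differential graded algebras to an algebra with zero differential. -/

import Mathlib

noncomputable section

open scoped Manifold ContDiff Topology Pointwise ComplexConjugate

/-! ## Differential forms on manifolds -/
section Forms

variable {E : Type*} [NormedAddCommGroup E] [NormedSpace ℝ E]

/-- The wedge product of alternating forms, as an algebraic alternating map (sum over shuffles). -/
def wedgeAlg {k l : ℕ} (a : E [⋀^Fin k]→L[ℝ] ℝ) (b : E [⋀^Fin l]→L[ℝ] ℝ) :
    E [⋀^Fin (k + l)]→ₗ[ℝ] ℝ :=
  ((LinearMap.mul' ℝ ℝ).compAlternatingMap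
    (a.toAlternatingMap.domCoprod b.toAlternatingMap)).domDomCongr finSumFinEquiv

theorem wedgeAlg_bound {k l : ℕ} (a : E [⋀^Fin k]→L[ℝ] ℝ) (b : E [⋀^Fin l]→L[ℝ] ℝ)
    (v : Fin (k + l) → E) :
    ‖wedgeAlg a b v‖ ≤ (Fintype.card (Equiv.Perm.ModSumCongr (Fin k) (Fin l)) * ‖a‖ * ‖b‖) *
      ∏ i, ‖v i‖ := by
  have h : wedgeAlg a b v = ∑ σ : Equiv.Perm.ModSumCongr (Fin k) (Fin l),
      LinearMap.mul' ℝ ℝ (AlternatingMap.domCoprod.summand a.toAlternatingMap b.toAlternatingMap σ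
        (v ∘ finSumFinEquiv)) := by
    simp [wedgeAlg, AlternatingMap.domCoprod_apply, Function.comp_def]
  rw [h]
  refine (norm_sum_le _ _).trans ?_
  have : ∀ σ ∈ (Finset.univ : Finset (Equiv.Perm.ModSumCongr (Fin k) (Fin l))),
      ‖LinearMap.mul' ℝ ℝ (AlternatingMap.domCoprod.summand a.toAlternatingMap b.toAlternatingMap σ
        (v ∘ finSumFinEquiv))‖ ≤ ‖a‖ * ‖b‖ * ∏ i, ‖v i‖ := by
    intro σ _
    induction σ using Quotient.inductionOn' with | _ σ
    rw [AlternatingMap.domCoprod.summand_mk'']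
    have hs : ∀ (c : ℤˣ) (x : ℝ), ‖c • x‖ = ‖x‖ := by
      intro c x
      rcases Int.units_eq_one_or c with rfl | rfl <;> simp
    have h1 := a.le_opNorm (fun i => v (finSumFinEquiv (σ (Sum.inl i))))
    have h2 := b.le_opNorm (fun i => v (finSumFinEquiv (σ (Sum.inr i))))
    have h3 : (∏ i, ‖v (finSumFinEquiv (σ (Sum.inl i)))‖) *
        ∏ i, ‖v (finSumFinEquiv (σ (Sum.inr i)))‖ = ∏ i, ‖v i‖ := by
      rw [← Fintype.prod_sum_type (fun s => ‖v (finSumFinEquiv (σ s))‖)]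
      exact Fintype.prod_equiv (σ.trans finSumFinEquiv) _ _ (fun _ => rfl)
    have h4 : LinearMap.mul' ℝ ℝ ((Equiv.Perm.sign σ • (MultilinearMap.domCoprod
        (↑a.toAlternatingMap : MultilinearMap ℝ (fun _ => E) ℝ)
        (↑b.toAlternatingMap : MultilinearMap ℝ (fun _ => E) ℝ)).domDomCongr σ)
        (v ∘ finSumFinEquiv)) = Equiv.Perm.sign σ •
          (a (fun i => v (finSumFinEquiv (σ (Sum.inl i)))) *
           b (fun i => v (finSumFinEquiv (σ (Sum.inr i))))) := by
      rcases Int.units_eq_one_or (Equiv.Perm.sign σ) with h | h <;> simp [h]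
    rw [h4, hs, norm_mul, ← h3]
    calc _ ≤ _ := mul_le_mul h1 h2 (norm_nonneg _) (by positivity)
      _ = _ := by ring
  refine (Finset.sum_le_card_nsmul _ _ _ this).trans (le_of_eq ?_)
  rw [nsmul_eq_mul, Finset.card_univ]
  ring

/-- The wedge product of alternating forms. -/
def wedgeAlt {k l : ℕ} (a : E [⋀^Fin k]→L[ℝ] ℝ) (b : E [⋀^Fin l]→L[ℝ] ℝ) :
    E [⋀^Fin (k + l)]→L[ℝ] ℝ :=
  (wedgeAlg a b).mkContinuous _ (wedgeAlg_bound a b)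

theorem wedgeAlt_comp {F : Type*} [NormedAddCommGroup F] [NormedSpace ℝ F] {k l : ℕ}
    (a : E [⋀^Fin k]→L[ℝ] ℝ) (b : E [⋀^Fin l]→L[ℝ] ℝ) (f : F →L[ℝ] E) :
    wedgeAlt (a.compContinuousLinearMap f) (b.compContinuousLinearMap f) =
      (wedgeAlt a b).compContinuousLinearMap f := by
  ext v
  simp only [wedgeAlt, wedgeAlg, AlternatingMap.coe_mkContinuous,
    ContinuousAlternatingMap.compContinuousLinearMap_apply, AlternatingMap.domDomCongr_apply,
    LinearMap.compAlternatingMap_apply, AlternatingMap.domCoprod_apply, sum_apply]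
  congr 1
  refine Finset.sum_congr rfl fun σ _ => ?_
  induction σ using Quotient.inductionOn' with | _ σ
  rfl

/-- The wedge product as a continuous bilinear map. -/
def wedgeCLM (E : Type*) [NormedAddCommGroup E] [NormedSpace ℝ E] (k l : ℕ) :
    (E [⋀^Fin k]→L[ℝ] ℝ) →L[ℝ] (E [⋀^Fin l]→L[ℝ] ℝ) →L[ℝ] (E [⋀^Fin (k + l)]→L[ℝ] ℝ) :=
  LinearMap.mkContinuous₂
    (LinearMap.mk₂ ℝ wedgeAlt
      (fun a a' b => by
        ext v
        simp [wedgeAlt, wedgeAlg, ← AlternatingMap.domCoprod'_apply, TensorProduct.add_tmul])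
      (fun c a b => by
        ext v
        simp [wedgeAlt, wedgeAlg, ← AlternatingMap.domCoprod'_apply, ← TensorProduct.smul_tmul'])
      (fun a b b' => by
        ext v
        simp [wedgeAlt, wedgeAlg, ← AlternatingMap.domCoprod'_apply, TensorProduct.tmul_add])
      (fun c a b => by
        ext v
        simp [wedgeAlt, wedgeAlg, ← AlternatingMap.domCoprod'_apply, TensorProduct.tmul_smul]))
    (Fintype.card (Equiv.Perm.ModSumCongr (Fin k) (Fin l)))
    (fun a b => AlternatingMap.mkContinuous_norm_le _ (by positivity) (wedgeAlg_bound a b))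

variable (E) (M : Type*) [TopologicalSpace M] [ChartedSpace E M]

/-- Smooth differential `k`-forms on a manifold `M` modelled on `E`: compatible families of smooth
local representatives `η e`, one on the target of each chart `e` of the atlas (normalised to be `0`
elsewhere). -/
def DiffForm (k : ℕ) :
    Submodule ℝ (OpenPartialHomeomorph M E → E → E [⋀^Fin k]→L[ℝ] ℝ) where
  carrier := {η |
    (∀ e ∈ atlas E M, ContDiffOn ℝ ∞ (η e) e.target) ∧
    (∀ e ∈ atlas E M, ∀ e' ∈ atlas E M, ∀ y ∈ (e.symm.trans e').source,
      η e y = (η e' (e' (e.symm y))).compContinuousLinearMap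
        (fderiv ℝ (fun z => e' (e.symm z)) y)) ∧
    (∀ e y, ¬(e ∈ atlas E M ∧ y ∈ e.target) → η e y = 0)}
  add_mem' := by
    rintro a b ⟨ha, ha', ha''⟩ ⟨hb, hb', hb''⟩
    refine ⟨fun e he => (ha e he).add (hb e he), fun e he e' he' y hy => ?_, fun e y h => ?_⟩
    · simp only [Pi.add_apply]
      rw [ha' e he e' he' y hy, hb' e he e' he' y hy]
      rfl
    · simp [ha'' e y h, hb'' e y h]
  zero_mem' := ⟨fun e _ => contDiffOn_const, fun _ _ _ _ _ _ => rfl, fun _ _ _ => rfl⟩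
  smul_mem' := by
    rintro c a ⟨ha, ha', ha''⟩
    refine ⟨fun e he => (ha e he).const_smul c, fun e he e' he' y hy => ?_, fun e y h => ?_⟩
    · simp only [Pi.smul_apply]
      rw [ha' e he e' he' y hy]
      rfl
    · simp [ha'' e y h]

variable {E M}

namespace DiffForm

/-- The local representative of a form in a chart. -/
def rep {k : ℕ} (η : DiffForm E M k) (e : OpenPartialHomeomorph M E) (y : E) :
    E [⋀^Fin k]→L[ℝ] ℝ :=
  η.1 e y

/-- The wedge product, computed in charts. -/
def wedge {k l : ℕ} (α : DiffForm E M k) (β : DiffForm E M l) : DiffForm E M (k + l) :=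
  ⟨fun e y => wedgeCLM E k l (α.1 e y) (β.1 e y), by
    obtain ⟨α, ha, ha', ha''⟩ := α
    obtain ⟨β, hb, hb', hb''⟩ := β
    refine ⟨fun e he => ?_, fun e he e' he' y hy => ?_, fun e y h => ?_⟩
    · exact ((wedgeCLM E k l).contDiff.comp_contDiffOn (ha e he)).clm_apply (hb e he)
    · simp only
      rw [ha' e he e' he' y hy, hb' e he e' he' y hy]
      exact wedgeAlt_comp _ _ _
    · simp [ha'' e y h]⟩

/-- The constant function `1`, the unit of the wedge product. -/
def one : DiffForm E M 0 :=
  ⟨fun e y => by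
    classical
    exact if e ∈ atlas E M ∧ y ∈ e.target then
      ContinuousAlternatingMap.constOfIsEmpty ℝ E (Fin 0) 1 else 0, by
    classical
    refine ⟨fun e he => ?_, fun e he e' he' y hy => ?_, fun e y h => ?_⟩
    · refine (contDiffOn_const (c := ContinuousAlternatingMap.constOfIsEmpty ℝ E (Fin 0)
        (1 : ℝ))).congr fun y hy => ?_
      simp [he, hy]
    · have h1 : y ∈ e.target := hy.1
      have h2 : e' (e.symm y) ∈ e'.target := e'.map_source hy.2
      simp only [he, he', h1, h2, and_self, if_true]
      ext v
      simp
    · simp only [h, if_false]⟩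

variable [IsManifold 𝓘(ℝ, E) ∞ M]

theorem contDiffOn_transition {e e' : OpenPartialHomeomorph M E} (he : e ∈ atlas E M)
    (he' : e' ∈ atlas E M) :
    ContDiffOn ℝ ∞ (fun z => e' (e.symm z)) (e.symm.trans e').source := by
  have h := (contDiffGroupoid ∞ 𝓘(ℝ, E)).compatible he he'
  rw [contDiffGroupoid, mem_groupoid_of_pregroupoid] at h
  simpa [contDiffPregroupoid, Function.comp_def] using h.1

open Classical in
/-- The exterior derivative, computed in charts. -/
def d {k : ℕ} : DiffForm E M k →ₗ[ℝ] DiffForm E M (k + 1) where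
  toFun η := ⟨fun e y => if e ∈ atlas E M ∧ y ∈ e.target then extDeriv (η.1 e) y else 0, by
    obtain ⟨η, h1, h2, h3⟩ := η
    refine ⟨fun e he => ?_, fun e he e' he' y hy => ?_, fun e y h => ?_⟩
    · have h4 : ContDiffOn ℝ ∞ (fun y => fderiv ℝ (η e) y) e.target :=
        (h1 e he).fderiv_of_isOpen e.open_target (by simp)
      refine ((ContinuousAlternatingMap.alternatizeUncurryFinCLM ℝ E ℝ
        (n := k)).contDiff.comp_contDiffOn h4).congr fun y hy => ?_
      simp only [he, hy, and_self, if_true]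
      rfl
    · have hy1 : y ∈ e.target := hy.1
      have hy2 : e' (e.symm y) ∈ e'.target := e'.map_source hy.2
      have ho : IsOpen (e.symm.trans e').source := (e.symm.trans e').open_source
      simp only [he, he', hy1, hy2, and_self, if_true]
      rw [← extDeriv_pullback (r := ∞) (f := fun z => e' (e.symm z))
        (((h1 e' he').contDiffAt (e'.open_target.mem_nhds hy2)).differentiableAt (by simp))
        ((contDiffOn_transition he he').contDiffAt (ho.mem_nhds hy))
        (by simpa using (WithTop.coe_le_coe.2 le_top : ((2 : ℕ∞) : ℕ∞ω) ≤ ∞))]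
      refine Filter.EventuallyEq.extDeriv_eq ?_
      filter_upwards [ho.mem_nhds hy] with z hz
      exact h2 e he e' he' z hz
    · simp only [h, if_false]⟩
  map_add' := by
    rintro ⟨a, ha, -⟩ ⟨b, hb, -⟩
    ext e y : 3
    by_cases h : e ∈ atlas E M ∧ y ∈ e.target
    · have hn := e.open_target.mem_nhds h.2
      simp only [h, and_self, if_true, Submodule.coe_add, Pi.add_apply]
      exact extDeriv_add (((ha e h.1).contDiffAt hn).differentiableAt (by simp))
        (((hb e h.1).contDiffAt hn).differentiableAt (by simp))
    · simp [h]
  map_smul' := by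
    rintro c ⟨a, ha, -⟩
    ext e y : 3
    by_cases h : e ∈ atlas E M ∧ y ∈ e.target
    · simp only [h, and_self, if_true, Submodule.coe_smul, Pi.smul_apply, RingHom.id_apply]
      exact extDeriv_smul c (a e)
    · simp [h]

/-- Exact forms: the forms `d β`; in degree `0` only the zero form. -/
def IsExact : {k : ℕ} → DiffForm E M k → Prop
  | 0, η => η = 0
  | _ + 1, η => ∃ β, d β = η

end DiffForm
end Forms

/-! ## Massey products and formality -/

section Massey

variable {E : Type*} [NormedAddCommGroup E] [NormedSpace ℝ E] {M : Type*} [TopologicalSpace M]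
  [ChartedSpace E M]

namespace DiffForm

/-- The value of a form at a point, expressed in the preferred chart at that point. -/
def valueAt {k : ℕ} (η : DiffForm E M k) (m : M) : E [⋀^Fin k]→L[ℝ] ℝ :=
  rep η (chartAt E m) (chartAt E m m)

/-- The value at `x` of the pullback of a form on `M` along a map `f : V → M`. -/
def pullbackAt {V : Type*} [NormedAddCommGroup V] [NormedSpace ℝ V] {k : ℕ} (η : DiffForm E M k)
    (f : V → M) (x : V) : V [⋀^Fin k]→L[ℝ] ℝ :=
  (valueAt η (f x)).compContinuousLinearMap (fderiv ℝ (fun y => chartAt E (f x) (f y)) x)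

variable [IsManifold 𝓘(ℝ, E) ∞ M]

/-- The triple Massey product `⟨[α₁], [α₂], [α₃]⟩` of classes of degree `2` is defined: the forms are
closed and `[α₁][α₂] = 0 = [α₂][α₃]` in cohomology. -/
def MasseyDefined (α₁ α₂ α₃ : DiffForm E M 2) : Prop :=
  (d α₁ = 0 ∧ d α₂ = 0 ∧ d α₃ = 0) ∧ IsExact (wedge α₁ α₂) ∧ IsExact (wedge α₂ α₃)

/-- The cocycle `ξ₁₂ ∧ α₃ - α₁ ∧ ξ₂₃` which represents the triple Massey product. -/
def masseyCocycle (α₁ α₃ : DiffForm E M 2) (ξ₁₂ ξ₂₃ : DiffForm E M 3) : DiffForm E M 5 :=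
  (wedge ξ₁₂ α₃ : DiffForm E M 5) - (wedge α₁ ξ₂₃ : DiffForm E M 5)

/-- The class of a `5`-form `y` lies in the ideal of the cohomology algebra generated by the classes
of the closed `2`-forms `α₁` and `α₃`. -/
def InMasseyIdeal (α₁ α₃ : DiffForm E M 2) (y : DiffForm E M 5) : Prop :=
  ∃ β γ : DiffForm E M 3, d β = 0 ∧ d γ = 0 ∧
    IsExact (y - ((wedge β α₁ : DiffForm E M 5) + (wedge γ α₃ : DiffForm E M 5)))

/-- The triple Massey product vanishes: for some choice of primitives of `α₁ ∧ α₂` and `α₂ ∧ α₃`, the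
class of the resulting cocycle lies in the ideal generated by `[α₁]` and `[α₃]`. -/
def MasseyVanishes (α₁ α₂ α₃ : DiffForm E M 2) : Prop :=
  ∃ ξ₁₂ ξ₂₃ : DiffForm E M 3, d ξ₁₂ = wedge α₁ α₂ ∧ d ξ₂₃ = wedge α₂ α₃ ∧
    InMasseyIdeal α₁ α₃ (masseyCocycle α₁ α₃ ξ₁₂ ξ₂₃)

end DiffForm

/-- A commutative differential graded algebra over `ℝ`, graded by the natural numbers. -/
structure CDGA where
  carrier : Type
  [ring : Ring carrier]
  [algebra : Algebra ℝ carrier]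
  grading : ℕ → Submodule ℝ carrier
  [graded : GradedAlgebra grading]
  d : carrier →ₗ[ℝ] carrier
  d_mem : ∀ {k a}, a ∈ grading k → d a ∈ grading (k + 1)
  d_d : ∀ a, d (d a) = 0
  leibniz : ∀ {k a} (b), a ∈ grading k → d (a * b) = d a * b + (-1 : ℝ) ^ k • (a * d b)
  comm : ∀ {k l a b}, a ∈ grading k → b ∈ grading l → a * b = (-1 : ℝ) ^ (k * l) • (b * a)

namespace CDGA

attribute [instance] ring algebra graded

/-- A quasi-isomorphism of commutative differential graded algebras: a morphism which induces an
isomorphism in cohomology. -/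
structure QuasiIso (A B : CDGA) where
  toFun : A.carrier →ₐ[ℝ] B.carrier
  map_mem : ∀ {k a}, a ∈ A.grading k → toFun a ∈ B.grading k
  map_d : ∀ a, toFun (A.d a) = B.d (toFun a)
  injective : ∀ a, A.d a = 0 → (∃ b, B.d b = toFun a) → ∃ c, A.d c = a
  surjective : ∀ b, B.d b = 0 → ∃ a, A.d a = 0 ∧ ∃ c, B.d c = toFun a - b

variable (E M) [IsManifold 𝓘(ℝ, E) ∞ M]

/-- A quasi-isomorphism from a commutative differential graded algebra to the de Rham algebra of a
manifold: linear maps in each degree which respect the unit, the product and the differential, and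
which induce an isomorphism in cohomology. -/
structure QuasiIsoDeRham (A : CDGA) where
  toFun : ∀ k, A.grading k →ₗ[ℝ] DiffForm E M k
  map_one : toFun 0 ⟨1, SetLike.GradedOne.one_mem⟩ = DiffForm.one
  map_mul : ∀ {k l} (a : A.grading k) (b : A.grading l),
    toFun (k + l) ⟨a * b, SetLike.GradedMul.mul_mem a.2 b.2⟩ = DiffForm.wedge (toFun k a) (toFun l b)
  map_d : ∀ {k} (a : A.grading k), toFun (k + 1) ⟨A.d a, A.d_mem a.2⟩ = DiffForm.d (toFun k a)
  injective : ∀ {k} (a : A.grading k), A.d a = 0 → DiffForm.IsExact (toFun k a) → ∃ c, A.d c = a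
  surjective : ∀ {k} (η : DiffForm E M k), DiffForm.d η = 0 →
    ∃ a : A.grading k, A.d a = 0 ∧ DiffForm.IsExact (toFun k a - η)

end CDGA

/-- A manifold is formal if its de Rham algebra is connected by quasi-isomorphisms of commutative
differential graded algebras to an algebra with zero differential (necessarily isomorphic to its
cohomology algebra). -/
def IsFormal (E : Type*) [NormedAddCommGroup E] [NormedSpace ℝ E] (M : Type*) [TopologicalSpace M]
    [ChartedSpace E M] [IsManifold 𝓘(ℝ, E) ∞ M] : Prop :=
  ∃ A B : CDGA, B.d = 0 ∧ Nonempty (A.QuasiIso B) ∧ Nonempty (A.QuasiIsoDeRham E M)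

end Massey

/-! ## Smooth structures from parametrizations -/

/-- A set `M` together with parametrizations `param i`, defined on open sets `dom i` of a normed
space `E`, that cover `M`, are locally injective, and differ from each other by smooth local maps:
the data of a smooth structure on `M`. -/
structure ParamAtlas (E : Type*) [NormedAddCommGroup E] [NormedSpace ℝ E] (M : Type*) where
  ι : Type
  dom : ι → Set E
  param : ι → E → M
  isOpen_dom : ∀ i, IsOpen (dom i)
  surj : ∀ m, ∃ i, ∃ x ∈ dom i, param i x = m
  inj : ∀ i, ∀ x ∈ dom i, ∃ V, IsOpen V ∧ x ∈ V ∧ V ⊆ dom i ∧ Set.InjOn (param i) V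
  lift : ∀ i j, ∀ x ∈ dom i, ∀ y ∈ dom j, param i x = param j y →
    ∃ g : E → E, ContDiffAt ℝ ∞ g x ∧ g x = y ∧ ∀ᶠ z in 𝓝 x, param j (g z) = param i z

namespace ParamAtlas

variable {E : Type*} [NormedAddCommGroup E] [NormedSpace ℝ E] {M : Type*} (P : ParamAtlas E M)

/-- The chart which inverts `param i` on a set where it is injective. -/
def chart (i : P.ι) (V : Set E) (h : Set.InjOn (P.param i) V) : PartialEquiv M E :=
  (h.toPartialEquiv (P.param i) V).symm

/-- The charts of the smooth structure: local inverses of the parametrizations. -/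
def charts : Set (PartialEquiv M E) :=
  {e | ∃ i V, IsOpen V ∧ V ⊆ P.dom i ∧ ∃ h : Set.InjOn (P.param i) V, e = P.chart i V h}

theorem exists_chart (m : M) : ∃ e ∈ P.charts, m ∈ e.source := by
  obtain ⟨i, x, hx, rfl⟩ := P.surj m
  obtain ⟨V, hV, hxV, hVd, hinj⟩ := P.inj i x hx
  exact ⟨P.chart i V hinj, ⟨i, V, hV, hVd, hinj, rfl⟩, Set.mem_image_of_mem _ hxV⟩

theorem transition {e e' : PartialEquiv M E} (he : e ∈ P.charts) (he' : e' ∈ P.charts) {x : E}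
    (hx : x ∈ (e.symm.trans e').source) :
    ∃ g : E → E, ContDiffAt ℝ ∞ g x ∧
      ∀ᶠ z in 𝓝 x, z ∈ (e.symm.trans e').source ∧ (e.symm.trans e') z = g z := by
  obtain ⟨i, V, hV, hVd, hinj, rfl⟩ := he
  obtain ⟨j, W, hW, hWd, hinj', rfl⟩ := he'
  obtain ⟨hxV, y, hyW, hxy⟩ := hx
  have hxV : x ∈ V := hxV
  have hxy : P.param j y = P.param i x := hxy
  obtain ⟨g, hg, hgx, hgl⟩ := P.lift i j x (hVd hxV) y (hWd hyW) hxy.symm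
  refine ⟨g, hg, ?_⟩
  have hgW : ∀ᶠ z in 𝓝 x, g z ∈ W := by
    apply hg.continuousAt
    rw [hgx]
    exact hW.mem_nhds hyW
  filter_upwards [hgl, hgW, hV.mem_nhds hxV] with z h1 h2 h3
  refine ⟨⟨h3, g z, h2, h1⟩, ?_⟩
  have h4 := (P.chart j W hinj').right_inv (x := g z) h2
  have h5 : (P.chart j W hinj').symm (g z) = (P.chart i V hinj).symm z := h1
  rw [h5] at h4
  exact h4

/-- The smooth structure defined by a family of parametrizations. -/
def core : ChartedSpaceCore E M where
  atlas := P.charts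
  chartAt m := (P.exists_chart m).choose
  mem_chart_source m := (P.exists_chart m).choose_spec.2
  chart_mem_atlas m := (P.exists_chart m).choose_spec.1
  open_source e e' he he' := by
    rw [isOpen_iff_mem_nhds]
    intro x hx
    obtain ⟨g, -, h⟩ := P.transition he he' hx
    filter_upwards [h] with z hz using hz.1
  continuousOn_toFun e e' he he' := by
    intro x hx
    obtain ⟨g, hg, h⟩ := P.transition he he' hx
    exact (hg.continuousAt.congr (h.mono fun z hz => hz.2.symm)).continuousWithinAt

theorem isManifold : @IsManifold ℝ _ E _ _ E _ 𝓘(ℝ, E) ∞ M P.core.toTopologicalSpace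
    P.core.toChartedSpace := by
  let _ := P.core.toTopologicalSpace
  let _ := P.core.toChartedSpace
  apply isManifold_of_contDiffOn
  intro e e' he he'
  have key : ∀ f ∈ atlas E M, f.toPartialEquiv ∈ P.charts := by
    intro f hf
    obtain ⟨_, ⟨f', rfl⟩, _, ⟨hf', rfl⟩, rfl⟩ := hf
    exact hf'
  intro x hx
  simp only [modelWithCornersSelf_coe_symm, modelWithCornersSelf_coe, Set.preimage_id,
    Set.range_id, Set.inter_univ] at hx
  obtain ⟨g, hg, h⟩ := P.transition (key e he) (key e' he') hx
  exact (hg.congr_of_eventuallyEq (h.mono fun z hz => hz.2)).contDiffWithinAt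

end ParamAtlas

/-! ## The orbifold and its resolution -/

/-- `ℝ⁷ = ℝ × ℂ³`, with coordinates `(t, z₁, z₂, z₃)`. -/
abbrev Space7 : Type := ℝ × ℂ × ℂ × ℂ

namespace JK

open Complex

/-- The Gaussian integer `a.1 + a.2 i`. -/
def gauss (a : ℤ × ℤ) : ℂ := (a.1 : ℂ) + (a.2 : ℂ) * I

/-- The translations `(t, z) ↦ (t, z + n)` of `ℝ × ℂ³` by Gaussian integer vectors `n`. -/
def translation (a b c : ℤ × ℤ) : Equiv.Perm Space7 where
  toFun x := (x.1, x.2.1 + gauss a, x.2.2.1 + gauss b, x.2.2.2 + gauss c)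
  invFun x := (x.1, x.2.1 - gauss a, x.2.2.1 - gauss b, x.2.2.2 - gauss c)
  left_inv x := by simp
  right_inv x := by simp

/-- `(t, z₁, z₂, z₃) ↦ (t + 1, i z₁, i z₂, -z₃)`, the gluing map of the mapping torus
`M = ℝ × T⁶ / ((t, [z]) ~ (t + 1, [i z₁, i z₂, -z₃]))`. -/
def deckF : Equiv.Perm Space7 where
  toFun x := (x.1 + 1, I * x.2.1, I * x.2.2.1, -x.2.2.2)
  invFun x := (x.1 - 1, -I * x.2.1, -I * x.2.2.1, -x.2.2.2)
  left_inv x := by simp [← mul_assoc]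
  right_inv x := by simp [← mul_assoc]

/-- The involution `ι₁` of `M`, lifted to `ℝ × ℂ³`. -/
def iota₁ : Equiv.Perm Space7 where
  toFun x := (x.1, -x.2.1, -x.2.2.1, x.2.2.2 + 1 / 2)
  invFun x := (x.1, -x.2.1, -x.2.2.1, x.2.2.2 - 1 / 2)
  left_inv x := by simp
  right_inv x := by simp

/-- The involution `ι₂` of `M`, lifted to `ℝ × ℂ³`. -/
def iota₂ : Equiv.Perm Space7 where
  toFun x := (x.1, -x.2.1, -x.2.2.1, x.2.2.2 + I / 2)
  invFun x := (x.1, -x.2.1, -x.2.2.1, x.2.2.2 - I / 2)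
  left_inv x := by simp
  right_inv x := by simp

/-- The involution `κ` of `M`, lifted to `ℝ × ℂ³`. -/
def kappa : Equiv.Perm Space7 where
  toFun x := (1 - x.1, conj x.2.1, conj x.2.2.1, conj x.2.2.2)
  invFun x := (1 - x.1, conj x.2.1, conj x.2.2.1, conj x.2.2.2)
  left_inv x := by simp
  right_inv x := by simp

/-- The group `Γ` of transformations of `ℝ × ℂ³ = ℝ⁷` generated by the translations, the gluing map and
`ι₁, ι₂, κ`. The mapping torus is the quotient of `ℝ⁷` by the first two, and the orbifold
`X = M / ⟨ι₁, ι₂, κ⟩` is the quotient of `ℝ⁷` by `Γ`. -/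
def Gam : Subgroup (Equiv.Perm Space7) :=
  Subgroup.closure ({deckF, iota₁, iota₂, kappa} ∪
    Set.range fun a : (ℤ × ℤ) × (ℤ × ℤ) × (ℤ × ℤ) => translation a.1 a.2.1 a.2.2)

/-- The normal form of the elements of `Γ` which do not reverse `t`. -/
def NF (g : Equiv.Perm Space7) : Prop :=
  ∃ (k p q : ℤ) (a b : ℤ × ℤ), ∀ x, g x =
    (x.1 + k, I ^ k * (-1) ^ (p + q) * x.2.1 + gauss a,
      I ^ k * (-1) ^ (p + q) * x.2.2.1 + gauss b, (-1) ^ k * x.2.2.2 + (p + q * I) / 2)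

theorem gauss_rot (k n : ℤ) (a : ℤ × ℤ) :
    ∃ b, I ^ k * (-1) ^ n * gauss a = gauss b := by
  have hI : ∀ a, ∃ b, I * gauss a = gauss b := fun a => ⟨(-a.2, a.1), by
    simp only [gauss]; push_cast; ring_nf; simp; ring⟩
  have hI' : ∀ a, ∃ b, I⁻¹ * gauss a = gauss b := fun a => ⟨(a.2, -a.1), by
    simp only [gauss, inv_I]; push_cast; ring_nf; simp⟩
  have hk : ∀ (k : ℤ) a, ∃ b, I ^ k * gauss a = gauss b := by
    intro k
    induction k using Int.induction_on with
    | zero => exact fun a => ⟨a, by simp⟩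
    | succ i ih =>
      intro a
      obtain ⟨b, hb⟩ := hI a
      obtain ⟨c, hc⟩ := ih b
      exact ⟨c, by rw [zpow_add_one₀ I_ne_zero, mul_assoc, hb, hc]⟩
    | pred i ih =>
      intro a
      obtain ⟨b, hb⟩ := hI' a
      obtain ⟨c, hc⟩ := ih b
      exact ⟨c, by rw [zpow_sub_one₀ I_ne_zero, mul_assoc, hb, hc]⟩
  have hn : ∀ a, ∃ b, (-1 : ℂ) ^ n * gauss a = gauss b := by
    intro a
    rcases Int.even_or_odd n with h | h
    · exact ⟨a, by simp [h.neg_one_zpow]⟩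
    · exact ⟨-a, by simp [h.neg_one_zpow, gauss]; ring⟩
  obtain ⟨b, hb⟩ := hn a
  obtain ⟨c, hc⟩ := hk k b
  exact ⟨c, by rw [mul_assoc, hb, hc]⟩

theorem gauss_add (a b : ℤ × ℤ) : gauss a + gauss b = gauss (a + b) := by
  simp [gauss]; ring

/-- `(-1)^k` as an integer -/
theorem sign_cases (k : ℤ) : ∃ s : ℤ, (s = 1 ∨ s = -1) ∧ ((-1 : ℂ) ^ k = s) ∧
    ∀ n m : ℤ, (-1 : ℂ) ^ (n + s * m) = (-1) ^ n * (-1) ^ m := by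
  have h0 : (-1 : ℂ) ≠ 0 := by norm_num
  rcases Int.even_or_odd k with h | h
  · exact ⟨1, Or.inl rfl, by simp [h.neg_one_zpow], fun n m => by simp [zpow_add₀ h0]⟩
  · refine ⟨-1, Or.inr rfl, by simp [h.neg_one_zpow], fun n m => ?_⟩
    rw [zpow_add₀ h0]
    congr 1
    rw [neg_one_mul, zpow_neg, ← inv_zpow]
    norm_num

theorem NF.mul {g h : Equiv.Perm Space7} (hg : NF g) (hh : NF h) : NF (g * h) := by
  obtain ⟨k, p, q, a, b, hg⟩ := hg
  obtain ⟨k', p', q', a', b', hh⟩ := hh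
  obtain ⟨s, -, hs, hs'⟩ := sign_cases k
  obtain ⟨a'', ha⟩ := gauss_rot k (p + q) a'
  obtain ⟨b'', hb⟩ := gauss_rot k (p + q) b'
  have h0 : (-1 : ℂ) ≠ 0 := by norm_num
  refine ⟨k + k', p + s * p', q + s * q', a'' + a, b'' + b, fun x => ?_⟩
  have e : p + s * p' + (q + s * q') = (p + q) + s * (p' + q') := by ring
  rw [Equiv.Perm.mul_apply, hh, hg, e, hs', zpow_add₀ I_ne_zero, ← gauss_add, ← gauss_add, ← ha,
    ← hb, zpow_add₀ h0 k, hs]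
  ext1
  · push_cast; ring
  ext1
  · push_cast; ring
  ext1
  · push_cast; ring
  · push_cast; ring

theorem NF.one : NF 1 := ⟨0, 0, 0, 0, 0, fun x => by simp [gauss]⟩

theorem NF.inv {g : Equiv.Perm Space7} (hg : NF g) : NF g⁻¹ := by
  obtain ⟨k, p, q, a, b, hg⟩ := hg
  obtain ⟨s, hs1, hs, hs'⟩ := sign_cases k
  obtain ⟨a'', ha⟩ := gauss_rot (-k) (p + q) a
  obtain ⟨b'', hb⟩ := gauss_rot (-k) (p + q) b
  have hn : ∀ c, gauss (-c) = - gauss c := fun c => by simp [gauss]; ring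
  have e : -(s * p) + -(s * q) = 0 + s * -(p + q) := by ring
  have h1 : (-1 : ℂ) ^ (-(s * p) + -(s * q)) = (-1) ^ (p + q) := by
    rw [e, hs', zpow_neg, ← inv_zpow]; norm_num
  have h2 : (-1 : ℂ) ^ (-k) = s := by rw [zpow_neg, ← inv_zpow, ← hs]; norm_num
  have h3 : (-1 : ℂ) ^ (p + q) * (-1) ^ (p + q) = 1 := by rw [← mul_zpow]; norm_num
  have h4 : I ^ k * I ^ (-k) = 1 := by rw [← zpow_add₀ I_ne_zero]; simp
  have hss : (s : ℂ) * s = 1 := by rcases hs1 with rfl | rfl <;> norm_num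
  refine ⟨-k, -(s * p), -(s * q), -a'', -b'', fun x => ?_⟩
  rw [Equiv.Perm.inv_eq_iff_eq, hg, h1, h2, hn, hn, ← ha, ← hb, hs]
  ext1
  · push_cast; ring
  ext1
  · linear_combination -(x.2.1 - gauss a) * h3 - (x.2.1 - gauss a) * ((-1) ^ (p + q) * (-1) ^ (p + q)) * h4
  ext1
  · linear_combination -(x.2.2.1 - gauss b) * h3 - (x.2.2.1 - gauss b) * ((-1) ^ (p + q) * (-1) ^ (p + q)) * h4
  · push_cast
    linear_combination -(x.2.2.2 - (p + q * I) / 2) * hss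

theorem kappa_kappa : kappa * kappa = 1 := by
  ext x <;> simp [kappa]

theorem NF.conj {g : Equiv.Perm Space7} (hg : NF g) : NF (kappa * g * kappa) := by
  obtain ⟨k, p, q, a, b, hg⟩ := hg
  obtain ⟨s, hs1, hs, hs'⟩ := sign_cases 1
  have hs2 : s = -1 := by
    have h : (-1 : ℂ) = s := by simpa using hs
    exact_mod_cast h.symm
  subst hs2
  have h0 : (-1 : ℂ) ≠ 0 := by norm_num
  have hc : ∀ c, conj (gauss c) = gauss (c.1, -c.2) := fun c => by simp [gauss]
  have hI : conj (I ^ k) = I ^ (-k) := by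
    rw [map_zpow₀, conj_I, ← inv_I, inv_zpow']
  have h2 : (-1 : ℂ) ^ (-k) = (-1) ^ k := by rw [zpow_neg, ← inv_zpow]; norm_num
  have h3 : (-1 : ℂ) ^ (p + -q) = (-1) ^ (p + q) := by
    have := hs' p q
    rw [zpow_add₀ h0 p q, ← this]; simp
  refine ⟨-k, p, -q, (a.1, -a.2), (b.1, -b.2), fun x => ?_⟩
  rw [Equiv.Perm.mul_apply, Equiv.Perm.mul_apply, h2, h3]
  simp only [kappa, Equiv.coe_fn_mk, hg, map_add, map_mul, hI, hc, map_zpow₀, map_neg, map_one,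
    map_div₀, map_intCast, conj_I, Complex.conj_conj, conj_ofNat]
  ext1
  · push_cast; ring
  ext1
  · rfl
  ext1
  · rfl
  · push_cast; ring

theorem NF_or {g : Equiv.Perm Space7} (hg : g ∈ Gam) : NF g ∨ NF (g * kappa) := by
  have kk := kappa_kappa
  induction hg using Subgroup.closure_induction with
  | mem x hx =>
    rcases hx with (rfl | rfl | rfl | rfl) | ⟨⟨a, b, c⟩, rfl⟩
    · exact Or.inl ⟨1, 0, 0, 0, 0, fun x => by simp [deckF, gauss]⟩
    · exact Or.inl ⟨0, 1, 0, 0, 0, fun x => by simp [iota₁, gauss]⟩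
    · exact Or.inl ⟨0, 0, 1, 0, 0, fun x => by simp [iota₂, gauss]⟩
    · exact Or.inr (by rw [kk]; exact NF.one)
    · refine Or.inl ⟨0, 2 * c.1, 2 * c.2, a, b, fun x => ?_⟩
      have h : Even (2 * c.1 + 2 * c.2) := ⟨c.1 + c.2, by ring⟩
      simp only [translation, gauss, Equiv.coe_fn_mk, h.neg_one_zpow]
      simp
      ring
  | one => exact Or.inl NF.one
  | mul x y _ _ hx hy =>
    rcases hx with hx | hx <;> rcases hy with hy | hy
    · exact Or.inl (hx.mul hy)
    · exact Or.inr (by rw [mul_assoc]; exact hx.mul hy)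
    · refine Or.inr ?_
      have := hx.mul hy.conj
      rwa [show x * kappa * (kappa * y * kappa) = x * (kappa * kappa) * y * kappa by group, kk,
        mul_one] at this
    · refine Or.inl ?_
      have := hx.mul hy.conj
      rwa [show x * kappa * (kappa * (y * kappa) * kappa) = x * (kappa * kappa) * y * (kappa * kappa)
        by group, kk, mul_one, mul_one] at this
  | inv x _ hx =>
    rcases hx with hx | hx
    · exact Or.inl hx.inv
    · refine Or.inr ?_
      have := hx.inv.conj
      rwa [mul_inv_rev, show kappa * (kappa⁻¹ * x⁻¹) * kappa = x⁻¹ * kappa by group] at this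


/-! ### Smoothness of the action -/
theorem contDiff_conj : ContDiff ℝ ∞ (fun z : ℂ => conj z) := conjCLE.contDiff

theorem Gam_smooth {g : Equiv.Perm Space7} (hg : g ∈ Gam) : ContDiff ℝ ∞ g ∧ Isometry g := by
  suffices h : (ContDiff ℝ ∞ g ∧ Isometry g) ∧ (ContDiff ℝ ∞ ⇑g⁻¹ ∧ Isometry ⇑g⁻¹) from h.1
  have inv_iso : ∀ g : Equiv.Perm Space7, Isometry g → Isometry ⇑g⁻¹ := fun g h =>
    h.right_inv (fun x => by simp)
  have key : ∀ g : Equiv.Perm Space7, ContDiff ℝ ∞ g → ContDiff ℝ ∞ ⇑g.symm → Isometry g →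
      (ContDiff ℝ ∞ g ∧ Isometry g) ∧ (ContDiff ℝ ∞ ⇑g⁻¹ ∧ Isometry ⇑g⁻¹) :=
    fun g h1 h2 h3 => ⟨⟨h1, h3⟩, h2, inv_iso g h3⟩
  induction hg using Subgroup.closure_induction with
  | mem x hx =>
    rcases hx with (rfl | rfl | rfl | rfl) | ⟨⟨a, b, c⟩, rfl⟩
    · apply key
      · simp only [deckF, Equiv.coe_fn_mk]; fun_prop
      · simp only [deckF, Equiv.symm_mk, Equiv.coe_fn_mk]; fun_prop
      · refine Isometry.of_dist_eq fun x y => ?_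
        have h : ∀ a b : ℂ, dist (I * a) (I * b) = dist a b := fun a b => by
          rw [dist_eq_norm, ← mul_sub, norm_mul, norm_I, one_mul, dist_eq_norm]
        simp only [deckF, Equiv.coe_fn_mk, Prod.dist_eq, h, dist_neg_neg, dist_add_right]
    · apply key
      · simp only [iota₁, Equiv.coe_fn_mk]; fun_prop
      · simp only [iota₁, Equiv.symm_mk, Equiv.coe_fn_mk]; fun_prop
      · refine Isometry.of_dist_eq fun x y => ?_
        simp [iota₁, Prod.dist_eq]
    · apply key
      · simp only [iota₂, Equiv.coe_fn_mk]; fun_prop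
      · simp only [iota₂, Equiv.symm_mk, Equiv.coe_fn_mk]; fun_prop
      · refine Isometry.of_dist_eq fun x y => ?_
        simp [iota₂, Prod.dist_eq]
    · have h : ContDiff ℝ ∞ kappa := by
        simp only [kappa, Equiv.coe_fn_mk]
        exact (by fun_prop : ContDiff ℝ ∞ fun x : Space7 => 1 - x.1).prodMk
          ((contDiff_conj.comp (by fun_prop : ContDiff ℝ ∞ fun x : Space7 => x.2.1)).prodMk
          ((contDiff_conj.comp (by fun_prop : ContDiff ℝ ∞ fun x : Space7 => x.2.2.1)).prodMk
          (contDiff_conj.comp (by fun_prop : ContDiff ℝ ∞ fun x : Space7 => x.2.2.2))))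
      apply key
      · exact h
      · exact h
      · refine Isometry.of_dist_eq fun x y => ?_
        simp only [kappa, Equiv.coe_fn_mk, Prod.dist_eq, dist_conj_conj, dist_sub_left]
    · apply key
      · simp only [translation, Equiv.coe_fn_mk]; fun_prop
      · simp only [translation, Equiv.symm_mk, Equiv.coe_fn_mk]; fun_prop
      · refine Isometry.of_dist_eq fun x y => ?_
        simp [translation, Prod.dist_eq]
  | one => exact ⟨⟨contDiff_id, isometry_id⟩, ⟨contDiff_id, isometry_id⟩⟩
  | mul x y _ _ hx hy =>
    refine ⟨⟨hx.1.1.comp hy.1.1, hx.1.2.comp hy.1.2⟩, ?_⟩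
    rw [mul_inv_rev]
    exact ⟨hy.2.1.comp hx.2.1, hy.2.2.comp hx.2.2⟩
  | inv x _ hx => exact ⟨hx.2, by rw [inv_inv]; exact hx.1⟩

/-! ### Proper discontinuity -/
theorem real_disc (α : ℝ) : ∀ᶠ r in 𝓝[>] (0 : ℝ), ∀ n : ℤ, |α + n / 2| < r → α + n / 2 = 0 := by
  by_cases h : ∃ n : ℤ, α + n / 2 = 0
  · obtain ⟨m, hm⟩ := h
    have : Set.Ioo (0 : ℝ) (1 / 2) ∈ 𝓝[>] (0 : ℝ) := Ioo_mem_nhdsGT (by norm_num)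
    filter_upwards [this] with r hr n hn
    have h1 : α + n / 2 = ((n - m : ℤ) : ℝ) / 2 := by push_cast; linarith
    rw [h1] at hn ⊢
    have h2 : |((n - m : ℤ) : ℝ)| < 1 := by
      rw [abs_div, abs_of_pos (by norm_num : (0 : ℝ) < 2)] at hn
      linarith [hr.2]
    have h3 : |n - m| < 1 := by exact_mod_cast h2
    have h4 : n - m = 0 := Int.abs_lt_one_iff.mp h3
    rw [h4]; simp
  · push Not at h
    let d := min (Int.fract (2 * α)) (1 - Int.fract (2 * α)) / 2
    have hf : Int.fract (2 * α) ≠ 0 := by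
      intro hf
      apply h (-⌊2 * α⌋)
      have := Int.self_sub_floor (2 * α)
      push_cast
      linarith
    have hf0 : 0 < Int.fract (2 * α) := lt_of_le_of_ne (Int.fract_nonneg _) (Ne.symm hf)
    have hd : 0 < d := by
      have := Int.fract_lt_one (2 * α)
      refine half_pos (lt_min hf0 (by linarith))
    filter_upwards [Ioo_mem_nhdsGT hd] with r hr n hn
    exfalso
    have h1 : 2 * α = ⌊2 * α⌋ + Int.fract (2 * α) := (Int.floor_add_fract _).symm
    have h2 : |(⌊2 * α⌋ + n : ℤ) + Int.fract (2 * α)| < 2 * d := by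
      have : ((⌊2 * α⌋ + n : ℤ) : ℝ) + Int.fract (2 * α) = 2 * (α + n / 2) := by
        push_cast; linarith
      rw [this, abs_mul, abs_of_pos (by norm_num : (0 : ℝ) < 2)]
      linarith [hr.2]
    have hd1 : 2 * d ≤ Int.fract (2 * α) := by
      have := min_le_left (Int.fract (2 * α)) (1 - Int.fract (2 * α))
      simp only [d]; linarith
    have hd2 : 2 * d ≤ 1 - Int.fract (2 * α) := by
      have := min_le_right (Int.fract (2 * α)) (1 - Int.fract (2 * α))
      simp only [d]; linarith
    rw [abs_lt] at h2
    rcases le_or_gt 0 (⌊2 * α⌋ + n) with h3 | h3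
    · have : (0 : ℝ) ≤ ((⌊2 * α⌋ + n : ℤ) : ℝ) := by exact_mod_cast h3
      linarith
    · have : ((⌊2 * α⌋ + n : ℤ) : ℝ) ≤ -1 := by exact_mod_cast (by omega : ⌊2 * α⌋ + n ≤ -1)
      linarith

theorem complex_disc (z : ℂ) : ∀ᶠ r in 𝓝[>] (0 : ℝ), ∀ m n : ℤ,
    ‖z + (m + n * I) / 2‖ < r → z + (m + n * I) / 2 = 0 := by
  filter_upwards [real_disc z.re, real_disc z.im] with r h1 h2 m n h
  have hre : (z + (m + n * I) / 2).re = z.re + m / 2 := by simp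
  have him : (z + (m + n * I) / 2).im = z.im + n / 2 := by simp
  apply Complex.ext
  · rw [hre]; exact h1 m (by rw [← hre]; exact (abs_re_le_norm _).trans_lt h)
  · rw [him]; exact h2 n (by rw [← him]; exact (abs_im_le_norm _).trans_lt h)

theorem rot_cases (k n : ℤ) : ∃ i : Fin 4, I ^ k * (-1) ^ n = I ^ (i : ℕ) := by
  have h1 : ∃ i : Fin 4, I ^ k = I ^ (i : ℕ) := by
    refine ⟨⟨(k % 4).toNat, by omega⟩, ?_⟩
    conv_lhs => rw [← Int.mul_ediv_add_emod k 4, zpow_add₀ I_ne_zero, zpow_mul]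
    have : (I ^ (4 : ℤ)) = 1 := by
      rw [show (4 : ℤ) = ((4 : ℕ) : ℤ) by rfl, zpow_natCast, I_pow_four]
    rw [this, one_zpow, one_mul, ← zpow_natCast, Int.toNat_of_nonneg (by omega)]
  obtain ⟨i, hi⟩ := h1
  rw [hi]
  rcases Int.even_or_odd n with h | h
  · exact ⟨i, by simp [h.neg_one_zpow]⟩
  · refine ⟨i + 2, ?_⟩
    rw [h.neg_one_zpow]
    fin_cases i <;> simp [pow_succ]

theorem NF_disc (x y : Space7) : ∀ᶠ r in 𝓝[>] (0 : ℝ), ∀ g, NF g → dist (g x) y < r → g x = y := by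
  have h1 := real_disc (x.1 - y.1)
  have h2 : ∀ᶠ r in 𝓝[>] (0 : ℝ), ∀ i : Fin 4, ∀ m n : ℤ,
      ‖(I ^ (i : ℕ) * x.2.1 - y.2.1) + (m + n * I) / 2‖ < r → (I ^ (i : ℕ) * x.2.1 - y.2.1) + (m + n * I) / 2 = 0 :=
    Filter.eventually_all.2 fun i => complex_disc _
  have h3 : ∀ᶠ r in 𝓝[>] (0 : ℝ), ∀ i : Fin 4, ∀ m n : ℤ,
      ‖(I ^ (i : ℕ) * x.2.2.1 - y.2.2.1) + (m + n * I) / 2‖ < r →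
        (I ^ (i : ℕ) * x.2.2.1 - y.2.2.1) + (m + n * I) / 2 = 0 :=
    Filter.eventually_all.2 fun i => complex_disc _
  filter_upwards [h1, h2, h3, complex_disc (x.2.2.2 - y.2.2.2), complex_disc (-x.2.2.2 - y.2.2.2)]
    with r h1 h2 h3 h4 h5 g ⟨k, p, q, a, b, hg⟩ hd
  obtain ⟨i, hi⟩ := rot_cases k (p + q)
  obtain ⟨s, hs1, hs, -⟩ := sign_cases k
  rw [hg, hi, hs] at hd ⊢
  rw [Prod.dist_eq, Prod.dist_eq, Prod.dist_eq, max_lt_iff, max_lt_iff, max_lt_iff] at hd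
  simp only [dist_eq_norm] at hd
  obtain ⟨d1, d2, d3, d4⟩ := hd
  ext1
  · have e : x.1 + k - y.1 = x.1 - y.1 + ((2 * k : ℤ) : ℝ) / 2 := by push_cast; ring
    simp only at d1 ⊢
    rw [Real.norm_eq_abs, e] at d1
    have := h1 _ d1
    rw [← e] at this
    linarith
  ext1
  · have e : I ^ (i : ℕ) * x.2.1 + gauss a - y.2.1 = (I ^ (i : ℕ) * x.2.1 - y.2.1) +
        (((2 * a.1 : ℤ) : ℂ) + ((2 * a.2 : ℤ) : ℂ) * I) / 2 := by
      simp only [gauss]; push_cast; ring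
    simp only at d2 ⊢
    rw [e] at d2
    have := h2 i _ _ d2
    rw [← e] at this
    exact sub_eq_zero.1 this
  ext1
  · have e : I ^ (i : ℕ) * x.2.2.1 + gauss b - y.2.2.1 = (I ^ (i : ℕ) * x.2.2.1 - y.2.2.1) +
        (((2 * b.1 : ℤ) : ℂ) + ((2 * b.2 : ℤ) : ℂ) * I) / 2 := by
      simp only [gauss]; push_cast; ring
    simp only at d3 ⊢
    rw [e] at d3
    have := h3 i _ _ d3
    rw [← e] at this
    exact sub_eq_zero.1 this
  · simp only at d4 ⊢
    rcases hs1 with rfl | rfl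
    · have e : ((1 : ℤ) : ℂ) * x.2.2.2 + (p + q * I) / 2 - y.2.2.2 =
        x.2.2.2 - y.2.2.2 + (p + q * I) / 2 := by push_cast; ring
      rw [e] at d4
      have := h4 _ _ d4
      rw [← e] at this
      exact sub_eq_zero.1 this
    · have e : ((-1 : ℤ) : ℂ) * x.2.2.2 + (p + q * I) / 2 - y.2.2.2 =
        -x.2.2.2 - y.2.2.2 + (p + q * I) / 2 := by push_cast; ring
      rw [e] at d4
      have := h5 _ _ d4
      rw [← e] at this
      exact sub_eq_zero.1 this

theorem Gam_disc (x₀ : Space7) : ∃ U, IsOpen U ∧ x₀ ∈ U ∧ ∀ g ∈ Gam, ∀ x ∈ U, g x ∈ U → g x₀ = x₀ := by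
  obtain ⟨r, hr0, h1, h2⟩ := (eventually_mem_nhdsWithin.and ((NF_disc x₀ x₀).and
    (NF_disc (kappa x₀) x₀))).exists
  have hr0 : 0 < r := hr0
  refine ⟨Metric.ball x₀ (r / 2), Metric.isOpen_ball, Metric.mem_ball_self (by linarith), ?_⟩
  intro g hg x hx hgx
  have h3 : dist (g x₀) x₀ < r := by
    have := (Gam_smooth hg).2.dist_eq x₀ x
    have h4 := dist_triangle (g x₀) (g x) x₀
    rw [Metric.mem_ball] at hx hgx
    rw [dist_comm x₀ x] at this
    linarith
  rcases NF_or hg with h | h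
  · exact h1 g h h3
  · have h4 : (g * kappa) (kappa x₀) = g x₀ := by
      rw [Equiv.Perm.mul_apply, ← Equiv.Perm.mul_apply kappa, kappa_kappa]; rfl
    rw [← h4] at h3 ⊢
    exact h2 _ h h3

/-! ### The singular locus and its normal frames

The singular locus of `X` has ten components `N_1, ..., N_10`, here indexed by `0, ..., 9`. The component
with index `j` is the image of the affine `3`-space `w₁ = w₂ = 0` under `tubeMap j`, where
`(s, c) ∈ ℝ × ℂ` are coordinates along it and `(w₁, w₂) ∈ ℂ²` are complex coordinates on its normal
spaces. They are complex linear for the complex structure `I` on the normal spaces given by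
`⟨I u, v⟩ = φ(χ, u, v)`, where `χ = ∂/∂y₃` for `N_1, N_2`, `χ = ∂/∂x₃` for `N_3, ..., N_10`, and
`φ = dt ∧ (dx₁ ∧ dy₁ + dx₂ ∧ dy₂ + dx₃ ∧ dy₃) + Re (dz₁ ∧ dz₂ ∧ dz₃)`. Normal frames `(e, I e, f, I f)`:
* `N_1` : `(∂t, ∂x₃, ∂x₁ + ∂y₁, -∂x₂ - ∂y₂)`;
* `N_2` : `(∂t, ∂x₃, ∂y₁ - ∂x₁, ∂y₂ - ∂x₂)`;
* `N_3, ..., N_6` : `(∂t, -∂y₃, ∂y₁, -∂y₂)`;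
* `N_7, ..., N_10` : `(∂t, -∂y₃, -∂x₁, -∂x₂)`. -/

/-- The value of `t` on the components. -/
def level : Fin 10 → ℝ := ![0, 0, 1/2, 1/2, 1/2, 1/2, 1/2, 1/2, 1/2, 1/2]
/-- The point of the components with `s = c = 0`: its first complex coordinate. -/
def base₁ : Fin 10 → ℂ := ![0, 0, 0, 0, I/2, I/2, 0, 0, 1/2, 1/2]
/-- The point of the components with `s = c = 0`: its second complex coordinate. -/
def base₂ : Fin 10 → ℂ := ![0, 0, 0, I/2, 0, I/2, 0, 1/2, 0, 1/2]
/-- The point of the components with `s = c = 0`: its third complex coordinate. -/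
def base₃ : Fin 10 → ℂ := ![0, -1/4, 0, 0, 0, 0, -I/4, -I/4, -I/4, -I/4]
/-- The tangential direction of the components in the first two complex coordinates. -/
def eta : Fin 10 → ℂ := ![1 - I, 1 + I, 1, 1, 1, 1, I, I, I, I]
/-- The tangential direction of the components in the third complex coordinate. -/
def theta : Fin 10 → ℂ := ![I, I, 1, 1, 1, 1, 1, 1, 1, 1]
/-- The sign of the last vector of the normal frame. -/
def sgn : Fin 10 → ℝ := ![-1, 1, -1, -1, -1, -1, 1, 1, 1, 1]

/-- The affine coordinates `(s, c, w₁, w₂)` around the component `N_(j+1)`: the exponential map of the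
(flat) normal bundle. -/
def tubeMap (j : Fin 10) (x : Space7) : Space7 :=
  (level j + x.2.2.1.re,
   base₁ j + eta j * (x.2.1.re + x.2.2.2.re * I),
   base₂ j + eta j * (x.2.1.im + sgn j * x.2.2.2.im * I),
   base₃ j + theta j * (x.1 - x.2.2.1.im * I))

/-- The principal square root. -/
def csqrt (u : ℂ) : ℂ := u ^ (2⁻¹ : ℂ)

/-- The standard charts `v ↦ [1 : v]` and `v ↦ [v : 1]` of the complex projective line. -/
def dir (b : Bool) (v : ℂ) : ℂ × ℂ := if b then (v, 1) else (1, v)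

/-- The complex line spanned by `w` in the normal space at the point `(s, c)` of a component, as a subset
of `ℝ⁷`. -/
def line (j : Fin 10) (s : ℝ) (c : ℂ) (w : ℂ × ℂ) : Set Space7 :=
  Set.range fun l : ℂ => tubeMap j (s, c, l * w.1, l * w.2)

/-- The points on which `Γ` acts freely. -/
def regular : Set Space7 := {x | ∀ g ∈ Gam, g x = x → g = 1}

/-- Pairs of a point and a set, up to the action of `Γ`. The resolution replaces the singular points by
the complex lines in their normal spaces, so that its points are orbits of pairs `(x, {x})` with `x`
free, and of pairs `(x, ℓ)` with `x` on the singular locus and `ℓ` a complex line in the normal space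
at `x`. -/
abbrev Marked : Type := MulAction.orbitRel.Quotient Gam (Space7 × Set Space7)
/-- The marked point of a point of `ℝ⁷`. -/
def ptQ (x : Space7) : Marked := Quotient.mk'' (x, {x})
/-- The marked point of a complex line in a normal space. -/
def lnQ (j : Fin 10) (s : ℝ) (c : ℂ) (w : ℂ × ℂ) : Marked :=
  Quotient.mk'' (tubeMap j (s, c, 0, 0), line j s c w)

/-! ### Properties of the tubes -/

/-- `2 * level` -/
def iT : Fin 10 → ℤ := ![0, 0, 1, 1, 1, 1, 1, 1, 1, 1]
/-- Integer code of `base₃`. -/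
def iB₃ : Fin 10 → ℤ := ![0, 1, 0, 0, 0, 0, 1, 1, 1, 1]
/-- Integer code of `base₁`. -/
def iB₁ : Fin 10 → ℤ := ![0, 0, 0, 0, 1, 1, 0, 0, 1, 1]
/-- Integer code of `base₂`. -/
def iB₂ : Fin 10 → ℤ := ![0, 0, 0, 1, 0, 1, 0, 1, 0, 1]

theorem index_ext : ∀ j j', iT j = iT j' → iB₃ j = iB₃ j' → iB₁ j = iB₁ j' → iB₂ j = iB₂ j' →
    j = j' := by decide

theorem level_eq (j) : level j = iT j / 2 := by
  fin_cases j <;> simp [level, iT]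
theorem theta_eq (j) : theta j = if iT j = 0 then I else 1 := by
  fin_cases j <;> simp [theta, iT]
theorem eta_eq (j) : eta j = if iT j = 0 then (if iB₃ j = 0 then 1 - I else 1 + I) else
    (if iB₃ j = 0 then 1 else I) := by
  fin_cases j <;> simp [eta, iT, iB₃]
theorem base₁_eq (j) : base₁ j = eta j * (((1 - 2 * iB₃ j) * iB₁ j / 2 : ℝ) * I) := by
  fin_cases j <;> simp [base₁, eta, iB₃, iB₁] <;> ring_nf <;> simp <;> norm_num
theorem base₂_eq (j) : base₂ j = eta j * (((1 - 2 * iB₃ j) * iB₂ j / 2 : ℝ) * I) := by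
  fin_cases j <;> simp [base₂, eta, iB₃, iB₂] <;> ring_nf <;> simp <;> norm_num
theorem base₃_eq (j) : base₃ j = theta j * (((1 - 2 * iT j) * iB₃ j / 4 : ℝ) * I) := by
  fin_cases j <;> simp [base₃, theta, iB₃, iT] <;> ring_nf <;> simp <;> norm_num
theorem iT_cases (j) : iT j = 0 ∨ iT j = 1 := by revert j; decide
theorem iB₃_cases (j) : iB₃ j = 0 ∨ iB₃ j = 1 := by revert j; decide
theorem iB₁_cases (j) : iB₁ j = 0 ∨ iB₁ j = 1 := by revert j; decide
theorem iB₂_cases (j) : iB₂ j = 0 ∨ iB₂ j = 1 := by revert j; decide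
theorem iB_zero (j) : iT j = 0 → iB₁ j = 0 ∧ iB₂ j = 0 := by revert j; decide
theorem sgn_mul (j) : (sgn j : ℂ) * sgn j = 1 := by fin_cases j <;> simp [sgn]
theorem eta_ne (j) : eta j ≠ 0 := by
  fin_cases j <;> simp [eta, Complex.ext_iff]
theorem theta_ne (j) : theta j ≠ 0 := by
  fin_cases j <;> simp [theta]

/-- The inverse of `tubeMap`. -/
def tubeInv (j : Fin 10) (x : Space7) : Space7 :=
  (((x.2.2.2 - base₃ j) / theta j).re,
   (((x.2.1 - base₁ j) / eta j).re : ℂ) + (((x.2.2.1 - base₂ j) / eta j).re : ℂ) * I,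
   ((x.1 - level j : ℝ) : ℂ) - (((x.2.2.2 - base₃ j) / theta j).im : ℂ) * I,
   (((x.2.1 - base₁ j) / eta j).im : ℂ) + sgn j * (((x.2.2.1 - base₂ j) / eta j).im : ℂ) * I)

theorem tubeInv_tubeMap (j x) : tubeInv j (tubeMap j x) = x := by
  have h1 := eta_ne j
  have h2 := theta_ne j
  have h3 : sgn j * sgn j = 1 := by exact_mod_cast sgn_mul j
  have h4 : sgn j * (sgn j * x.2.2.2.im) = x.2.2.2.im := by rw [← mul_assoc, h3, one_mul]
  simp only [tubeInv, tubeMap, add_sub_cancel_left, mul_div_cancel_left₀ _ h1,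
    mul_div_cancel_left₀ _ h2]
  ext1
  · simp
  ext1
  · apply Complex.ext <;> simp
  ext1
  · apply Complex.ext <;> simp
  · apply Complex.ext <;> simp [h4]

theorem tubeMap_tubeInv (j x) : tubeMap j (tubeInv j x) = x := by
  have h1 := eta_ne j
  have h2 := theta_ne j
  have h3 : sgn j * sgn j = 1 := by exact_mod_cast sgn_mul j
  have h5 : ∀ y : ℝ, sgn j * (sgn j * y) = y := fun y => by rw [← mul_assoc, h3, one_mul]
  have h6 : ∀ z : ℂ, (z.re : ℂ) + z.im * I = z := fun z => by apply Complex.ext <;> simp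
  ext1
  · simp [tubeInv, tubeMap]
  ext1
  · simp only [tubeInv, tubeMap]
    rw [show ∀ a b : ℂ, base₁ j + eta j * a = b ↔ a = (b - base₁ j) / eta j from fun a b => by
      field_simp; constructor <;> intro h <;> linear_combination h]
    conv_rhs => rw [← h6 ((x.2.1 - base₁ j) / eta j)]
    simp
  ext1
  · simp only [tubeInv, tubeMap]
    rw [show ∀ a b : ℂ, base₂ j + eta j * a = b ↔ a = (b - base₂ j) / eta j from fun a b => by
      field_simp; constructor <;> intro h <;> linear_combination h]
    conv_rhs => rw [← h6 ((x.2.2.1 - base₂ j) / eta j)]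
    apply Complex.ext <;> simp [h5]
  · simp only [tubeInv, tubeMap]
    rw [show ∀ a b : ℂ, base₃ j + theta j * a = b ↔ a = (b - base₃ j) / theta j from fun a b => by
      field_simp; constructor <;> intro h <;> linear_combination h]
    conv_rhs => rw [← h6 ((x.2.2.2 - base₃ j) / theta j)]
    apply Complex.ext <;> simp

theorem tubeMap_injective (j) : Function.Injective (tubeMap j) :=
  Function.LeftInverse.injective (tubeInv_tubeMap j)

theorem contDiff_ofReal : ContDiff ℝ ∞ (fun x : ℝ => (x : ℂ)) := ofRealCLM.contDiff
theorem contDiff_re : ContDiff ℝ ∞ (fun z : ℂ => z.re) := reCLM.contDiff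
theorem contDiff_im : ContDiff ℝ ∞ (fun z : ℂ => z.im) := imCLM.contDiff

theorem contDiff_tubeMap (j) : ContDiff ℝ ∞ (tubeMap j) := by
  have h1 := contDiff_ofReal
  have h2 := contDiff_re
  have h3 := contDiff_im
  have hc : ContDiff ℝ ∞ fun x : Space7 => x.2.1 := by fun_prop
  have hw : ContDiff ℝ ∞ fun x : Space7 => x.2.2.1 := by fun_prop
  have hv : ContDiff ℝ ∞ fun x : Space7 => x.2.2.2 := by fun_prop
  have hs : ContDiff ℝ ∞ fun x : Space7 => x.1 := by fun_prop
  exact (contDiff_const.add (h2.comp hw)).prodMk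
    ((contDiff_const.add (contDiff_const.mul ((h1.comp (h2.comp hc)).add
      ((h1.comp (h2.comp hv)).mul contDiff_const)))).prodMk
    ((contDiff_const.add (contDiff_const.mul ((h1.comp (h3.comp hc)).add
      ((contDiff_const.mul (h1.comp (h3.comp hv))).mul contDiff_const)))).prodMk
    (contDiff_const.add (contDiff_const.mul ((h1.comp hs).sub
      ((h1.comp (h3.comp hw)).mul contDiff_const))))))

theorem contDiff_tubeInv (j) : ContDiff ℝ ∞ (tubeInv j) := by
  have h1 := contDiff_ofReal
  have h2 := contDiff_re
  have h3 := contDiff_im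
  have ha : ContDiff ℝ ∞ fun x : Space7 => (x.2.1 - base₁ j) / eta j := by
    simp only [div_eq_mul_inv]; fun_prop
  have hb : ContDiff ℝ ∞ fun x : Space7 => (x.2.2.1 - base₂ j) / eta j := by
    simp only [div_eq_mul_inv]; fun_prop
  have hc : ContDiff ℝ ∞ fun x : Space7 => (x.2.2.2 - base₃ j) / theta j := by
    simp only [div_eq_mul_inv]; fun_prop
  have ht : ContDiff ℝ ∞ fun x : Space7 => x.1 - level j := by fun_prop
  exact (h2.comp hc).prodMk
    (((h1.comp (h2.comp ha)).add ((h1.comp (h2.comp hb)).mul contDiff_const)).prodMk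
    (((h1.comp ht).sub ((h1.comp (h3.comp hc)).mul contDiff_const)).prodMk
    ((h1.comp (h3.comp ha)).add ((contDiff_const.mul (h1.comp (h3.comp hb))).mul contDiff_const))))

/-! ### The involutions -/
theorem mem_F : deckF ∈ Gam := Subgroup.subset_closure (by simp)
theorem mem_i1 : iota₁ ∈ Gam := Subgroup.subset_closure (by simp)
theorem mem_i2 : iota₂ ∈ Gam := Subgroup.subset_closure (by simp)
theorem mem_k : kappa ∈ Gam := Subgroup.subset_closure (by simp)
theorem mem_t (a b c) : translation a b c ∈ Gam :=
  Subgroup.subset_closure (Or.inr ⟨(a, b, c), rfl⟩)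

theorem exists_refl (j : Fin 10) : ∃ g ∈ Gam, ∀ s c w z, g (tubeMap j (s, c, w, z)) =
    tubeMap j (s, c, -w, -z) := by
  have hF : deckF⁻¹ ∈ Gam := inv_mem mem_F
  have hFe : ∀ x, deckF⁻¹ x = (x.1 - 1, -I * x.2.1, -I * x.2.2.1, -x.2.2.2) := fun x => rfl
  have hT : ∀ a b c x, translation a b c x =
    (x.1, x.2.1 + gauss a, x.2.2.1 + gauss b, x.2.2.2 + gauss c) := fun _ _ _ _ => rfl
  have h1 : ∀ x, iota₁ x = (x.1, -x.2.1, -x.2.2.1, x.2.2.2 + 1 / 2) := fun _ => rfl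
  have h2 : ∀ x, iota₂ x = (x.1, -x.2.1, -x.2.2.1, x.2.2.2 + I / 2) := fun _ => rfl
  have hk : ∀ x, kappa x = (1 - x.1, conj x.2.1, conj x.2.2.1, conj x.2.2.2) := fun _ => rfl
  have c2 : conj (2 : ℂ) = 2 := Complex.conj_ofNat 2
  have c4 : conj (4 : ℂ) = 4 := Complex.conj_ofNat 4
  have A : ∀ (m n : ℤ), level j = 1 / 2 → base₁ j = m * I / 2 → base₂ j = n * I / 2 →
      base₃ j = 0 → eta j = 1 → theta j = 1 → ∃ g ∈ Gam, ∀ s c w z, g (tubeMap j (s, c, w, z)) =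
        tubeMap j (s, c, -w, -z) := by
    intro m n e1 e2 e3 e4 e5 e6
    refine ⟨translation (0, m) (0, n) 0 * kappa, mul_mem (mem_t _ _ _) mem_k, fun s c w z => ?_⟩
    simp only [Equiv.Perm.mul_apply, hT, hk, gauss, tubeMap, e1, e2, e3, e4, e5, e6]
    refine Prod.ext ?_ (Prod.ext (Complex.ext ?_ ?_) (Prod.ext (Complex.ext ?_ ?_)
      (Complex.ext ?_ ?_))) <;> simp [c2, c4] <;> ring
  have B : ∀ (m n : ℤ), level j = 1 / 2 → base₁ j = m / 2 → base₂ j = n / 2 →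
      base₃ j = -I / 4 → eta j = I → theta j = 1 → ∃ g ∈ Gam, ∀ s c w z,
        g (tubeMap j (s, c, w, z)) = tubeMap j (s, c, -w, -z) := by
    intro m n e1 e2 e3 e4 e5 e6
    refine ⟨translation (m, 0) (n, 0) (0, -1) * (iota₂ * kappa),
      mul_mem (mem_t _ _ _) (mul_mem mem_i2 mem_k), fun s c w z => ?_⟩
    simp only [Equiv.Perm.mul_apply, hT, h2, hk, gauss, tubeMap, e1, e2, e3, e4, e5, e6]
    refine Prod.ext ?_ (Prod.ext (Complex.ext ?_ ?_) (Prod.ext (Complex.ext ?_ ?_)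
      (Complex.ext ?_ ?_))) <;> simp [c2, c4] <;> ring
  fin_cases j
  · refine ⟨deckF⁻¹ * kappa, mul_mem hF mem_k, fun s c w z => ?_⟩
    simp only [Equiv.Perm.mul_apply, hFe, hk]
    refine Prod.ext ?_ (Prod.ext (Complex.ext ?_ ?_) (Prod.ext (Complex.ext ?_ ?_)
      (Complex.ext ?_ ?_))) <;>
      simp [tubeMap, level, base₁, base₂, base₃, eta, theta, sgn, c2, c4] <;> ring
  · refine ⟨translation 0 0 (-1, 0) * (iota₁ * (deckF⁻¹ * kappa)),
      mul_mem (mem_t _ _ _) (mul_mem mem_i1 (mul_mem hF mem_k)), fun s c w z => ?_⟩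
    simp only [Equiv.Perm.mul_apply, hT, h1, hFe, hk, gauss]
    refine Prod.ext ?_ (Prod.ext (Complex.ext ?_ ?_) (Prod.ext (Complex.ext ?_ ?_)
      (Complex.ext ?_ ?_))) <;>
      simp [tubeMap, level, base₁, base₂, base₃, eta, theta, sgn, c2, c4] <;> ring
  · apply A 0 0 <;> simp [level, base₁, base₂, base₃, eta, theta]
  · apply A 0 1 <;> simp [level, base₁, base₂, base₃, eta, theta]
  · apply A 1 0 <;> simp [level, base₁, base₂, base₃, eta, theta]
  · apply A 1 1 <;> simp [level, base₁, base₂, base₃, eta, theta]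
  · apply B 0 0 <;> simp [level, base₁, base₂, base₃, eta, theta]
  · apply B 0 1 <;> simp [level, base₁, base₂, base₃, eta, theta]
  · apply B 1 0 <;> simp [level, base₁, base₂, base₃, eta, theta]
  · apply B 1 1 <;> simp [level, base₁, base₂, base₃, eta, theta]

/-! ### Stabilizers -/
/-- The element of the group acting as `-1` on the fibres of the tube. -/
def reflJ (j : Fin 10) : Equiv.Perm Space7 := (exists_refl j).choose
theorem mem_reflJ (j) : reflJ j ∈ Gam := (exists_refl j).choose_spec.1
theorem reflJ_apply (j s c w z) : reflJ j (tubeMap j (s, c, w, z)) = tubeMap j (s, c, -w, -z) :=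
  (exists_refl j).choose_spec.2 s c w z

theorem reflJ_sq (j) : reflJ j * reflJ j = 1 := by
  ext1 x
  obtain ⟨⟨s, c, w, z⟩, rfl⟩ : ∃ y, tubeMap j y = x := ⟨_, tubeMap_tubeInv j x⟩
  rw [Equiv.Perm.mul_apply, reflJ_apply, reflJ_apply, neg_neg, neg_neg]
  rfl

theorem reflJ_not_NF (j) : ¬ NF (reflJ j) := by
  rintro ⟨k, p, q, a, b, h⟩
  have h0 := congrArg Prod.fst ((reflJ_apply j 0 0 0 0).symm.trans (h _))
  have h1 := congrArg Prod.fst ((reflJ_apply j 0 0 1 0).symm.trans (h _))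
  simp [tubeMap] at h0 h1
  rw [h0] at h1
  push_cast at h1
  linarith

theorem NF_fix {g : Equiv.Perm Space7} (hg : NF g) {x : Space7} (h : g x = x) : g = 1 := by
  obtain ⟨k, p, q, a, b, hg⟩ := hg
  rw [hg] at h
  obtain ⟨t, z₁, z₂, z₃⟩ := x
  simp only [Prod.mk.injEq] at h
  obtain ⟨h1, h2, h3, h4⟩ := h
  have hk : k = 0 := by
    have : (k : ℝ) = 0 := by linarith
    exact_mod_cast this
  subst hk
  have h5 : ((p : ℂ) + q * I) / 2 = 0 := by linear_combination h4
  have hp : p = 0 := by simpa using congrArg Complex.re h5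
  have hq : q = 0 := by simpa using congrArg Complex.im h5
  subst hp hq
  simp at h2 h3
  ext1 x
  rw [hg, h2, h3]
  simp

theorem stab_cases {g : Equiv.Perm Space7} (hg : g ∈ Gam) {j s c}
    (h : g (tubeMap j (s, c, 0, 0)) = tubeMap j (s, c, 0, 0)) : g = 1 ∨ g = reflJ j := by
  rcases NF_or hg with h1 | h1
  · exact Or.inl (NF_fix h1 h)
  · right
    have h2 : NF (reflJ j * kappa) := (NF_or (mem_reflJ j)).resolve_left (reflJ_not_NF j)
    have h3 : NF (g * reflJ j) := by
      have := h1.mul h2.conj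
      rwa [show g * kappa * (kappa * (reflJ j * kappa) * kappa) =
        g * (kappa * kappa) * reflJ j * (kappa * kappa) by group, kappa_kappa, mul_one, mul_one]
        at this
    have h4 : g * reflJ j = 1 := NF_fix h3 (x := tubeMap j (s, c, 0, 0)) (by
      rw [Equiv.Perm.mul_apply, reflJ_apply, neg_zero, h])
    rw [mul_eq_one_iff_eq_inv] at h4
    rw [h4]
    exact inv_eq_of_mul_eq_one_right (reflJ_sq j)

theorem par_eq {x y : ℤ} (hx : x = 0 ∨ x = 1) (hy : y = 0 ∨ y = 1) {n : ℤ} (h : x + 2 * n = y) :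
    x = y := by omega

theorem sign_real (n : ℤ) : ∃ e : ℝ, (e = 1 ∨ e = -1) ∧ ((-1 : ℂ) ^ n = e) := by
  rcases Int.even_or_odd n with h | h
  · exact ⟨1, Or.inl rfl, by simp [h.neg_one_zpow]⟩
  · exact ⟨-1, Or.inr rfl, by simp [h.neg_one_zpow]⟩

/-- parity comparison for the first two complex coordinates -/
theorem par_aux {β β' e : ℝ} {B B' : ℤ} {σ : ℝ} {m : ℤ} (hσ : σ = 1 ∨ σ = -1)
    (he : e = 1 ∨ e = -1) (hB : B = 0 ∨ B = 1) (hB' : B' = 0 ∨ B' = 1)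
    (hβ : β = σ * B / 2) (hβ' : β' = σ * B' / 2) (h : e * β + m = β') : B = B' := by
  subst hβ hβ'
  rcases hσ with rfl | rfl <;> rcases he with rfl | rfl
  · have : (B + 2 * m : ℝ) = B' := by linarith
    exact par_eq hB hB' (n := m) (by exact_mod_cast this)
  · have : (B + 2 * (m - B) : ℝ) = B' := by linarith
    exact par_eq hB hB' (n := m - B) (by exact_mod_cast this)
  · have : (B + 2 * (-m) : ℝ) = B' := by linarith
    exact par_eq hB hB' (n := -m) (by exact_mod_cast this)
  · have : (B + 2 * (-m - B) : ℝ) = B' := by linarith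
    exact par_eq hB hB' (n := -m - B) (by exact_mod_cast this)

theorem NF_tube {g : Equiv.Perm Space7} (hg : NF g) {j j' : Fin 10} {s₀ s₀' : ℝ} {c₀ c₀' : ℂ}
    (h : g (tubeMap j (s₀, c₀, 0, 0)) = tubeMap j' (s₀', c₀', 0, 0)) :
    j = j' ∧ ∃ e : ℝ, (e = 1 ∨ e = -1) ∧ ∀ s c w z, g (tubeMap j (s, c, w, z)) =
      tubeMap j (s + (s₀' - s₀), e * c + (c₀' - e * c₀), w, e * z) := by
  obtain ⟨k, p, q, a, b, hg⟩ := hg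
  obtain ⟨e, he, hee⟩ := sign_real (p + q)
  rw [hg] at h
  simp only [tubeMap, Prod.mk.injEq] at h
  obtain ⟨h1, h2, h3, h4⟩ := h
  simp only [zero_re, add_zero, level_eq] at h1
  have hT : iT j + 2 * k = iT j' := by
    have : (iT j : ℝ) + 2 * k = iT j' := by linarith
    exact_mod_cast this
  have hTe : iT j = iT j' := par_eq (iT_cases j) (iT_cases j') hT
  have hk : k = 0 := by omega
  subst hk
  simp only [zpow_zero, one_mul, hee, ofReal_zero, zero_im, zero_re, mul_zero, zero_mul, add_zero,
    sub_zero] at h2 h3 h4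
  have hB₃ : iB₃ j = iB₃ j' := by
    rw [base₃_eq, base₃_eq, theta_eq, theta_eq, ← hTe] at h4
    rcases iT_cases j with hj | hj
    · simp only [hj, if_true] at h4
      have := congrArg Complex.re h4
      simp at this
      have h5 : (iB₃ j : ℝ) + 2 * (-p) = iB₃ j' := by linarith
      exact par_eq (iB₃_cases j) (iB₃_cases j') (n := -p) (by exact_mod_cast h5)
    · simp only [hj] at h4
      have := congrArg Complex.im h4
      simp at this
      have h5 : (iB₃ j : ℝ) + 2 * (-q) = iB₃ j' := by linarith
      exact par_eq (iB₃_cases j) (iB₃_cases j') (n := -q) (by exact_mod_cast h5)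
  have heta : eta j = eta j' := by rw [eta_eq, eta_eq, hTe, hB₃]
  have aux : ∀ (B B' : ℤ) (x y : ℝ) (a : ℤ × ℤ), (B = 0 ∨ B = 1) → (B' = 0 ∨ B' = 1) →
      iT j = 1 → e * (eta j * (((1 - 2 * iB₃ j) * B / 2 : ℝ) * I) + eta j * x) + gauss a =
        eta j * (((1 - 2 * iB₃ j) * B' / 2 : ℝ) * I) + eta j * y → B = B' := by
    intro B B' x y a hB hB' hj h
    have hσ : ((1 : ℝ) - 2 * iB₃ j = 1 ∨ (1 : ℝ) - 2 * iB₃ j = -1) := by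
      rcases iB₃_cases j with h | h <;> rw [h] <;> norm_num
    rw [eta_eq, hj] at h
    rcases iB₃_cases j with hb | hb
    · rw [hb] at h hσ
      have := congrArg Complex.im h
      simp [gauss] at this
      exact par_aux (m := a.2) (σ := 1) (Or.inl rfl) he hB hB' rfl rfl
        (by linarith)
    · rw [hb] at h hσ
      have := congrArg Complex.re h
      simp [gauss] at this
      exact par_aux (m := -a.1) (σ := -1) (Or.inr rfl) he hB hB' rfl rfl
        (by push_cast; linarith)
  have hB₁ : iB₁ j = iB₁ j' := by
    rcases iT_cases j with hj | hj
    · rw [(iB_zero j hj).1, (iB_zero j' (hTe ▸ hj)).1]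
    · rw [base₁_eq, base₁_eq, ← heta, ← hB₃] at h2
      exact aux _ _ _ _ a (iB₁_cases j) (iB₁_cases j') hj h2
  have hB₂ : iB₂ j = iB₂ j' := by
    rcases iT_cases j with hj | hj
    · rw [(iB_zero j hj).2, (iB_zero j' (hTe ▸ hj)).2]
    · rw [base₂_eq, base₂_eq, ← heta, ← hB₃] at h3
      exact aux _ _ _ _ b (iB₂_cases j) (iB₂_cases j') hj h3
  obtain rfl := index_ext j j' hTe hB₃ hB₁ hB₂
  refine ⟨rfl, e, he, fun s c w z => ?_⟩
  rw [hg]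
  simp only [tubeMap, zpow_zero, one_mul, hee]
  ext1
  · simp
  ext1
  · simp
    linear_combination h2
  ext1
  · simp
    linear_combination h3
  · simp
    linear_combination h4

theorem Gam_tube {g : Equiv.Perm Space7} (hg : g ∈ Gam) {j j' : Fin 10} {s₀ s₀' : ℝ} {c₀ c₀' : ℂ}
    (h : g (tubeMap j (s₀, c₀, 0, 0)) = tubeMap j' (s₀', c₀', 0, 0)) :
    j = j' ∧ ∃ g' ∈ Gam, (g' = g ∨ g' = g * reflJ j) ∧
    ∃ e : ℝ, (e = 1 ∨ e = -1) ∧ ∀ s c w z, g' (tubeMap j (s, c, w, z)) =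
      tubeMap j (s + (s₀' - s₀), e * c + (c₀' - e * c₀), w, e * z) := by
  rcases NF_or hg with h1 | h1
  · obtain ⟨hj, h2⟩ := NF_tube h1 h
    exact ⟨hj, g, hg, Or.inl rfl, h2⟩
  · have h2 : NF (reflJ j * kappa) := (NF_or (mem_reflJ j)).resolve_left (reflJ_not_NF j)
    have h3 : NF (g * reflJ j) := by
      have := h1.mul h2.conj
      rwa [show g * kappa * (kappa * (reflJ j * kappa) * kappa) =
        g * (kappa * kappa) * reflJ j * (kappa * kappa) by group, kappa_kappa, mul_one, mul_one]
        at this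
    obtain ⟨hj, h2⟩ := NF_tube h3 (s₀ := s₀) (c₀ := c₀) (j := j) (by
      rw [Equiv.Perm.mul_apply, reflJ_apply, neg_zero, h])
    exact ⟨hj, _, mul_mem hg (mem_reflJ j), Or.inr rfl, h2⟩

/-! ### Marked points -/
theorem ptQ_eq {x y : Space7} : ptQ x = ptQ y ↔ ∃ g ∈ Gam, g x = y := by
  rw [ptQ, ptQ, Quotient.eq'', MulAction.orbitRel_apply, MulAction.mem_orbit_iff]
  constructor
  · rintro ⟨⟨g, hg⟩, h⟩
    refine ⟨g⁻¹, inv_mem hg, ?_⟩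
    have h1 : g y = x := congrArg Prod.fst h
    rw [← h1]; simp
  · rintro ⟨g, hg, rfl⟩
    refine ⟨⟨g⁻¹, inv_mem hg⟩, ?_⟩
    have h1 : g⁻¹ (g x) = x := by simp
    refine Prod.ext h1 ?_
    change ⇑g⁻¹ '' {g x} = {x}
    rw [Set.image_singleton, h1]

theorem lnQ_eq {j s c w j' s' c' w'} : lnQ j s c w = lnQ j' s' c' w' ↔
    ∃ g ∈ Gam, g (tubeMap j (s, c, 0, 0)) = tubeMap j' (s', c', 0, 0) ∧
      g '' line j s c w = line j' s' c' w' := by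
  rw [lnQ, lnQ, Quotient.eq'', MulAction.orbitRel_apply, MulAction.mem_orbit_iff]
  constructor
  · rintro ⟨⟨g, hg⟩, h⟩
    refine ⟨g⁻¹, inv_mem hg, ?_, ?_⟩
    · have h1 : g (tubeMap j' (s', c', 0, 0)) = tubeMap j (s, c, 0, 0) := congrArg Prod.fst h
      rw [← h1]; simp
    · have h1 : g '' line j' s' c' w' = line j s c w := congrArg Prod.snd h
      rw [← h1, ← Set.image_comp, ← Equiv.Perm.coe_mul, inv_mul_cancel, Equiv.Perm.coe_one,
        Set.image_id]
  · rintro ⟨g, hg, h1, h2⟩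
    refine ⟨⟨g⁻¹, inv_mem hg⟩, Prod.ext ?_ ?_⟩
    · change g⁻¹ (tubeMap j' (s', c', 0, 0)) = _
      rw [← h1]; simp
    · change ⇑g⁻¹ '' line j' s' c' w' = line j s c w
      rw [← h2, ← Set.image_comp, ← Equiv.Perm.coe_mul, inv_mul_cancel, Equiv.Perm.coe_one,
        Set.image_id]

theorem dir_ne (b v) : ((dir b v).1 ≠ 0) ∨ ((dir b v).2 ≠ 0) := by
  cases b <;> simp [dir]

theorem mem_line {j s c w s' c' w' z'} : tubeMap j (s', c', w', z') ∈ line j s c w ↔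
    s' = s ∧ c' = c ∧ ∃ l : ℂ, w' = l * w.1 ∧ z' = l * w.2 := by
  constructor
  · rintro ⟨l, hl⟩
    have := tubeMap_injective j hl
    simp only [Prod.mk.injEq] at this
    exact ⟨this.1.symm, this.2.1.symm, l, this.2.2.1.symm, this.2.2.2.symm⟩
  · rintro ⟨rfl, rfl, l, rfl, rfl⟩
    exact ⟨l, rfl⟩

theorem base_mem_line (j s c w) : tubeMap j (s, c, 0, 0) ∈ line j s c w :=
  mem_line.2 ⟨rfl, rfl, 0, by simp, by simp⟩

theorem ptQ_ne_lnQ (x j s c b v) : ptQ x ≠ lnQ j s c (dir b v) := by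
  intro h
  rw [ptQ, lnQ, Quotient.eq'', MulAction.orbitRel_apply, MulAction.mem_orbit_iff] at h
  obtain ⟨⟨g, hg⟩, h⟩ := h
  have h1 : g '' line j s c (dir b v) = {x} := congrArg Prod.snd h
  have h2 : line j s c (dir b v) = {g⁻¹ x} := by
    rw [← Set.image_singleton (f := ⇑g⁻¹), ← h1, ← Set.image_comp, ← Equiv.Perm.coe_mul,
      inv_mul_cancel, Equiv.Perm.coe_one, Set.image_id]
  have h3 := base_mem_line j s c (dir b v)
  have h4 : tubeMap j (s, c, (dir b v).1, (dir b v).2) ∈ line j s c (dir b v) :=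
    mem_line.2 ⟨rfl, rfl, 1, by simp, by simp⟩
  rw [h2, Set.mem_singleton_iff] at h3 h4
  have h5 := tubeMap_injective j (h4.trans h3.symm)
  simp only [Prod.mk.injEq, true_and] at h5
  rcases dir_ne b v with h | h
  · exact h h5.1
  · exact h h5.2

theorem image_line {g : Equiv.Perm Space7} {j : Fin 10} {σ : ℝ} {α : ℂ} {e₁ e : ℂ}
    (h : ∀ s c w z, g (tubeMap j (s, c, w, z)) = tubeMap j (s + σ, e₁ * c + α, w, e * z))
    (s : ℝ) (c : ℂ) (w : ℂ × ℂ) :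
    g '' line j s c w = line j (s + σ) (e₁ * c + α) (w.1, e * w.2) := by
  rw [line, line, ← Set.range_comp]
  congr 1
  ext1 l
  simp only [Function.comp_apply, h]
  rw [mul_left_comm]

theorem reflJ_line (j s c w) : reflJ j '' line j s c w = line j s c w := by
  ext x
  constructor
  · rintro ⟨_, ⟨l, rfl⟩, rfl⟩
    refine ⟨-l, ?_⟩
    simp only [reflJ_apply, neg_mul]
  · rintro ⟨l, rfl⟩
    refine ⟨_, ⟨-l, rfl⟩, ?_⟩
    simp only [reflJ_apply, neg_mul, neg_neg]

theorem line_smul (j s c w) {l : ℂ} (hl : l ≠ 0) : line j s c (l * w.1, l * w.2) = line j s c w := by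
  ext x
  constructor
  · rintro ⟨m, rfl⟩
    exact ⟨m * l, by simp only [mul_assoc]⟩
  · rintro ⟨m, rfl⟩
    exact ⟨m * l⁻¹, by simp [mul_assoc, hl]⟩

theorem regular_smul {g : Equiv.Perm Space7} (hg : g ∈ Gam) {x} (hx : x ∈ regular) :
    g x ∈ regular := by
  intro h hh hx'
  have : g⁻¹ * h * g = 1 := hx _ (mul_mem (mul_mem (inv_mem hg) hh) hg) (by
    rw [Equiv.Perm.mul_apply, Equiv.Perm.mul_apply, hx']; simp)
  have h2 : h = g * (g⁻¹ * h * g) * g⁻¹ := by group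
  rw [h2, this]; simp

theorem isOpen_regular : IsOpen regular := by
  rw [isOpen_iff_mem_nhds]
  intro x hx
  obtain ⟨U, hU, hxU, h⟩ := Gam_disc x
  filter_upwards [hU.mem_nhds hxU] with y hy g hg hgy
  exact hx g hg (h g hg y hy (by rwa [hgy]))

/-! ### Coordinates near the exceptional divisors -/
/-- The map `(s, c, r, v) ↦ (s, c, r w)` where `w` is the direction given by `v`. -/
def blow (b : Bool) (p : Space7) : Space7 :=
  (p.1, p.2.1, p.2.2.1 * (dir b p.2.2.2).1, p.2.2.1 * (dir b p.2.2.2).2)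

/-- Away from the exceptional set, the coordinates `(s, c, u, v)` of the point `(s, c, w₁, w₂)`:
`u = w₁²` and `v = w₂ / w₁`, or `u = w₂²` and `v = w₁ / w₂`. -/
def unblow (b : Bool) (p : Space7) : Space7 :=
  if b then (p.1, p.2.1, p.2.2.2 ^ 2, p.2.2.1 / p.2.2.2)
  else (p.1, p.2.1, p.2.2.1 ^ 2, p.2.2.2 / p.2.2.1)

theorem unblow_blow (b s c r v) (hr : r ≠ 0) : unblow b (blow b (s, c, r, v)) = (s, c, r ^ 2, v) := by
  cases b <;> simp [blow, unblow, dir, hr]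

theorem contDiff_blow (b) : ContDiff ℝ ∞ (blow b) := by
  have hc : ContDiff ℝ ∞ fun x : Space7 => x.2.1 := by fun_prop
  have hw : ContDiff ℝ ∞ fun x : Space7 => x.2.2.1 := by fun_prop
  have hv : ContDiff ℝ ∞ fun x : Space7 => x.2.2.2 := by fun_prop
  have hs : ContDiff ℝ ∞ fun x : Space7 => x.1 := by fun_prop
  cases b
  · exact hs.prodMk (hc.prodMk ((hw.mul contDiff_const).prodMk (hw.mul hv)))
  · exact hs.prodMk (hc.prodMk ((hw.mul hv).prodMk (hw.mul contDiff_const)))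

theorem csqrt_sq (u : ℂ) : csqrt u ^ 2 = u := by
  have := Complex.cpow_nat_inv_pow u (n := 2) (by norm_num)
  simpa [csqrt] using this

theorem csqrt_ne {u : ℂ} (hu : u ≠ 0) : csqrt u ≠ 0 := by
  intro h
  have := csqrt_sq u
  rw [h] at this
  simp at this
  exact hu this.symm

/-- The parametrizations near an exceptional divisor. The resolution of `ℂ² / ±1` has the points
`± (w, ℓ)` with `w ∈ ℓ`, and smooth coordinates `u = w₁²`, `v = w₂ / w₁` where `ℓ` is spanned by `(1, v)`,
and `u = w₂²`, `v = w₁ / w₂` where `ℓ` is spanned by `(v, 1)`. The exceptional divisor is `u = 0`, and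
`(w, ℓ)` with `w ≠ 0` is identified with the point `w`. -/
def psiQ (j : Fin 10) (b : Bool) (p : Space7) : Marked :=
  if p.2.2.1 = 0 then lnQ j p.1 p.2.1 (dir b p.2.2.2)
  else ptQ (tubeMap j (blow b (p.1, p.2.1, csqrt p.2.2.1, p.2.2.2)))

theorem blow_neg (b s c r v) : blow b (s, c, -r, v) =
    ((blow b (s, c, r, v)).1, (blow b (s, c, r, v)).2.1, -(blow b (s, c, r, v)).2.2.1,
      -(blow b (s, c, r, v)).2.2.2) := by
  simp [blow]

theorem reflJ_blow (j b s c r v) : reflJ j (tubeMap j (blow b (s, c, r, v))) =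
    tubeMap j (blow b (s, c, -r, v)) := by
  rw [blow_neg, ← reflJ_apply]

theorem root_cases {u r : ℂ} (h : r ^ 2 = u) : r = csqrt u ∨ r = -csqrt u :=
  sq_eq_sq_iff_eq_or_eq_neg.1 (h.trans (csqrt_sq u).symm)

theorem psiQ_eq {j b s c u v r} (hu : u ≠ 0) (h : r ^ 2 = u) :
    psiQ j b (s, c, u, v) = ptQ (tubeMap j (blow b (s, c, r, v))) := by
  simp only [psiQ, hu, if_false]
  rcases root_cases h with rfl | rfl
  · rfl
  · exact ptQ_eq.2 ⟨_, mem_reflJ j, reflJ_blow _ _ _ _ _ _⟩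

theorem psiQ_zero (j b s c v) : psiQ j b (s, c, 0, v) = lnQ j s c (dir b v) := by simp [psiQ]

/-- The domain of the parametrization: points which lie on the exceptional divisor, or over free points. -/
def domJ (j : Fin 10) (b : Bool) : Set Space7 :=
  {p | p.2.2.1 = 0 ∨ tubeMap j (blow b (p.1, p.2.1, csqrt p.2.2.1, p.2.2.2)) ∈ regular}

theorem domJ_iff {j b s c u v r} (hu : u ≠ 0) (h : r ^ 2 = u) :
    (s, c, u, v) ∈ domJ j b ↔ tubeMap j (blow b (s, c, r, v)) ∈ regular := by
  simp only [domJ, Set.mem_ofPred_eq, hu, false_or]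
  rcases root_cases h with rfl | rfl
  · rfl
  · constructor
    · intro h
      rw [← reflJ_blow]
      exact regular_smul (mem_reflJ j) h
    · intro h
      rw [← neg_neg (csqrt u), ← reflJ_blow]
      exact regular_smul (mem_reflJ j) h

/-- A branch of the square root of `u` with value `r` at `u = r ^ 2`. -/
def branch (r u : ℂ) : ℂ := r * csqrt (u / r ^ 2)

theorem branch_sq {r u : ℂ} (hr : r ≠ 0) : branch r u ^ 2 = u := by
  rw [branch, mul_pow, csqrt_sq]; field_simp

theorem branch_self {r : ℂ} (hr : r ≠ 0) : branch r (r ^ 2) = r := by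
  rw [branch, div_self (pow_ne_zero 2 hr), csqrt, one_cpow, mul_one]

theorem contDiffAt_branch {r : ℂ} (hr : r ≠ 0) : ContDiffAt ℝ ∞ (branch r) (r ^ 2) := by
  have h1 : ContDiffAt ℂ ∞ csqrt ((r ^ 2) / r ^ 2) := by
    rw [div_self (pow_ne_zero 2 hr)]
    have h : AnalyticAt ℂ csqrt 1 := by
      unfold csqrt
      exact analyticAt_id.cpow analyticAt_const (by simp)
    exact h.contDiffAt
  have h2 : ContDiffAt ℂ ∞ (fun u : ℂ => u / r ^ 2) (r ^ 2) := by
    simp only [div_eq_mul_inv]; fun_prop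
  have h3 : ContDiffAt ℂ ∞ (branch r) (r ^ 2) := contDiffAt_const.mul (h1.comp (f := fun u : ℂ => u / r ^ 2) (r ^ 2) h2)
  exact h3.restrict_scalars ℝ

/-- the branch, as a map of coordinates -/
def branchMap (r : ℂ) (p : Space7) : Space7 := (p.1, p.2.1, branch r p.2.2.1, p.2.2.2)

theorem contDiffAt_branchMap {r : ℂ} (hr : r ≠ 0) (s c v) :
    ContDiffAt ℝ ∞ (branchMap r) (s, c, r ^ 2, v) := by
  have hc : ContDiffAt ℝ ∞ (fun x : Space7 => x.2.1) (s, c, r ^ 2, v) := by fun_prop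
  have hw : ContDiffAt ℝ ∞ (fun x : Space7 => x.2.2.1) (s, c, r ^ 2, v) := by fun_prop
  have hv : ContDiffAt ℝ ∞ (fun x : Space7 => x.2.2.2) (s, c, r ^ 2, v) := by fun_prop
  have hs : ContDiffAt ℝ ∞ (fun x : Space7 => x.1) (s, c, r ^ 2, v) := by fun_prop
  have hb : ContDiffAt ℝ ∞ (fun x : Space7 => branch r x.2.2.1) (s, c, r ^ 2, v) :=
    (contDiffAt_branch hr).comp (f := fun x : Space7 => x.2.2.1) (s, c, r ^ 2, v) hw
  exact hs.prodMk (hc.prodMk (hb.prodMk hv))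

theorem branchMap_self {r : ℂ} (hr : r ≠ 0) (s c v) :
    branchMap r (s, c, r ^ 2, v) = (s, c, r, v) := by simp [branchMap, branch_self hr]

/-- the square-root lift of the parametrization -/
def up (j : Fin 10) (b : Bool) (r : ℂ) (p : Space7) : Space7 := tubeMap j (blow b (branchMap r p))

theorem contDiffAt_up {r : ℂ} (hr : r ≠ 0) (j b s c v) :
    ContDiffAt ℝ ∞ (up j b r) (s, c, r ^ 2, v) :=
  (contDiff_tubeMap j).contDiffAt.comp _
    ((contDiff_blow b).contDiffAt.comp _ (contDiffAt_branchMap hr s c v))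

theorem up_self {r : ℂ} (hr : r ≠ 0) (j b s c v) :
    up j b r (s, c, r ^ 2, v) = tubeMap j (blow b (s, c, r, v)) := by
  rw [up, branchMap_self hr]

theorem psiQ_up {r : ℂ} (hr : r ≠ 0) (j b) {p : Space7} (hp : p.2.2.1 ≠ 0) :
    psiQ j b p = ptQ (up j b r p) :=
  psiQ_eq (s := p.1) (c := p.2.1) (v := p.2.2.2) hp (branch_sq hr)

theorem domJ_up {r : ℂ} (hr : r ≠ 0) (j b) {p : Space7} (hp : p.2.2.1 ≠ 0) :
    p ∈ domJ j b ↔ up j b r p ∈ regular :=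
  domJ_iff (s := p.1) (c := p.2.1) (v := p.2.2.2) hp (branch_sq hr)

theorem branch_ne {r u : ℂ} (hr : r ≠ 0) (hu : u ≠ 0) : branch r u ≠ 0 := by
  intro h
  have := branch_sq (u := u) hr
  rw [h] at this
  simp at this
  exact hu this.symm

theorem up_inj {r : ℂ} (hr : r ≠ 0) (j b) {p q : Space7} (hp : p.2.2.1 ≠ 0) (hq : q.2.2.1 ≠ 0)
    (h : up j b r p = up j b r q) : p = q := by
  have h1 := congrArg (unblow b) (tubeMap_injective j h)
  rw [branchMap, branchMap, unblow_blow _ _ _ _ _ (branch_ne hr hp),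
    unblow_blow _ _ _ _ _ (branch_ne hr hq), branch_sq hr, branch_sq hr] at h1
  exact h1

theorem exists_root {u : ℂ} (hu : u ≠ 0) : ∃ r : ℂ, r ≠ 0 ∧ r ^ 2 = u :=
  ⟨csqrt u, csqrt_ne hu, csqrt_sq u⟩

theorem continuousAt_csqrt_zero : ContinuousAt csqrt 0 :=
  Complex.continuousAt_cpow_const_of_re_pos (Or.inl le_rfl) (by simp)

theorem csqrt_zero : csqrt 0 = 0 := by simp [csqrt]

/-- the (discontinuous) principal lift is continuous on the exceptional set -/
theorem continuousAt_center (j b s c v) :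
    ContinuousAt (fun p : Space7 => tubeMap j (blow b (p.1, p.2.1, csqrt p.2.2.1, p.2.2.2)))
      (s, c, 0, v) := by
  have h : ContinuousAt (fun p : Space7 => (p.1, p.2.1, csqrt p.2.2.1, p.2.2.2)) (s, c, 0, v) := by
    have hw : ContinuousAt (fun p : Space7 => csqrt p.2.2.1) (s, c, 0, v) :=
      ContinuousAt.comp (f := fun p : Space7 => p.2.2.1) (x := (s, c, 0, v))
        continuousAt_csqrt_zero (by fun_prop)
    have hc : ContinuousAt (fun x : Space7 => x.2.1) (s, c, 0, v) := by fun_prop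
    have hv : ContinuousAt (fun x : Space7 => x.2.2.2) (s, c, 0, v) := by fun_prop
    have hs : ContinuousAt (fun x : Space7 => x.1) (s, c, 0, v) := by fun_prop
    exact hs.prodMk (hc.prodMk (hw.prodMk hv))
  exact (((contDiff_tubeMap j).comp (contDiff_blow b)).continuous.continuousAt).comp
    (f := fun p : Space7 => (p.1, p.2.1, csqrt p.2.2.1, p.2.2.2)) h

theorem blow_zero (b s c v) : blow b (s, c, 0, v) = (s, c, 0, 0) := by simp [blow]

/-- near the exceptional set -/
theorem near_center (j : Fin 10) (b : Bool) (s : ℝ) (c v : ℂ) : ∃ V : Set Space7, IsOpen V ∧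
    (s, c, 0, v) ∈ V ∧ ∀ p ∈ V, ∀ p' ∈ V, ∀ g ∈ Gam,
      g (tubeMap j (blow b (p.1, p.2.1, csqrt p.2.2.1, p.2.2.2))) =
        tubeMap j (blow b (p'.1, p'.2.1, csqrt p'.2.2.1, p'.2.2.2)) → g = 1 ∨ g = reflJ j := by
  obtain ⟨U, hU, hxU, h⟩ := Gam_disc (tubeMap j (s, c, 0, 0))
  have h1 : ∀ᶠ p : Space7 in 𝓝 (s, c, 0, v),
      tubeMap j (blow b (p.1, p.2.1, csqrt p.2.2.1, p.2.2.2)) ∈ U := by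
    apply continuousAt_center
    simp only [csqrt_zero, blow_zero]
    exact hU.mem_nhds hxU
  obtain ⟨V, hV1, hV2, hV3⟩ := eventually_nhds_iff.1 h1
  refine ⟨V, hV2, hV3, fun p hp p' hp' g hg e => ?_⟩
  exact stab_cases hg (h g hg _ (hV1 p hp) (by rw [e]; exact hV1 p' hp'))

theorem isOpen_domJ (j b) : IsOpen (domJ j b) := by
  rw [isOpen_iff_mem_nhds]
  rintro ⟨s, c, u, v⟩ hp
  by_cases hu : u = 0
  · subst hu
    obtain ⟨V, hV, hm, h⟩ := near_center j b s c v
    filter_upwards [hV.mem_nhds hm] with p hp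
    by_cases hz : p.2.2.1 = 0
    · exact Or.inl hz
    · refine Or.inr fun g hg he => ?_
      rcases h p hp p hp g hg he with h | h
      · exact h
      · exfalso
        rw [h, reflJ_blow] at he
        have h1 := congrArg (fun x : Space7 => (x.2.2.1, x.2.2.2)) (tubeMap_injective j he)
        have h2 := csqrt_ne hz
        simp only [blow, Prod.mk.injEq, neg_mul, neg_eq_self] at h1
        rcases dir_ne b p.2.2.2 with h3 | h3
        · exact mul_ne_zero h2 h3 h1.1
        · exact mul_ne_zero h2 h3 h1.2
  · obtain ⟨r, hr, rfl⟩ := exists_root hu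
    have h1 := (domJ_up hr j b hu).1 hp
    have h2 := (contDiffAt_up hr j b s c v).continuousAt (isOpen_regular.mem_nhds h1)
    have h3 : ∀ᶠ p : Space7 in 𝓝 (s, c, r ^ 2, v), p.2.2.1 ≠ 0 :=
      (by fun_prop : Continuous fun p : Space7 => p.2.2.1).continuousAt.eventually_ne hu
    filter_upwards [h2, h3] with p hp hz
    exact (domJ_up hr j b hz).2 hp

theorem inj_ptQ {x} (hx : x ∈ regular) : ∃ V, IsOpen V ∧ x ∈ V ∧ V ⊆ regular ∧
    Set.InjOn ptQ V := by
  obtain ⟨U, hU, hxU, h⟩ := Gam_disc x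
  refine ⟨U ∩ regular, hU.inter isOpen_regular, ⟨hxU, hx⟩, Set.inter_subset_right, ?_⟩
  rintro y ⟨hy, -⟩ z ⟨hz, -⟩ e
  obtain ⟨g, hg, rfl⟩ := ptQ_eq.1 e
  rw [hx g hg (h g hg y hy hz)]
  rfl

theorem dir_inj {b v v'} {l : ℂ} (h1 : (dir b v').1 = l * (dir b v).1)
    (h2 : (dir b v').2 = l * (dir b v).2) : v' = v := by
  cases b
  · simp only [dir, Bool.false_eq_true, if_false, mul_one] at h1 h2
    rw [h2, ← h1, one_mul]
  · simp only [dir, if_true, mul_one] at h1 h2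
    rw [h1, ← h2, one_mul]

theorem inj_psiQ {j b p} (hp : p ∈ domJ j b) : ∃ V, IsOpen V ∧ p ∈ V ∧ V ⊆ domJ j b ∧
    Set.InjOn (psiQ j b) V := by
  obtain ⟨s, c, u, v⟩ := p
  by_cases hu : u = 0
  · subst hu
    obtain ⟨V, hV, hm, h⟩ := near_center j b s c v
    refine ⟨V ∩ domJ j b, hV.inter (isOpen_domJ j b), ⟨hm, hp⟩, Set.inter_subset_right, ?_⟩
    rintro ⟨s₁, c₁, u₁, v₁⟩ ⟨hy, -⟩ ⟨s₂, c₂, u₂, v₂⟩ ⟨hz, -⟩ e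
    by_cases h1 : u₁ = 0 <;> by_cases h2 : u₂ = 0
    · subst h1 h2
      rw [psiQ_zero, psiQ_zero, lnQ_eq] at e
      obtain ⟨g, hg, e1, e2⟩ := e
      have h3 : tubeMap j (s₁, c₁, 0, 0) = tubeMap j (s₂, c₂, 0, 0) ∧
          line j s₁ c₁ (dir b v₁) = line j s₂ c₂ (dir b v₂) := by
        rcases h _ hy _ hz g hg (by simp only [csqrt_zero, blow_zero, e1]) with rfl | rfl
        · exact ⟨e1, by simpa using e2⟩
        · rw [reflJ_apply, neg_zero] at e1
          rw [reflJ_line] at e2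
          exact ⟨e1, e2⟩
      obtain ⟨h3, h4⟩ := h3
      have h5 := tubeMap_injective j h3
      simp only [Prod.mk.injEq, and_true] at h5
      obtain ⟨rfl, rfl⟩ := h5
      have h6 : tubeMap j (s₁, c₁, (dir b v₂).1, (dir b v₂).2) ∈ line j s₁ c₁ (dir b v₁) := by
        rw [h4]
        exact mem_line.2 ⟨rfl, rfl, 1, by simp, by simp⟩
      obtain ⟨-, -, l, h7, h8⟩ := mem_line.1 h6
      rw [dir_inj h7 h8]
    · subst h1
      rw [psiQ_zero, psiQ_eq h2 (csqrt_sq u₂)] at e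
      exact absurd e.symm (ptQ_ne_lnQ _ _ _ _ _ _)
    · subst h2
      rw [psiQ_zero, psiQ_eq h1 (csqrt_sq u₁)] at e
      exact absurd e (ptQ_ne_lnQ _ _ _ _ _ _)
    · rw [psiQ_eq h1 (csqrt_sq u₁), psiQ_eq h2 (csqrt_sq u₂), ptQ_eq] at e
      obtain ⟨g, hg, e⟩ := e
      have h3 : ∃ r : ℂ, r ^ 2 = u₁ ∧ blow b (s₁, c₁, r, v₁) = blow b (s₂, c₂, csqrt u₂, v₂) := by
        rcases h _ hy _ hz g hg e with rfl | rfl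
        · exact ⟨_, csqrt_sq u₁, tubeMap_injective j e⟩
        · rw [reflJ_blow] at e
          exact ⟨-csqrt u₁, by rw [neg_sq, csqrt_sq], tubeMap_injective j e⟩
      obtain ⟨r, hr, h4⟩ := h3
      have hr0 : r ≠ 0 := by
        rintro rfl
        exact h1 (by rw [← hr]; simp)
      have h5 := congrArg (unblow b) h4
      rw [unblow_blow _ _ _ _ _ hr0, unblow_blow _ _ _ _ _ (csqrt_ne h2), hr, csqrt_sq] at h5
      exact h5
  · obtain ⟨r, hr, rfl⟩ := exists_root hu
    have h1 := (domJ_up hr j b hu).1 hp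
    obtain ⟨U, hU, hxU, h⟩ := Gam_disc (up j b r (s, c, r ^ 2, v))
    have h2 := (contDiffAt_up hr j b s c v).continuousAt (hU.mem_nhds hxU)
    have h3 : ∀ᶠ p : Space7 in 𝓝 (s, c, r ^ 2, v), p.2.2.1 ≠ 0 :=
      (by fun_prop : Continuous fun p : Space7 => p.2.2.1).continuousAt.eventually_ne hu
    obtain ⟨V, hV1, hV2, hV3⟩ := eventually_nhds_iff.1 (Filter.Eventually.and h2 h3)
    refine ⟨V ∩ domJ j b, hV2.inter (isOpen_domJ j b), ⟨hV3, hp⟩, Set.inter_subset_right, ?_⟩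
    rintro y ⟨hy, -⟩ z ⟨hz, -⟩ e
    obtain ⟨hy1, hy2⟩ := hV1 y hy
    obtain ⟨hz1, hz2⟩ := hV1 z hz
    rw [psiQ_up hr j b hy2, psiQ_up hr j b hz2, ptQ_eq] at e
    obtain ⟨g, hg, e⟩ := e
    have h4 : g = 1 := h1 g hg (h g hg _ hy1 (by rw [e]; exact hz1))
    rw [h4] at e
    exact up_inj hr j b hy2 hz2 e

/-! ### Smooth transition maps -/
theorem contDiffAt_unblow {b s c w z} (h : (if b then z else w) ≠ 0) :
    ContDiffAt ℝ ∞ (unblow b) (s, c, w, z) := by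
  have hc : ContDiffAt ℝ ∞ (fun x : Space7 => x.2.1) (s, c, w, z) := by fun_prop
  have hw : ContDiffAt ℝ ∞ (fun x : Space7 => x.2.2.1) (s, c, w, z) := by fun_prop
  have hv : ContDiffAt ℝ ∞ (fun x : Space7 => x.2.2.2) (s, c, w, z) := by fun_prop
  have hs : ContDiffAt ℝ ∞ (fun x : Space7 => x.1) (s, c, w, z) := by fun_prop
  cases b
  · exact hs.prodMk (hc.prodMk ((hw.pow 2).prodMk (hv.mul (hw.inv h)))) |>.congr_of_eventuallyEq
      (Filter.Eventually.of_forall fun p => by simp [unblow, div_eq_mul_inv])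
  · exact hs.prodMk (hc.prodMk ((hv.pow 2).prodMk (hw.mul (hv.inv h)))) |>.congr_of_eventuallyEq
      (Filter.Eventually.of_forall fun p => by simp [unblow, div_eq_mul_inv])

theorem psiQ_unblow {j b} {p : Space7} (h : (if b then p.2.2.2 else p.2.2.1) ≠ 0) :
    psiQ j b (unblow b p) = ptQ (tubeMap j p) := by
  obtain ⟨s, c, w, z⟩ := p
  cases b
  · have h : w ≠ 0 := h
    rw [unblow, if_neg (by simp), psiQ_eq (r := w) (by simp [h]) rfl]
    simp only [blow, dir]
    simp
    field_simp
  · have h : z ≠ 0 := h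
    rw [unblow, if_pos rfl, psiQ_eq (r := z) (by simp [h]) rfl]
    simp only [blow, dir]
    simp
    field_simp

/-- The abstract form of a smooth local lift of `f` through `f'` from `x` to `y`. -/
def HasLift (f f' : Space7 → Marked) (x y : Space7) : Prop :=
  ∃ g : Space7 → Space7, ContDiffAt ℝ ∞ g x ∧ g x = y ∧ ∀ᶠ z in 𝓝 x, f' (g z) = f z

theorem HasLift.trans {f₁ f₂ f₃ x y z} (h : HasLift f₁ f₂ x y) (h' : HasLift f₂ f₃ y z) :
    HasLift f₁ f₃ x z := by
  obtain ⟨g, hg, rfl, hgl⟩ := h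
  obtain ⟨g', hg', rfl, hgl'⟩ := h'
  refine ⟨g' ∘ g, hg'.comp x hg, rfl, ?_⟩
  filter_upwards [hgl, hg.continuousAt.eventually hgl'] with z h1 h2
  rw [Function.comp_apply, h2, h1]

theorem lift_pt {x y} (h : ptQ x = ptQ y) : HasLift ptQ ptQ x y := by
  obtain ⟨g, hg, rfl⟩ := ptQ_eq.1 h
  exact ⟨g, (Gam_smooth hg).1.contDiffAt, rfl,
    Filter.Eventually.of_forall fun z => (ptQ_eq.2 ⟨g, hg, rfl⟩).symm⟩

theorem lift_up {j b s c v r} (hr : r ≠ 0) :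
    HasLift (psiQ j b) ptQ (s, c, r ^ 2, v) (tubeMap j (blow b (s, c, r, v))) := by
  refine ⟨up j b r, contDiffAt_up hr j b s c v, up_self hr j b s c v, ?_⟩
  have h3 : ∀ᶠ p : Space7 in 𝓝 (s, c, r ^ 2, v), p.2.2.1 ≠ 0 :=
    (by fun_prop : Continuous fun p : Space7 => p.2.2.1).continuousAt.eventually_ne
      (pow_ne_zero 2 hr)
  filter_upwards [h3] with p hp
  rw [psiQ_up hr j b hp]

theorem lift_down {j b s c v r} (hr : r ≠ 0) :
    HasLift ptQ (psiQ j b) (tubeMap j (blow b (s, c, r, v))) (s, c, r ^ 2, v) := by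
  have h0 : (if b then (blow b (s, c, r, v)).2.2.2 else (blow b (s, c, r, v)).2.2.1) ≠ 0 := by
    cases b <;> simp [blow, dir, hr]
  have hi := contDiff_tubeInv j
  have h1 : ContDiffAt ℝ ∞ (unblow b) (tubeInv j (tubeMap j (blow b (s, c, r, v)))) := by
    rw [tubeInv_tubeMap]
    exact contDiffAt_unblow h0
  refine ⟨fun x => unblow b (tubeInv j x), h1.comp _ hi.contDiffAt, ?_, ?_⟩
  · simp only [tubeInv_tubeMap, unblow_blow _ _ _ _ _ hr]
  · have h2 : Continuous fun x : Space7 =>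
        (if b then (tubeInv j x).2.2.2 else (tubeInv j x).2.2.1) := by
      have := hi.continuous
      cases b <;> simp <;> fun_prop
    have h3 : ∀ᶠ x in 𝓝 (tubeMap j (blow b (s, c, r, v))),
        (if b then (tubeInv j x).2.2.2 else (tubeInv j x).2.2.1) ≠ 0 :=
      h2.continuousAt.eventually_ne (by simp only [tubeInv_tubeMap]; exact h0)
    filter_upwards [h3] with x hx
    rw [psiQ_unblow hx, tubeMap_tubeInv]

theorem lift_center {j b s c v j' b' s' c' v'} (h : lnQ j s c (dir b v) = lnQ j' s' c' (dir b' v')) :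
    HasLift (psiQ j b) (psiQ j' b') (s, c, 0, v) (s', c', 0, v') := by
  obtain ⟨g₀, hg₀, e1, e2⟩ := lnQ_eq.1 h
  obtain ⟨rfl, g, hg, hgg, e, he, hact⟩ := Gam_tube hg₀ e1
  have e3 : g '' line j s c (dir b v) = line j s' c' (dir b' v') := by
    rcases hgg with rfl | rfl
    · exact e2
    · rw [Equiv.Perm.coe_mul, Set.image_comp, reflJ_line, e2]
  have hline := image_line hact
  have he0 : (e : ℂ) ≠ 0 := by rcases he with rfl | rfl <;> norm_num
  have hee : (e : ℂ) * e = 1 := by rcases he with rfl | rfl <;> norm_num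
  have hs : s + (s' - s) = s' := by ring
  have hc : e * c + (c' - e * c) = c' := by ring
  rw [hline, hs, hc] at e3
  have h6 : tubeMap j (s', c', (dir b' v').1, (dir b' v').2) ∈
      line j s' c' ((dir b v).1, e * (dir b v).2) := by
    rw [e3]
    exact mem_line.2 ⟨rfl, rfl, 1, by simp, by simp⟩
  obtain ⟨-, -, l, h7, h8⟩ := mem_line.1 h6
  simp only at h7 h8
  have hC : ContDiff ℝ ∞ fun x : Space7 => x.2.1 := by fun_prop
  have hW : ContDiff ℝ ∞ fun x : Space7 => x.2.2.1 := by fun_prop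
  have hV : ContDiff ℝ ∞ fun x : Space7 => x.2.2.2 := by fun_prop
  have hS : ContDiff ℝ ∞ fun x : Space7 => x.1 := by fun_prop
  -- the action on points outside the exceptional set
  have key : ∀ (p : Space7) (r r' v₁ : ℂ), p.2.2.1 ≠ 0 → r ^ 2 = p.2.2.1 → r' ≠ 0 →
      r' * (dir b' v₁).1 = r * (dir b p.2.2.2).1 →
      r' * (dir b' v₁).2 = e * (r * (dir b p.2.2.2).2) →
      psiQ j b' (p.1 + (s' - s), e * p.2.1 + (c' - e * c), r' ^ 2, v₁) = psiQ j b p := by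
    rintro ⟨s₁, c₁, u, v₂⟩ r r' v₁ hu hr hr' h1 h2
    rw [psiQ_eq (r := r') (pow_ne_zero 2 hr') rfl, psiQ_eq (r := r) hu hr, eq_comm, ptQ_eq]
    refine ⟨g, hg, ?_⟩
    simp only [blow, hact]
    simp only at h1 h2
    rw [h1, h2]
  have key0 : ∀ (p : Space7) (v₁ l : ℂ), p.2.2.1 = 0 → l ≠ 0 →
      (dir b p.2.2.2).1 = l * (dir b' v₁).1 → e * (dir b p.2.2.2).2 = l * (dir b' v₁).2 →
      psiQ j b' (p.1 + (s' - s), e * p.2.1 + (c' - e * c), 0, v₁) = psiQ j b p := by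
    rintro ⟨s₁, c₁, u, v₂⟩ v₁ l hu hl h1 h2
    simp only at hu h1 h2
    subst hu
    rw [psiQ_zero, psiQ_zero, eq_comm, lnQ_eq]
    refine ⟨g, hg, by simp [hact], ?_⟩
    rw [hline, h1, h2, line_smul _ _ _ _ hl]
  by_cases hb : b = b'
  · subst hb
    have hv : v' = e * v := by
      cases b
      · simp only [dir, Bool.false_eq_true, if_false, mul_one] at h7 h8
        rw [h8, ← h7, one_mul]
      · simp only [dir, if_true, mul_one] at h7 h8
        rw [h7, show l = e by linear_combination -e * h8 - l * hee]
    refine ⟨fun p => (p.1 + (s' - s), e * p.2.1 + (c' - e * c), p.2.2.1, e * p.2.2.2), ?_, ?_, ?_⟩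
    · exact ((hS.add contDiff_const).prodMk (((contDiff_const.mul hC).add contDiff_const).prodMk
        (hW.prodMk (contDiff_const.mul hV)))).contDiffAt
    · simp [hv]
    · refine Filter.Eventually.of_forall fun p => ?_
      simp only
      by_cases hu : p.2.2.1 = 0
      · rw [hu]
        cases b
        · exact key0 p _ 1 hu one_ne_zero (by simp [dir]) (by simp [dir])
        · exact key0 p _ e hu he0 (by simp [dir, ← mul_assoc, hee]) (by simp [dir])
      · obtain ⟨r, hr, hru⟩ := exists_root hu
        rw [← hru]
        cases b
        · exact key p r r _ hu hru hr (by simp [dir]) (by simp [dir]; ring)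
        · have := key p r (e * r) (e * p.2.2.2) hu hru (mul_ne_zero he0 hr)
            (by simp [dir]; linear_combination r * p.2.2.2 * hee) (by simp [dir])
          rwa [show (e * r) ^ 2 = r ^ 2 by linear_combination r ^ 2 * hee] at this
  · have hv : v ≠ 0 ∧ v' = e / v := by
      cases b <;> cases b'
      · exact absurd rfl hb
      · simp only [dir, if_true, mul_one, Bool.false_eq_true, if_false] at h7 h8
        have hv0 : v ≠ 0 := by rintro rfl; simp at h8
        refine ⟨hv0, ?_⟩
        rw [eq_div_iff hv0, h7]
        linear_combination -e * h8 - l * v * hee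
      · simp only [dir, if_true, mul_one, Bool.false_eq_true, if_false] at h7 h8
        have hv0 : v ≠ 0 := by rintro rfl; simp at h7
        refine ⟨hv0, ?_⟩
        rw [eq_div_iff hv0, h8]
        linear_combination -e * h7
      · exact absurd rfl hb
    obtain ⟨hv0, hv⟩ := hv
    have h3 : ∀ᶠ p : Space7 in 𝓝 (s, c, 0, v), p.2.2.2 ≠ 0 :=
      hV.continuous.continuousAt.eventually_ne hv0
    refine ⟨fun p => (p.1 + (s' - s), e * p.2.1 + (c' - e * c), p.2.2.1 * p.2.2.2 ^ 2,
      e * (p.2.2.2)⁻¹), ?_, ?_, ?_⟩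
    · exact (hS.add contDiff_const).contDiffAt.prodMk
        (((contDiff_const.mul hC).add contDiff_const).contDiffAt.prodMk
        ((hW.mul (hV.pow 2)).contDiffAt.prodMk (contDiffAt_const.mul (hV.contDiffAt.inv hv0))))
    · simp [hv, div_eq_mul_inv]
    · filter_upwards [h3] with p hp
      by_cases hu : p.2.2.1 = 0
      · simp only [hu, zero_mul]
        cases b <;> cases b'
        · exact absurd rfl hb
        · exact key0 p _ (e * p.2.2.2) hu (mul_ne_zero he0 hp)
            (by simp [dir]; field_simp; linear_combination -hee) (by simp [dir])
        · exact key0 p _ p.2.2.2 hu hp (by simp [dir])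
            (by simp [dir]; field_simp)
        · exact absurd rfl hb
      · obtain ⟨r, hr, hru⟩ := exists_root hu
        simp only [← hru]
        cases b <;> cases b'
        · exact absurd rfl hb
        · have := key p r (e * (r * p.2.2.2)) (e * (p.2.2.2)⁻¹) hu hru
            (mul_ne_zero he0 (mul_ne_zero hr hp))
            (by simp [dir]; field_simp; linear_combination hee) (by simp [dir])
          rwa [show (e * (r * p.2.2.2)) ^ 2 = r ^ 2 * p.2.2.2 ^ 2 by
            linear_combination r ^ 2 * p.2.2.2 ^ 2 * hee] at this
        · have := key p r (r * p.2.2.2) (e * (p.2.2.2)⁻¹) hu hru (mul_ne_zero hr hp)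
            (by simp [dir]) (by simp [dir]; field_simp)
          rwa [show (r * p.2.2.2) ^ 2 = r ^ 2 * p.2.2.2 ^ 2 by ring] at this
        · exact absurd rfl hb

/-! ### The resolution as a smooth manifold -/

/-- The marked points which are points of the resolution: free points of `ℝ⁷`, and complex lines in
the normal spaces of the singular locus. -/
def IsResolutionPoint (q : Marked) : Prop :=
  (∃ x ∈ regular, q = ptQ x) ∨ ∃ j b s c v, q = lnQ j s c (dir b v)

/-- The compact `7`-manifold `M̃`, the resolution of the orbifold `X = ℝ⁷ / Γ`. -/
def Resolution : Type := {q : Marked // IsResolutionPoint q}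

open Classical in
/-- The point of the resolution given by a marked point (a junk value if there is none). -/
def toResolution (q : Marked) : Resolution :=
  if h : IsResolutionPoint q then ⟨q, h⟩
  else ⟨lnQ 0 0 0 (dir false 0), Or.inr ⟨0, false, 0, 0, 0, rfl⟩⟩

theorem toResolution_val {q : Marked} (h : IsResolutionPoint q) : (toResolution q).1 = q := by
  simp [toResolution, h]

/-- The domains of the parametrizations of the resolution. -/
def paramDom : Option (Fin 10 × Bool) → Set Space7
  | none => regular
  | some (j, b) => domJ j b

/-- The parametrizations of the resolution, as maps to marked points. -/
def paramQ : Option (Fin 10 × Bool) → Space7 → Marked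
  | none => ptQ
  | some (j, b) => psiQ j b

theorem isResolutionPoint_paramQ {i x} (hx : x ∈ paramDom i) : IsResolutionPoint (paramQ i x) := by
  rcases i with _ | ⟨j, b⟩
  · exact Or.inl ⟨x, hx, rfl⟩
  · obtain ⟨s, c, u, v⟩ := x
    by_cases hu : u = 0
    · subst hu
      exact Or.inr ⟨j, b, s, c, v, psiQ_zero _ _ _ _ _⟩
    · exact Or.inl ⟨_, (domJ_iff hu (csqrt_sq u)).1 hx, psiQ_eq hu (csqrt_sq u)⟩

theorem hasLift_paramQ {i i' x y} (h : paramQ i x = paramQ i' y) :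
    HasLift (paramQ i) (paramQ i') x y := by
  rcases i with _ | ⟨j, b⟩ <;> rcases i' with _ | ⟨j', b'⟩
  · exact lift_pt h
  · obtain ⟨s, c, u, v⟩ := y
    have h : ptQ x = psiQ j' b' (s, c, u, v) := h
    by_cases hu : u = 0
    · subst hu
      rw [psiQ_zero] at h
      exact absurd h (ptQ_ne_lnQ _ _ _ _ _ _)
    · obtain ⟨r, hr, rfl⟩ := exists_root hu
      rw [psiQ_eq hu rfl] at h
      exact (lift_pt h).trans (lift_down hr)
  · obtain ⟨s, c, u, v⟩ := x
    have h : psiQ j b (s, c, u, v) = ptQ y := h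
    by_cases hu : u = 0
    · subst hu
      rw [psiQ_zero] at h
      exact absurd h.symm (ptQ_ne_lnQ _ _ _ _ _ _)
    · obtain ⟨r, hr, rfl⟩ := exists_root hu
      rw [psiQ_eq hu rfl] at h
      exact (lift_up hr).trans (lift_pt h)
  · obtain ⟨s, c, u, v⟩ := x
    obtain ⟨s', c', u', v'⟩ := y
    have h : psiQ j b (s, c, u, v) = psiQ j' b' (s', c', u', v') := h
    by_cases hu : u = 0 <;> by_cases hu' : u' = 0
    · subst hu hu'
      rw [psiQ_zero, psiQ_zero] at h
      exact lift_center h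
    · subst hu
      rw [psiQ_zero, psiQ_eq hu' (csqrt_sq u')] at h
      exact absurd h.symm (ptQ_ne_lnQ _ _ _ _ _ _)
    · subst hu'
      rw [psiQ_zero, psiQ_eq hu (csqrt_sq u)] at h
      exact absurd h (ptQ_ne_lnQ _ _ _ _ _ _)
    · obtain ⟨r, hr, rfl⟩ := exists_root hu
      obtain ⟨r', hr', rfl⟩ := exists_root hu'
      rw [psiQ_eq hu rfl, psiQ_eq hu' rfl] at h
      exact ((lift_up hr).trans (lift_pt h)).trans (lift_down hr')

/-- The parametrizations which define the smooth structure of the resolution. -/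
def resolutionAtlas : ParamAtlas Space7 Resolution where
  ι := Option (Fin 10 × Bool)
  dom := paramDom
  param i x := toResolution (paramQ i x)
  isOpen_dom i := by
    rcases i with _ | ⟨j, b⟩
    · exact isOpen_regular
    · exact isOpen_domJ j b
  surj m := by
    obtain ⟨q, h⟩ := m
    have key : ∀ i, ∀ x ∈ paramDom i, q = paramQ i x →
        ∃ i, ∃ x ∈ paramDom i, toResolution (paramQ i x) = ⟨q, h⟩ := fun i x hx e =>
      ⟨i, x, hx, Subtype.ext (by rw [← e]; exact toResolution_val h)⟩
    rcases id h with ⟨x, hx, e⟩ | ⟨j, b, s, c, v, e⟩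
    · exact key none x hx e
    · exact key (some (j, b)) (s, c, 0, v) (Or.inl rfl) (by rw [e]; exact (psiQ_zero _ _ _ _ _).symm)
  inj i x hx := by
    obtain ⟨V, h1, h2, h3, h4⟩ : ∃ V, IsOpen V ∧ x ∈ V ∧ V ⊆ paramDom i ∧
        Set.InjOn (paramQ i) V := by
      rcases i with _ | ⟨j, b⟩
      · exact inj_ptQ hx
      · exact inj_psiQ hx
    refine ⟨V, h1, h2, h3, fun y hy z hz e => h4 hy hz ?_⟩
    have e := congrArg Subtype.val e
    rwa [toResolution_val (isResolutionPoint_paramQ (h3 hy)),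
      toResolution_val (isResolutionPoint_paramQ (h3 hz))] at e
  lift i j x hx y hy e := by
    have e := congrArg Subtype.val e
    rw [toResolution_val (isResolutionPoint_paramQ hx),
      toResolution_val (isResolutionPoint_paramQ hy)] at e
    obtain ⟨g, h1, h2, h3⟩ := hasLift_paramQ e
    exact ⟨g, h1, h2, h3.mono fun z hz => congrArg toResolution hz⟩

instance : TopologicalSpace Resolution := resolutionAtlas.core.toTopologicalSpace
instance : ChartedSpace Space7 Resolution := resolutionAtlas.core.toChartedSpace
instance : IsManifold 𝓘(ℝ, Space7) ∞ Resolution := resolutionAtlas.isManifold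

/-! ### The orbifold, tubes and Thom forms -/

/-- The orbifold `X = ℝ⁷ / Γ`. -/
abbrev Orbifold : Type := MulAction.orbitRel.Quotient Gam Space7

/-- The resolution map `ρ : M̃ → X`, sending a marked point `[(x, ℓ)]` to `[x]`. -/
def rho (q : Resolution) : Orbifold :=
  Quotient.map' (s₁ := MulAction.orbitRel Gam (Space7 × Set Space7))
    (s₂ := MulAction.orbitRel Gam Space7) Prod.fst
    (fun a b h => by
      rw [MulAction.orbitRel_apply, MulAction.mem_orbit_iff] at h ⊢
      obtain ⟨g, hg⟩ := h
      exact ⟨g, congrArg Prod.fst hg⟩) q.1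

/-- The (squared) radius of the tubes; it is small enough for the ten tubes to be embedded and
pairwise disjoint. -/
def sqRadius : ℝ := 1 / 256

/-- The tubular neighbourhood `O_j` of the component `N_j` of the singular locus of `X`. -/
def tube (j : Fin 10) : Set Orbifold :=
  {q | ∃ s c w₁ w₂, ‖w₁‖ ^ 2 + ‖w₂‖ ^ 2 < sqRadius ∧ q = Quotient.mk'' (tubeMap j (s, c, w₁, w₂))}

/-- The parametrizations `(s, c, u, v)` of the resolution near the exceptional divisor `E_j`. -/
def psi (j : Fin 10) (b : Bool) (p : Space7) : Resolution := toResolution (psiQ j b p)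

/-- `τ` is a Thom form of the exceptional divisor `E_j`: a closed `2`-form with compact support in
`ρ⁻¹(O_j)` whose integral over every fibre of the normal bundle of `E_j` (the discs on which only the
coordinate `u` varies, with their complex orientation) is `1`. -/
def IsThomForm (j : Fin 10) (τ : DiffForm Space7 Resolution 2) : Prop :=
  DiffForm.d τ = 0 ∧
  (∃ K : Set Resolution, IsCompact K ∧ K ⊆ rho ⁻¹' tube j ∧ ∀ m ∉ K, DiffForm.valueAt τ m = 0) ∧
  ∀ (b : Bool) (s : ℝ) (c v : ℂ),
    ∫ u in {u : ℂ | ‖u‖ * (1 + ‖v‖ ^ 2) < sqRadius},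
      DiffForm.pullbackAt τ (fun u : ℂ => psi j b (s, c, u, v)) u ![1, I] = 1

end JK

end

noncomputable section
open scoped Manifold ContDiff Topology Pointwise ComplexConjugate

/-- Alternating forms on `ℝ⁷`. -/
abbrev JK.Alt7 (k : ℕ) : Type := Space7 [⋀^Fin k]→L[ℝ] ℝ

set_option maxRecDepth 40000
open MeasureTheory
open ContinuousAlternatingMap (alternatizeUncurryFin alternatizeUncurryFin_apply)
open ContinuousLinearMap (inl fst snd)
local notation:max "𝓦" a:max b:max => DiffForm.wedge (k := a) (l := b)
local notation:max "𝓛" E:max k:max => E [⋀^Fin k]→L[ℝ] ℝ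
local notation "Smooth" => ContDiff ℝ ∞
local notation "SmoothAt" => ContDiffAt ℝ ∞
local notation "SmoothOn" => ContDiffOn ℝ ∞
local notation "𝓐" k:max => Space7 → JK.Alt7 k
local notation "𝓓" => DiffForm Space7 JK.Resolution
local notation "Perm7" => Equiv.Perm Space7

lemma prod_ext₄ {α β γ δ : Type*} {p q : α × β × γ × δ} (h₁ : p.1 = q.1) (h₂ : p.2.1 = q.2.1) (h₃ : p.2.2.1 = q.2.2.1)
    (h₄ : p.2.2.2 = q.2.2.2) : p = q := Prod.ext h₁ (Prod.ext h₂ (Prod.ext h₃ h₄))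

lemma ContDiff.diff {E F : Type*} [NormedAddCommGroup E] [NormedSpace ℝ E] [NormedAddCommGroup F] [NormedSpace ℝ F] {f : E → F}
    (h : Smooth f) : Differentiable ℝ f := h.differentiable (by simp)

lemma ContDiffAt.diffAt {E F : Type*} [NormedAddCommGroup E] [NormedSpace ℝ E] [NormedAddCommGroup F] [NormedSpace ℝ F] {f : E → F}
    {x : E} {n : WithTop ℕ∞} (h : ContDiffAt ℝ n f x) (hn : n ≠ 0 := by simp) : DifferentiableAt ℝ f x := h.differentiableAt hn

section WedgeAlgebra

open Equiv Nat

variable {E : Type*} {ι κ μ : Type*} [Fintype ι] [DecidableEq ι] [Fintype κ] [DecidableEq κ]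

/-- Antisymmetrization of a function of several vectors. -/
def asym (F : (ι → E) → ℝ) (v : ι → E) : ℝ := ∑ σ : Perm ι, ((Perm.sign σ : ℤ) : ℝ) * F (v ∘ σ)

lemma asym_comp_perm (F : (ι → E) → ℝ) (ρ : Perm ι) (v : ι → E) : asym (fun w => F (w ∘ ρ)) v = ((Perm.sign ρ : ℤ) : ℝ) * asym F v := by
  unfold asym
  rw [Finset.mul_sum]
  refine Fintype.sum_equiv (Equiv.mulRight ρ) _ _ fun σ => ?_
  have h : ((Perm.sign ρ : ℤ) : ℝ) * ((Perm.sign ρ : ℤ) : ℝ) = 1 := by rcases Int.units_eq_one_or (Perm.sign ρ) with h | h <;> simp [h]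
  simp only [Equiv.coe_mulRight, Perm.sign_mul, Units.val_mul, Int.cast_mul, Perm.coe_mul, Function.comp_assoc]
  linear_combination (-(((Perm.sign σ : ℤ) : ℝ)) * F (v ∘ σ ∘ ρ)) * h

lemma asym_congr_equiv (e : κ ≃ ι) (F : (ι → E) → ℝ) (v : ι → E) : asym F v = asym (fun w => F (w ∘ e.symm)) (v ∘ e) := by
  unfold asym
  refine Fintype.sum_equiv (e.symm.permCongr) _ _ fun σ => ?_
  rw [Perm.sign_permCongr]
  congr 2
  ext i
  simp [Equiv.permCongr_apply]

lemma asym_congr {F G : (ι → E) → ℝ} (h : ∀ w, F w = G w) (v : ι → E) : asym F v = asym G v := by rw [funext h]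

lemma asym_mul_left (c : ℝ) (F : (ι → E) → ℝ) (v : ι → E) : asym (fun w => c * F w) v = c * asym F v := by
  simp only [asym, Finset.mul_sum]
  exact Finset.sum_congr rfl fun σ _ => by ring

lemma asym_mul_right (c : ℝ) (F : (ι → E) → ℝ) (v : ι → E) : asym (fun w => F w * c) v = asym F v * c := by
  simp only [asym, Finset.sum_mul]
  exact Finset.sum_congr rfl fun σ _ => by ring

lemma asym_absorb (j : κ ↪ ι) (j' : μ → ι) (hj : ∀ x, j' x ∉ Set.range j) (F : (κ → E) → (μ → E) → ℝ) (v : ι → E) : asym (fun w => asym (fun u => F u (w ∘ j')) (w ∘ j)) v =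
      (Fintype.card κ)! * asym (fun w => F (w ∘ j) (w ∘ j')) v := by
  set G : (ι → E) → ℝ := fun w => F (w ∘ j) (w ∘ j') with hG
  have h1 : ∀ w : ι → E, asym (fun u => F u (w ∘ j')) (w ∘ j) = ∑ ρ : Perm κ, ((Perm.sign ρ : ℤ) : ℝ) * G (w ∘ ρ.viaFintypeEmbedding j) := by
    intro w
    refine Finset.sum_congr rfl fun ρ _ => ?_
    have e1 : (w ∘ j) ∘ ρ = (w ∘ ρ.viaFintypeEmbedding j) ∘ j := by ext x; simp [Perm.viaFintypeEmbedding_apply_image]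
    have e2 : w ∘ j' = (w ∘ ρ.viaFintypeEmbedding j) ∘ j' := by ext x; simp [Perm.viaFintypeEmbedding_apply_notMem_range _ _ (hj x)]
    simp only [hG]
    rw [e1, ← e2]
  have h2 : asym (fun w => asym (fun u => F u (w ∘ j')) (w ∘ j)) v = ∑ ρ : Perm κ, ((Perm.sign ρ : ℤ) : ℝ) * asym (fun w => G (w ∘ ρ.viaFintypeEmbedding j)) v := by
    simp only [h1]
    unfold asym
    simp only [Finset.mul_sum]
    rw [Finset.sum_comm]
    refine Finset.sum_congr rfl fun ρ _ => Finset.sum_congr rfl fun σ _ => by ring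
  rw [h2]
  have h4 : ∀ ρ : Perm κ, ((Perm.sign ρ : ℤ) : ℝ) * asym (fun w => G (w ∘ ρ.viaFintypeEmbedding j)) v = asym G v := by
    intro ρ
    rw [asym_comp_perm, Perm.viaFintypeEmbedding_sign, ← mul_assoc]
    rcases Int.units_eq_one_or (Perm.sign ρ) with h | h <;> simp [h]
  simp only [h4, Finset.sum_const, Finset.card_univ, Fintype.card_perm, nsmul_eq_mul]

variable [NormedAddCommGroup E] [NormedSpace ℝ E]

lemma asym_wedgeAlt {k l : ℕ} (a : 𝓛 E k) (b : 𝓛 E l) (v : Fin (k + l) → E) : (k ! * l ! : ℝ) * wedgeAlt a b v =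
      asym (fun w => a (w ∘ Fin.castAdd l) * b (w ∘ Fin.natAdd k)) v := by
  have h := MultilinearMap.domCoprod_alternization_eq a.toAlternatingMap b.toAlternatingMap
  have h2 := congrArg (fun f => LinearMap.mul' ℝ ℝ (f (v ∘ finSumFinEquiv))) h
  simp only [AlternatingMap.smul_apply, Fintype.card_fin, MultilinearMap.alternatization_apply, map_sum] at h2
  have h3 : wedgeAlt a b v = LinearMap.mul' ℝ ℝ ((a.toAlternatingMap.domCoprod b.toAlternatingMap)
    (v ∘ finSumFinEquiv)) := rfl
  rw [h3, asym_congr_equiv finSumFinEquiv]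
  have h4 : ((k ! * l ! : ℝ)) * (LinearMap.mul' ℝ ℝ ((a.toAlternatingMap.domCoprod
      b.toAlternatingMap) (v ∘ finSumFinEquiv))) = (k ! * l !) • (LinearMap.mul' ℝ ℝ
      ((a.toAlternatingMap.domCoprod b.toAlternatingMap) (v ∘ finSumFinEquiv))) := by
    simp
  rw [h4, ← map_nsmul, ← h2]
  unfold asym
  refine Finset.sum_congr rfl fun σ _ => ?_
  have h5 : LinearMap.mul' ℝ ℝ (MultilinearMap.domDomCongr σ (MultilinearMap.domCoprod
        (↑a.toAlternatingMap : MultilinearMap ℝ (fun _ => E) ℝ)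
        (↑b.toAlternatingMap : MultilinearMap ℝ (fun _ => E) ℝ))
        (v ∘ finSumFinEquiv)) = 
          (a (fun i => v (finSumFinEquiv (σ (Sum.inl i)))) * b (fun i => v (finSumFinEquiv (σ (Sum.inr i))))) := rfl
  have h6 : a (((v ∘ finSumFinEquiv) ∘ σ) ∘ finSumFinEquiv.symm ∘ Fin.castAdd l) = a (fun i => v (finSumFinEquiv (σ (Sum.inl i)))) := by congr 1; ext i; simp
  have h7 : b (((v ∘ finSumFinEquiv) ∘ σ) ∘ finSumFinEquiv.symm ∘ Fin.natAdd k) = b (fun i => v (finSumFinEquiv (σ (Sum.inr i)))) := by congr 1; ext i; simp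
  simp only [Function.comp_assoc] at h6 h7 ⊢
  rw [h6, h7]
  rcases Int.units_eq_one_or (Perm.sign σ) with h | h <;> simp [h, Function.comp_def]

lemma asym_self {k : ℕ} (a : 𝓛 E k) (v : Fin k → E) : asym (fun w => a w) v = k ! * a v := by
  have : ∀ σ : Perm (Fin k), ((Perm.sign σ : ℤ) : ℝ) * a (v ∘ σ) = a v := by
    intro σ
    have h := a.toAlternatingMap.map_perm v σ
    have h' : a (v ∘ σ) = Perm.sign σ • a v := h
    rw [h']
    rcases Int.units_eq_one_or (Perm.sign σ) with h | h <;> simp [h]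
  simp [asym, this, Fintype.card_perm]

lemma asym_alternatizeUncurryFin {k : ℕ} (A : E →L[ℝ] 𝓛 E k) (v : Fin (k + 1) → E) : (k ! : ℝ) * alternatizeUncurryFin A v = asym (fun w => A (w 0) (w ∘ Fin.succ)) v := by
  have h1 : ∀ w : Fin (k + 1) → E, alternatizeUncurryFin A w = ∑ i : Fin (k + 1), ((Perm.sign i.cycleRange.symm : ℤ) : ℝ) *
        (fun w => A (w 0) (w ∘ Fin.succ)) (w ∘ i.cycleRange.symm) := by
    intro w
    rw [alternatizeUncurryFin_apply]
    refine Finset.sum_congr rfl fun i _ => ?_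
    have e : (w ∘ i.cycleRange.symm) ∘ Fin.succ = i.removeNth w := by ext j; simp [Fin.removeNth]
    simp only [e, Function.comp_apply, Fin.cycleRange_symm_zero, Perm.sign_symm, Fin.sign_cycleRange]
    simp
  have h2 := asym_self (alternatizeUncurryFin A) v
  have h3 : asym (fun w => alternatizeUncurryFin A w) v = (k + 1) * asym (fun w => A (w 0) (w ∘ Fin.succ)) v := by
    have h4 : asym (fun w => alternatizeUncurryFin A w) v = ∑ i : Fin (k + 1), ((Perm.sign i.cycleRange.symm : ℤ) : ℝ) *
          asym (fun w => (fun w => A (w 0) (w ∘ Fin.succ)) (w ∘ i.cycleRange.symm)) v := by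
      simp only [h1]
      unfold asym
      simp only [Finset.mul_sum]
      rw [Finset.sum_comm]
      exact Finset.sum_congr rfl fun ρ _ => Finset.sum_congr rfl fun σ _ => by ring
    rw [h4]
    have h5 : ∀ i : Fin (k + 1), ((Perm.sign i.cycleRange.symm : ℤ) : ℝ) * asym (fun w => (fun w => A (w 0) (w ∘ Fin.succ)) (w ∘ i.cycleRange.symm)) v =
        asym (fun w => A (w 0) (w ∘ Fin.succ)) v := by
      intro i
      rw [asym_comp_perm (fun w => A (w 0) (w ∘ Fin.succ)), ← mul_assoc]
      rcases Int.units_eq_one_or (Perm.sign i.cycleRange.symm) with h | h <;> simp [h]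
    simp only [h5, Finset.sum_const, Finset.card_univ, Fintype.card_fin, nsmul_eq_mul]
    push_cast; ring
  have h6 : ((k + 1 : ℕ) : ℝ) ≠ 0 := by positivity
  have h7 := h2.symm.trans h3
  rw [Nat.factorial_succ] at h7
  push_cast at h7 h6
  exact mul_left_cancel₀ h6 (by linear_combination h7)

lemma wedgeAlt_assoc {k l m : ℕ} (a : 𝓛 E k) (b : 𝓛 E l) (c : 𝓛 E m) (v : Fin (k + l + m) → E) : wedgeAlt (wedgeAlt a b) c v =
      wedgeAlt a (wedgeAlt b c) (v ∘ Fin.cast (Nat.add_assoc k l m).symm) := by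
  have hl : (k ! * l ! * m ! : ℝ) * wedgeAlt (wedgeAlt a b) c v = asym (fun w => a (w ∘ Fin.castAdd m ∘ Fin.castAdd l) * b (w ∘ Fin.castAdd m ∘ Fin.natAdd k) *
        c (w ∘ Fin.natAdd (k + l))) v := by
    have h1 := asym_wedgeAlt (wedgeAlt a b) c v
    have h2 := asym_absorb (Fin.castAddEmb m) (Fin.natAdd (k + l)) (by
        rintro x ⟨y, hy⟩
        have := congrArg Fin.val hy
        simp at this; omega)
      (fun w u => a (w ∘ Fin.castAdd l) * b (w ∘ Fin.natAdd k) * c u) v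
    simp only [asym_mul_right, ← asym_wedgeAlt, mul_assoc _ (wedgeAlt a b _), asym_mul_left] at h2
    rw [Fintype.card_fin] at h2
    have h4 : ((k + l)! : ℝ) ≠ 0 := by positivity
    refine mul_left_cancel₀ h4 (Eq.trans ?_ h2)
    refine Eq.trans ?_ (congrArg _ h1)
    ring
  have hr : ∀ u : Fin (k + (l + m)) → E, (k ! * l ! * m ! : ℝ) * wedgeAlt a (wedgeAlt b c) u =
      asym (fun w => a (w ∘ Fin.castAdd (l + m)) * b (w ∘ Fin.natAdd k ∘ Fin.castAdd m) * c (w ∘ Fin.natAdd k ∘ Fin.natAdd l)) u := by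
    intro u
    have h1 := asym_wedgeAlt a (wedgeAlt b c) u
    have h2 := asym_absorb (Fin.natAddEmb k) (Fin.castAdd (l + m)) (by
        rintro x ⟨y, hy⟩
        have := congrArg Fin.val hy
        simp at this; omega)
      (fun w u => a u * (b (w ∘ Fin.castAdd m) * c (w ∘ Fin.natAdd l))) u
    simp only [asym_mul_left, ← asym_wedgeAlt] at h2
    simp only [mul_left_comm (a _) (_ * _), asym_mul_left] at h2
    rw [Fintype.card_fin] at h2
    have h4 : ((l + m)! : ℝ) ≠ 0 := by positivity
    refine mul_left_cancel₀ h4 ?_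
    refine Eq.trans (Eq.trans ?_ (congrArg (fun x => (l ! * m ! : ℝ) * x) h1)) (h2.trans ?_)
    · ring
    · congr 1
      exact asym_congr (fun w => (mul_assoc _ _ _).symm) _
  have h0 : (k ! * l ! * m ! : ℝ) ≠ 0 := by positivity
  refine mul_left_cancel₀ h0 ?_
  rw [hl, hr, asym_congr_equiv (finCongr (Nat.add_assoc k l m).symm)]
  refine asym_congr (fun w => ?_) _
  refine congrArg₂ (· * ·) (congrArg₂ (· * ·) (congrArg a (funext fun i => congrArg w ?_))
    (congrArg b (funext fun i => congrArg w ?_))) (congrArg c (funext fun i => congrArg w ?_)) <;> ext <;> simp [Nat.add_assoc]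

lemma wedgeAlt_flip {k l : ℕ} (a : 𝓛 E k) (b : 𝓛 E l) (v : Fin (k + l) → E) : wedgeAlt a b v = wedgeAlt b a (v ∘ finAddFlip.symm) := by
  have h0 : (k ! * l ! : ℝ) ≠ 0 := by positivity
  refine mul_left_cancel₀ h0 ?_
  rw [asym_wedgeAlt, mul_comm (k ! : ℝ), asym_wedgeAlt, asym_congr_equiv finAddFlip.symm]
  refine asym_congr (fun w => ?_) _
  rw [mul_comm]
  refine congrArg₂ (· * ·) (congrArg b (funext fun i => congrArg w ?_))
    (congrArg a (funext fun i => congrArg w ?_)) <;> simp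

lemma alternating_comp_perm_of_sign {n : ℕ} (c : 𝓛 E n) (e : Perm (Fin n)) (he : Perm.sign e = 1) (v : Fin n → E) : c (v ∘ e) = c v := by
  have h := c.toAlternatingMap.map_perm v e
  rw [he, one_smul] at h
  exact h

lemma wedgeAlt_comm_two_two (a b : 𝓛 E 2) : wedgeAlt a b = wedgeAlt b a := by
  ext v
  rw [wedgeAlt_flip]
  exact alternating_comp_perm_of_sign (wedgeAlt b a) (finAddFlip.symm : Fin (2 + 2) ≃ Fin (2 + 2))
    (by decide) v

lemma wedgeAlt_comm_of_perm {k l : ℕ} (h : l + k = k + l) (e : Perm (Fin (l + k))) (he : Perm.sign e = 1) (hv : ∀ i, (finAddFlip.symm i : Fin (k + l)) = Fin.cast h (e i))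
    (a : 𝓛 E k) (b : 𝓛 E l) (v : Fin (k + l) → E) : wedgeAlt a b v = wedgeAlt b a (v ∘ Fin.cast h) := by
  rw [wedgeAlt_flip]
  have : v ∘ finAddFlip.symm = (v ∘ Fin.cast h) ∘ e := funext fun i => by simp [hv]
  rw [this]
  exact alternating_comp_perm_of_sign _ _ he _

lemma sign_finRotate_sq (n : ℕ) : Perm.sign (finRotate n * finRotate n) = 1 := by rw [Perm.sign_mul, Int.units_mul_self]

lemma finAddFlip_symm_two_three (i : Fin (3 + 2)) : (finAddFlip.symm i : Fin (2 + 3)) = Fin.cast rfl ((finRotate (3 + 2) * finRotate (3 + 2)) i) := by revert i; decide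

lemma wedgeAlt_comm_two_three (a : 𝓛 E 2) (b : 𝓛 E 3) : (wedgeAlt (k := 2) (l := 3) a b : 𝓛 E 5) = wedgeAlt (k := 3) (l := 2) b a := by
  ext v
  have h := wedgeAlt_comm_of_perm (k := 2) (l := 3) (by rfl) _ (sign_finRotate_sq (3 + 2))
    finAddFlip_symm_two_three a b v
  have hv : v ∘ Fin.cast (by rfl : 3 + 2 = 2 + 3) = v := rfl
  rw [hv] at h
  exact h

lemma alternatizeUncurryFin_wedge_left {k l : ℕ} (A : E →L[ℝ] 𝓛 E k) (b : 𝓛 E l) (v : Fin (k + l + 1) → E) : alternatizeUncurryFin ((wedgeCLM E k l).flip b ∘L A) v =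
      wedgeAlt (alternatizeUncurryFin A) b
        (v ∘ Fin.cast (Nat.add_right_comm k 1 l)) := by
  have hl : (k ! * l ! : ℝ) * alternatizeUncurryFin ((wedgeCLM E k l).flip b ∘L A) v =
      asym (fun w => A (w 0) (w ∘ Fin.succ ∘ Fin.castAdd l) * b (w ∘ Fin.succ ∘ Fin.natAdd k)) v := by
    have h1 := asym_alternatizeUncurryFin ((wedgeCLM E k l).flip b ∘L A) v
    have h2 := asym_absorb (Fin.succEmb (k + l)) (fun _ : Unit => (0 : Fin (k + l + 1)))
      (by
        rintro x ⟨y, hy⟩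
        exact Fin.succ_ne_zero _ hy)
      (fun w u => A (u ()) (w ∘ Fin.castAdd l) * b (w ∘ Fin.natAdd k)) v
    simp only [← asym_wedgeAlt, asym_mul_left] at h2
    rw [Fintype.card_fin] at h2
    have h4 : ((k + l)! : ℝ) ≠ 0 := by positivity
    refine mul_left_cancel₀ h4 (Eq.trans (Eq.trans ?_ (congrArg (fun x => (k ! * l ! : ℝ) * x) h1)) h2)
    ring
  have hr : ∀ u : Fin (k + 1 + l) → E, (k ! * l ! : ℝ) * wedgeAlt (alternatizeUncurryFin A) b u = asym (fun w => A (w (Fin.castAdd l 0)) (w ∘ Fin.castAdd l ∘ Fin.succ) *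
        b (w ∘ Fin.natAdd (k + 1))) u := by
    intro u
    have h1 := asym_wedgeAlt (alternatizeUncurryFin A) b u
    have h2 := asym_absorb (Fin.castAddEmb l) (Fin.natAdd (k + 1)) (by
        rintro x ⟨y, hy⟩
        have := congrArg Fin.val hy
        simp at this; omega)
      (fun w u => A (w 0) (w ∘ Fin.succ) * b u) u
    simp only [asym_mul_right, ← asym_alternatizeUncurryFin, mul_assoc _ (alternatizeUncurryFin A _), asym_mul_left] at h2
    rw [Fintype.card_fin] at h2
    have h4 : ((k + 1)! : ℝ) ≠ 0 := by positivity
    refine mul_left_cancel₀ h4 (Eq.trans (Eq.trans ?_ (congrArg (fun x => (k ! : ℝ) * x) h1)) h2)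
    ring
  have h0 : (k ! * l ! : ℝ) ≠ 0 := by positivity
  refine mul_left_cancel₀ h0 ?_
  rw [hl, hr, asym_congr_equiv (finCongr (Nat.add_right_comm k l 1))]
  refine asym_congr (fun w => ?_) _
  refine congrArg₂ (· * ·) (congrArg₂ (fun (B : 𝓛 E k) u => B u)
    (congrArg A (congrArg w ?_)) (funext fun i => congrArg w ?_))
    (congrArg b (funext fun i => congrArg w ?_)) <;> ext <;> simp
  omega

lemma alternatizeUncurryFin_wedge_right {k l : ℕ} (a : 𝓛 E k) (B : E →L[ℝ] 𝓛 E l) (v : Fin (k + l + 1) → E) : alternatizeUncurryFin (wedgeCLM E k l a ∘L B) v =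
      (-1) ^ k * wedgeAlt a (alternatizeUncurryFin B) v := by
  have hl : (k ! * l ! : ℝ) * alternatizeUncurryFin (wedgeCLM E k l a ∘L B) v =
      asym (fun w => a (w ∘ Fin.succ ∘ Fin.castAdd l) * B (w 0) (w ∘ Fin.succ ∘ Fin.natAdd k)) v := by
    have h1 := asym_alternatizeUncurryFin (wedgeCLM E k l a ∘L B) v
    have h2 := asym_absorb (Fin.succEmb (k + l)) (fun _ : Unit => (0 : Fin (k + l + 1)))
      (by
        rintro x ⟨y, hy⟩
        exact Fin.succ_ne_zero _ hy)
      (fun w u => a (w ∘ Fin.castAdd l) * B (u ()) (w ∘ Fin.natAdd k)) v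
    simp only [← asym_wedgeAlt, asym_mul_left] at h2
    rw [Fintype.card_fin] at h2
    have h4 : ((k + l)! : ℝ) ≠ 0 := by positivity
    refine mul_left_cancel₀ h4 (Eq.trans (Eq.trans ?_ (congrArg (fun x => (k ! * l ! : ℝ) * x) h1)) h2)
    ring
  have hr : ∀ u : Fin (k + (l + 1)) → E, (k ! * l ! : ℝ) * wedgeAlt a (alternatizeUncurryFin B) u = asym (fun w => a (w ∘ Fin.castAdd (l + 1)) * B (w (Fin.natAdd k 0))
        (w ∘ Fin.natAdd k ∘ Fin.succ)) u := by
    intro u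
    have h1 := asym_wedgeAlt a (alternatizeUncurryFin B) u
    have h2 := asym_absorb (Fin.natAddEmb k) (Fin.castAdd (l + 1)) (by
        rintro x ⟨y, hy⟩
        have := congrArg Fin.val hy
        simp at this; omega)
      (fun w u => a u * B (w 0) (w ∘ Fin.succ)) u
    simp only [asym_mul_left, ← asym_alternatizeUncurryFin] at h2
    simp only [mul_left_comm (a _), asym_mul_left] at h2
    rw [Fintype.card_fin] at h2
    have h4 : ((l + 1)! : ℝ) ≠ 0 := by positivity
    refine mul_left_cancel₀ h4 (Eq.trans (Eq.trans ?_ (congrArg (fun x => (l ! : ℝ) * x) h1)) h2)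
    ring
  have h0 : (k ! * l ! : ℝ) ≠ 0 := by positivity
  refine mul_left_cancel₀ h0 ?_
  have hc := asym_comp_perm (fun w : Fin (k + l + 1) → E => a (w ∘ Fin.castAdd (l + 1)) * B (w (Fin.natAdd k (0 : Fin (l + 1)))) (w ∘ Fin.natAdd k ∘ Fin.succ))
    (Fin.cycleRange (⟨k, by omega⟩ : Fin (k + l + 1))) v
  rw [Fin.sign_cycleRange] at hc
  rw [hl, mul_left_comm, hr]
  refine Eq.trans (asym_congr (fun w => ?_) _) (hc.trans (by simp; rfl))
  have e1 : (w ∘ (Fin.cycleRange (⟨k, by omega⟩ : Fin (k + l + 1)))) ∘ Fin.castAdd (l + 1) = w ∘ Fin.succ ∘ Fin.castAdd l := by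
    ext i
    simp only [Function.comp_apply]
    congr 1
    ext
    rw [Fin.coe_cycleRange_of_lt (by simp [Fin.lt_def])]
    simp
  have e2 : (w ∘ (Fin.cycleRange (⟨k, by omega⟩ : Fin (k + l + 1)))) (Fin.natAdd k (0 : Fin (l + 1))) = w 0 := by
    simp only [Function.comp_apply]
    congr 1
    exact Fin.cycleRange_self _
  have e3 : (w ∘ (Fin.cycleRange (⟨k, by omega⟩ : Fin (k + l + 1)))) ∘ Fin.natAdd k ∘ Fin.succ = w ∘ Fin.succ ∘ Fin.natAdd k := by
    ext i
    simp only [Function.comp_apply]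
    congr 1
    rw [Fin.cycleRange_of_gt (by simp [Fin.lt_def])]
    ext
    simp [Nat.add_assoc]
  rw [e1, e2, e3]

lemma alternating_two_swap (c : 𝓛 E 2) (x y : E) : c ![y, x] = - c ![x, y] := by
  have := c.toAlternatingMap.map_swap ![x, y] (i := 0) (j := 1) (by simp)
  have e : ![x, y] ∘ swap (0 : Fin 2) 1 = ![y, x] := by ext i; fin_cases i <;> simp
  rw [e] at this
  exact this

lemma wedgeAlt_two_two_apply (a b : 𝓛 E 2) (v : Fin 4 → E) : wedgeAlt a b v = a ![v 0, v 1] * b ![v 2, v 3] - a ![v 0, v 2] * b ![v 1, v 3] +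
      a ![v 0, v 3] * b ![v 1, v 2] + a ![v 1, v 2] * b ![v 0, v 3] - a ![v 1, v 3] * b ![v 0, v 2] + a ![v 2, v 3] * b ![v 0, v 1] := by
  have h := asym_wedgeAlt a b v
  have h1 : asym (fun w : Fin 4 → E => a (w ∘ Fin.castAdd 2) * b (w ∘ Fin.natAdd 2)) v = asym (fun w => a ![w 0, w 1] * b ![w 2, w 3]) v := by
    refine asym_congr (fun w => ?_) v
    congr 2 <;> (ext i; fin_cases i <;> rfl)
  rw [h1] at h
  unfold asym at h
  rw [← Equiv.sum_comp Perm.decomposeFin.symm, Fintype.sum_prod_type] at h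
  simp only [Fin.sum_univ_succ] at h
  simp only [← Equiv.sum_comp (Perm.decomposeFin (n := 2)).symm, Fintype.sum_prod_type] at h
  simp only [Fin.sum_univ_succ] at h
  simp only [← Equiv.sum_comp (Perm.decomposeFin (n := 1)).symm, Fintype.sum_prod_type] at h
  have e2 : ∀ (p : Fin 4) (e : Perm (Fin 3)), Perm.decomposeFin.symm (p, e) 2 = swap 0 p (e 1).succ := fun p e => Perm.decomposeFin_symm_apply_succ e p 1
  have e3 : ∀ (p : Fin 4) (e : Perm (Fin 3)), Perm.decomposeFin.symm (p, e) 3 = swap 0 p (e 2).succ := fun p e => Perm.decomposeFin_symm_apply_succ e p 2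
  have e4 : ∀ (p : Fin 3) (e : Perm (Fin 2)), Perm.decomposeFin.symm (p, e) 2 = swap 0 p (e 1).succ := fun p e => Perm.decomposeFin_symm_apply_succ e p 1
  simp [Fin.sum_univ_succ, e2, e3, e4, swap_apply_def] at h
  simp only [alternating_two_swap _ (v 0) (v 1), alternating_two_swap _ (v 0) (v 2), alternating_two_swap _ (v 0) (v 3), alternating_two_swap _ (v 1) (v 2),
    alternating_two_swap _ (v 1) (v 3), alternating_two_swap _ (v 2) (v 3)] at h
  linarith

end WedgeAlgebra

section Leibniz

variable {E : Type*} [NormedAddCommGroup E] [NormedSpace ℝ E]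

lemma wedgeCLM_apply {k l : ℕ} (a : 𝓛 E k) (b : 𝓛 E l) : wedgeCLM E k l a b = wedgeAlt a b := rfl

lemma extDeriv_wedge {k l : ℕ} {a : E → 𝓛 E k} {b : E → 𝓛 E l} {x : E} (ha : DifferentiableAt ℝ a x) (hb : DifferentiableAt ℝ b x) (v : Fin (k + l + 1) → E) :
    extDeriv (fun y => wedgeCLM E k l (a y) (b y)) x v = wedgeAlt (extDeriv a x) (b x) (v ∘ Fin.cast (Nat.add_right_comm k 1 l)) +
        (-1) ^ k * wedgeAlt (a x) (extDeriv b x) v := by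
  have h : fderiv ℝ (fun y => wedgeCLM E k l (a y) (b y)) x = wedgeCLM E k l (a x) ∘L fderiv ℝ b x + (wedgeCLM E k l).flip (b x) ∘L fderiv ℝ a x := by
    rw [ContinuousLinearMap.fderiv_of_bilinear _ ha hb]
    rfl
  unfold extDeriv
  rw [h, ContinuousAlternatingMap.alternatizeUncurryFin_add, ContinuousAlternatingMap.add_apply, alternatizeUncurryFin_wedge_left, alternatizeUncurryFin_wedge_right, add_comm]

end Leibniz

namespace DiffForm

variable {E : Type*} [NormedAddCommGroup E] [NormedSpace ℝ E] {M : Type*} [TopologicalSpace M]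
  [ChartedSpace E M]
local notation "𝓔" => DiffForm E M

lemma ext_apply {k : ℕ} {α β : 𝓔 k} (h : ∀ e ∈ atlas E M, ∀ y ∈ e.target, ∀ v, α.1 e y v = β.1 e y v) : α = β := by
  refine Subtype.ext (funext fun e => funext fun y => ?_)
  by_cases hy : e ∈ atlas E M ∧ y ∈ e.target
  · exact ContinuousAlternatingMap.ext fun v => h e hy.1 y hy.2 v
  · rw [α.2.2.2 e y hy, β.2.2.2 e y hy]

lemma wedge_val {k l : ℕ} (α : 𝓔 k) (β : 𝓔 l) (e : OpenPartialHomeomorph M E) (y : E) : (wedge α β).1 e y = wedgeAlt (α.1 e y) (β.1 e y) := rfl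

lemma wedge_add_left {k l : ℕ} (α α' : 𝓔 k) (β : 𝓔 l) : wedge (α + α') β = wedge α β + wedge α' β :=
  Subtype.ext (funext fun _ => funext fun _ => (wedgeCLM E k l).map_add₂ _ _ _)

lemma wedge_add_right {k l : ℕ} (α : 𝓔 k) (β β' : 𝓔 l) : wedge α (β + β') = wedge α β + wedge α β' :=
  Subtype.ext (funext fun _ => funext fun _ => map_add _ _ _)

lemma wedge_smul_left {k l : ℕ} (c : ℝ) (α : 𝓔 k) (β : 𝓔 l) : wedge (c • α) β = c • wedge α β :=
  Subtype.ext (funext fun _ => funext fun _ => (wedgeCLM E k l).map_smul₂ _ _ _)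

lemma wedge_smul_right {k l : ℕ} (c : ℝ) (α : 𝓔 k) (β : 𝓔 l) : wedge α (c • β) = c • wedge α β :=
  Subtype.ext (funext fun e => funext fun y => map_smul (wedgeCLM E k l (α.1 e y)) c (β.1 e y))

lemma sub_eq_add_smul {k : ℕ} (α β : 𝓔 k) : α - β = α + (-1 : ℝ) • β := by module



lemma wedge_sub_left {k l : ℕ} (α α' : 𝓔 k) (β : 𝓔 l) : wedge (α - α') β = wedge α β - wedge α' β := by rw [sub_eq_add_smul, sub_eq_add_smul, wedge_add_left, wedge_smul_left]

lemma wedge_sub_right {k l : ℕ} (α : 𝓔 k) (β β' : 𝓔 l) : wedge α (β - β') = wedge α β - wedge α β' := by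
  rw [sub_eq_add_smul, sub_eq_add_smul, wedge_add_right, wedge_smul_right]

lemma wedge_zero_left {k l : ℕ} (β : 𝓔 l) : wedge (0 : 𝓔 k) β = 0 := by simpa using wedge_smul_left 0 (0 : 𝓔 k) β

lemma wedge_zero_right {k l : ℕ} (α : 𝓔 k) : wedge α (0 : 𝓔 l) = 0 := by simpa using wedge_smul_right 0 α (0 : 𝓔 l)

lemma wedge_assoc_apply {k l m : ℕ} (α : 𝓔 k) (β : 𝓔 l) (γ : 𝓔 m) (e : OpenPartialHomeomorph M E) (y : E) (v : Fin (k + l + m) → E)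
    (w : Fin (k + (l + m)) → E) (h : ∀ i, w i = v (Fin.cast (Nat.add_assoc k l m).symm i)) : (wedge (wedge α β) γ).1 e y v = (wedge α (wedge β γ)).1 e y w :=
  (wedgeAlt_assoc _ _ _ _).trans (congrArg _ (funext h).symm)

lemma wedge_assoc_one_two_two (α : 𝓔 1) (β : 𝓔 2) (γ : 𝓔 2) : 𝓦 3 2 (𝓦 1 2 α β) γ = (𝓦 1 4 α (𝓦 2 2 β γ) : 𝓔 5) := by
  refine ext_apply fun e _ y _ v => ?_
  exact wedge_assoc_apply (k := 1) (l := 2) (m := 2) α β γ e y v v fun _ => rfl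

lemma wedge_assoc_two_two_one (α : 𝓔 2) (β : 𝓔 2) (γ : 𝓔 1) : 𝓦 4 1 (𝓦 2 2 α β) γ = (𝓦 2 3 α (𝓦 2 1 β γ) : 𝓔 5) := by
  refine ext_apply fun e _ y _ v => ?_
  exact wedge_assoc_apply (k := 2) (l := 2) (m := 1) α β γ e y v v fun _ => rfl

lemma wedge_assoc_two_one_two (α : 𝓔 2) (β : 𝓔 1) (γ : 𝓔 2) : 𝓦 3 2 (𝓦 2 1 α β) γ = (𝓦 2 3 α (𝓦 1 2 β γ) : 𝓔 5) := by
  refine ext_apply fun e _ y _ v => ?_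
  exact wedge_assoc_apply (k := 2) (l := 1) (m := 2) α β γ e y v v fun _ => rfl

lemma wedge_assoc_three_two_two (α : 𝓔 3) (β : 𝓔 2) (γ : 𝓔 2) : 𝓦 5 2 (𝓦 3 2 α β) γ = (𝓦 3 4 α (𝓦 2 2 β γ) : 𝓔 7) := by
  refine ext_apply fun e _ y _ v => ?_
  exact wedge_assoc_apply (k := 3) (l := 2) (m := 2) α β γ e y v v fun _ => rfl

lemma wedge_comm_two_two (α β : 𝓔 2) : wedge α β = wedge β α :=
  Subtype.ext (funext fun _ => funext fun _ => wedgeAlt_comm_two_two _ _)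

lemma wedge_comm_two_three (α : 𝓔 2) (β : 𝓔 3) : 𝓦 2 3 α β = (𝓦 3 2 β α : 𝓔 5) :=
  Subtype.ext (funext fun _ => funext fun _ => wedgeAlt_comm_two_three _ _)

variable [IsManifold 𝓘(ℝ, E) ∞ M]

lemma d_val {k : ℕ} (α : 𝓔 k) {e : OpenPartialHomeomorph M E} (he : e ∈ atlas E M) {y : E} (hy : y ∈ e.target) : (d α).1 e y = extDeriv (α.1 e) y :=
  if_pos ⟨he, hy⟩

lemma differentiableAt_val {k : ℕ} (α : 𝓔 k) {e : OpenPartialHomeomorph M E} (he : e ∈ atlas E M) {y : E} (hy : y ∈ e.target) : DifferentiableAt ℝ (α.1 e) y :=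
  ((α.2.1 e he).contDiffAt (e.open_target.mem_nhds hy)).diffAt

lemma d_sub {k : ℕ} (α β : 𝓔 k) : d (α - β) = d α - d β := map_sub d α β

lemma d_neg {k : ℕ} (α : 𝓔 k) : d (-α) = -d α := map_neg d α

lemma d_d {k : ℕ} (α : 𝓔 k) : d (d α) = 0 := by
  refine ext_apply fun e he y hy v => ?_
  rw [d_val _ he hy]
  have h : (d α).1 e =ᶠ[𝓝 y] extDeriv (α.1 e) := by
    filter_upwards [e.open_target.mem_nhds hy] with z hz
    exact d_val α he hz
  rw [h.extDeriv_eq, extDeriv_extDeriv_apply ((α.2.1 e he).contDiffAt (e.open_target.mem_nhds hy))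
    (by simpa using (WithTop.coe_le_coe.2 le_top : ((2 : ℕ∞) : ℕ∞ω) ≤ ∞))]
  rfl

lemma d_wedge_apply {k l : ℕ} (α : 𝓔 k) (β : 𝓔 l) {e : OpenPartialHomeomorph M E} (he : e ∈ atlas E M) {y : E} (hy : y ∈ e.target)
    (v : Fin (k + l + 1) → E) (w : Fin (k + 1 + l) → E)
    (h : ∀ i, w i = v (Fin.cast (Nat.add_right_comm k 1 l) i)) : (d (wedge α β)).1 e y v = (wedge (d α) β).1 e y w + (-1) ^ k * (wedge α (d β)).1 e y v := by
  rw [d_val _ he hy, wedge_val, wedge_val, d_val _ he hy, d_val _ he hy, funext h]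
  exact extDeriv_wedge (differentiableAt_val α he hy) (differentiableAt_val β he hy) v

lemma d_wedge_one_two (α : 𝓔 1) (β : 𝓔 2) : d (k := 3) (𝓦 1 2 α β) = 𝓦 2 2 (d α) β - (𝓦 1 3 α (d β) : 𝓔 4) := by
  refine ext_apply fun e he y hy v => ?_
  refine (d_wedge_apply (k := 1) (l := 2) α β he hy v v fun _ => rfl).trans ?_
  rw [Odd.neg_one_pow (by decide), neg_one_mul, ← sub_eq_add_neg]; rfl

lemma d_wedge_one_three (α : 𝓔 1) (β : 𝓔 3) : d (k := 4) (𝓦 1 3 α β) = 𝓦 2 3 (d α) β - (𝓦 1 4 α (d β) : 𝓔 5) := by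
  refine ext_apply fun e he y hy v => ?_
  refine (d_wedge_apply (k := 1) (l := 3) α β he hy v v fun _ => rfl).trans ?_
  rw [Odd.neg_one_pow (by decide), neg_one_mul, ← sub_eq_add_neg]; rfl

lemma d_wedge_two_one (α : 𝓔 2) (β : 𝓔 1) : d (k := 3) (𝓦 2 1 α β) = 𝓦 3 1 (d α) β + (𝓦 2 2 α (d β) : 𝓔 4) := by
  refine ext_apply fun e he y hy v => ?_
  refine (d_wedge_apply (k := 2) (l := 1) α β he hy v v fun _ => rfl).trans ?_
  rw [Even.neg_one_pow (by decide), one_mul]; rfl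

lemma d_wedge_three_one (α : 𝓔 3) (β : 𝓔 1) : d (k := 4) (𝓦 3 1 α β) = 𝓦 4 1 (d α) β - (𝓦 3 2 α (d β) : 𝓔 5) := by
  refine ext_apply fun e he y hy v => ?_
  refine (d_wedge_apply (k := 3) (l := 1) α β he hy v v fun _ => rfl).trans ?_
  rw [Odd.neg_one_pow (by decide), neg_one_mul, ← sub_eq_add_neg]; rfl

lemma d_wedge_four_two (α : 𝓔 4) (β : 𝓔 2) : d (k := 6) (𝓦 4 2 α β) = 𝓦 5 2 (d α) β + (𝓦 4 3 α (d β) : 𝓔 7) := by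
  refine ext_apply fun e he y hy v => ?_
  refine (d_wedge_apply (k := 4) (l := 2) α β he hy v v fun _ => rfl).trans ?_
  rw [Even.neg_one_pow (by decide), one_mul]; rfl

lemma d_wedge_three_three (α : 𝓔 3) (β : 𝓔 3) : d (k := 6) (𝓦 3 3 α β) = 𝓦 4 3 (d α) β - (𝓦 3 4 α (d β) : 𝓔 7) := by
  refine ext_apply fun e he y hy v => ?_
  refine (d_wedge_apply (k := 3) (l := 3) α β he hy v v fun _ => rfl).trans ?_
  rw [Odd.neg_one_pow (by decide), neg_one_mul, ← sub_eq_add_neg]; rfl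

lemma d_wedge_closed_right {η : 𝓔 1} {α : 𝓔 2} (hα : d α = 0) : d (k := 3) (𝓦 1 2 η α) = 𝓦 2 2 (d η) α := by
  rw [d_wedge_one_two, hα, wedge_zero_right]
  exact sub_zero (𝓦 2 2 (d η) α)

lemma d_wedge_closed_left {η : 𝓔 1} {α : 𝓔 2} (hα : d α = 0) : d (k := 3) (𝓦 2 1 α η) = 𝓦 2 2 α (d η) := by
  rw [d_wedge_two_one, hα, wedge_zero_left]
  exact zero_add _

lemma wedge_three_d {β : 𝓔 3} (η : 𝓔 1) (hβ : d β = 0) : 𝓦 3 2 β (d η) = - d (k := 4) (𝓦 3 1 β η) := by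
  rw [d_wedge_three_one, hβ, wedge_zero_left]
  exact (neg_neg (𝓦 3 2 β (d η))).symm.trans (congrArg Neg.neg (zero_sub _).symm)

lemma MasseyDefined.congr {α₁ α₂ α₃ : 𝓔 2} (η₁ η₂ η₃ : 𝓔 1) (h : MasseyDefined α₁ α₂ α₃) : MasseyDefined (α₁ + d η₁) (α₂ + d η₂) (α₃ + d η₃) := by
  obtain ⟨⟨h1, h2, h3⟩, ⟨x, hx⟩, ⟨y, hy⟩⟩ := h
  have c1 : d (α₁ + d η₁) = 0 := by rw [map_add, h1, d_d, add_zero]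
  have c2 : d (α₂ + d η₂) = 0 := by rw [map_add, h2, d_d, add_zero]
  have c3 : d (α₃ + d η₃) = 0 := by rw [map_add, h3, d_d, add_zero]
  refine ⟨⟨c1, c2, c3⟩, ⟨x + 𝓦 2 1 α₁ η₂ + 𝓦 1 2 η₁ (α₂ + d η₂), ?_⟩, ⟨y + 𝓦 2 1 α₂ η₃ + 𝓦 1 2 η₂ (α₃ + d η₃), ?_⟩⟩
  · rw [wedge_add_left, wedge_add_right α₁]
    exact (map_add _ _ _).trans (congrArg₂ (· + ·) ((map_add _ _ _).trans (congrArg₂ (· + ·) hx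
      (d_wedge_closed_left h1))) (d_wedge_closed_right c2))
  · rw [wedge_add_left, wedge_add_right α₂]
    exact (map_add _ _ _).trans (congrArg₂ (· + ·) ((map_add _ _ _).trans (congrArg₂ (· + ·) hy
      (d_wedge_closed_left h2))) (d_wedge_closed_right c3))

lemma MasseyVanishes.congr_left {α₁ α₂ α₃ : 𝓔 2} (η : 𝓔 1) (h2 : d α₂ = 0) (h : MasseyVanishes α₁ α₂ α₃) : MasseyVanishes (α₁ + d η) α₂ α₃ := by
  obtain ⟨ξ, ζ, hξ, hζ, β, γ, hβ, hγ, ⟨x, hx⟩⟩ := h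
  refine ⟨ξ + 𝓦 1 2 η α₂, ζ, ?_, hζ, β, γ, hβ, hγ, ⟨x - 𝓦 1 3 η ζ + 𝓦 3 1 β η, ?_⟩⟩
  · rw [wedge_add_left]
    exact (map_add _ _ _).trans (congrArg₂ (· + ·) hξ (d_wedge_closed_right h2))
  · have e1 := d_wedge_one_three η ζ
    rw [hζ] at e1
    have e2 := wedge_assoc_one_two_two η α₂ α₃
    have e3 := wedge_three_d η hβ
    have e4 := wedge_add_left (k := 3) (l := 2) ξ (𝓦 1 2 η α₂) α₃
    have e5 := wedge_add_left (k := 2) (l := 3) α₁ (d η) ζ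
    have e6 := wedge_add_right (k := 3) (l := 2) β α₁ (d η)
    rw [map_add, d_sub, hx, e1]
    simp only [masseyCocycle]
    rw [e4, e5, e6, e2, e3]
    module

lemma MasseyVanishes.congr_right {α₁ α₂ α₃ : 𝓔 2} (η : 𝓔 1) (h2 : d α₂ = 0) (h : MasseyVanishes α₁ α₂ α₃) : MasseyVanishes α₁ α₂ (α₃ + d η) := by
  obtain ⟨ξ, ζ, hξ, hζ, β, γ, hβ, hγ, ⟨x, hx⟩⟩ := h
  refine ⟨ξ, ζ + 𝓦 2 1 α₂ η, hξ, ?_, β, γ, hβ, hγ, ⟨x - 𝓦 3 1 ξ η + 𝓦 3 1 γ η, ?_⟩⟩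
  · rw [wedge_add_right]
    exact (map_add _ _ _).trans (congrArg₂ (· + ·) hζ (d_wedge_closed_left h2))
  · have e1 := d_wedge_three_one ξ η
    rw [hξ] at e1
    have e2 := wedge_assoc_two_two_one α₁ α₂ η
    have e3 := wedge_three_d η hγ
    have e4 := wedge_add_right (k := 2) (l := 3) α₁ ζ (𝓦 2 1 α₂ η)
    have e5 := wedge_add_right (k := 3) (l := 2) ξ α₃ (d η)
    have e6 := wedge_add_right (k := 3) (l := 2) γ α₃ (d η)
    rw [map_add, d_sub, hx, e1]
    simp only [masseyCocycle]
    rw [e4, e5, e6, e2, e3]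
    module

lemma MasseyVanishes.congr_mid {α₁ α₂ α₃ : 𝓔 2} (η : 𝓔 1) (h1 : d α₁ = 0) (h3 : d α₃ = 0) (h : MasseyVanishes α₁ α₂ α₃) : MasseyVanishes α₁ (α₂ + d η) α₃ := by
  obtain ⟨ξ, ζ, hξ, hζ, β, γ, hβ, hγ, ⟨x, hx⟩⟩ := h
  refine ⟨ξ + 𝓦 2 1 α₁ η, ζ + 𝓦 1 2 η α₃, ?_, ?_, β, γ, hβ, hγ, ⟨x, ?_⟩⟩
  · rw [wedge_add_right]
    exact (map_add _ _ _).trans (congrArg₂ (· + ·) hξ (d_wedge_closed_left h1))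
  · rw [wedge_add_left]
    exact (map_add _ _ _).trans (congrArg₂ (· + ·) hζ (d_wedge_closed_right h3))
  · have e2 := wedge_assoc_two_one_two α₁ η α₃
    have e4 := wedge_add_right (k := 2) (l := 3) α₁ ζ (𝓦 1 2 η α₃)
    have e5 := wedge_add_left (k := 3) (l := 2) ξ (𝓦 2 1 α₁ η) α₃
    rw [hx]
    simp only [masseyCocycle]
    rw [e4, e5, e2]
    module

lemma MasseyVanishes.congr {α₁ α₂ α₃ : 𝓔 2} (η₁ η₂ η₃ : 𝓔 1) (h1 : d α₁ = 0) (h2 : d α₂ = 0) (h3 : d α₃ = 0) (h : MasseyVanishes α₁ α₂ α₃) :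
    MasseyVanishes (α₁ + d η₁) (α₂ + d η₂) (α₃ + d η₃) := by
  have c1 : d (α₁ + d η₁) = 0 := by rw [map_add, h1, d_d, add_zero]
  have c2 : d (α₂ + d η₂) = 0 := by rw [map_add, h2, d_d, add_zero]
  exact ((h.congr_left η₁ h2).congr_mid η₂ c1 h3).congr_right η₃ c2

end DiffForm

namespace CDGA

variable {A B : CDGA}

/-- Homogeneous components. -/
def comp (A : CDGA) (k : ℕ) : A.carrier →ₗ[ℝ] A.carrier := GradedAlgebra.proj A.grading k

lemma comp_mem (k : ℕ) (a : A.carrier) : A.comp k a ∈ A.grading k :=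
  SetLike.coe_mem _

lemma comp_same {k : ℕ} {a : A.carrier} (h : a ∈ A.grading k) : A.comp k a = a :=
  DirectSum.decompose_of_mem_same _ h

lemma comp_ne {k l : ℕ} {a : A.carrier} (h : a ∈ A.grading k) (hkl : k ≠ l) : A.comp l a = 0 :=
  DirectSum.decompose_of_mem_ne _ h hkl

lemma comp_d (k : ℕ) (a : A.carrier) : A.comp (k + 1) (A.d a) = A.d (A.comp k a) := by
  induction a using DirectSum.Decomposition.inductionOn A.grading with
  | zero => simp
  | @homogeneous i m =>
    by_cases h : i = k
    · subst h
      rw [comp_same m.2, comp_same (A.d_mem m.2)]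
    · rw [comp_ne m.2 h, comp_ne (A.d_mem m.2) (by omega), map_zero]
  | add x y hx hy => simp only [map_add, hx, hy]

lemma QuasiIso.comp_map (f : A.QuasiIso B) (k : ℕ) (a : A.carrier) : B.comp k (f.toFun a) = f.toFun (A.comp k a) := by
  induction a using DirectSum.Decomposition.inductionOn A.grading with
  | zero => simp
  | @homogeneous i m =>
    by_cases h : i = k
    · subst h
      rw [comp_same m.2, comp_same (f.map_mem m.2)]
    · rw [comp_ne m.2 h, comp_ne (f.map_mem m.2) h, map_zero]
  | add x y hx hy => simp only [map_add, hx, hy]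

lemma QuasiIso.exists_primitive (f : A.QuasiIso B) (hB : B.d = 0) {k : ℕ} {a x : A.carrier} (ha : a ∈ A.grading (k + 1)) (hx : A.d x = a) :
    ∃ y ∈ A.grading k, A.d y = a ∧ f.toFun y = 0 := by
  obtain ⟨c, hc, b, hb⟩ := f.surjective (f.toFun (A.comp k x)) (by rw [hB]; rfl)
  rw [hB, LinearMap.zero_apply, eq_comm, sub_eq_zero] at hb
  refine ⟨A.comp k x - A.comp k c, sub_mem (comp_mem _ _) (comp_mem _ _), ?_, ?_⟩
  · rw [map_sub, ← comp_d, ← comp_d, hx, hc, map_zero, sub_zero, comp_same ha]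
  · rw [map_sub, ← f.comp_map k c, hb, f.comp_map, comp_same (comp_mem k x), sub_self]

end CDGA

namespace DiffForm

variable {E : Type*} [NormedAddCommGroup E] [NormedSpace ℝ E] {M : Type*} [TopologicalSpace M]
  [ChartedSpace E M] [IsManifold 𝓘(ℝ, E) ∞ M]
local notation "𝓔" => DiffForm E M

lemma masseyVanishes_of_isFormal (hf : IsFormal E M) {α₁ α₂ α₃ : 𝓔 2} (h : MasseyDefined α₁ α₂ α₃) : MasseyVanishes α₁ α₂ α₃ := by
  obtain ⟨A, B, hB, ⟨f⟩, ⟨φ⟩⟩ := hf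
  have key : ∀ α : 𝓔 2, d α = 0 → ∃ (a : A.grading 2) (η : 𝓔 1), A.d a = 0 ∧ φ.toFun 2 a = α + d η := by
    intro α hα
    obtain ⟨a, ha, η, hη⟩ := φ.surjective α hα
    refine ⟨a, η, ha, ?_⟩
    have : φ.toFun 2 a = α + (φ.toFun 2 a - α) := by module
    exact this.trans (congrArg₂ (· + ·) rfl hη.symm)
  obtain ⟨a₁, η₁, ha₁, h₁⟩ := key α₁ h.1.1
  obtain ⟨a₂, η₂, ha₂, h₂⟩ := key α₂ h.1.2.1
  obtain ⟨a₃, η₃, ha₃, h₃⟩ := key α₃ h.1.2.2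
  have hd := h.congr η₁ η₂ η₃
  rw [← h₁, ← h₂, ← h₃] at hd
  suffices hv : MasseyVanishes (φ.toFun 2 a₁) (φ.toFun 2 a₂) (φ.toFun 2 a₃) by
    have h4 := hv.congr (-η₁) (-η₂) (-η₃) hd.1.1 hd.1.2.1 hd.1.2.2
    rw [h₁, h₂, h₃] at h4
    have e : ∀ (α : 𝓔 2) (η : 𝓔 1), α + d η + d (-η) = α := by
      intro α η
      rw [d_neg]
      module
    rwa [e, e, e] at h4
  have prod : ∀ a b : A.grading 2, A.d a = 0 → A.d b = 0 → IsExact (wedge (φ.toFun 2 a) (φ.toFun 2 b)) → ∃ y : A.grading 3, A.d y = a * b ∧ f.toFun y = 0 := by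
    intro a b ha hb hab
    rw [← φ.map_mul] at hab
    have hc : A.d (a * b : A.carrier) = 0 := by rw [A.leibniz _ a.2, ha, hb, zero_mul, mul_zero, smul_zero, add_zero]
    obtain ⟨x, hx⟩ := φ.injective _ hc hab
    obtain ⟨y, hy, hy1, hy2⟩ := f.exists_primitive hB (k := 3) (SetLike.GradedMul.mul_mem (i := 2) (j := 2) a.2 b.2) hx
    exact ⟨⟨y, hy⟩, hy1, hy2⟩
  obtain ⟨x, hx, fx⟩ := prod a₁ a₂ ha₁ ha₂ hd.2.1
  obtain ⟨y, hy, fy⟩ := prod a₂ a₃ ha₂ ha₃ hd.2.2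
  have dx : d (φ.toFun 3 x) = wedge (φ.toFun 2 a₁) (φ.toFun 2 a₂) := by
    rw [← φ.map_mul, ← φ.map_d]
    congr 1
    exact Subtype.ext hx
  have dy : d (φ.toFun 3 y) = wedge (φ.toFun 2 a₂) (φ.toFun 2 a₃) := by
    rw [← φ.map_mul, ← φ.map_d]
    congr 1
    exact Subtype.ext hy
  let m₁ : A.grading 5 := ⟨x * a₃, SetLike.GradedMul.mul_mem x.2 a₃.2⟩
  let m₂ : A.grading 5 := ⟨a₁ * y, SetLike.GradedMul.mul_mem a₁.2 y.2⟩
  have hm : A.d ((m₁ - m₂ : A.grading 5) : A.carrier) = 0 := by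
    have e1 : A.d (x * a₃ : A.carrier) = a₁ * a₂ * a₃ := by rw [A.leibniz _ x.2, hx, ha₃, mul_zero, smul_zero, add_zero]
    have e2 : A.d (a₁ * y : A.carrier) = a₁ * (a₂ * a₃) := by rw [A.leibniz _ a₁.2, hy, ha₁, zero_mul, neg_one_sq, one_smul, zero_add]
    have e3 : ((m₁ - m₂ : A.grading 5) : A.carrier) = x * a₃ - a₁ * y := rfl
    rw [e3, map_sub, e1, e2, mul_assoc, sub_self]
  have fm : f.toFun ((m₁ - m₂ : A.grading 5) : A.carrier) = 0 := by
    have e3 : ((m₁ - m₂ : A.grading 5) : A.carrier) = x * a₃ - a₁ * y := rfl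
    rw [e3, map_sub, map_mul, map_mul, fx, fy, zero_mul, mul_zero, sub_self]
  obtain ⟨c, hc⟩ := f.injective _ hm ⟨0, by rw [map_zero, fm]⟩
  have hc' : A.d (A.comp 4 c) = (m₁ - m₂ : A.grading 5) := by rw [← CDGA.comp_d, hc, CDGA.comp_same (m₁ - m₂ : A.grading 5).2]
  refine ⟨φ.toFun 3 x, φ.toFun 3 y, dx, dy, 0, 0, map_zero _, map_zero _, ⟨φ.toFun 4 ⟨A.comp 4 c, CDGA.comp_mem 4 c⟩, ?_⟩⟩
  have e5 : (⟨A.d (A.comp 4 c), A.d_mem (CDGA.comp_mem 4 c)⟩ : A.grading 5) = m₁ - m₂ :=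
    Subtype.ext hc'
  have e6 := φ.map_d (k := 4) ⟨A.comp 4 c, CDGA.comp_mem 4 c⟩
  refine e6.symm.trans ((congrArg (φ.toFun 5) e5).trans ?_)
  rw [map_sub]
  have e7 := φ.map_mul (k := 3) (l := 2) x a₃
  have e8 := φ.map_mul (k := 2) (l := 3) a₁ y
  have e9 : 𝓦 3 2 (0 : 𝓔 3) (φ.toFun 2 a₁) + 𝓦 3 2 (0 : 𝓔 3) (φ.toFun 2 a₃) = 0 := by rw [wedge_zero_left, wedge_zero_left]; exact add_zero _
  refine (congrArg₂ (· - ·) e7 e8).trans ?_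
  exact (sub_zero _).symm.trans (congrArg₂ (· - ·) rfl e9.symm)

end DiffForm

namespace JK


/-- Pullback of a form on `ℝ⁷`. -/
def pb {k : ℕ} (f : Space7 → Space7) (a : 𝓐 k) (x : Space7) : Alt7 k :=
  (a (f x)).compContinuousLinearMap (fderiv ℝ f x)

/-- The parametrizations of the resolution. -/
def param (i : Option (Fin 10 × Bool)) (x : Space7) : Resolution := resolutionAtlas.param i x

/-- The chart of the resolution inverse to a parametrization. -/
def mkChart (i : Option (Fin 10 × Bool)) (V : Set Space7) (hV : IsOpen V) (hd : V ⊆ paramDom i) (hi : Set.InjOn (param i) V) : OpenPartialHomeomorph Resolution Space7 :=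
  resolutionAtlas.core.openPartialHomeomorph (resolutionAtlas.chart i V hi) ⟨i, V, hV, hd, hi, rfl⟩

section mkChart

variable {i : Option (Fin 10 × Bool)} {V : Set Space7} {hV : IsOpen V} {hd : V ⊆ paramDom i}
  {hi : Set.InjOn (param i) V}

lemma mkChart_mem_atlas : mkChart i V hV hd hi ∈ atlas Space7 Resolution :=
  Set.mem_iUnion.2 ⟨_, Set.mem_iUnion.2 ⟨⟨i, V, hV, hd, hi, rfl⟩, rfl⟩⟩

lemma mkChart_target : (mkChart i V hV hd hi).target = V := rfl


lemma mkChart_symm (y : Space7) : (mkChart i V hV hd hi).symm y = param i y := rfl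

lemma mkChart_param {x : Space7} (hx : x ∈ V) : mkChart i V hV hd hi (param i x) = x :=
  (mkChart i V hV hd hi).right_inv hx

end mkChart

lemma exists_mkChart {e : OpenPartialHomeomorph Resolution Space7} (he : e ∈ atlas Space7 Resolution) : ∃ i V hV hd hi, e = mkChart i V hV hd hi := by
  obtain ⟨_, ⟨f', rfl⟩, _, ⟨⟨i, V, hV, hd, hi, rfl⟩, rfl⟩, rfl⟩ := he
  exact ⟨i, V, hV, hd, hi, rfl⟩

lemma exists_mkChart_mem {i : Option (Fin 10 × Bool)} {x : Space7} (hx : x ∈ paramDom i) : ∃ V, ∃ (_ : IsOpen V) (_ : V ⊆ paramDom i) (_ : Set.InjOn (param i) V), x ∈ V := by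
  obtain ⟨V, hV, hxV, hd, hi⟩ := resolutionAtlas.inj i x hx
  exact ⟨V, hV, hd, hi, hxV⟩

lemma exists_param (m : Resolution) : ∃ i, ∃ x ∈ paramDom i, param i x = m :=
  resolutionAtlas.surj m

lemma isOpen_paramDom (i) : IsOpen (paramDom i) := resolutionAtlas.isOpen_dom i

lemma exists_lift {i j x y} (hx : x ∈ paramDom i) (hy : y ∈ paramDom j) (h : param i x = param j y) :
    ∃ g : Space7 → Space7, SmoothAt g x ∧ g x = y ∧ ∀ᶠ z in 𝓝 x, param j (g z) = param i z :=
  resolutionAtlas.lift i j x hx y hy h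

variable {k l : ℕ} {x : Space7}

lemma rep_lift (η : 𝓓 k) {i j V W hV hd hi hW hd' hi'} {x : Space7} (hx : x ∈ V) {g : Space7 → Space7} (hg : ContinuousAt g x) (hgx : g x ∈ W)
    (hl : ∀ᶠ z in 𝓝 x, param j (g z) = param i z) : η.1 (mkChart i V hV hd hi) x = (η.1 (mkChart j W hW hd' hi') (g x)).compContinuousLinearMap (fderiv ℝ g x) := by
  have h1 : param i x ∈ (mkChart j W hW hd' hi').source := ⟨g x, hgx, hl.self_of_nhds⟩
  rw [η.2.2.1 _ mkChart_mem_atlas _ (mkChart_mem_atlas (hV := hW) (hd := hd') (hi := hi')) x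
    ⟨hx, h1⟩]
  have h2 : (fun z => (mkChart j W hW hd' hi') ((mkChart i V hV hd hi).symm z)) =ᶠ[𝓝 x] g := by
    filter_upwards [hl, hg (hW.mem_nhds hgx)] with z h3 h4
    have h4 : g z ∈ W := h4
    rw [mkChart_symm, ← h3, mkChart_param h4]
  have h3 : (mkChart j W hW hd' hi') ((mkChart i V hV hd hi).symm x) = g x := h2.self_of_nhds
  rw [h2.fderiv_eq, h3]

open Classical in
/-- The local representative of a form in a parametrization. -/
def loc (η : 𝓓 k) (i : Option (Fin 10 × Bool)) (x : Space7) : Alt7 k :=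
  if h : x ∈ paramDom i then
    η.1 (mkChart i (exists_mkChart_mem h).choose (exists_mkChart_mem h).choose_spec.choose
      (exists_mkChart_mem h).choose_spec.choose_spec.choose
      (exists_mkChart_mem h).choose_spec.choose_spec.choose_spec.choose) x
  else 0

lemma loc_eq (η : 𝓓 k) {i V hV hd hi} (hx : x ∈ V) : loc η i x = η.1 (mkChart i V hV hd hi) x := by
  have h : x ∈ paramDom i := hd hx
  rw [loc, dif_pos h, rep_lift η (exists_mkChart_mem h).choose_spec.choose_spec.choose_spec.choose_spec
    (g := id) (hW := hV) (hd' := hd) (hi' := hi) continuousAt_id hx (.of_forall fun _ => rfl)]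
  rw [fderiv_id]
  rfl

lemma loc_lift (η : 𝓓 k) {i j} {g : Space7 → Space7} (hx : x ∈ paramDom i) (hg : ContinuousAt g x) (hgx : g x ∈ paramDom j)
    (hl : ∀ᶠ z in 𝓝 x, param j (g z) = param i z) : loc η i x = pb g (loc η j) x := by
  obtain ⟨V, hV, hd, hi, hxV⟩ := exists_mkChart_mem hx
  obtain ⟨W, hW, hd', hi', hxW⟩ := exists_mkChart_mem hgx
  rw [loc_eq η (hV := hV) (hd := hd) (hi := hi) hxV, pb, loc_eq η (hV := hW) (hd := hd') (hi := hi') hxW]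
  exact rep_lift η hxV hg hxW hl

lemma loc_eventuallyEq (η : 𝓓 k) {i V hV hd hi} (hx : x ∈ V) : loc η i =ᶠ[𝓝 x] η.1 (mkChart i V hV hd hi) := by filter_upwards [hV.mem_nhds hx] with z hz using loc_eq η hz

lemma contDiffAt_loc (η : 𝓓 k) {i} (hx : x ∈ paramDom i) : SmoothAt (loc η i) x := by
  obtain ⟨V, hV, hd, hi, hxV⟩ := exists_mkChart_mem hx
  exact ((η.2.1 _ (mkChart_mem_atlas (hV := hV) (hd := hd) (hi := hi))).contDiffAt
    (hV.mem_nhds hxV)).congr_of_eventuallyEq (loc_eventuallyEq η hxV)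

lemma ext_loc {η η' : 𝓓 k} (h : ∀ i, ∀ x ∈ paramDom i, loc η i x = loc η' i x) : η = η' := by
  refine DiffForm.ext_apply fun e he y hy v => ?_
  obtain ⟨i, V, hV, hd, hi, rfl⟩ := exists_mkChart he
  have hy : y ∈ V := hy
  rw [← loc_eq η hy, ← loc_eq η' hy, h i y (hd hy)]


lemma loc_sub (η η' : 𝓓 k) (i x) : loc (η - η') i x = loc η i x - loc η' i x := by unfold loc; split_ifs <;> simp


lemma loc_zero (i x) : loc (0 : 𝓓 k) i x = 0 := by unfold loc; split_ifs <;> simp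

lemma loc_wedge (α : 𝓓 k) (β : 𝓓 l) (i x) : loc (DiffForm.wedge α β) i x = wedgeCLM Space7 k l (loc α i x) (loc β i x) := by
  unfold loc
  split_ifs
  · rfl
  · simp

lemma loc_d (η : 𝓓 k) {i} (hx : x ∈ paramDom i) : loc (DiffForm.d η) i x = extDeriv (loc η i) x := by
  obtain ⟨V, hV, hd, hi, hxV⟩ := exists_mkChart_mem hx
  rw [loc_eq (DiffForm.d η) (hV := hV) (hd := hd) (hi := hi) hxV, (loc_eventuallyEq η (hV := hV) (hd := hd) (hi := hi) hxV).extDeriv_eq]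
  exact DiffForm.d_val η mkChart_mem_atlas hxV

lemma valueAt_eq (η : 𝓓 k) (m : Resolution) : ∃ j W hW hd hi, ∃ y ∈ W, chartAt Space7 m = mkChart j W hW hd hi ∧ param j y = m ∧ chartAt Space7 m m = y ∧
      DiffForm.valueAt η m = loc η j y := by
  obtain ⟨j, W, hW, hd, hi, he⟩ := exists_mkChart (chart_mem_atlas Space7 m)
  have hm : m ∈ (mkChart j W hW hd hi).source := he ▸ mem_chart_source Space7 m
  obtain ⟨y, hy, hp⟩ := hm
  have hp : param j y = m := hp
  subst hp
  have h1 : chartAt Space7 (param j y) (param j y) = y := by rw [he, mkChart_param hy]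
  refine ⟨j, W, hW, hd, hi, y, hy, he, rfl, h1, ?_⟩
  rw [DiffForm.valueAt, DiffForm.rep, h1, he, loc_eq η hy]

lemma valueAt_param_eq_zero (η : 𝓓 k) {i} {x : Space7} (hx : x ∈ paramDom i) : DiffForm.valueAt η (param i x) = 0 ↔ loc η i x = 0 := by
  obtain ⟨j, W, hW, hd, hi, y, hy, -, hp, -, hv⟩ := valueAt_eq η (param i x)
  rw [hv]
  have key : ∀ {i j} {x y : Space7}, x ∈ paramDom i → y ∈ paramDom j → param j y = param i x → loc η j y = 0 → loc η i x = 0 := by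
    intro i j x y hx hy h h0
    obtain ⟨g, hg, rfl, hl⟩ := exists_lift hx hy h.symm
    rw [loc_lift η hx hg.continuousAt hy hl, pb, h0]
    rfl
  exact ⟨key hx (hd hy) hp, key (hd hy) hx hp.symm⟩

lemma pullbackAt_eq {V : Type*} [NormedAddCommGroup V] [NormedSpace ℝ V] (η : 𝓓 k) {i} {h : V → Space7} {f : V → Resolution} {x : V}
    (hf : ∀ y, f y = param i (h y)) (hx : h x ∈ paramDom i) (hh : DifferentiableAt ℝ h x) :
    DiffForm.pullbackAt η f x = (loc η i (h x)).compContinuousLinearMap (fderiv ℝ h x) := by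
  obtain ⟨j, W, hW, hd, hi, y, hy, he, hp, hc, hv⟩ := valueAt_eq η (f x)
  have hp' := hp.trans (hf x)
  obtain ⟨g, hg, rfl, hl⟩ := exists_lift hx (hd hy) hp'.symm
  rw [DiffForm.pullbackAt, hv, he, loc_lift η hx hg.continuousAt (hd hy) hl]
  have h2 : (fun y => mkChart j W hW hd hi (f y)) =ᶠ[𝓝 x] g ∘ h := by
    filter_upwards [hh.continuousAt.eventually hl, hh.continuousAt.eventually (hg.continuousAt (hW.mem_nhds hy))] with z h3 h4
    rw [hf, ← h3, mkChart_param h4, Function.comp_apply]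
  rw [h2.fderiv_eq, fderiv_comp x (hg.diffAt) hh]
  rfl

open Classical in
/-- A form on the resolution from compatible local representatives. -/
def ofLoc (a : Option (Fin 10 × Bool) → 𝓐 k) (ha : ∀ i, ∀ x ∈ paramDom i, SmoothAt (a i) x) (hl : ∀ i j (g : Space7 → Space7) (x : Space7), x ∈ paramDom i → g x ∈ paramDom j →
      SmoothAt g x → (∀ᶠ z in 𝓝 x, param j (g z) = param i z) → a i x = pb g (a j) x) : 𝓓 k :=
  ⟨fun e y => if h : e ∈ atlas Space7 Resolution ∧ y ∈ e.target then
      a (exists_mkChart h.1).choose y else 0, by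
    refine ⟨fun e he => ?_, fun e he e' he' y hy => ?_, fun e y h => dif_neg h⟩
    · obtain ⟨V, hV, hd, hi, e1⟩ := (exists_mkChart he).choose_spec
      refine ContDiffOn.congr (f := a (exists_mkChart he).choose) (fun y hy => ?_) fun y hy => ?_
      · rw [e1, mkChart_target] at hy
        exact (ha _ _ (hd hy)).contDiffWithinAt
      · exact dif_pos ⟨he, hy⟩
    · have hy2 : e' (e.symm y) ∈ e'.target := e'.map_source hy.2
      have hy1 : y ∈ e.target := hy.1
      simp only [he, he', hy1, hy2, and_self, dite_true]
      obtain ⟨V, hV, hd, hi, e1⟩ := (exists_mkChart he).choose_spec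
      obtain ⟨W, hW, hd', hi', e2⟩ := (exists_mkChart he').choose_spec
      have ho : IsOpen (e.symm.trans e').source := (e.symm.trans e').open_source
      refine hl _ _ (fun z => e' (e.symm z)) y ?_ ?_ ?_ ?_
      · have : y ∈ e.target := hy.1
        rw [e1] at this
        exact hd this
      · have ht : e'.target = W := by
          conv_lhs => rw [e2]
          rfl
        exact hd' (ht ▸ hy2)
      · exact (DiffForm.contDiffOn_transition he he').contDiffAt (ho.mem_nhds hy)
      · filter_upwards [ho.mem_nhds hy] with z hz
        have h1 : e'.symm (e' (e.symm z)) = e.symm z := e'.left_inv hz.2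
        have h2 : ∀ w, e'.symm w = param (exists_mkChart he').choose w := by
          intro w; conv_lhs => rw [e2]
          rfl
        have h3 : ∀ w, e.symm w = param (exists_mkChart he).choose w := by
          intro w; conv_lhs => rw [e1]
          rfl
        rw [← h2, h1, h3]⟩

lemma loc_ofLoc {a : Option (Fin 10 × Bool) → 𝓐 k} (ha) (hl) {i} {x : Space7} (hx : x ∈ paramDom i) : loc (ofLoc a ha hl) i x = a i x := by
  obtain ⟨V, hV, hd, hi, hxV⟩ := exists_mkChart_mem hx
  rw [loc_eq _ (hV := hV) (hd := hd) (hi := hi) hxV]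
  have hm : mkChart i V hV hd hi ∈ atlas Space7 Resolution := mkChart_mem_atlas
  have h1 : (ofLoc a ha hl).1 (mkChart i V hV hd hi) x = a (exists_mkChart hm).choose x :=
    dif_pos ⟨hm, hxV⟩
  rw [h1]
  obtain ⟨W, hW, hd', hi', e1⟩ := (exists_mkChart hm).choose_spec
  have h2 : ∀ w, param i w = param (exists_mkChart hm).choose w := fun w =>
    congrArg (fun e : OpenPartialHomeomorph Resolution Space7 => e.symm w) e1
  have h3 : V = W := congrArg (fun e : OpenPartialHomeomorph Resolution Space7 => e.target) e1
  have h4 := hl (exists_mkChart hm).choose i id x (hd' (h3 ▸ hxV)) hx contDiffAt_id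
    (.of_forall h2)
  rw [h4, pb, fderiv_id]
  rfl

end JK

section ParametricIntegral

variable {E F : Type} [NormedAddCommGroup E] [NormedAddCommGroup F]

/-- The parameters for which a whole unit segment lies in a set. -/
def segDom (S : Set (E × ℝ)) : Set E := {x | ∀ φ ∈ Set.Icc (0 : ℝ) 1, (x, φ) ∈ S}

lemma isOpen_segDom {S : Set (E × ℝ)} (hS : IsOpen S) : IsOpen (segDom S) := by
  rw [isOpen_iff_mem_nhds]
  intro x hx
  exact isCompact_Icc.eventually_forall_of_forall_eventually (P := fun x φ => (x, φ) ∈ S)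
    fun φ hφ => hS.mem_nhds (hx φ hφ)

variable [NormedSpace ℝ E] [NormedSpace ℝ F]

lemma hasFDerivAt_integral_segDom {S : Set (E × ℝ)} (hS : IsOpen S) {f : E × ℝ → F} (hf : ContDiffOn ℝ 1 f S) {x : E} (hx : x ∈ segDom S) :
    HasFDerivAt (fun y => ∫ φ in (0 : ℝ)..1, f (y, φ))
      (∫ φ in (0 : ℝ)..1, fderiv ℝ f (x, φ) ∘L inl ℝ E ℝ) x := by
  set D : E → ℝ → E →L[ℝ] F := fun y φ => fderiv ℝ f (y, φ) ∘L inl ℝ E ℝ with hD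
  have hc : ∀ y ∈ segDom S, ContinuousOn (fun φ => f (y, φ)) (Set.Icc 0 1) := fun y hy =>
    hf.continuousOn.comp (by fun_prop) hy
  have hfd : ContinuousOn (fun p => fderiv ℝ f p ∘L inl ℝ E ℝ) S :=
    (hf.continuousOn_fderiv_of_isOpen hS le_rfl).clm_comp continuousOn_const
  have hdc : ∀ y ∈ segDom S, ContinuousOn (D y) (Set.Icc 0 1) := fun y hy =>
    hfd.comp (f := fun φ : ℝ => (y, φ)) (by fun_prop) hy
  have hio : Set.uIoc (0 : ℝ) 1 ⊆ Set.Icc 0 1 := by rw [Set.uIoc_of_le zero_le_one]; exact Set.Ioc_subset_Icc_self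
  obtain ⟨C, hC⟩ := isCompact_Icc.exists_bound_of_continuousOn (hdc x hx)
  have hb : ∀ᶠ y in 𝓝 x, ∀ φ ∈ Set.Icc (0 : ℝ) 1, (y, φ) ∈ S ∧ ‖D y φ‖ ≤ C + 1 := by
    refine isCompact_Icc.eventually_forall_of_forall_eventually
      (P := fun y φ => (y, φ) ∈ S ∧ ‖D y φ‖ ≤ C + 1) fun φ hφ => ?_
    have h1 := hS.mem_nhds (hx φ hφ)
    have h2 : ∀ᶠ p in 𝓝 (x, φ), ‖fderiv ℝ f p ∘L inl ℝ E ℝ‖ < C + 1 :=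
      (hfd.continuousAt h1).norm.eventually_lt continuousAt_const
        (lt_of_le_of_lt (hC φ hφ) (by linarith))
    filter_upwards [h1, h2] with p hp hp2 using ⟨hp, hp2.le⟩
  refine intervalIntegral.hasFDerivAt_integral_of_dominated_of_fderiv_le (bound := fun _ => C + 1)
    (F := fun y φ => f (y, φ)) (F' := D) hb ?_ ?_ ?_ ?_ (by simp) ?_
  · filter_upwards [hb] with y hy
    exact ((hc y fun φ hφ => (hy φ hφ).1).mono hio).aestronglyMeasurable measurableSet_uIoc
  · refine ContinuousOn.intervalIntegrable ?_
    rw [Set.uIcc_of_le zero_le_one]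
    exact hc x hx
  · exact ((hdc x hx).mono hio).aestronglyMeasurable measurableSet_uIoc
  · exact .of_forall fun φ hφ y hy => (hy φ (hio hφ)).2
  · refine .of_forall fun φ hφ y hy => ?_
    have h1 : DifferentiableAt ℝ f (y, φ) :=
      (hf.contDiffAt (hS.mem_nhds (hy φ (hio hφ)).1)).diffAt
    exact h1.hasFDerivAt.comp y (hasFDerivAt_prodMk_left y φ)

lemma contDiffOn_nat_integral_segDom {S : Set (E × ℝ)} (hS : IsOpen S) (n : ℕ) : ∀ {F : Type} [NormedAddCommGroup F] [NormedSpace ℝ F] [CompleteSpace F] {f : E × ℝ → F},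
    SmoothOn f S → ContDiffOn ℝ n (fun y => ∫ φ in (0 : ℝ)..1, f (y, φ)) (segDom S) := by
  induction n with
  | zero =>
    intro F _ _ _ f hf
    rw [Nat.cast_zero, contDiffOn_zero]
    exact fun x hx => (hasFDerivAt_integral_segDom hS (hf.of_le (by exact_mod_cast le_top))
      hx).continuousAt.continuousWithinAt
  | succ n ih =>
    intro F _ _ _ f hf
    have h1 : ∀ x ∈ segDom S, HasFDerivAt (fun y => ∫ φ in (0 : ℝ)..1, f (y, φ))
      (∫ φ in (0 : ℝ)..1, fderiv ℝ f (x, φ) ∘L inl ℝ E ℝ) x := fun x hx =>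
      hasFDerivAt_integral_segDom hS (hf.of_le (by exact_mod_cast le_top)) hx
    rw [Nat.cast_succ, contDiffOn_succ_iff_fderiv_of_isOpen (isOpen_segDom hS)]
    refine ⟨fun x hx => (h1 x hx).differentiableAt.differentiableWithinAt, by simp, ?_⟩
    refine (ih (f := fun p => fderiv ℝ f p ∘L inl ℝ E ℝ) ?_).congr
      fun x hx => (h1 x hx).fderiv
    exact (hf.fderiv_of_isOpen hS (by simp)).clm_comp contDiffOn_const

lemma contDiffOn_integral_segDom [CompleteSpace F] {S : Set (E × ℝ)} (hS : IsOpen S) {f : E × ℝ → F} (hf : SmoothOn f S) :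
    SmoothOn (fun y => ∫ φ in (0 : ℝ)..1, f (y, φ)) (segDom S) :=
  contDiffOn_infty.2 fun n => contDiffOn_nat_integral_segDom hS n hf

end ParametricIntegral

section AlternatingSmooth

variable {X E F : Type*} [NormedAddCommGroup X] [NormedSpace ℝ X] [NormedAddCommGroup E]
  [NormedSpace ℝ E] [NormedAddCommGroup F] [NormedSpace ℝ F]

lemma contDiffAt_alternating [FiniteDimensional ℝ E] {k : ℕ} {n : ℕ∞ω} {f : X → 𝓛 E k} {x : X} (h : ∀ v, ContDiffAt ℝ n (fun y => f y v) x) : ContDiffAt ℝ n f x := by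
  let b := Module.finBasis ℝ E
  let ev : (𝓛 E k) →ₗ[ℝ] ((Fin k → Fin (Module.finrank ℝ E)) → ℝ) :=
    { toFun := fun a s => a (fun i => b (s i))
      map_add' := fun _ _ => rfl
      map_smul' := fun _ _ => rfl }
  have hev : Function.Injective ev := by
    intro a a' haa
    have h1 : a.toMultilinearMap = a'.toMultilinearMap :=
      Module.Basis.ext_multilinear (fun _ => b) fun s => congrFun haa s
    exact ContinuousAlternatingMap.ext fun v => congrArg (fun u => u v) h1
  obtain ⟨L, hL⟩ := ev.exists_leftInverse_of_injective (LinearMap.ker_eq_bot.2 hev)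
  have h2 : f = fun y => LinearMap.toContinuousLinearMap L (fun s => f y (fun i => b (s i))) := by
    funext y
    exact (LinearMap.congr_fun hL (f y)).symm
  rw [h2]
  exact (ContinuousLinearMap.contDiff _).contDiffAt.comp x (contDiffAt_pi.2 fun s => h _)

lemma ContDiffAt.alternating_apply {k : ℕ} {n : ℕ∞ω} {f : X → 𝓛 E k} {x : X} (h : ContDiffAt ℝ n f x) (v : Fin k → E) : ContDiffAt ℝ n (fun y => f y v) x :=
  (ContinuousAlternatingMap.apply ℝ E ℝ v).contDiff.contDiffAt.comp x h

lemma ContDiffAt.compAlternating [FiniteDimensional ℝ F] {k : ℕ} {n : ℕ∞ω} {f : X → 𝓛 E k} {g : X → F →L[ℝ] E} {x : X} (hf : ContDiffAt ℝ n f x) (hg : ContDiffAt ℝ n g x) :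
    ContDiffAt ℝ n (fun y => (f y).compContinuousLinearMap (g y)) x := by
  refine contDiffAt_alternating fun v => ?_
  have h1 : ContDiffAt ℝ n (fun y => ContinuousMultilinearMap.compContinuousLinearMapContinuousMultilinear ℝ
      (fun _ : Fin k => F) (fun _ : Fin k => E) ℝ (fun _ => g y)) x :=
    (ContinuousMultilinearMap.contDiff _).contDiffAt.comp x (contDiffAt_pi.2 fun _ => hg)
  have h2 : ContDiffAt ℝ n (fun y => (f y).toContinuousMultilinearMap) x :=
    (ContinuousAlternatingMap.toContinuousMultilinearMapLI (𝕜 := ℝ) (E := E) (F := ℝ)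
      (ι := Fin k)).contDiff.contDiffAt.comp x hf
  exact (ContinuousMultilinearMap.apply ℝ (fun _ : Fin k => F) ℝ v).contDiff.contDiffAt.comp x
    (h1.clm_apply h2)

lemma ContDiffAt.alternating_apply_apply {k : ℕ} {n : ℕ∞ω} {f : X → 𝓛 E k} {g : Fin k → X → E} {x : X} (hf : ContDiffAt ℝ n f x) (hg : ∀ i, ContDiffAt ℝ n (g i) x) :
    ContDiffAt ℝ n (fun y => f y fun i => g i y) x := by
  have h1 : ContDiffAt ℝ n (fun y => ∑ i, (ContinuousLinearMap.proj (R := ℝ)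
      (φ := fun _ : Fin k => ℝ) i).smulRight (g i y)) x :=
    ContDiffAt.sum fun i _ => contDiffAt_const.smulRight (hg i)
  refine ((hf.compAlternating h1).alternating_apply fun i => Pi.single i (1 : ℝ)).congr_of_eventuallyEq
    (.of_forall fun y => congrArg (f y) (funext fun i => ?_))
  simp [Pi.single_apply]

lemma contDiffAt_pullback [FiniteDimensional ℝ F] {k : ℕ} {ω' : E → 𝓛 E k} {f : F → E} {x : F} (ha : SmoothAt ω' (f x)) (hf : SmoothAt f x) :
    SmoothAt (fun y => (ω' (f y)).compContinuousLinearMap (fderiv ℝ f y)) x :=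
  (ha.comp x hf).compAlternating (hf.fderiv_right (by simp))

end AlternatingSmooth

section Homotopy

variable {E : Type} [NormedAddCommGroup E] [NormedSpace ℝ E] [FiniteDimensional ℝ E]

/-- The pullback of a form by one map of a family. -/
def homPull {k : ℕ} (A : E × ℝ → E) (a : E → 𝓛 E k) (p : E × ℝ) : 𝓛 E k :=
  (a (A p)).compContinuousLinearMap (fderiv ℝ A p ∘L inl ℝ E ℝ)

/-- The contraction of the pullback of a form by a family of maps with the direction of the
parameter. -/
def homContract {k : ℕ} (A : E × ℝ → E) (a : E → 𝓛 E (k + 1)) (p : E × ℝ) : 𝓛 E k :=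
  ((a (A p)).curryLeft (fderiv ℝ A p (0, 1))).compContinuousLinearMap
    (fderiv ℝ A p ∘L inl ℝ E ℝ)

/-- The homotopy operator of a family of maps, with weight `φ ↦ m φ + n`. -/
def homOp {k : ℕ} (m n : ℝ) (A : E × ℝ → E) (a : E → 𝓛 E (k + 1)) (x : E) : 𝓛 E k :=
  ∫ φ in (0 : ℝ)..1, (m * φ + n) • homContract A a (x, φ)

variable {k : ℕ} {A : E × ℝ → E} {W : Set E} {S : Set (E × ℝ)}

lemma contDiffOn_homPull {a : E → 𝓛 E k} (hW : IsOpen W) (hS : IsOpen S) (ha : SmoothOn a W) (hA : SmoothOn A S) (hAW : Set.MapsTo A S W) :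
    SmoothOn (homPull A a) S := fun p hp => by
  have h1 := hA.contDiffAt (hS.mem_nhds hp)
  exact (((ha.contDiffAt (hW.mem_nhds (hAW hp))).comp p h1).compAlternating
    ((h1.fderiv_right (by simp)).clm_comp contDiffAt_const)).contDiffWithinAt

lemma contDiffOn_homContract {a : E → 𝓛 E (k + 1)} (hW : IsOpen W) (hS : IsOpen S) (ha : SmoothOn a W) (hA : SmoothOn A S) (hAW : Set.MapsTo A S W) :
    SmoothOn (homContract A a) S := fun p hp => by
  have h1 := hA.contDiffAt (hS.mem_nhds hp)
  have h2 := (ha.contDiffAt (hW.mem_nhds (hAW hp))).comp p h1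
  have h4 : SmoothAt (fderiv ℝ A) p := h1.fderiv_right (by simp)
  have h5 : SmoothAt (homContract A a) p := by
    refine contDiffAt_alternating fun u => ?_
    refine (h2.alternating_apply_apply (g := Matrix.vecCons (fun p => fderiv ℝ A p (0, 1))
      fun i p => fderiv ℝ A p (u i, 0)) fun i => by
        refine Fin.cases ?_ (fun i => ?_) i
        · exact h4.clm_apply contDiffAt_const
        · exact h4.clm_apply contDiffAt_const).congr_of_eventuallyEq
      (.of_forall fun p => congrArg (a (A p)) (funext fun i => ?_))
    refine Fin.cases ?_ (fun i => ?_) i <;> rfl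
  exact h5.contDiffWithinAt

lemma contDiffOn_homOp {a : E → 𝓛 E (k + 1)} (m n : ℝ) (hW : IsOpen W) (hS : IsOpen S) (ha : SmoothOn a W) (hA : SmoothOn A S) (hAW : Set.MapsTo A S W) :
    SmoothOn (homOp m n A a) (segDom S) := by
  refine contDiffOn_integral_segDom hS (f := fun p => (m * p.2 + n) • homContract A a p) ?_
  have hw : Smooth (fun p : E × ℝ => m * p.2 + n) := by fun_prop
  exact hw.contDiffOn.smul (contDiffOn_homContract hW hS ha hA hAW)

lemma fderiv_homPull {a : E → 𝓛 E (k + 1)} (hW : IsOpen W) (hS : IsOpen S) (ha : SmoothOn a W) (hA : SmoothOn A S) (hAW : Set.MapsTo A S W)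
    (hd : ∀ x ∈ W, extDeriv a x = 0) {p : E × ℝ} (hp : p ∈ S) (v : Fin (k + 1) → E) : fderiv ℝ (fun q => homPull A a q v) p (0, 1) =
      ∑ i : Fin (k + 1), (-1 : ℤ) ^ (i : ℕ) • fderiv ℝ (fun q => homContract A a q (i.removeNth v)) p (v i, 0) := by
  have h1 := hA.contDiffAt (hS.mem_nhds hp)
  have h2 := ha.contDiffAt (hW.mem_nhds (hAW hp))
  have h3 := extDeriv_pullback (h2.diffAt) h1
    (by simpa using (WithTop.coe_le_coe.2 le_top : ((2 : ℕ∞) : ℕ∞ω) ≤ ∞))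
  rw [hd _ (hAW hp)] at h3
  have h4 : DifferentiableAt ℝ (fun y => (a (A y)).compContinuousLinearMap (fderiv ℝ A y)) p :=
    (contDiffAt_pullback h2 h1).diffAt
  have h5 := congrArg (fun f => f (Fin.cons ((0, 1) : E × ℝ) fun i => ((v i, 0) : E × ℝ))) h3
  simp only [extDeriv_apply h4, Fin.sum_univ_succ (n := k + 1)] at h5
  have e1 : ∀ q, ((a (A q)).compContinuousLinearMap (fderiv ℝ A q)) (Fin.removeNth (α := fun _ => E × ℝ) 0
      (Fin.cons ((0, 1) : E × ℝ) fun i => ((v i, 0) : E × ℝ))) = homPull A a q v :=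
    fun q => by
    simp only [homPull, ContinuousAlternatingMap.compContinuousLinearMap_apply]
    congr 1
  have e2 : ∀ (i : Fin (k + 1)) q, ((a (A q)).compContinuousLinearMap (fderiv ℝ A q))
      (Fin.removeNth (α := fun _ => E × ℝ) i.succ (Fin.cons ((0, 1) : E × ℝ) fun i => ((v i, 0) : E × ℝ))) = homContract A a q (i.removeNth v) := by
    intro i q
    simp only [homContract, ContinuousAlternatingMap.compContinuousLinearMap_apply, ContinuousAlternatingMap.curryLeft_apply_apply]
    congr 1
    funext j
    refine Fin.cases ?_ (fun j => ?_) j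
    · simp [Fin.removeNth]
    · simp [Fin.removeNth]
  simp only [e1, e2] at h5
  simp only [Fin.val_zero, pow_zero, one_smul, Fin.cons_zero, Fin.val_succ, pow_succ, mul_neg, mul_one, neg_smul, Finset.sum_neg_distrib, Fin.cons_succ] at h5
  have h6 : ((0 : (E × ℝ) [⋀^Fin (k + 1 + 1)]→L[ℝ] ℝ)) (Fin.cons ((0, 1) : E × ℝ) fun i => ((v i, 0) : E × ℝ)) = 0 := rfl
  have h7 := h5.trans h6
  linarith

lemma extDeriv_homOp {a : E → 𝓛 E (k + 1)} (m n : ℝ) (hW : IsOpen W) (hS : IsOpen S) (ha : SmoothOn a W) (hA : SmoothOn A S) (hAW : Set.MapsTo A S W)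
    (hd : ∀ x ∈ W, extDeriv a x = 0) {x : E} (hx : x ∈ segDom S) (v : Fin (k + 1) → E) :
    extDeriv (homOp m n A a) x v = (m + n) * homPull A a (x, 1) v - n * homPull A a (x, 0) v - m * ∫ φ in (0 : ℝ)..1, homPull A a (x, φ) v := by
  have hK := (contDiffOn_homOp m n hW hS ha hA hAW).contDiffAt ((isOpen_segDom hS).mem_nhds hx)
  have hC := contDiffOn_homContract hW hS ha hA hAW
  have hP := contDiffOn_homPull hW hS ha hA hAW
  have hw1 : Continuous fun φ : ℝ => m * φ + n := by fun_prop
  have hcont : ∀ {y}, y ∈ segDom S → IntervalIntegrable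
      (fun φ => (m * φ + n) • homContract A a (y, φ)) volume 0 1 := by
    intro y hy
    refine ContinuousOn.intervalIntegrable ?_
    rw [Set.uIcc_of_le zero_le_one]
    exact hw1.continuousOn.smul (hC.continuousOn.comp (f := fun φ : ℝ => (y, φ)) (by fun_prop) hy)
  have hev : ∀ u : Fin k → E, (fun y => homOp m n A a y u) =ᶠ[𝓝 x]
      fun y => ∫ φ in (0 : ℝ)..1, (m * φ + n) * homContract A a (y, φ) u := by
    intro u
    filter_upwards [(isOpen_segDom hS).mem_nhds hx] with y hy
    exact ((ContinuousAlternatingMap.apply ℝ E ℝ u).intervalIntegral_comp_comm (hcont hy)).symm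
  have hsm : ∀ u : Fin k → E, SmoothOn (fun p : E × ℝ => homContract A a p u) S := fun u p hp =>
    (hC.contDiffAt (hS.mem_nhds hp)).alternating_apply u |>.contDiffWithinAt
  have hw : Smooth (fun p : E × ℝ => m * p.2 + n) := by fun_prop
  have hfd : ∀ (u : Fin k → E) (w : E), fderiv ℝ (fun y => homOp m n A a y u) x w =
      ∫ φ in (0 : ℝ)..1, (m * φ + n) * fderiv ℝ (fun q => homContract A a q u) (x, φ) (w, 0) := by
    intro u w
    have hf : SmoothOn (fun p : E × ℝ => (m * p.2 + n) * homContract A a p u) S :=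
      hw.contDiffOn.mul (hsm u)
    rw [(hev u).fderiv_eq, (hasFDerivAt_integral_segDom hS (hf.of_le (by exact_mod_cast le_top)) hx).fderiv]
    have hi : IntervalIntegrable (fun φ => fderiv ℝ (fun p : E × ℝ => (m * p.2 + n) * homContract A a p u) (x, φ) ∘L inl ℝ E ℝ) volume 0 1 := by
      refine ContinuousOn.intervalIntegrable ?_
      rw [Set.uIcc_of_le zero_le_one]
      exact ((hf.continuousOn_fderiv_of_isOpen hS (by simp)).comp (by fun_prop) hx).clm_comp
        continuousOn_const
    rw [ContinuousLinearMap.intervalIntegral_apply hi]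
    refine intervalIntegral.integral_congr fun φ hφ => ?_
    rw [Set.uIcc_of_le zero_le_one] at hφ
    have h1 : DifferentiableAt ℝ (fun q => homContract A a q u) (x, φ) :=
      ((hsm u).contDiffAt (hS.mem_nhds (hx φ hφ))).diffAt
    have h2 : HasFDerivAt (fun p : E × ℝ => m * p.2 + n) (m • snd ℝ E ℝ) (x, φ) :=
      ((snd ℝ E ℝ).hasFDerivAt.const_smul m).add_const n
    have h3 := h2.mul h1.hasFDerivAt
    refine (congrArg (fun L => L (w, (0 : ℝ))) h3.fderiv).trans ?_
    simp
  rw [extDeriv_apply (hK.diffAt)]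
  simp only [hfd]
  have hci : ∀ (u : Fin k → E) (w : E), IntervalIntegrable (fun φ => (m * φ + n) * fderiv ℝ (fun q => homContract A a q u) (x, φ) (w, 0)) volume 0 1 := by
    intro u w
    refine ContinuousOn.intervalIntegrable ?_
    rw [Set.uIcc_of_le zero_le_one]
    refine hw1.continuousOn.mul (ContinuousOn.clm_apply ?_ continuousOn_const)
    exact ((hsm u).continuousOn_fderiv_of_isOpen hS (by simp)).comp (by fun_prop) hx
  have hsum : ∑ i : Fin (k + 1), (-1 : ℤ) ^ (i : ℕ) • ∫ φ in (0 : ℝ)..1, (m * φ + n) * fderiv ℝ (fun q => homContract A a q (i.removeNth v)) (x, φ) (v i, 0) =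
      ∫ φ in (0 : ℝ)..1, (m * φ + n) * fderiv ℝ (fun q => homPull A a q v) (x, φ) (0, 1) := by
    simp only [zsmul_eq_mul, ← intervalIntegral.integral_const_mul]
    rw [← intervalIntegral.integral_finsetSum fun i _ => (hci _ _).const_mul _]
    refine intervalIntegral.integral_congr fun φ hφ => ?_
    rw [Set.uIcc_of_le zero_le_one] at hφ
    simp only [fderiv_homPull hW hS ha hA hAW hd (hx φ hφ), Finset.mul_sum, zsmul_eq_mul]
    exact Finset.sum_congr rfl fun i _ => by ring
  refine hsum.trans ?_
  have hPs : SmoothOn (fun p : E × ℝ => homPull A a p v) S := fun p hp =>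
    (hP.contDiffAt (hS.mem_nhds hp)).alternating_apply v |>.contDiffWithinAt
  have hder : ∀ φ ∈ Set.uIcc (0 : ℝ) 1, HasDerivAt (fun φ => homPull A a (x, φ) v)
      (fderiv ℝ (fun q => homPull A a q v) (x, φ) (0, 1)) φ := by
    intro φ hφ
    rw [Set.uIcc_of_le zero_le_one] at hφ
    have h1 : DifferentiableAt ℝ (fun q => homPull A a q v) (x, φ) :=
      (hPs.contDiffAt (hS.mem_nhds (hx φ hφ))).diffAt
    exact h1.hasFDerivAt.comp_hasDerivAt φ ((hasDerivAt_const φ x).prodMk (hasDerivAt_id φ))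
  have hu : ∀ φ ∈ Set.uIcc (0 : ℝ) 1, HasDerivAt (fun φ => m * φ + n) m φ := by
    intro φ _
    simpa using ((hasDerivAt_id φ).const_mul m).add_const n
  have hi : IntervalIntegrable (fun φ => fderiv ℝ (fun q => homPull A a q v) (x, φ) (0, 1))
      volume 0 1 := by
    refine ContinuousOn.intervalIntegrable ?_
    rw [Set.uIcc_of_le zero_le_one]
    exact ((hPs.continuousOn_fderiv_of_isOpen hS (by simp)).comp (by fun_prop) hx).clm_apply
      continuousOn_const
  rw [intervalIntegral.integral_mul_deriv_eq_deriv_mul hu hder (by simp) hi, intervalIntegral.integral_const_mul]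
  ring

end Homotopy

namespace JK
open Complex

/-- The squared distance to the core, in the coordinates of a tube. -/
def radSq (p : Space7) : ℝ := ‖p.2.2.1‖ ^ 2 + ‖p.2.2.2‖ ^ 2

lemma radSq_nonneg (p) : 0 ≤ radSq p := by unfold radSq; positivity

lemma radSq_eq (p : Space7) : radSq p = p.2.2.1.re ^ 2 + p.2.2.1.im ^ 2 + (p.2.2.2.re ^ 2 + p.2.2.2.im ^ 2) := by
  rw [radSq, ← Complex.normSq_eq_norm_sq, ← Complex.normSq_eq_norm_sq, Complex.normSq_apply, Complex.normSq_apply]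
  ring

lemma contDiff_radSq : Smooth radSq := by
  have h : radSq = fun p : Space7 => p.2.2.1.re ^ 2 + p.2.2.1.im ^ 2 + (p.2.2.2.re ^ 2 + p.2.2.2.im ^ 2) :=
    funext radSq_eq
  rw [h]
  have h1 : Smooth fun p : Space7 => p.2.2.1 := by fun_prop
  have h2 : Smooth fun p : Space7 => p.2.2.2 := by fun_prop
  exact (((contDiff_re.comp h1).pow 2).add ((contDiff_im.comp h1).pow 2)).add
    (((contDiff_re.comp h2).pow 2).add ((contDiff_im.comp h2).pow 2))

lemma coord_lt_of_radSq {p : Space7} (h : radSq p < sqRadius) :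
    |p.2.2.1.re| < 1 / 16 ∧ |p.2.2.1.im| < 1 / 16 ∧ |p.2.2.2.re| < 1 / 16 ∧ |p.2.2.2.im| < 1 / 16 := by
  rw [radSq_eq, sqRadius] at h
  refine ⟨?_, ?_, ?_, ?_⟩ <;> refine abs_lt_of_sq_lt_sq ?_ (by norm_num) <;> nlinarith [sq_nonneg p.2.2.1.re, sq_nonneg p.2.2.1.im, sq_nonneg p.2.2.2.re, sq_nonneg p.2.2.2.im]

lemma int_eq_of_close {n m : ℤ} {x : ℝ} (h : (n : ℝ) + x = m) (hx : |x| < 1) : n = m ∧ x = 0 := by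
  have h1 : ((m - n : ℤ) : ℝ) = x := by push_cast; linarith
  have h2 : |((m - n : ℤ) : ℝ)| < 1 := by rw [h1]; exact hx
  have h3 : |m - n| < 1 := by exact_mod_cast h2
  have h4 : m - n = 0 := Int.abs_lt_one_iff.1 h3
  refine ⟨by omega, ?_⟩
  rw [← h1, h4]; simp

lemma sign_mul_abs {e y : ℝ} (he : e = 1 ∨ e = -1) : |e * y| = |y| := by rcases he with rfl | rfl <;> simp

lemma sgn_cases (j) : sgn j = 1 ∨ sgn j = -1 := by fin_cases j <;> simp [sgn]

lemma NF_core {g : Perm7} (hg : NF g) {j j' : Fin 10} {p p' : Space7} (hp : radSq p < sqRadius) (hp' : radSq p' < sqRadius) (h : g (tubeMap j p) = tubeMap j' p') :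
    g (tubeMap j (p.1, p.2.1, 0, 0)) = tubeMap j' (p'.1, p'.2.1, 0, 0) := by
  obtain ⟨s, c, w, z⟩ := p
  obtain ⟨s', c', w', z'⟩ := p'
  obtain ⟨hw1, hw2, hz1, hz2⟩ := coord_lt_of_radSq hp
  obtain ⟨hw1', hw2', hz1', hz2'⟩ := coord_lt_of_radSq hp'
  clear hp hp'
  obtain ⟨k, m, n, a, b, hg⟩ := hg
  obtain ⟨e, he, hee⟩ := sign_real (m + n)
  rw [hg] at h ⊢
  simp only [tubeMap, Prod.mk.injEq] at h hw1 hw2 hz1 hz2 hw1' hw2' hz1' hz2' ⊢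
  obtain ⟨h1, h2, h3, h4⟩ := h
  simp only [level_eq] at h1 ⊢
  obtain ⟨hT, hwre⟩ := int_eq_of_close (n := iT j + 2 * k) (m := iT j') (x := 2 * (w.re - w'.re))
    (by push_cast; linarith) (by rw [abs_lt] at *; constructor <;> linarith [hw1.1, hw1.2, hw1'.1, hw1'.2])
  have hTe : iT j = iT j' := par_eq (iT_cases j) (iT_cases j') hT
  have hk : k = 0 := by omega
  subst hk
  have hB3 : iB₃ j = iB₃ j' ∧ w.im = w'.im := by
    rw [base₃_eq, base₃_eq, theta_eq, theta_eq, ← hTe] at h4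
    rcases iT_cases j with hj | hj
    · simp only [hj, if_true] at h4
      have := congrArg Complex.re h4
      simp at this
      obtain ⟨h5, h6⟩ := int_eq_of_close (n := iB₃ j + 2 * (-m)) (m := iB₃ j') (x := 4 * (w'.im - w.im))
        (by push_cast; linarith) (by rw [abs_lt] at *; constructor <;> linarith [hw2.1, hw2.2, hw2'.1, hw2'.2])
      exact ⟨par_eq (iB₃_cases j) (iB₃_cases j') h5, by linarith⟩
    · simp only [hj] at h4
      have := congrArg Complex.im h4
      simp at this
      obtain ⟨h5, h6⟩ := int_eq_of_close (n := iB₃ j + 2 * (-n)) (m := iB₃ j') (x := 4 * (w.im - w'.im))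
        (by push_cast; linarith) (by rw [abs_lt] at *; constructor <;> linarith [hw2.1, hw2.2, hw2'.1, hw2'.2])
      exact ⟨par_eq (iB₃_cases j) (iB₃_cases j') h5, by linarith⟩
  obtain ⟨hB₃, hwim⟩ := hB3
  have heta : eta j = eta j' := by rw [eta_eq, eta_eq, hTe, hB₃]
  have htheta : theta j = theta j' := by rw [theta_eq, theta_eq, hTe]
  have aux : ∀ (B B' : ℤ) (x y x' y' : ℝ) (a : ℤ × ℤ), |y| < 1 / 16 → |y'| < 1 / 16 →
      (iT j = 0 → B = 0 ∧ B' = 0) → e * (eta j * (((1 - 2 * iB₃ j) * B / 2 : ℝ) * I) + eta j * (x + y * I)) + gauss a =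
        eta j * (((1 - 2 * iB₃ j) * B' / 2 : ℝ) * I) + eta j * (x' + y' * I) → y' = e * y := by
    intro B B' x y x' y' a hy hy' hB h
    rw [← sign_mul_abs he] at hy
    obtain ⟨σ, hσ, hσe⟩ : ∃ σ : ℤ, (σ = 1 ∨ σ = -1) ∧ e = σ := by
      rcases he with rfl | rfl
      exacts [⟨1, by simp⟩, ⟨-1, by simp⟩]
    rw [eta_eq] at h
    have hre := congrArg Complex.re h
    have him := congrArg Complex.im h
    have fin : ∀ N M : ℤ, (N : ℝ) + 2 * (y' - e * y) = M → y' = e * y := by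
      intro N M hNM
      have := (int_eq_of_close hNM (by rw [abs_lt] at *; constructor <;> linarith [hy.1, hy.2, hy'.1, hy'.2])).2
      linarith
    rcases iT_cases j with hj | hj
    · rw [hj, (hB hj).1, (hB hj).2] at hre him
      rcases iB₃_cases j with hb | hb
      · simp [hb, gauss] at hre him
        exact fin 0 (a.1 + a.2) (by push_cast; linarith)
      · simp [hb, gauss] at hre him
        exact fin 0 (a.2 - a.1) (by push_cast; linarith)
    · rw [hj] at hre him
      rcases iB₃_cases j with hb | hb
      · simp [hb, gauss] at him
        exact fin B' (σ * B + 2 * a.2) (by push_cast; rw [← hσe]; linarith)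
      · simp [hb, gauss] at hre
        exact fin (-B') (-σ * B - 2 * a.1) (by push_cast; rw [← hσe]; linarith)
  have hy1 : z'.re = e * z.re := by
    have h2' := h2
    rw [base₁_eq, base₁_eq, ← heta, ← hB₃, zpow_zero, one_mul, hee] at h2'
    exact aux _ _ _ _ _ _ a hz1 hz1' (fun hj => ⟨(iB_zero j hj).1, (iB_zero j' (hTe ▸ hj)).1⟩) h2'
  have hy2 : sgn j' * z'.im = e * (sgn j * z.im) := by
    have h2' := h3
    rw [base₂_eq, base₂_eq, ← heta, ← hB₃, zpow_zero, one_mul, hee] at h2'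
    refine aux _ _ c.im _ c'.im _ b ?_ ?_ (fun hj => ⟨(iB_zero j hj).2, (iB_zero j' (hTe ▸ hj)).2⟩) ?_
    · rwa [sign_mul_abs (sgn_cases j)]
    · rwa [sign_mul_abs (sgn_cases j')]
    · simpa only [ofReal_mul] using h2'
  simp only [zpow_zero, one_mul, hee, ← heta, ← htheta] at h2 h3 h4 ⊢
  have hy1' : (z'.re : ℂ) = e * z.re := by exact_mod_cast hy1
  have hy2' : (sgn j' : ℂ) * z'.im = e * (sgn j * z.im) := by exact_mod_cast hy2
  rw [hy1'] at h2
  rw [hy2'] at h3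
  rw [← hwim] at h4
  refine ⟨?_, ?_, ?_, ?_⟩
  · simp; linarith
  · simp; linear_combination h2
  · simp; linear_combination h3
  · simp; linear_combination h4

lemma Gam_core {g : Perm7} (hg : g ∈ Gam) {j j' : Fin 10} {p p' : Space7} (hp : radSq p < sqRadius) (hp' : radSq p' < sqRadius) (h : g (tubeMap j p) = tubeMap j' p') :
    g (tubeMap j (p.1, p.2.1, 0, 0)) = tubeMap j' (p'.1, p'.2.1, 0, 0) := by
  rcases NF_or hg with h1 | h1
  · exact NF_core h1 hp hp' h
  · have h2 : NF (reflJ j * kappa) := (NF_or (mem_reflJ j)).resolve_left (reflJ_not_NF j)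
    have h3 : NF (g * reflJ j) := by
      have := h1.mul h2.conj
      rwa [show g * kappa * (kappa * (reflJ j * kappa) * kappa) = g * (kappa * kappa) * reflJ j * (kappa * kappa) by group, kappa_kappa, mul_one, mul_one]
        at this
    have h4 := NF_core h3 (p := (p.1, p.2.1, -p.2.2.1, -p.2.2.2)) (by simpa [radSq] using hp) hp' (j := j) (by
      rw [Equiv.Perm.mul_apply, reflJ_apply, neg_neg, neg_neg, ← h])
    rwa [Equiv.Perm.mul_apply, reflJ_apply, neg_zero] at h4

lemma Gam_match {g : Perm7} (hg : g ∈ Gam) {j j' : Fin 10} {p p' : Space7} (hp : radSq p < sqRadius) (hp' : radSq p' < sqRadius) (h : g (tubeMap j p) = tubeMap j' p') :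
    j = j' ∧ ∃ (i e : ℝ) (σ : ℝ) (α : ℂ), (i = 1 ∨ i = -1) ∧ (e = 1 ∨ e = -1) ∧ ∀ s c w z, g (tubeMap j (s, c, w, z)) = tubeMap j (s + σ, e * c + α, i * w, i * (e * z)) := by
  obtain ⟨rfl, g', hg', h1, e, he, h2⟩ := Gam_tube hg (Gam_core hg hp hp' h)
  refine ⟨rfl, ?_⟩
  rcases h1 with rfl | rfl
  · exact ⟨1, e, p'.1 - p.1, p'.2.1 - e * p.2.1, Or.inl rfl, he, fun s c w z => by rw [h2]; simp⟩
  · refine ⟨-1, e, p'.1 - p.1, p'.2.1 - e * p.2.1, Or.inr rfl, he, fun s c w z => ?_⟩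
    have := h2 s c (-w) (-z)
    rw [Equiv.Perm.mul_apply, reflJ_apply, neg_neg, neg_neg] at this
    rw [this]
    simp

lemma tubeMap_regular {j : Fin 10} {p : Space7} (hp : radSq p < sqRadius) (h0 : radSq p ≠ 0) : tubeMap j p ∈ regular := by
  intro g hg h
  have h1 := Gam_core hg hp hp h
  rcases stab_cases hg h1 with rfl | rfl
  · rfl
  · exfalso
    apply h0
    obtain ⟨s, c, w, z⟩ := p
    rw [reflJ_apply] at h
    have h2 := tubeMap_injective j h
    simp only [Prod.mk.injEq, neg_eq_self, true_and] at h2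
    simp [radSq, h2.1, h2.2]

/-- The linear part of `tubeInv`. -/
def tubeLin (j : Fin 10) : Space7 →ₗ[ℝ] Space7 where
  toFun x := ((x.2.2.2 / theta j).re, ((x.2.1 / eta j).re : ℂ) + ((x.2.2.1 / eta j).re : ℂ) * I, (x.1 : ℂ) - ((x.2.2.2 / theta j).im : ℂ) * I,
   ((x.2.1 / eta j).im : ℂ) + sgn j * ((x.2.2.1 / eta j).im : ℂ) * I)
  map_add' x y := by
    simp only [Prod.fst_add, Prod.snd_add, add_div, add_re, add_im, ofReal_add, Prod.mk_add_mk]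
    refine prod_ext₄ rfl ?_ ?_ ?_ <;> simp only <;> ring
  map_smul' m x := by
    simp only [Prod.smul_fst, Prod.smul_snd, real_smul, mul_div_assoc, re_ofReal_mul, im_ofReal_mul, ofReal_mul, RingHom.id_apply, Prod.smul_mk, smul_eq_mul]
    refine prod_ext₄ rfl ?_ ?_ ?_ <;> simp only <;> ring

lemma tubeInv_sub (j : Fin 10) (x y : Space7) : tubeInv j x - tubeInv j y = tubeLin j (x - y) := by
  simp only [tubeInv, tubeLin, LinearMap.coe_mk, AddHom.coe_mk, Prod.fst_sub, Prod.snd_sub, sub_div, sub_re, sub_im, ofReal_sub, Prod.mk_sub_mk]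
  refine Prod.ext (by simp only; ring) (Prod.ext ?_ (Prod.ext ?_ ?_)) <;> simp only <;> ring


lemma exists_lipschitz_tubeInv (j : Fin 10) : ∃ C, 0 < C ∧ ∀ x y, dist (tubeInv j x) (tubeInv j y) ≤ C * dist x y := by
  refine ⟨‖LinearMap.toContinuousLinearMap (tubeLin j)‖ + 1, by positivity, fun x y => ?_⟩
  rw [dist_eq_norm, dist_eq_norm, tubeInv_sub]
  refine ((LinearMap.toContinuousLinearMap (tubeLin j)).le_opNorm _).trans ?_
  gcongr
  linarith

lemma exists_radSq_lt {r₁ r₂ : ℝ} (h : r₁ < r₂) : ∃ δ > 0, ∀ p p' : Space7, radSq p < r₁ → dist p p' < δ → radSq p' < r₂ := by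
  by_cases hr : r₁ ≤ 0
  · exact ⟨1, one_pos, fun p p' hp => absurd (hp.trans_le hr) (radSq_nonneg p).not_gt⟩
  push Not at hr
  refine ⟨min 1 ((r₂ - r₁) / (4 * r₁ + 7)), lt_min one_pos (by apply div_pos <;> linarith), fun p p' hp hd => ?_⟩
  obtain ⟨h1, h2⟩ := lt_min_iff.1 hd
  rw [lt_div_iff₀ (by linarith)] at h2
  have hw : ‖p'.2.2.1‖ ≤ ‖p.2.2.1‖ + dist p p' := by
    have : dist p.2.2.1 p'.2.2.1 ≤ dist p p' :=
      (le_max_left _ _).trans ((le_max_right _ _).trans (le_max_right _ _))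
    rw [dist_eq_norm, norm_sub_rev] at this
    linarith [norm_sub_norm_le p'.2.2.1 p.2.2.1]
  have hz : ‖p'.2.2.2‖ ≤ ‖p.2.2.2‖ + dist p p' := by
    have : dist p.2.2.2 p'.2.2.2 ≤ dist p p' :=
      (le_max_right _ _).trans ((le_max_right _ _).trans (le_max_right _ _))
    rw [dist_eq_norm, norm_sub_rev] at this
    linarith [norm_sub_norm_le p'.2.2.2 p.2.2.2]
  have h0 := dist_nonneg (x := p) (y := p')
  simp only [radSq] at hp ⊢
  set δ := dist p p'
  have hw1 : ‖p.2.2.1‖ ≤ r₁ + 1 := by nlinarith [norm_nonneg p.2.2.1, norm_nonneg p.2.2.2, sq_nonneg (‖p.2.2.1‖ - 1), sq_nonneg ‖p.2.2.2‖]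
  have hz1 : ‖p.2.2.2‖ ≤ r₁ + 1 := by nlinarith [norm_nonneg p.2.2.1, norm_nonneg p.2.2.2, sq_nonneg (‖p.2.2.2‖ - 1), sq_nonneg ‖p.2.2.1‖]
  have hw2 : ‖p'.2.2.1‖ ^ 2 ≤ (‖p.2.2.1‖ + δ) ^ 2 := pow_le_pow_left₀ (norm_nonneg _) hw 2
  have hz2 : ‖p'.2.2.2‖ ^ 2 ≤ (‖p.2.2.2‖ + δ) ^ 2 := pow_le_pow_left₀ (norm_nonneg _) hz 2
  have e1 : δ * ‖p.2.2.1‖ ≤ δ * (r₁ + 1) := mul_le_mul_of_nonneg_left hw1 h0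
  have e2 : δ * ‖p.2.2.2‖ ≤ δ * (r₁ + 1) := mul_le_mul_of_nonneg_left hz1 h0
  have e3 : δ * δ ≤ δ * 1 := mul_le_mul_of_nonneg_left h1.le h0
  nlinarith

/-- The `Γ`-translates of a tube. -/
def orbTube (j : Fin 10) (r : ℝ) : Set Space7 :=
  {x | ∃ g ∈ Gam, ∃ p, radSq p < r ∧ g (tubeMap j p) = x}

lemma mem_orbTube {j r g p} (hg : g ∈ Gam) (hp : radSq p < r) : g (tubeMap j p) ∈ orbTube j r :=
  ⟨g, hg, p, hp, rfl⟩

lemma orbTube_mono {j r r'} (h : r ≤ r') : orbTube j r ⊆ orbTube j r' :=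
  fun _ ⟨g, hg, p, hp, e⟩ => ⟨g, hg, p, hp.trans_le h, e⟩

lemma smul_mem_orbTube {j r g x} (hg : g ∈ Gam) : g x ∈ orbTube j r ↔ x ∈ orbTube j r := by
  constructor
  · rintro ⟨h, hh, p, hp, e⟩
    exact ⟨g⁻¹ * h, mul_mem (inv_mem hg) hh, p, hp, by rw [Equiv.Perm.mul_apply, e]; simp⟩
  · rintro ⟨h, hh, p, hp, rfl⟩
    exact ⟨g * h, mul_mem hg hh, p, hp, rfl⟩

/-- The coordinates of a translated tube. -/
def tubeCo (j : Fin 10) (g : Perm7) (x : Space7) : Space7 := tubeInv j (g⁻¹ x)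

lemma tubeCo_apply (j) (g : Perm7) (p) : tubeCo j g (g (tubeMap j p)) = p := by simp [tubeCo, tubeInv_tubeMap]

lemma apply_tubeCo (j) (g : Perm7) (x) : g (tubeMap j (tubeCo j g x)) = x := by simp [tubeCo, tubeMap_tubeInv]

lemma contDiff_tubeCo {j g} (hg : g ∈ Gam) : Smooth (tubeCo j g) :=
  (contDiff_tubeInv j).comp (Gam_smooth (inv_mem hg)).1

lemma contDiff_smul_tubeMap {j g} (hg : g ∈ Gam) : Smooth fun p => g (tubeMap j p) :=
  (Gam_smooth hg).1.comp (contDiff_tubeMap j)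

lemma isOpen_orbTube (j r) : IsOpen (orbTube j r) := by
  rw [isOpen_iff_mem_nhds]
  rintro _ ⟨g, hg, p, hp, rfl⟩
  have h : ∀ᶠ x in 𝓝 (g (tubeMap j p)), radSq (tubeCo j g x) < r :=
    (contDiff_radSq.continuous.comp (contDiff_tubeCo hg).continuous).continuousAt.eventually_lt_const
      (by simpa [tubeCo_apply] using hp)
  filter_upwards [h] with x hx
  exact ⟨g, hg, _, hx, apply_tubeCo _ _ _⟩

lemma eventually_notMem_orbTube {j r₁ r₂ x} (h : r₁ < r₂) (hx : x ∉ orbTube j r₂) : ∀ᶠ y in 𝓝 x, y ∉ orbTube j r₁ := by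
  obtain ⟨δ, hδ, h1⟩ := exists_radSq_lt h
  obtain ⟨C, hC, h2⟩ := exists_lipschitz_tubeInv j
  filter_upwards [Metric.ball_mem_nhds x (div_pos hδ hC)] with y hy hy'
  obtain ⟨g, hg, p, hp, rfl⟩ := hy'
  refine hx ⟨g, hg, tubeCo j g x, h1 p _ hp ?_, apply_tubeCo _ _ _⟩
  have h3 := h2 (tubeMap j p) (g⁻¹ x)
  rw [tubeInv_tubeMap] at h3
  refine h3.trans_lt ?_
  have h4 : dist (tubeMap j p) (g⁻¹ x) = dist (g (tubeMap j p)) x := by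
    have := (Gam_smooth (inv_mem hg)).2.dist_eq (g (tubeMap j p)) x
    simpa using this
  rw [h4, mul_comm]
  exact (lt_div_iff₀ hC).1 hy

lemma orbTube_disjoint {j j' x} (h : x ∈ orbTube j sqRadius) (h' : x ∈ orbTube j' sqRadius) : j = j' := by
  obtain ⟨g, hg, p, hp, rfl⟩ := h
  obtain ⟨g', hg', p', hp', e⟩ := h'
  refine (Gam_match (mul_mem (inv_mem hg') hg) hp hp' ?_).1
  rw [Equiv.Perm.mul_apply, ← e]
  simp

/-! ### Pullbacks -/

variable {k l : ℕ} {g : Perm7} {a : 𝓐 k}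

lemma pb_comp {f g : Space7 → Space7} {x} (hf : DifferentiableAt ℝ f (g x)) (hg : DifferentiableAt ℝ g x) : pb (fun y => f (g y)) a x = pb g (pb f a) x := by
  unfold pb
  have : fderiv ℝ (fun y => f (g y)) x = fderiv ℝ f (g x) ∘L fderiv ℝ g x := fderiv_comp x hf hg
  rw [this]
  rfl

lemma pb_congr {f f' : Space7 → Space7} {x} (h : f =ᶠ[𝓝 x] f') : pb f a x = pb f' a x := by
  unfold pb
  rw [h.fderiv_eq, h.eq_of_nhds]

lemma pb_congr_form {f : Space7 → Space7} {a a' : 𝓐 k} {x} (h : a (f x) = a' (f x)) : pb f a x = pb f a' x := by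
  unfold pb
  rw [h]

lemma pb_of_eventuallyEq_id {f : Space7 → Space7} {x} (h : f =ᶠ[𝓝 x] id) : pb f a x = a x := by
  rw [pb_congr h]
  unfold pb
  rw [fderiv_id]
  exact ContinuousAlternatingMap.ext fun v => rfl

lemma pb_wedge {f : Space7 → Space7} {b : 𝓐 l} {x} : pb f (fun y => wedgeCLM Space7 k l (a y) (b y)) x = wedgeCLM Space7 k l (pb f a x) (pb f b x) := by
  rw [pb, wedgeCLM_apply, wedgeCLM_apply]
  exact (wedgeAlt_comp (a (f x)) (b (f x)) (fderiv ℝ f x)).symm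

lemma extDeriv_pb {f : Space7 → Space7} {x} (ha : DifferentiableAt ℝ a (f x)) (hf : SmoothAt f x) : extDeriv (pb f a) x = pb f (extDeriv a) x :=
  extDeriv_pullback ha hf (by simpa using (WithTop.coe_le_coe.2 le_top : ((2 : ℕ∞) : ℕ∞ω) ≤ ∞))

lemma contDiffAt_pb {f : Space7 → Space7} {x} (ha : SmoothAt a (f x)) (hf : SmoothAt f x) : SmoothAt (pb f a) x := contDiffAt_pullback ha hf

/-! ### Forms on the tubes -/

/-- The transformation of the coordinates of a tube by an element of `Γ`. -/
def tubeAct (j : Fin 10) (g : Perm7) (p : Space7) : Space7 := tubeInv j (g (tubeMap j p))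

lemma contDiff_tubeAct {j g} (hg : g ∈ Gam) : Smooth (tubeAct j g) :=
  (contDiff_tubeInv j).comp (contDiff_smul_tubeMap hg)

open Classical in
/-- The extension of forms, which are given in the coordinates of the tubes, to their `Γ`-translates. -/
def glue (a : Fin 10 → 𝓐 k) (x : Space7) : Alt7 k :=
  if h : ∃ (j : Fin 10) (g : Perm7), g ∈ Gam ∧ radSq (tubeCo j g x) < sqRadius then
    pb (tubeCo h.choose h.choose_spec.choose) (a h.choose) x
  else 0

/-- The forms on the tubes which are compatible with `Γ`. -/
def TubeInvariant (a : Fin 10 → 𝓐 k) : Prop :=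
  ∀ j, ∀ g ∈ Gam, ∀ p, radSq p < sqRadius → radSq (tubeAct j g p) < sqRadius → a j p = pb (tubeAct j g) (a j) p

lemma glue_eq {a : Fin 10 → 𝓐 k} (ha : TubeInvariant a) {j g x} (hg : g ∈ Gam) (hx : radSq (tubeCo j g x) < sqRadius) : glue a x = pb (tubeCo j g) (a j) x := by
  have h : ∃ (j : Fin 10) (g : Perm7), g ∈ Gam ∧ radSq (tubeCo j g x) < sqRadius := ⟨j, g, hg, hx⟩
  rw [glue, dif_pos h]
  obtain ⟨hg', hx'⟩ := h.choose_spec.choose_spec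
  set j' := h.choose
  set g' := h.choose_spec.choose
  obtain rfl : j' = j := orbTube_disjoint (x := x) ⟨g', hg', _, hx', apply_tubeCo _ _ _⟩
    ⟨g, hg, _, hx, apply_tubeCo _ _ _⟩
  have hm : g⁻¹ * g' ∈ Gam := mul_mem (inv_mem hg) hg'
  have e : ∀ y, tubeCo j' g y = tubeAct j' (g⁻¹ * g') (tubeCo j' g' y) := by
    intro y
    rw [tubeAct, Equiv.Perm.mul_apply, apply_tubeCo, tubeCo]
  have h1 := ha j' _ hm (tubeCo j' g' x) hx' (by rwa [← e])
  rw [show tubeCo j' g = fun y => tubeAct j' (g⁻¹ * g') (tubeCo j' g' y) from funext e, pb_comp ((contDiff_tubeAct hm).diff _) ((contDiff_tubeCo hg').diff _)]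
  exact pb_congr_form h1

lemma glue_eq_zero {a : Fin 10 → 𝓐 k} {x} (hx : ∀ j, x ∉ orbTube j sqRadius) : glue a x = 0 := by
  rw [glue, dif_neg]
  rintro ⟨j, g, hg, h⟩
  exact hx j ⟨g, hg, _, h, apply_tubeCo _ _ _⟩

lemma glue_invariant {a : Fin 10 → 𝓐 k} (ha : TubeInvariant a) {h} (hh : h ∈ Gam) (x) : glue a x = pb h (glue a) x := by
  by_cases hx : ∃ j, x ∈ orbTube j sqRadius
  · obtain ⟨j, g, hg, p, hp, rfl⟩ := hx
    have h1 : radSq (tubeCo j (h * g) (h (g (tubeMap j p)))) < sqRadius := by rwa [← Equiv.Perm.mul_apply, tubeCo_apply]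
    have e : pb h (glue a) (g (tubeMap j p)) = pb h (pb (tubeCo j (h * g)) (a j)) (g (tubeMap j p)) :=
      pb_congr_form (glue_eq ha (mul_mem hh hg) h1)
    rw [glue_eq ha hg (by rwa [tubeCo_apply]), e, ← pb_comp
      ((contDiff_tubeCo (mul_mem hh hg)).diff _) ((Gam_smooth hh).1.diff _)]
    congr 1
    funext y
    simp [tubeCo]
  · push Not at hx
    rw [glue_eq_zero hx, pb, glue_eq_zero fun j => by rw [smul_mem_orbTube hh]; exact hx j]
    rfl

lemma glue_eventuallyEq {a : Fin 10 → 𝓐 k} (ha : TubeInvariant a) {j g x} (hg : g ∈ Gam) (hx : radSq (tubeCo j g x) < sqRadius) : glue a =ᶠ[𝓝 x] pb (tubeCo j g) (a j) := by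
  have h : ∀ᶠ y in 𝓝 x, radSq (tubeCo j g y) < sqRadius :=
    (contDiff_radSq.continuous.comp (contDiff_tubeCo hg).continuous).continuousAt.eventually_lt_const hx
  filter_upwards [h] with y hy using glue_eq ha hg hy

lemma glue_eventually_zero {a : Fin 10 → 𝓐 k} (ha : TubeInvariant a) {r : ℝ} (hr : r < sqRadius)
    (h0 : ∀ j p, r ≤ radSq p → a j p = 0) {x} (hx : ∀ j, x ∉ orbTube j sqRadius) : ∀ᶠ y in 𝓝 x, glue a y = 0 := by
  filter_upwards [Filter.eventually_all.2 fun j => eventually_notMem_orbTube hr (hx j)] with y hy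
  by_cases h : ∃ j, y ∈ orbTube j sqRadius
  · obtain ⟨j, g, hg, p, hp, rfl⟩ := h
    rw [glue_eq ha hg (by rwa [tubeCo_apply]), pb, tubeCo_apply, h0]
    · rfl
    · by_contra h
      push Not at h
      exact hy j (mem_orbTube hg h)
  · push Not at h
    exact glue_eq_zero h

lemma contDiffAt_glue {a : Fin 10 → 𝓐 k} (ha : TubeInvariant a) {r : ℝ} (hr : r < sqRadius) (h0 : ∀ j p, r ≤ radSq p → a j p = 0) {x}
    (h : ∀ j, ∀ g ∈ Gam, radSq (tubeCo j g x) < sqRadius → SmoothAt (a j) (tubeCo j g x)) : SmoothAt (glue a) x := by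
  by_cases hx : ∃ j, x ∈ orbTube j sqRadius
  · obtain ⟨j, g, hg, p, hp, rfl⟩ := hx
    have hp' : radSq (tubeCo j g (g (tubeMap j p))) < sqRadius := by rwa [tubeCo_apply]
    exact (contDiffAt_pb (h j g hg hp') (contDiff_tubeCo hg).contDiffAt).congr_of_eventuallyEq
      (glue_eventuallyEq ha hg hp')
  · push Not at hx
    exact contDiffAt_const.congr_of_eventuallyEq (glue_eventually_zero ha hr h0 hx)

lemma pb_glue {a : Fin 10 → 𝓐 k} (ha : TubeInvariant a) {j g p} (hg : g ∈ Gam) (hp : radSq p < sqRadius) : pb (fun q => g (tubeMap j q)) (glue a) p = a j p := by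
  have e : pb (fun q => g (tubeMap j q)) (glue a) p = pb (fun q => g (tubeMap j q)) (pb (tubeCo j g) (a j)) p :=
    pb_congr_form (glue_eq ha hg (by rwa [tubeCo_apply]))
  rw [e, ← pb_comp ((contDiff_tubeCo hg).diff _)
    ((contDiff_smul_tubeMap hg).diff _)]
  exact pb_of_eventuallyEq_id (.of_forall fun q => tubeCo_apply _ _ _)

end JK

namespace JK
open Complex

variable {k l : ℕ} {x : Space7} {p : Space7}

lemma exists_eventually_smul {f g : Space7 → Space7} (hf : ContinuousAt f x) (hg : ContinuousAt g x) (hx : f x ∈ regular) (h : ∀ᶠ z in 𝓝 x, ptQ (f z) = ptQ (g z)) :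
    ∃ γ ∈ Gam, g =ᶠ[𝓝 x] fun z => γ (f z) := by
  obtain ⟨γ, hγ, e⟩ := ptQ_eq.1 h.self_of_nhds
  refine ⟨γ, hγ, ?_⟩
  obtain ⟨V, hV, hxV, -, hi⟩ := inj_ptQ (regular_smul hγ hx)
  have h1 : ∀ᶠ z in 𝓝 x, γ (f z) ∈ V :=
    (((Gam_smooth hγ).1.continuous.continuousAt).comp hf).eventually_mem (hV.mem_nhds hxV)
  have h2 : ∀ᶠ z in 𝓝 x, g z ∈ V := hg.eventually_mem (hV.mem_nhds (by rwa [← e]))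
  filter_upwards [h, h1, h2] with z hz hz1 hz2
  exact hi hz2 hz1 (hz.symm.trans (ptQ_eq.2 ⟨γ, hγ, rfl⟩))

/-- A `Γ`-invariant smooth form on the free part of `ℝ⁷` which extends to the resolution. -/
structure IsGForm (a : 𝓐 k) : Prop where
  inv : ∀ g ∈ Gam, ∀ x ∈ regular, a x = pb g a x
  smooth : ∀ x ∈ regular, SmoothAt a x
  ext : ∀ (j : Fin 10) (b : Bool) (s : ℝ) (c v : ℂ), ∃ a' : 𝓐 k, SmoothAt a' (s, c, 0, v) ∧
    ∀ᶠ p in 𝓝 ((s, c, 0, v) : Space7), p.2.2.1 ≠ 0 → ∀ r, r ^ 2 = p.2.2.1 → a' p = pb (up j b r) a p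

lemma pb_eq_of_ptQ {a : 𝓐 k} (ha : ∀ g ∈ Gam, ∀ x ∈ regular, a x = pb g a x) {f g : Space7 → Space7} (hf : DifferentiableAt ℝ f x)
    (hg : ContinuousAt g x) (hx : f x ∈ regular) (h : ∀ᶠ z in 𝓝 x, ptQ (f z) = ptQ (g z)) : pb g a x = pb f a x := by
  obtain ⟨γ, hγ, e⟩ := exists_eventually_smul hf.continuousAt hg hx h
  rw [pb_congr e, pb_comp ((Gam_smooth hγ).1.diff _) hf]
  exact pb_congr_form (ha γ hγ _ hx).symm

instance neBot_nhdsWithin_ne (q : Space7) : (𝓝[{p : Space7 | p.2.2.1 ≠ q.2.2.1}] q).NeBot := by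
  obtain ⟨s, c, u, v⟩ := q
  have h : Filter.Tendsto (fun t : ℂ => ((s, c, u + t, v) : Space7)) (𝓝[≠] 0)
      (𝓝[{p : Space7 | p.2.2.1 ≠ u}] (s, c, u, v)) := by
    refine tendsto_nhdsWithin_iff.2 ⟨?_, ?_⟩
    · have : Continuous fun t : ℂ => ((s, c, u + t, v) : Space7) := by fun_prop
      simpa using (this.tendsto 0).mono_left (nhdsWithin_le_nhds (s := {0}ᶜ))
    · filter_upwards [self_mem_nhdsWithin] with t ht
      simpa using ht
  exact h.neBot

lemma eq_of_eventually_eq_ne {F : Type*} [TopologicalSpace F] [T2Space F] {f g : Space7 → F} {q : Space7} (hf : ContinuousAt f q) (hg : ContinuousAt g q) (hq : q.2.2.1 = 0)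
    (h : ∀ᶠ p in 𝓝 q, p.2.2.1 ≠ 0 → f p = g p) : f q = g q := by
  have h1 : f =ᶠ[𝓝[{p : Space7 | p.2.2.1 ≠ q.2.2.1}] q] g := by
    rw [hq]
    exact eventually_nhdsWithin_iff.2 h
  exact tendsto_nhds_unique (hf.mono_left nhdsWithin_le_nhds)
    ((hg.mono_left nhdsWithin_le_nhds).congr' h1.symm)

lemma eventually_continuousAt {a : 𝓐 k} {x} (h : SmoothAt a x) : ∀ᶠ y in 𝓝 x, ContinuousAt a y :=
  ((h.of_le (by exact_mod_cast le_top) : ContDiffAt ℝ 1 a x).eventually (by simp)).mono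
    fun y hy => hy.continuousAt

lemma eventually_differentiableAt {F : Type*} [NormedAddCommGroup F] [NormedSpace ℝ F] {a : Space7 → F} {x} (h : SmoothAt a x) : ∀ᶠ y in 𝓝 x, DifferentiableAt ℝ a y :=
  ((h.of_le (by exact_mod_cast le_top) : ContDiffAt ℝ 1 a x).eventually (by simp)).mono
    fun y hy => hy.diffAt

lemma eventually_ne_zero (h : p.2.2.1 ≠ 0) : ∀ᶠ q : Space7 in 𝓝 p, q.2.2.1 ≠ 0 :=
  (by fun_prop : Continuous fun q : Space7 => q.2.2.1).continuousAt.eventually_ne h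

lemma contDiffAt_up' {r : ℂ} (hp : p.2.2.1 ≠ 0) (h : r ^ 2 = p.2.2.1) (j b) : SmoothAt (up j b r) p := by
  obtain ⟨s, c, u, v⟩ := p
  obtain rfl : r ^ 2 = u := h
  exact contDiffAt_up (fun h => hp (by simp [h])) j b s c v

namespace IsGForm

variable {a : 𝓐 k} (h : IsGForm a)

open Classical in
/-- The local representatives of an invariant form near the exceptional divisors. -/
def extA (h : IsGForm a) (j : Fin 10) (b : Bool) (p : Space7) : Alt7 k :=
  if p.2.2.1 = 0 then (h.ext j b p.1 p.2.1 p.2.2.2).choose p else pb (up j b (csqrt p.2.2.1)) a p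

lemma extA_eq {j b} {r : ℂ} (hp : p.2.2.1 ≠ 0) (hd : p ∈ domJ j b) (hr : r ≠ 0) (hu : DifferentiableAt ℝ (up j b r) p) : h.extA j b p = pb (up j b r) a p := by
  rw [extA, if_neg hp]
  refine pb_eq_of_ptQ h.inv hu (contDiffAt_up' hp (csqrt_sq _) j b).continuousAt ((domJ_up hr j b hp).1 hd) ?_
  filter_upwards [eventually_ne_zero hp] with q hq
  rw [← psiQ_up hr j b hq, psiQ_up (csqrt_ne hp) j b hq]

lemma extA_eventuallyEq (j b s c v) : h.extA j b =ᶠ[𝓝 (s, c, 0, v)] (h.ext j b s c v).choose := by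
  obtain ⟨h1, h2⟩ := (h.ext j b s c v).choose_spec
  filter_upwards [h2.eventually_nhds, eventually_continuousAt h1] with q hq hc
  by_cases hq0 : q.2.2.1 = 0
  · rw [extA, if_pos hq0]
    obtain ⟨s', c', u', v'⟩ := q
    obtain rfl : u' = 0 := hq0
    obtain ⟨h3, h4⟩ := (h.ext j b s' c' v').choose_spec
    refine eq_of_eventually_eq_ne h3.continuousAt hc rfl ?_
    filter_upwards [hq, h4] with p hp hp' hp0
    rw [hp' hp0 _ (csqrt_sq _), hp hp0 _ (csqrt_sq _)]
  · rw [extA, if_neg hq0, hq.self_of_nhds hq0 _ (csqrt_sq _)]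

lemma contDiffAt_extA {j b} (hd : p ∈ domJ j b) : SmoothAt (h.extA j b) p := by
  by_cases hp : p.2.2.1 = 0
  · obtain ⟨s, c, u, v⟩ := p
    obtain rfl : u = 0 := hp
    exact (h.ext j b s c v).choose_spec.1.congr_of_eventuallyEq (h.extA_eventuallyEq j b s c v)
  · have hu := contDiffAt_up' hp (csqrt_sq _) j b
    have hr := csqrt_ne hp
    have hs : SmoothAt (pb (up j b (csqrt p.2.2.1)) a) p :=
      contDiffAt_pb (h.smooth _ ((domJ_up hr j b hp).1 hd)) hu
    refine hs.congr_of_eventuallyEq ?_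
    filter_upwards [eventually_ne_zero hp, (isOpen_domJ j b).mem_nhds hd, eventually_differentiableAt hu]
      with q hq hqd hqu
    exact h.extA_eq hq hqd hr hqu

/-- The local representatives of an invariant form. -/
def locA (h : IsGForm a) : Option (Fin 10 × Bool) → 𝓐 k
  | none => a
  | some (j, b) => h.extA j b

lemma contDiffAt_locA {i x} (hx : x ∈ paramDom i) : SmoothAt (h.locA i) x := by
  rcases i with _ | ⟨j, b⟩
  · exact h.smooth x hx
  · exact h.contDiffAt_extA hx

lemma exists_lift_regular {i x} (hx : x ∈ paramDom i) (hi : i = none ∨ x.2.2.1 ≠ 0) :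
    ∃ f : Space7 → Space7, SmoothAt f x ∧ f x ∈ regular ∧ (∀ᶠ z in 𝓝 x, ptQ (f z) = paramQ i z) ∧ h.locA i x = pb f a x := by
  rcases i with _ | ⟨j, b⟩
  · exact ⟨id, contDiffAt_id, hx, .of_forall fun z => rfl, (pb_of_eventuallyEq_id (Filter.EventuallyEq.refl _ _)).symm⟩
  · have hp : x.2.2.1 ≠ 0 := by simpa using hi
    have hu := contDiffAt_up' hp (csqrt_sq _) j b
    have hr := csqrt_ne hp
    refine ⟨_, hu, (domJ_up hr j b hp).1 hx, ?_, h.extA_eq hp hx hr (hu.diffAt)⟩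
    filter_upwards [eventually_ne_zero hp] with q hq
    exact (psiQ_up hr j b hq).symm

lemma locA_compat_regular {i j} {g : Space7 → Space7} (hx : x ∈ paramDom i) (hy : g x ∈ paramDom j)
    (hg : DifferentiableAt ℝ g x) (hl : ∀ᶠ z in 𝓝 x, paramQ j (g z) = paramQ i z) (hi : i = none ∨ x.2.2.1 ≠ 0) : h.locA i x = pb g (h.locA j) x := by
  obtain ⟨f, hf, hfx, hfl, e⟩ := h.exists_lift_regular hx hi
  have hj : j = none ∨ (g x).2.2.1 ≠ 0 := by
    rcases j with _ | ⟨j, b⟩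
    · exact Or.inl rfl
    · right
      intro h0
      have h1 := hfl.self_of_nhds.trans hl.self_of_nhds.symm
      have h2 : paramQ (some (j, b)) (g x) = lnQ j (g x).1 (g x).2.1 (dir b (g x).2.2.2) := by
        show psiQ j b (g x) = _
        rw [psiQ, if_pos h0]
      rw [h2] at h1
      exact ptQ_ne_lnQ _ _ _ _ _ _ h1
  obtain ⟨f', hf', hfx', hfl', e'⟩ := h.exists_lift_regular hy hj
  have hd := hf'.diffAt
  rw [e, pb_congr_form e', ← pb_comp hd hg]
  refine pb_eq_of_ptQ h.inv (hd.comp x hg) hf.continuousAt hfx' ?_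
  filter_upwards [hg.continuousAt.eventually hfl', hl, hfl] with z h1 h2 h3
  rw [h3, ← h2, h1]

lemma locA_compat {i j} {g : Space7 → Space7} (hx : x ∈ paramDom i) (hy : g x ∈ paramDom j) (hg : SmoothAt g x) (hl : ∀ᶠ z in 𝓝 x, param j (g z) = param i z) :
    h.locA i x = pb g (h.locA j) x := by
  have hyd : ∀ᶠ z in 𝓝 x, g z ∈ paramDom j := hg.continuousAt.eventually_mem ((isOpen_paramDom j).mem_nhds hy)
  have hxd : ∀ᶠ z in 𝓝 x, z ∈ paramDom i := (isOpen_paramDom i).mem_nhds hx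
  have hq : ∀ᶠ z in 𝓝 x, paramQ j (g z) = paramQ i z := by
    filter_upwards [hl, hyd, hxd] with z h1 h2 h3
    have h4 := congrArg Subtype.val h1
    rwa [param, param, show resolutionAtlas.param j (g z) = toResolution (paramQ j (g z)) from rfl, show resolutionAtlas.param i z = toResolution (paramQ i z) from rfl,
      toResolution_val (isResolutionPoint_paramQ h2), toResolution_val (isResolutionPoint_paramQ h3)] at h4
  by_cases hi : i = none ∨ x.2.2.1 ≠ 0
  · exact h.locA_compat_regular hx hy (hg.diffAt) hq hi
  · push Not at hi
    refine eq_of_eventually_eq_ne (h.contDiffAt_locA hx).continuousAt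
      (contDiffAt_pb (h.contDiffAt_locA hy) hg).continuousAt hi.2 ?_
    filter_upwards [hyd, hxd, hq.eventually_nhds, eventually_differentiableAt hg] with z h1 h2 h3 h4 hz
    exact h.locA_compat_regular h2 h1 h4 h3 (Or.inr hz)

/-- The form on the resolution given by an invariant form. -/
def toForm (h : IsGForm a) : 𝓓 k :=
  ofLoc h.locA (fun _ _ hx => h.contDiffAt_locA hx) fun _ _ _ _ hx hy hg hl => h.locA_compat hx hy hg hl

lemma loc_toForm {x} (hx : x ∈ regular) : loc h.toForm none x = a x :=
  loc_ofLoc (i := none) _ _ hx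

lemma loc_toForm_some {j b p} (hp : p ∈ domJ j b) : loc h.toForm (some (j, b)) p = h.extA j b p :=
  loc_ofLoc (i := some (j, b)) _ _ hp

end IsGForm

lemma param_up {j b r} (hr : r ≠ 0) (hp : p.2.2.1 ≠ 0) : param none (up j b r p) = param (some (j, b)) p :=
  congrArg toResolution (psiQ_up hr j b hp).symm

lemma loc_up (η : 𝓓 k) {j b r} (hp : p.2.2.1 ≠ 0) (hd : p ∈ domJ j b)
    (hr : r ≠ 0) (hu : ContinuousAt (up j b r) p) : loc η (some (j, b)) p = pb (up j b r) (loc η none) p := by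
  refine loc_lift η (i := some (j, b)) (j := none) hd hu ((domJ_up hr j b hp).1 hd) ?_
  filter_upwards [eventually_ne_zero hp] with q hq
  exact param_up hr hq

lemma loc_smul_Gam (η : 𝓓 k) {g} (hg : g ∈ Gam) {x} (hx : x ∈ regular) : loc η none x = pb g (loc η none) x := by
  refine loc_lift η (i := none) (j := none) hx (Gam_smooth hg).1.continuous.continuousAt (regular_smul hg hx) ?_
  refine .of_forall fun z => congrArg toResolution ?_
  exact (ptQ_eq.2 ⟨g, hg, rfl⟩).symm


lemma ext_regular {η η' : 𝓓 k} (h : ∀ x ∈ regular, loc η none x = loc η' none x) : η = η' := by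
  refine ext_loc fun i x hx => ?_
  rcases i with _ | ⟨j, b⟩
  · exact h x hx
  · have key : ∀ p ∈ domJ j b, p.2.2.1 ≠ 0 → loc η (some (j, b)) p = loc η' (some (j, b)) p := by
      intro p hp hp0
      have hu := (contDiffAt_up' hp0 (csqrt_sq _) j b).continuousAt
      rw [loc_up η hp0 hp (csqrt_ne hp0) hu, loc_up η' hp0 hp (csqrt_ne hp0) hu]
      exact pb_congr_form (h _ ((domJ_up (csqrt_ne hp0) j b hp0).1 hp))
    by_cases hx0 : x.2.2.1 = 0
    · refine eq_of_eventually_eq_ne (contDiffAt_loc η hx).continuousAt (contDiffAt_loc η' hx).continuousAt hx0 ?_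
      filter_upwards [(isOpen_domJ j b).mem_nhds hx] with p hp hp0 using key p hp hp0
    · exact key x hx hx0

end JK

namespace JK
open Complex

variable {k l : ℕ} {p : Space7} {h : ℝ} {q : Space7}

/-! ### Gluing forms on the tubes to forms on the resolution -/

/-- The transformations of the coordinates of a tube which come from `Γ`. -/
def signMap (i e σ : ℝ) (α : ℂ) (p : Space7) : Space7 := (p.1 + σ, e * p.2.1 + α, i * p.2.2.1, i * (e * p.2.2.2))

/-- The linear part of `signMap`. -/
def signLin (i e : ℝ) : Space7 →L[ℝ] Space7 :=
  LinearMap.toContinuousLinearMap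
    { toFun := fun a => (a.1, e * a.2.1, i * a.2.2.1, i * (e * a.2.2.2))
      map_add' := fun x y => by refine prod_ext₄ rfl ?_ ?_ ?_ <;> simp <;> ring
      map_smul' := fun m x => by refine prod_ext₄ rfl ?_ ?_ ?_ <;> simp <;> ring }

lemma signLin_apply (i e : ℝ) (a : Space7) : signLin i e a = (a.1, e * a.2.1, i * a.2.2.1, i * (e * a.2.2.2)) := rfl

lemma hasFDerivAt_signMap (i e σ α x) : HasFDerivAt (signMap i e σ α) (signLin i e) x := by
  have h : signMap i e σ α = fun p => signLin i e p + (σ, α, 0, 0) := by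
    funext p
    refine prod_ext₄ rfl rfl ?_ ?_ <;> simp [signMap, signLin_apply]
  rw [h]
  exact (ContinuousLinearMap.hasFDerivAt _).add_const _

lemma radSq_signMap {i e : ℝ} (hi : i = 1 ∨ i = -1) (he : e = 1 ∨ e = -1) (σ α p) : radSq (signMap i e σ α p) = radSq p := by
  rcases hi with rfl | rfl <;> rcases he with rfl | rfl <;> simp [radSq, signMap]

lemma exists_tubeAct_eq {j : Fin 10} {g} (hg : g ∈ Gam) {p} (hp : radSq p < sqRadius)
    (hp' : radSq (tubeAct j g p) < sqRadius) : ∃ (i e σ : ℝ) (α : ℂ), (i = 1 ∨ i = -1) ∧ (e = 1 ∨ e = -1) ∧ tubeAct j g = signMap i e σ α := by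
  obtain ⟨-, i, e, σ, α, hi, he, h⟩ := Gam_match hg hp hp' (j := j) (j' := j) (by rw [tubeAct, tubeMap_tubeInv])
  refine ⟨i, e, σ, α, hi, he, funext fun q => ?_⟩
  rw [tubeAct, show q = (q.1, q.2.1, q.2.2.1, q.2.2.2) from rfl, h, tubeInv_tubeMap]
  rfl

lemma tubeInvariant_of_signMap {a : Fin 10 → 𝓐 k} (h : ∀ (j : Fin 10) (i e σ : ℝ) (α : ℂ), (i = 1 ∨ i = -1) → (e = 1 ∨ e = -1) → ∀ p, a j p = pb (signMap i e σ α) (a j) p) :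
    TubeInvariant a := by
  intro j g hg p hp hp'
  obtain ⟨i, e, σ, α, hi, he, h1⟩ := exists_tubeAct_eq hg hp hp'
  rw [h1]
  exact h j i e σ α hi he p

lemma radSq_ne_of_regular {j : Fin 10} {g} {x} (hx : x ∈ regular) (hg : g ∈ Gam) : radSq (tubeCo j g x) ≠ 0 := by
  intro h
  have h1 : tubeMap j (tubeCo j g x) ∈ regular := by
    rw [tubeCo, tubeMap_tubeInv]
    exact regular_smul (inv_mem hg) hx
  generalize tubeCo j g x = y at h h1
  obtain ⟨s, c, w, z⟩ := y
  simp only [radSq] at h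
  have hw : w = 0 := by
    have : ‖w‖ ^ 2 = 0 := by nlinarith [sq_nonneg ‖w‖, sq_nonneg ‖z‖]
    simpa using this
  have hz : z = 0 := by
    have : ‖z‖ ^ 2 = 0 := by nlinarith [sq_nonneg ‖w‖, sq_nonneg ‖z‖]
    simpa using this
  subst hw hz
  have h2 := h1 _ (mem_reflJ j) (by rw [reflJ_apply, neg_zero])
  apply reflJ_not_NF j
  rw [h2]
  exact NF.one

/-- The coordinates in a tube of a point near the exceptional divisor. -/
def bl (b : Bool) (r : ℂ) (q : Space7) : Space7 := blow b (branchMap r q)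

lemma radSq_blow (b s c r v) : radSq (blow b (s, c, r, v)) = ‖r‖ ^ 2 * (1 + ‖v‖ ^ 2) := by cases b <;> simp [radSq, blow, dir] <;> ring

/-- The squared distance to the core in the coordinates near the exceptional divisor. -/
def hUV (q : Space7) : ℝ := ‖q.2.2.1‖ * (1 + ‖q.2.2.2‖ ^ 2)

lemma radSq_bl {b r q} (hr : r ≠ 0) : radSq (bl b r q) = hUV q := by rw [bl, branchMap, radSq_blow, hUV, ← norm_pow, branch_sq hr]

lemma contDiffAt_bl {r : ℂ} (hp : p.2.2.1 ≠ 0) (h : r ^ 2 = p.2.2.1) (b) : SmoothAt (bl b r) p := by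
  obtain ⟨s, c, u, v⟩ := p
  obtain rfl : r ^ 2 = u := h
  exact (contDiff_blow b).contDiffAt.comp _ (contDiffAt_branchMap (fun h => hp (by simp [h])) s c v)

lemma continuous_hUV : Continuous hUV := by unfold hUV; fun_prop

lemma pb_up_glue {a : Fin 10 → 𝓐 k} (ha : TubeInvariant a) {j b r q} (hq : q.2.2.1 ≠ 0)
    (hr : r ^ 2 = q.2.2.1) (hh : hUV q < sqRadius) : pb (up j b r) (glue a) q = pb (bl b r) (a j) q := by
  have hr0 : r ≠ 0 := fun h => hq (by rw [← hr, h]; simp)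
  have h2 := pb_glue ha (j := j) (g := 1) (p := bl b r q) (one_mem Gam) (by rwa [radSq_bl hr0])
  simp only [Equiv.Perm.one_apply] at h2
  exact (pb_comp (f := tubeMap j) (g := bl b r) ((contDiff_tubeMap j).diff _)
    ((contDiffAt_bl hq hr b).diffAt)).trans (pb_congr_form h2)

lemma isGForm_glue {a : Fin 10 → 𝓐 k} (ha : TubeInvariant a) {ε : ℝ} (hr : ε < sqRadius) (h0 : ∀ j p, ε ≤ radSq p → a j p = 0) (hs : ∀ j p, radSq p ≠ 0 → SmoothAt (a j) p)
    (he : ∀ (j : Fin 10) (b : Bool) (s : ℝ) (c v : ℂ), ∃ a' : 𝓐 k, SmoothAt a' (s, c, 0, v) ∧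
      ∀ᶠ p in 𝓝 ((s, c, 0, v) : Space7), p.2.2.1 ≠ 0 → ∀ r, r ^ 2 = p.2.2.1 → a' p = pb (bl b r) (a j) p) : IsGForm (glue a) where
  inv g hg x _ := glue_invariant ha hg x
  smooth x hx := contDiffAt_glue ha hr h0 fun j g hg _ => hs j _ (radSq_ne_of_regular hx hg)
  ext j b s c v := by
    obtain ⟨a', h1, h2⟩ := he j b s c v
    refine ⟨a', h1, ?_⟩
    have h3 : ∀ᶠ q in 𝓝 ((s, c, 0, v) : Space7), hUV q < sqRadius :=
      continuous_hUV.continuousAt.eventually_lt_const (by simp [hUV, sqRadius])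
    filter_upwards [h2, h3] with q hq hq3 hq0 r hr
    rw [hq hq0 r hr, pb_up_glue ha hq0 hr hq3]

/-! ### One-forms -/

/-- A linear functional as an alternating form. -/
def oneForm (L : Space7 →L[ℝ] ℝ) : Alt7 1 := ContinuousAlternatingMap.ofSubsingleton ℝ Space7 ℝ 0 L

lemma oneForm_apply (L : Space7 →L[ℝ] ℝ) (v) : oneForm L v = L (v 0) := rfl

lemma contDiffAt_oneForm {L : Space7 → Space7 →L[ℝ] ℝ} {x} (hL : SmoothAt L x) : SmoothAt (fun y => oneForm (L y)) x :=
  contDiffAt_alternating fun v => hL.clm_apply (contDiffAt_const (c := v 0))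

lemma extDeriv_oneForm {L : Space7 → Space7 →L[ℝ] ℝ} {x} (hL : SmoothAt L x) (v : Fin 2 → Space7) : extDeriv (fun y => oneForm (L y)) x v =
      fderiv ℝ (fun y => L y (v 1)) x (v 0) - fderiv ℝ (fun y => L y (v 0)) x (v 1) := by
  rw [extDeriv_apply ((contDiffAt_oneForm hL).diffAt), Fin.sum_univ_two]
  simp only [oneForm_apply]
  simp [Fin.removeNth, sub_eq_add_neg]

/-! ### The Thom form in a tube -/

/-- A cutoff function. -/
def bump (h : ℝ) : ℝ := Real.smoothTransition (2 - 1024 * h)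

lemma bump_one (hh : h ≤ 1 / 1024) : bump h = 1 := Real.smoothTransition.one_of_one_le (by linarith)
lemma bump_zero (hh : 1 / 512 ≤ h) : bump h = 0 := Real.smoothTransition.zero_of_nonpos (by linarith)
lemma contDiff_bump : Smooth bump := Real.smoothTransition.contDiff.comp (by fun_prop)
lemma bump_nonneg (h : ℝ) : 0 ≤ bump h := Real.smoothTransition.nonneg _

/-- The radial factor of the primitive of the Thom form. -/
def gFun (h : ℝ) : ℝ := -(bump h / Real.pi) / h

lemma contDiffAt_gFun (hh : h ≠ 0) : SmoothAt gFun h :=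
  ((contDiff_bump.div_const _).neg.contDiffAt).div contDiffAt_id hh

/-- The third and fourth coordinates. -/
def projW : Space7 →L[ℝ] ℂ := fst ℝ ℂ ℂ ∘L snd ℝ ℂ (ℂ × ℂ) ∘L snd ℝ ℝ (ℂ × ℂ × ℂ)
/-- The fourth coordinate. -/
def projZ : Space7 →L[ℝ] ℂ := snd ℝ ℂ ℂ ∘L snd ℝ ℂ (ℂ × ℂ) ∘L snd ℝ ℝ (ℂ × ℂ × ℂ)

@[simp] theorem projW_apply (a : Space7) : projW a = a.2.2.1 := rfl
@[simp] theorem projZ_apply (a : Space7) : projZ a = a.2.2.2 := rfl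

lemma contDiff_projW_re : Smooth fun p : Space7 => p.2.2.1.re := contDiff_re.comp projW.contDiff
lemma contDiff_projW_im : Smooth fun p : Space7 => p.2.2.1.im := contDiff_im.comp projW.contDiff
lemma contDiff_projZ_re : Smooth fun p : Space7 => p.2.2.2.re := contDiff_re.comp projZ.contDiff
lemma contDiff_projZ_im : Smooth fun p : Space7 => p.2.2.2.im := contDiff_im.comp projZ.contDiff

/-- The functional `a ↦ Im (w̄ a)` on the normal spaces. -/
def imForm (p : Space7) : Space7 →L[ℝ] ℝ :=
  (p.2.2.1.re • (imCLM ∘L projW) - p.2.2.1.im • (reCLM ∘L projW)) + (p.2.2.2.re • (imCLM ∘L projZ) - p.2.2.2.im • (reCLM ∘L projZ))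

lemma imForm_apply (p a : Space7) : imForm p a = (p.2.2.1.re * a.2.2.1.im - p.2.2.1.im * a.2.2.1.re) + (p.2.2.2.re * a.2.2.2.im - p.2.2.2.im * a.2.2.2.re) := by simp [imForm]

lemma imForm_eq (p a : Space7) : imForm p a = (conj p.2.2.1 * a.2.2.1 + conj p.2.2.2 * a.2.2.2).im := by rw [imForm_apply]; simp; ring

lemma contDiff_imForm : Smooth imForm :=
  ((contDiff_projW_re.smul contDiff_const).sub (contDiff_projW_im.smul contDiff_const)).add
    ((contDiff_projZ_re.smul contDiff_const).sub (contDiff_projZ_im.smul contDiff_const))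

/-- A primitive of the Thom form away from the exceptional divisor. -/
def kapForm (p : Space7) : Alt7 1 := oneForm (gFun (radSq p) • imForm p)

lemma kapForm_apply (p v) : kapForm p v = gFun (radSq p) * imForm p (v 0) := rfl

lemma contDiffAt_gFun_radSq (hp : radSq p ≠ 0) : SmoothAt (fun p => gFun (radSq p)) p :=
  (contDiffAt_gFun hp).comp p contDiff_radSq.contDiffAt

lemma contDiffAt_kapForm (hp : radSq p ≠ 0) : SmoothAt kapForm p :=
  contDiffAt_oneForm ((contDiffAt_gFun_radSq hp).smul contDiff_imForm.contDiffAt)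

open Classical in
/-- The Thom form in the coordinates of a tube. -/
def tauForm (p : Space7) : Alt7 2 := if radSq p = 0 then 0 else extDeriv kapForm p

lemma contDiffAt_extDeriv {a : 𝓐 k} {p} (h : SmoothAt a p) : SmoothAt (extDeriv a) p :=
  (ContinuousAlternatingMap.alternatizeUncurryFinCLM ℝ Space7 ℝ).contDiff.contDiffAt.comp p (h.fderiv_right (by simp))

lemma eventually_radSq_ne (hp : radSq p ≠ 0) : ∀ᶠ q in 𝓝 p, radSq q ≠ 0 :=
  contDiff_radSq.continuous.continuousAt.eventually_ne hp

lemma tauForm_eventuallyEq (hp : radSq p ≠ 0) : tauForm =ᶠ[𝓝 p] extDeriv kapForm := by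
  filter_upwards [eventually_radSq_ne hp] with q hq
  rw [tauForm, if_neg hq]

lemma contDiffAt_tauForm (hp : radSq p ≠ 0) : SmoothAt tauForm p :=
  (contDiffAt_extDeriv (contDiffAt_kapForm hp)).congr_of_eventuallyEq (tauForm_eventuallyEq hp)

lemma pb_signMap_kapForm {i e : ℝ} (hi : i = 1 ∨ i = -1) (he : e = 1 ∨ e = -1) (σ α) : pb (signMap i e σ α) kapForm = kapForm := by
  funext p
  rw [pb, (hasFDerivAt_signMap i e σ α p).fderiv]
  ext v
  rw [ContinuousAlternatingMap.compContinuousLinearMap_apply, kapForm_apply, kapForm_apply, radSq_signMap hi he]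
  congr 1
  rw [imForm_apply, imForm_apply]
  rcases hi with rfl | rfl <;> rcases he with rfl | rfl <;> simp [signMap, signLin_apply]

lemma pb_signMap_tauForm {i e : ℝ} (hi : i = 1 ∨ i = -1) (he : e = 1 ∨ e = -1) (σ α p) : tauForm p = pb (signMap i e σ α) tauForm p := by
  by_cases hp : radSq p = 0
  · rw [pb, tauForm, if_pos hp, tauForm, if_pos (by rwa [radSq_signMap hi he])]
    rfl
  · have hp' : radSq (signMap i e σ α p) ≠ 0 := by rwa [radSq_signMap hi he]
    have h1 : pb (signMap i e σ α) tauForm p = pb (signMap i e σ α) (extDeriv kapForm) p :=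
      pb_congr_form (tauForm_eventuallyEq hp').self_of_nhds
    have hc : Smooth (signMap i e σ α) := by
      have h : signMap i e σ α = fun p => signLin i e p + signMap i e σ α 0 := by
        funext p
        refine prod_ext₄ ?_ ?_ ?_ ?_ <;> simp [signMap, signLin_apply]
      rw [h]
      fun_prop
    rw [h1, ← extDeriv_pb ((contDiffAt_kapForm hp').diffAt) hc.contDiffAt, pb_signMap_kapForm hi he, tauForm, if_neg hp]

lemma extDeriv_zero_form (p : Space7) : extDeriv (fun _ : Space7 => (0 : Alt7 k)) p = 0 := by
  simp only [extDeriv, fderiv_fun_const, Pi.zero_apply]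
  exact map_zero (ContinuousAlternatingMap.alternatizeUncurryFinCLM ℝ Space7 ℝ)

lemma tauForm_zero (hp : 1 / 512 < radSq p) : tauForm p = 0 := by
  have h0 : radSq p ≠ 0 := by linarith
  have h1 : kapForm =ᶠ[𝓝 p] fun _ => 0 := by
    filter_upwards [contDiff_radSq.continuous.continuousAt.eventually_const_lt hp] with q hq
    ext v
    rw [kapForm_apply, gFun, bump_zero hq.le]
    simp
  rw [tauForm, if_neg h0, h1.extDeriv_eq, extDeriv_zero_form]

/-- The data of a form on one of the tubes. -/
def single (j₀ : Fin 10) (t : 𝓐 k) (j : Fin 10) : 𝓐 k := if j = j₀ then t else 0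

lemma single_self (j₀ : Fin 10) (t : 𝓐 k) : single j₀ t j₀ = t := if_pos rfl

lemma single_ne {j₀ j : Fin 10} (h : j ≠ j₀) (t : 𝓐 k) : single j₀ t j = 0 := if_neg h

/-! ### The Thom form near the exceptional divisor -/

/-- The functional `a ↦ Im (a_v v̄) / (1 + |v|²)`. -/
def nuForm (q : Space7) : Space7 →L[ℝ] ℝ :=
  (1 + (q.2.2.2.re ^ 2 + q.2.2.2.im ^ 2))⁻¹ • (q.2.2.2.re • (imCLM ∘L projZ) - q.2.2.2.im • (reCLM ∘L projZ))

lemma contDiff_nuForm : Smooth nuForm := by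
  have h : Smooth fun q : Space7 => q.2.2.2.re • (imCLM ∘L projZ) - q.2.2.2.im • (reCLM ∘L projZ) :=
    (contDiff_projZ_re.smul contDiff_const).sub (contDiff_projZ_im.smul contDiff_const)
  have h1 : Smooth fun q : Space7 => (1 + (q.2.2.2.re ^ 2 + q.2.2.2.im ^ 2))⁻¹ :=
    ((contDiff_const (c := (1 : ℝ))).add ((contDiff_projZ_re.pow 2).add (contDiff_projZ_im.pow 2))).inv
      fun x => by positivity
  exact h1.smul h

lemma nuForm_apply (q a : Space7) : nuForm q a = (conj q.2.2.2 * a.2.2.2).im / (1 + ‖q.2.2.2‖ ^ 2) := by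
  rw [← Complex.normSq_eq_norm_sq, Complex.normSq_apply]
  simp [nuForm]
  ring

/-- The functional `a ↦ Im (a_u / u)`. -/
def muForm (q : Space7) : Space7 →L[ℝ] ℝ :=
  (q.2.2.1⁻¹).re • (imCLM ∘L projW) + (q.2.2.1⁻¹).im • (reCLM ∘L projW)

lemma muForm_apply (q a : Space7) : muForm q a = (q.2.2.1⁻¹ * a.2.2.1).im := by simp [muForm]

lemma contDiffAt_muForm (hq : q.2.2.1 ≠ 0) : SmoothAt muForm q := by
  have h : SmoothAt (fun p : Space7 => p.2.2.1⁻¹) q := (contDiffAt_inv ℝ hq).comp q projW.contDiff.contDiffAt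
  exact ((contDiff_re.contDiffAt.comp q h).smul contDiffAt_const).add
    ((contDiff_im.contDiffAt.comp q h).smul contDiffAt_const)

lemma fderiv_muForm (hq : q.2.2.1 ≠ 0) (a b : Space7) : fderiv ℝ (fun p => muForm p a) q b = -(q.2.2.1⁻¹ * b.2.2.1 * (q.2.2.1⁻¹ * a.2.2.1)).im := by
  simp only [muForm_apply]
  have h1 : HasFDerivAt (fun p : Space7 => p.2.2.1) projW q := projW.hasFDerivAt
  have h2 : HasFDerivAt (fun u : ℂ => u⁻¹) (ContinuousLinearMap.restrictScalars ℝ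
      (ContinuousLinearMap.toSpanSingleton ℂ (-(q.2.2.1 ^ 2)⁻¹))) q.2.2.1 :=
    (hasDerivAt_inv hq).hasFDerivAt.restrictScalars ℝ
  have h3 := imCLM.hasFDerivAt.comp q ((h2.comp q h1).mul_const a.2.2.1)
  have h4 : fderiv ℝ (fun p : Space7 => (p.2.2.1⁻¹ * a.2.2.1).im) q b = _ :=
    congrArg (fun L : Space7 →L[ℝ] ℝ => L b) h3.fderiv
  rw [h4]
  simp only [ContinuousLinearMap.comp_apply, imCLM_apply, FunLike.coe_smul, Pi.smul_apply, smul_eq_mul, projW_apply,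
    ContinuousLinearMap.coe_restrictScalars', ContinuousLinearMap.toSpanSingleton_apply]
  rw [← neg_im]
  congr 1
  field_simp

lemma extDeriv_muForm (hq : q.2.2.1 ≠ 0) : extDeriv (fun p => oneForm (muForm p)) q = 0 := by
  ext v
  rw [extDeriv_oneForm (contDiffAt_muForm hq), fderiv_muForm hq, fderiv_muForm hq]
  simp only [ContinuousAlternatingMap.coe_zero, Pi.zero_apply]
  rw [mul_comm (q.2.2.1⁻¹ * (v 0).2.2.1), sub_self]

lemma fderiv_branch {r u : ℂ} (hr : r ≠ 0) (h : DifferentiableAt ℝ (branch r) u) (a : ℂ) : 2 * (branch r u * fderiv ℝ (branch r) u a) = a := by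
  have h1 := h.hasFDerivAt.mul h.hasFDerivAt
  have h2 : (branch r * branch r) = fun u => u := by
    funext u
    rw [Pi.mul_apply, ← sq, branch_sq hr]
  rw [h2] at h1
  have h3 := h1.unique (hasFDerivAt_id (𝕜 := ℝ) u)
  have h4 := congrArg (fun L : ℂ →L[ℝ] ℂ => L a) h3
  simp at h4
  linear_combination h4

lemma differentiableAt_branch {b r} (h : DifferentiableAt ℝ (bl b r) q) : DifferentiableAt ℝ (branch r) q.2.2.1 := by
  have h1 : DifferentiableAt ℝ (fun u : ℂ => ((q.1, q.2.1, u, q.2.2.2) : Space7)) q.2.2.1 := by fun_prop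
  have h2 := DifferentiableAt.comp (g := bl b r) (f := fun u : ℂ => ((q.1, q.2.1, u, q.2.2.2) : Space7))
    q.2.2.1 h h1
  cases b
  · have h3 := projW.differentiableAt.comp q.2.2.1 h2
    refine h3.congr_of_eventuallyEq (.of_forall fun u => ?_)
    simp [bl, blow, branchMap, dir]
  · have h3 := projZ.differentiableAt.comp q.2.2.1 h2
    refine h3.congr_of_eventuallyEq (.of_forall fun u => ?_)
    simp [bl, blow, branchMap, dir]

lemma imForm_bl {b r} (hr : r ≠ 0) (hq : q.2.2.1 ≠ 0) (hd : DifferentiableAt ℝ (bl b r) q) (a : Space7) : imForm (bl b r q) (fderiv ℝ (bl b r) q a) =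
      hUV q * ((1 / 2) * muForm q a + nuForm q a) := by
  have hB := differentiableAt_branch hd
  have h1 : HasFDerivAt (fun q : Space7 => branch r q.2.2.1) (fderiv ℝ (branch r) q.2.2.1 ∘L projW) q :=
    HasFDerivAt.comp (g := branch r) (f := fun q : Space7 => q.2.2.1) q hB.hasFDerivAt projW.hasFDerivAt
  have h2 : HasFDerivAt (fun q : Space7 => q.2.2.2) projZ q := projZ.hasFDerivAt
  have h3 := h1.mul h2
  have hw : (fderiv ℝ (bl b r) q a).2.2.1 = fderiv ℝ (fun q => (bl b r q).2.2.1) q a :=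
    (congrArg (fun L : Space7 →L[ℝ] ℂ => L a) (projW.hasFDerivAt.comp q hd.hasFDerivAt).fderiv).symm
  have hz : (fderiv ℝ (bl b r) q a).2.2.2 = fderiv ℝ (fun q => (bl b r q).2.2.2) q a :=
    (congrArg (fun L : Space7 →L[ℝ] ℂ => L a) (projZ.hasFDerivAt.comp q hd.hasFDerivAt).fderiv).symm
  have hρ := fderiv_branch hr hB a.2.2.1
  have hs := branch_sq (u := q.2.2.1) hr
  have hne := branch_ne hr hq
  have e1 : fderiv ℝ (fun q : Space7 => branch r q.2.2.1) q a = fderiv ℝ (branch r) q.2.2.1 a.2.2.1 := by rw [h1.fderiv]; rfl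
  have e2 : fderiv ℝ (fun q : Space7 => branch r q.2.2.1 * q.2.2.2) q a = branch r q.2.2.1 * a.2.2.2 + q.2.2.2 * fderiv ℝ (branch r) q.2.2.1 a.2.2.1 := by
    refine (congrArg (fun L : Space7 →L[ℝ] ℂ => L a) h3.fderiv).trans ?_
    simp
  have key : ∀ ρ' : ℂ, ρ' = fderiv ℝ (branch r) q.2.2.1 a.2.2.1 → (conj (branch r q.2.2.1) * ρ' + conj (branch r q.2.2.1 * q.2.2.2) *
        (branch r q.2.2.1 * a.2.2.2 + q.2.2.2 * ρ')).im = hUV q * ((1 / 2) * muForm q a + nuForm q a) := by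
    intro ρ' hρ'
    rw [← hρ'] at hρ
    set ρ := branch r q.2.2.1
    have hn : (‖q.2.2.1‖ : ℂ) = ρ * conj ρ := by rw [Complex.mul_conj, Complex.normSq_eq_norm_sq, ← norm_pow, hs]
    have hv : (‖q.2.2.2‖ : ℂ) ^ 2 = q.2.2.2 * conj q.2.2.2 := by rw [Complex.mul_conj, Complex.normSq_eq_norm_sq]; push_cast; rfl
    have e3 : conj ρ * ρ' + conj (ρ * q.2.2.2) * (ρ * a.2.2.2 + q.2.2.2 * ρ') =
        ((hUV q / 2 : ℝ) : ℂ) * (q.2.2.1⁻¹ * a.2.2.1) + ((‖q.2.2.1‖ : ℝ) : ℂ) * (conj q.2.2.2 * a.2.2.2) := by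
      rw [hUV]
      push_cast
      rw [hn, hv, ← hρ, ← hs, map_mul]
      field_simp
      ring
    rw [e3, add_im, im_ofReal_mul, im_ofReal_mul, muForm_apply, nuForm_apply, hUV]
    have : (1 + ‖q.2.2.2‖ ^ 2) ≠ 0 := by positivity
    field_simp
  rw [imForm_eq, hw, hz]
  cases b
  · have e4 : (fun q : Space7 => (bl false r q).2.2.1) = fun q => branch r q.2.2.1 := by
      funext q; simp [bl, blow, branchMap, dir]
    have e5 : (fun q : Space7 => (bl false r q).2.2.2) = fun q => branch r q.2.2.1 * q.2.2.2 := by funext q; simp [bl, blow, branchMap, dir]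
    rw [e4, e5, e1, e2, congrFun e4 q, congrFun e5 q]
    exact key _ rfl
  · have e4 : (fun q : Space7 => (bl true r q).2.2.2) = fun q => branch r q.2.2.1 := by
      funext q; simp [bl, blow, branchMap, dir]
    have e5 : (fun q : Space7 => (bl true r q).2.2.1) = fun q => branch r q.2.2.1 * q.2.2.2 := by funext q; simp [bl, blow, branchMap, dir]
    rw [e4, e5, e1, e2, congrFun e4 q, congrFun e5 q, add_comm]
    exact key _ rfl

/-- The primitive of the Thom form in the coordinates near the exceptional divisor. -/
def kapUV (q : Space7) : Space7 →L[ℝ] ℝ := (-(bump (hUV q) / Real.pi)) • ((1 / 2 : ℝ) • muForm q + nuForm q)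

lemma hUV_ne (hq : q.2.2.1 ≠ 0) : hUV q ≠ 0 := by
  unfold hUV
  have := norm_pos_iff.2 hq
  positivity

lemma pb_bl_kapForm {b r} (hr : r ≠ 0) (hq : q.2.2.1 ≠ 0) (hd : DifferentiableAt ℝ (bl b r) q) : pb (bl b r) kapForm q = oneForm (kapUV q) := by
  ext v
  rw [pb, ContinuousAlternatingMap.compContinuousLinearMap_apply, kapForm_apply, oneForm_apply, radSq_bl hr]
  simp only [Function.comp_apply]
  rw [imForm_bl hr hq hd, gFun, kapUV]
  have := hUV_ne hq
  simp only [FunLike.coe_smul, Pi.smul_apply, FunLike.coe_add, Pi.add_apply, smul_eq_mul]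
  field_simp

lemma pb_bl_tauForm {b r} (hq : q.2.2.1 ≠ 0) (hr : r ^ 2 = q.2.2.1) : pb (bl b r) tauForm q = extDeriv (fun p => oneForm (kapUV p)) q := by
  have hr0 : r ≠ 0 := fun h => hq (by rw [← hr, h]; simp)
  have hd := contDiffAt_bl hq hr b
  have h0 : radSq (bl b r q) ≠ 0 := by rw [radSq_bl hr0]; exact hUV_ne hq
  have h1 : pb (bl b r) tauForm q = pb (bl b r) (extDeriv kapForm) q :=
    pb_congr_form (tauForm_eventuallyEq h0).self_of_nhds
  rw [h1, ← extDeriv_pb ((contDiffAt_kapForm h0).diffAt) hd]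
  refine Filter.EventuallyEq.extDeriv_eq ?_
  filter_upwards [eventually_ne_zero hq, eventually_differentiableAt hd] with p hp hpd
  exact pb_bl_kapForm hr0 hp hpd

/-- The Thom form near the exceptional divisor. -/
def tauExc (q : Space7) : Alt7 2 := (-(1 / Real.pi)) • extDeriv (fun p => oneForm (nuForm p)) q

lemma contDiffAt_tauExc (q) : SmoothAt tauExc q :=
  ((contDiffAt_const (c := -(1 / Real.pi))).smul (contDiffAt_extDeriv
    (contDiffAt_oneForm contDiff_nuForm.contDiffAt))).congr_of_eventuallyEq
    (.of_forall fun _ => rfl)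

lemma extDeriv_kapUV (hq : q.2.2.1 ≠ 0) (hh : hUV q < 1 / 1024) : extDeriv (fun p => oneForm (kapUV p)) q = tauExc q := by
  have h1 : (fun p => oneForm (kapUV p)) =ᶠ[𝓝 q] fun p => (-(1 / (2 * Real.pi))) • oneForm (muForm p) + (-(1 / Real.pi)) • oneForm (nuForm p) := by
    filter_upwards [continuous_hUV.continuousAt.eventually_lt_const hh] with p hp
    ext v
    rw [oneForm_apply, kapUV, bump_one hp.le]
    simp only [FunLike.coe_smul, Pi.smul_apply, FunLike.coe_add, Pi.add_apply, smul_eq_mul,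
      ContinuousAlternatingMap.add_apply, ContinuousAlternatingMap.smul_apply, oneForm_apply]
    field_simp
    ring
  have d1 : DifferentiableAt ℝ (fun p => oneForm (muForm p)) q :=
    (contDiffAt_oneForm (contDiffAt_muForm hq)).diffAt
  have d2 : DifferentiableAt ℝ (fun p => oneForm (nuForm p)) q :=
    (contDiffAt_oneForm contDiff_nuForm.contDiffAt).diffAt
  have d3 : DifferentiableAt ℝ (fun p => (-(1 / (2 * Real.pi))) • oneForm (muForm p)) q := d1.fun_const_smul _
  have d4 : DifferentiableAt ℝ (fun p => (-(1 / Real.pi)) • oneForm (nuForm p)) q := d2.fun_const_smul _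
  rw [h1.extDeriv_eq, extDeriv_fun_add d3 d4]
  have e1 := extDeriv_smul (x := q) (-(1 / (2 * Real.pi))) fun p => oneForm (muForm p)
  have e2 := extDeriv_smul (x := q) (-(1 / Real.pi)) fun p => oneForm (nuForm p)
  rw [extDeriv_muForm hq, smul_zero] at e1
  exact (congrArg₂ _ e1 e2).trans (zero_add _)

lemma tubeInvariant_single {j₀ : Fin 10} {t : 𝓐 k} (h : ∀ (i e σ : ℝ) (α : ℂ), (i = 1 ∨ i = -1) →
    (e = 1 ∨ e = -1) → ∀ p, t p = pb (signMap i e σ α) t p) : TubeInvariant (single j₀ t) := by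
  refine tubeInvariant_of_signMap fun j i e σ α hi he p => ?_
  by_cases hj : j = j₀
  · rw [hj, single_self]
    exact h i e σ α hi he p
  · rw [single_ne hj]
    rfl

lemma isGForm_thom (j₀ : Fin 10) : IsGForm (glue (single j₀ tauForm)) := by
  refine isGForm_glue (tubeInvariant_single fun i e σ α hi he p => pb_signMap_tauForm hi he σ α p) (ε := 1 / 300)
    (by rw [sqRadius]; norm_num) (fun j p hp => ?_) (fun j p hp => ?_) fun j b s c v => ?_
  · by_cases hj : j = j₀
    · rw [hj, single_self, tauForm_zero (by linarith)]
    · rw [single_ne hj]; rfl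
  · by_cases hj : j = j₀
    · rw [hj, single_self]; exact contDiffAt_tauForm hp
    · rw [single_ne hj]; exact contDiffAt_const
  · by_cases hj : j = j₀
    · rw [hj, single_self]
      refine ⟨tauExc, contDiffAt_tauExc _, ?_⟩
      filter_upwards [continuous_hUV.continuousAt.eventually_lt_const (u := 1 / 1024)
        (by simp [hUV] : hUV ((s, c, 0, v) : Space7) < 1 / 1024)] with q hq hq0 r hr
      rw [pb_bl_tauForm hq0 hr, extDeriv_kapUV hq0 hq]
    · rw [single_ne hj]
      exact ⟨0, contDiffAt_const, .of_forall fun q _ r _ => rfl⟩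

end JK

namespace JK
open Complex

variable {k l : ℕ}

/-! ### The tubes in the resolution -/

lemma mem_domJ_of_hUV {j b} {p : Space7} (h : hUV p < sqRadius) : p ∈ domJ j b := by
  by_cases hp : p.2.2.1 = 0
  · exact Or.inl hp
  · right
    have h1 : radSq (blow b (p.1, p.2.1, csqrt p.2.2.1, p.2.2.2)) = hUV p := by rw [radSq_blow, hUV, ← norm_pow, csqrt_sq]
    exact tubeMap_regular (by rwa [h1]) (by rw [h1]; exact hUV_ne hp)

lemma continuousAt_param {i x} (hx : x ∈ paramDom i) : ContinuousAt (param i) x := by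
  obtain ⟨V, hV, hd, hi, hxV⟩ := exists_mkChart_mem hx
  have h := (mkChart i V hV hd hi).continuousOn_symm
  exact h.continuousAt (hV.mem_nhds hxV)

lemma rho_toResolution {x : Space7} {S : Set Space7} {q : Marked} (h : IsResolutionPoint q) (hq : q = Quotient.mk'' (x, S)) : rho (toResolution q) = Quotient.mk'' x := by
  subst hq
  rw [rho, toResolution_val h]
  rfl

lemma rho_param_none {x} (hx : x ∈ regular) : rho (param none x) = Quotient.mk'' x :=
  rho_toResolution (isResolutionPoint_paramQ (i := none) hx) rfl

lemma orbifold_mk_eq {x y : Space7} : (Quotient.mk'' x : Orbifold) = Quotient.mk'' y ↔ ∃ g ∈ Gam, g x = y := by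
  rw [Quotient.eq'', MulAction.orbitRel_apply, MulAction.mem_orbit_iff]
  constructor
  · rintro ⟨⟨g, hg⟩, h⟩
    have h1 : g y = x := h
    exact ⟨g⁻¹, inv_mem hg, by rw [← h1]; simp⟩
  · rintro ⟨g, hg, rfl⟩
    exact ⟨⟨g⁻¹, inv_mem hg⟩, show g⁻¹ (g x) = x by simp⟩

/-- The part of radius `r` of the tube around an exceptional divisor. -/
def rhoTube (j : Fin 10) (r : ℝ) : Set Resolution :=
  {m | ∃ p, radSq p < r ∧ rho m = Quotient.mk'' (tubeMap j p)}

lemma rho_preimage_tube (j : Fin 10) : rho ⁻¹' tube j = rhoTube j sqRadius := by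
  ext m
  constructor
  · rintro ⟨s, c, w, z, h, e⟩
    exact ⟨(s, c, w, z), h, e⟩
  · rintro ⟨⟨s, c, w, z⟩, h, e⟩
    exact ⟨s, c, w, z, h, e⟩

lemma param_none_mem_rhoTube {j r x} (hx : x ∈ regular) : param none x ∈ rhoTube j r ↔ x ∈ orbTube j r := by
  constructor
  · rintro ⟨p, hp, e⟩
    rw [rho_param_none hx] at e
    obtain ⟨g, hg, h⟩ := orbifold_mk_eq.1 e.symm
    exact ⟨g, hg, p, hp, h⟩
  · rintro ⟨g, hg, p, hp, e⟩
    exact ⟨p, hp, by rw [rho_param_none hx]; exact (orbifold_mk_eq.2 ⟨g, hg, e⟩).symm⟩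

lemma rho_param_zero (j b s c v) : rho (param (some (j, b)) (s, c, 0, v)) = Quotient.mk'' (tubeMap j (s, c, 0, 0)) :=
  rho_toResolution (isResolutionPoint_paramQ (i := some (j, b)) (Or.inl rfl)) (psiQ_zero j b s c v)

lemma param_some_mem_rhoTube {j b r} {p : Space7} (hr : r ≤ sqRadius) (hp : hUV p < r) : param (some (j, b)) p ∈ rhoTube j r := by
  have hd := mem_domJ_of_hUV (j := j) (b := b) (hp.trans_le hr)
  by_cases h0 : p.2.2.1 = 0
  · obtain ⟨s, c, u, v⟩ := p
    obtain rfl : u = 0 := h0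
    refine ⟨(s, c, 0, 0), ?_, rho_param_zero j b s c v⟩
    simpa [radSq, hUV] using hp
  · have hr0 := csqrt_ne h0
    rw [← param_up hr0 h0, param_none_mem_rhoTube ((domJ_up hr0 j b h0).1 hd)]
    exact ⟨1, one_mem _, bl b (csqrt p.2.2.1) p, by rwa [radSq_bl hr0], rfl⟩

lemma line_dir_inv (j s c) {b : Bool} {v : ℂ} (hv : v ≠ 0) : line j s c (dir b v) = line j s c (dir (!b) v⁻¹) := by
  rw [← line_smul j s c (dir (!b) v⁻¹) hv]
  congr 1
  cases b <;> simp [dir, hv]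

lemma exists_translation (j : Fin 10) (m n o : ℤ) : ∃ g ∈ Gam, ∀ s c w z, g (tubeMap j (s, c, w, z)) = tubeMap j (s + m, (1 : ℝ) * c + (n + o * I), w, (1 : ℝ) * z) := by
  have hη : ∃ e, gauss e = eta j := by
    fin_cases j
    exacts [⟨(1, -1), by simp [gauss, eta]; ring⟩, ⟨(1, 1), by simp [gauss, eta]⟩, ⟨(1, 0), by simp [gauss, eta]⟩,
      ⟨(1, 0), by simp [gauss, eta]⟩, ⟨(1, 0), by simp [gauss, eta]⟩, ⟨(1, 0), by simp [gauss, eta]⟩,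
      ⟨(0, 1), by simp [gauss, eta]⟩, ⟨(0, 1), by simp [gauss, eta]⟩, ⟨(0, 1), by simp [gauss, eta]⟩, ⟨(0, 1), by simp [gauss, eta]⟩]
  have hθ : ∃ e, gauss e = theta j := by
    rw [theta_eq]
    split_ifs
    exacts [⟨(0, 1), by simp [gauss]⟩, ⟨(1, 0), by simp [gauss]⟩]
  obtain ⟨e, he⟩ := hη
  obtain ⟨e', he'⟩ := hθ
  refine ⟨translation (n • e) (o • e) (m • e'), mem_t _ _ _, fun s c w z => ?_⟩
  have hs : ∀ (x : ℤ) (e : ℤ × ℤ), gauss (x • e) = x * gauss e := by intro x e; simp [gauss]; ring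
  show (_, _, _, _) = _
  rw [hs, hs, hs, he, he']
  simp only [tubeMap]
  refine prod_ext₄ rfl ?_ ?_ ?_ <;> simp <;> ring

lemma param_translate (j b) {g} (hg : g ∈ Gam) {σ : ℝ} {α : ℂ} (h : ∀ s c w z, g (tubeMap j (s, c, w, z)) = tubeMap j (s + σ, (1 : ℝ) * c + α, w, (1 : ℝ) * z)) (s c u v) :
    param (some (j, b)) (s, c, u, v) = param (some (j, b)) (s + σ, c + α, u, v) := by
  refine congrArg toResolution (?_ : psiQ j b _ = psiQ j b _)
  by_cases hu : u = 0
  · subst hu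
    rw [psiQ_zero, psiQ_zero, lnQ_eq]
    refine ⟨g, hg, ?_, ?_⟩
    · rw [h]; simp
    · have := image_line (e₁ := ((1 : ℝ) : ℂ)) (e := ((1 : ℝ) : ℂ)) h s c (dir b v)
      simpa using this
  · rw [psiQ_eq hu (csqrt_sq u), psiQ_eq hu (csqrt_sq u), ptQ_eq]
    refine ⟨g, hg, ?_⟩
    rw [blow, blow, h]
    simp

/-- A compact part of the coordinates near an exceptional divisor. -/
def boxUV (r : ℝ) : Set Space7 := {p | p.1 ∈ Set.Icc 0 1 ∧ ‖p.2.1‖ ≤ 2 ∧ ‖p.2.2.1‖ ≤ r ∧ ‖p.2.2.2‖ ≤ 1 ∧ hUV p ≤ r}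

lemma isCompact_boxUV (r : ℝ) : IsCompact (boxUV r) := by
  have h1 : IsCompact (Set.Icc (0 : ℝ) 1 ×ˢ Metric.closedBall (0 : ℂ) 2 ×ˢ Metric.closedBall (0 : ℂ) r ×ˢ
      Metric.closedBall (0 : ℂ) 1) :=
    isCompact_Icc.prod ((isCompact_closedBall _ _).prod ((isCompact_closedBall _ _).prod (isCompact_closedBall _ _)))
  have h2 : boxUV r = (Set.Icc (0 : ℝ) 1 ×ˢ Metric.closedBall (0 : ℂ) 2 ×ˢ Metric.closedBall (0 : ℂ) r ×ˢ
      Metric.closedBall (0 : ℂ) 1) ∩ {p | hUV p ≤ r} := by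
    ext p
    simp [boxUV, and_assoc]
  rw [h2]
  exact h1.inter_right (isClosed_le continuous_hUV continuous_const)

lemma exists_translate_bounded (j : Fin 10) (s : ℝ) (c : ℂ) : ∃ g ∈ Gam, ∃ (σ : ℝ) (α : ℂ), (∀ s c w z,
    g (tubeMap j (s, c, w, z)) = tubeMap j (s + σ, (1 : ℝ) * c + α, w, (1 : ℝ) * z)) ∧ s + σ ∈ Set.Icc 0 1 ∧ ‖c + α‖ ≤ 2 := by
  obtain ⟨g, hg, h⟩ := exists_translation j (-⌊s⌋) (-⌊c.re⌋) (-⌊c.im⌋)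
  refine ⟨g, hg, _, _, h, ⟨?_, ?_⟩, ?_⟩
  · push_cast; linarith [Int.floor_le s]
  · push_cast; linarith [Int.lt_floor_add_one s]
  · refine (norm_le_abs_re_add_abs_im _).trans ?_
    have e1 : (c + (((-⌊c.re⌋ : ℤ) : ℂ) + ((-⌊c.im⌋ : ℤ) : ℂ) * I)).re = c.re - ⌊c.re⌋ := by simp [sub_eq_add_neg]
    have e2 : (c + (((-⌊c.re⌋ : ℤ) : ℂ) + ((-⌊c.im⌋ : ℤ) : ℂ) * I)).im = c.im - ⌊c.im⌋ := by simp [sub_eq_add_neg]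
    rw [e1, e2, abs_of_nonneg (by linarith [Int.floor_le c.re]), abs_of_nonneg (by linarith [Int.floor_le c.im])]
    linarith [Int.lt_floor_add_one c.re, Int.lt_floor_add_one c.im]

lemma exists_boxUV {m : Resolution} {j : Fin 10} {r : ℝ} (hr : r ≤ sqRadius) (hm : m ∈ rhoTube j r) : ∃ b p, p ∈ boxUV (hUV p) ∧ hUV p < r ∧ param (some (j, b)) p = m := by
  have h1 : ∃ b p, ‖(p : Space7).2.2.2‖ ≤ 1 ∧ hUV p < r ∧ param (some (j, b)) p = m := by
    obtain ⟨q, hq⟩ := m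
    rcases id hq with ⟨x, hx, rfl⟩ | ⟨j', b, s, c, v, rfl⟩
    · have hmx : (⟨ptQ x, hq⟩ : Resolution) = param none x :=
        Subtype.ext (toResolution_val hq).symm
      rw [hmx] at hm ⊢
      rw [param_none_mem_rhoTube hx] at hm
      obtain ⟨g, hg, p, hp, rfl⟩ := hm
      have hreg : tubeMap j p ∈ regular := by
        have := regular_smul (inv_mem hg) hx
        simpa using this
      have hne : radSq p ≠ 0 := by
        have := radSq_ne_of_regular (j := j) (g := 1) hreg (one_mem _)
        simpa [tubeCo, tubeInv_tubeMap] using this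
      obtain ⟨s, c, w, z⟩ := p
      have key : ∀ b : Bool, (if b then z else w) ≠ 0 → hUV (unblow b (s, c, w, z)) = radSq (s, c, w, z) ∧
          param (some (j, b)) (unblow b (s, c, w, z)) = param none (g (tubeMap j (s, c, w, z))) := by
        intro b hb
        refine ⟨?_, ?_⟩
        · cases b
          · have hb : w ≠ 0 := hb
            have := norm_pos_iff.2 hb
            simp [hUV, unblow, radSq]; field_simp
          · have hb : z ≠ 0 := hb
            have := norm_pos_iff.2 hb
            simp [hUV, unblow, radSq]; field_simp; ring
        · refine congrArg toResolution (?_ : psiQ j b _ = ptQ _)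
          rw [psiQ_unblow hb, ptQ_eq]
          exact ⟨g, hg, rfl⟩
      rcases le_total ‖z‖ ‖w‖ with hle | hle
      · have hb : (if false then z else w) ≠ 0 := by
          intro h
          have h : w = 0 := h
          rw [h, norm_zero] at hle
          exact hne (by simp [radSq, h, norm_le_zero_iff.1 hle])
        obtain ⟨e1, e2⟩ := key false hb
        refine ⟨false, _, ?_, by rwa [e1], e2⟩
        have hb : w ≠ 0 := hb
        simp [unblow]
        exact div_le_one_of_le₀ hle (norm_nonneg _)
      · have hb : (if true then z else w) ≠ 0 := by
          intro h
          have h : z = 0 := h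
          rw [h, norm_zero] at hle
          exact hne (by simp [radSq, h, norm_le_zero_iff.1 hle])
        obtain ⟨e1, e2⟩ := key true hb
        refine ⟨true, _, ?_, by rwa [e1], e2⟩
        simp [unblow]
        exact div_le_one_of_le₀ hle (norm_nonneg _)
    · have hmx : (⟨lnQ j' s c (dir b v), hq⟩ : Resolution) = param (some (j', b)) (s, c, 0, v) := by
        refine Subtype.ext ?_
        have : paramQ (some (j', b)) (s, c, 0, v) = lnQ j' s c (dir b v) := psiQ_zero _ _ _ _ _
        show _ = (toResolution (paramQ (some (j', b)) (s, c, 0, v))).1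
        rw [this, toResolution_val hq]
      rw [hmx] at hm ⊢
      obtain ⟨p, hp, e⟩ := hm
      rw [rho_param_zero] at e
      obtain ⟨g, hg, h⟩ := orbifold_mk_eq.1 e
      have hrpos : 0 < r := (radSq_nonneg p).trans_lt hp
      obtain rfl : j' = j := (Gam_match hg (by simp [radSq, sqRadius]) (hp.trans_le hr) h).1
      by_cases hv : ‖v‖ ≤ 1
      · exact ⟨b, (s, c, 0, v), hv, by simpa [hUV] using hrpos, rfl⟩
      · have hv0 : v ≠ 0 := fun h => hv (by simp [h])
        refine ⟨!b, (s, c, 0, v⁻¹), ?_, by simpa [hUV] using hrpos, ?_⟩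
        · rw [norm_inv]
          exact inv_le_one_of_one_le₀ (not_le.1 hv).le
        · refine congrArg toResolution (?_ : psiQ j' _ _ = psiQ j' _ _)
          rw [psiQ_zero, psiQ_zero, lnQ, lnQ, line_dir_inv j' s c hv0]
  obtain ⟨b, ⟨s, c, u, v⟩, hv, hh, e⟩ := h1
  obtain ⟨g, hg, σ, α, h, hs, hc⟩ := exists_translate_bounded j s c
  refine ⟨b, (s + σ, c + α, u, v), ⟨hs, hc, ?_, hv, le_rfl⟩, hh, (param_translate j b hg h s c u v).symm.trans e⟩
  simp only [hUV]
  nlinarith [norm_nonneg u, sq_nonneg ‖v‖]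

lemma isOpen_rhoTube {j r} (hr : r ≤ sqRadius) : IsOpen (rhoTube j r) := by
  rw [isOpen_iff_mem_nhds]
  intro m hm
  obtain ⟨b, p, -, hp, rfl⟩ := exists_boxUV hr hm
  have hd : p ∈ paramDom (some (j, b)) := mem_domJ_of_hUV (hp.trans_le hr)
  obtain ⟨V, hV, hd', hi, hxV⟩ := exists_mkChart_mem hd
  have h1 : IsOpen (V ∩ {q | hUV q < r}) := hV.inter (isOpen_lt continuous_hUV continuous_const)
  have h2 := (mkChart (some (j, b)) V hV hd' hi).isOpen_image_symm_of_subset_target h1 Set.inter_subset_left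
  refine Filter.mem_of_superset (h2.mem_nhds ⟨p, ⟨hxV, hp⟩, rfl⟩) ?_
  rintro _ ⟨q, ⟨-, hq⟩, rfl⟩
  exact param_some_mem_rhoTube hr hq

lemma exists_radius {K : Set Resolution} (hK : IsCompact K) {j} (h : K ⊆ rhoTube j sqRadius) : ∃ r, 0 < r ∧ r < sqRadius ∧ K ⊆ rhoTube j r := by
  have hs : (0 : ℝ) < sqRadius := by norm_num [sqRadius]
  obtain ⟨n, hn⟩ := hK.elim_directed_cover (ι := ℕ) (fun n : ℕ => rhoTube j (sqRadius - sqRadius / (n + 2)))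
    (fun n => isOpen_rhoTube (by have : 0 < sqRadius / ((n : ℝ) + 2) := by positivity
                                 linarith)) (fun m hm => by
      obtain ⟨p, hp, e⟩ := h hm
      obtain ⟨n, hn⟩ := exists_nat_gt (sqRadius / (sqRadius - radSq p))
      refine Set.mem_iUnion.2 ⟨n, p, ?_, e⟩
      have h1 : 0 < sqRadius - radSq p := by linarith
      rw [div_lt_iff₀ h1] at hn
      have h2 : sqRadius / ((n : ℝ) + 2) < sqRadius - radSq p := by
        rw [div_lt_iff₀ (by positivity)]
        nlinarith
      linarith) (by
      refine Monotone.directed_le fun m n hmn x hx => ?_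
      obtain ⟨p, hp, e⟩ := hx
      refine ⟨p, hp.trans_le ?_, e⟩
      have : sqRadius / ((n : ℝ) + 2) ≤ sqRadius / ((m : ℝ) + 2) := by gcongr
      linarith)
  refine ⟨_, ?_, ?_, hn⟩
  · have : sqRadius / ((n : ℝ) + 2) < sqRadius := div_lt_self hs (by linarith [Nat.cast_nonneg (α := ℝ) n])
    linarith
  · have : 0 < sqRadius / ((n : ℝ) + 2) := by positivity
    linarith

end JK

namespace JK
open Complex

variable {k l : ℕ} {a : 𝓐 k} {p : Space7} {q : Space7}

/-! ### Existence of Thom forms -/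

lemma extDeriv_glue {a : Fin 10 → 𝓐 k} (ha : TubeInvariant a) {j g x} (hg : g ∈ Gam) (hx : radSq (tubeCo j g x) < sqRadius) (hd : DifferentiableAt ℝ (a j) (tubeCo j g x)) :
    extDeriv (glue a) x = pb (tubeCo j g) (extDeriv (a j)) x := by
  rw [(glue_eventuallyEq ha hg hx).extDeriv_eq, extDeriv_pb hd (contDiff_tubeCo hg).contDiffAt]

lemma extDeriv_of_eventually_zero {x} (h : ∀ᶠ y in 𝓝 x, a y = 0) : extDeriv a x = 0 := by
  have h1 : a =ᶠ[𝓝 x] fun _ => 0 := h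
  rw [h1.extDeriv_eq, extDeriv_zero_form]

lemma pb_zero {f : Space7 → Space7} {x} (h : a (f x) = 0) : pb f a x = 0 := by
  rw [pb, h]
  rfl

lemma exists_tubeCo {j r x} (hx : x ∈ orbTube j r) : ∃ g ∈ Gam, radSq (tubeCo j g x) < r := by
  obtain ⟨g, hg, p, hp, rfl⟩ := hx
  exact ⟨g, hg, by rwa [tubeCo_apply]⟩

lemma mem_orbTube_of_tubeCo {j r g x} (hg : g ∈ Gam) (hx : radSq (tubeCo j g x) < r) : x ∈ orbTube j r := by
  have := mem_orbTube (j := j) hg hx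
  rwa [apply_tubeCo] at this

lemma extDeriv_tauForm (hp : radSq p ≠ 0) : extDeriv tauForm p = 0 := by
  rw [(tauForm_eventuallyEq hp).extDeriv_eq]
  exact extDeriv_extDeriv_apply (contDiffAt_kapForm hp)
    (by rw [minSmoothness_of_isRCLikeNormedField]; exact WithTop.coe_le_coe.2 le_top)

lemma loc_toForm_eventuallyEq (h : IsGForm a) {x} (hx : x ∈ regular) : loc h.toForm none =ᶠ[𝓝 x] a := by
  filter_upwards [(isOpen_paramDom none).mem_nhds hx] with y hy
  exact h.loc_toForm hy

lemma d_toForm_eq (h : IsGForm a) {η : 𝓓 (k + 1)} (hη : ∀ x ∈ regular, extDeriv a x = loc η none x) : DiffForm.d h.toForm = η := by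
  refine ext_regular fun x hx => ?_
  rw [loc_d _ (i := none) hx, (loc_toForm_eventuallyEq h hx).extDeriv_eq, hη x hx]

def thomForm (j : Fin 10) : 𝓓 2 := (isGForm_thom j).toForm

lemma tubeInvariant_thom (j : Fin 10) : TubeInvariant (single j tauForm) :=
  tubeInvariant_single fun _ _ σ α hi he p => pb_signMap_tauForm hi he σ α p

lemma single_tau_zero (j₀ j : Fin 10) (hp : 1 / 512 < radSq p) : single j₀ tauForm j p = 0 := by
  by_cases hj : j = j₀
  · rw [hj, single_self, tauForm_zero hp]
  · rw [single_ne hj]; rfl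

lemma glue_thom_eventually_zero (j : Fin 10) {x} (hx : ∀ j, x ∉ orbTube j sqRadius) : ∀ᶠ y in 𝓝 x, glue (single j tauForm) y = 0 :=
  glue_eventually_zero (tubeInvariant_thom j) (r := 1 / 300) (by norm_num [sqRadius])
    (fun _ _ hp => single_tau_zero _ _ (by linarith)) hx

lemma d_thomForm (j : Fin 10) : DiffForm.d (thomForm j) = 0 := by
  refine d_toForm_eq _ fun x hx => ?_
  rw [loc_zero]
  by_cases h : ∃ j', x ∈ orbTube j' sqRadius
  · obtain ⟨j', h⟩ := h
    obtain ⟨g, hg, hp⟩ := exists_tubeCo h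
    have hne := radSq_ne_of_regular (j := j') hx hg
    by_cases hj : j' = j
    · subst hj
      rw [extDeriv_glue (tubeInvariant_thom j') hg hp (by rw [single_self]; exact (contDiffAt_tauForm hne).diffAt), single_self, pb_zero (extDeriv_tauForm hne)]
    · rw [extDeriv_glue (tubeInvariant_thom j) hg hp (by rw [single_ne hj]; exact differentiableAt_const _), single_ne hj]
      exact pb_zero (extDeriv_zero_form _)
  · push Not at h
    exact extDeriv_of_eventually_zero (glue_thom_eventually_zero j h)

lemma glue_single_eq_zero {j : Fin 10} {t : 𝓐 k} (h : TubeInvariant (single j t)) {r : ℝ}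
    (h0 : ∀ p, r ≤ radSq p → t p = 0) {x} (hx : x ∉ orbTube j r) : glue (single j t) x = 0 := by
  by_cases h1 : ∃ j', x ∈ orbTube j' sqRadius
  · obtain ⟨j', h1⟩ := h1
    obtain ⟨g, hg, hp⟩ := exists_tubeCo h1
    rw [glue_eq h hg hp]
    by_cases hj : j' = j
    · subst hj
      rw [single_self]
      exact pb_zero (h0 _ (not_lt.1 fun h2 => hx (mem_orbTube_of_tubeCo hg h2)))
    · rw [single_ne hj]
      exact pb_zero rfl
  · push Not at h1
    exact glue_eq_zero h1

/-- A compact tube around an exceptional divisor. -/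
def excTube (j : Fin 10) (r : ℝ) : Set Resolution := ⋃ b, param (some (j, b)) '' boxUV r

lemma isCompact_excTube {j r} (hr : r < sqRadius) : IsCompact (excTube j r) := by
  refine isCompact_iUnion fun b => (isCompact_boxUV r).image_of_continuousOn fun p hp => ?_
  exact (continuousAt_param (i := some (j, b)) (mem_domJ_of_hUV (hp.2.2.2.2.trans_lt hr))).continuousWithinAt

lemma excTube_subset {j r r'} (h : r < r') (hr : r' ≤ sqRadius) : excTube j r ⊆ rhoTube j r' := by
  intro m hm
  obtain ⟨b, p, hp, rfl⟩ := Set.mem_iUnion.1 hm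
  exact param_some_mem_rhoTube hr (hp.2.2.2.2.trans_lt h)

lemma rhoTube_subset {j r} (hr : r ≤ sqRadius) : rhoTube j r ⊆ excTube j r := by
  intro m hm
  obtain ⟨b, p, hp, h, rfl⟩ := exists_boxUV hr hm
  refine Set.mem_iUnion.2 ⟨b, p, ⟨hp.1, hp.2.1, hp.2.2.1.trans h.le, hp.2.2.2.1, h.le⟩, rfl⟩

lemma valueAt_eq_zero {η : 𝓓 k} {j : Fin 10} {r : ℝ} (hr0 : 0 < r) (hr : r ≤ sqRadius) (h : ∀ x ∈ regular, x ∉ orbTube j r → loc η none x = 0) {m} (hm : m ∉ rhoTube j r) :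
    DiffForm.valueAt η m = 0 := by
  obtain ⟨i, x, hx, rfl⟩ := exists_param m
  rw [valueAt_param_eq_zero η hx]
  have key : ∀ x ∈ regular, param none x ∉ rhoTube j r → loc η none x = 0 := fun x hx hm =>
    h x hx (by rwa [param_none_mem_rhoTube hx] at hm)
  rcases i with _ | ⟨j', b⟩
  · exact key x hx hm
  · by_cases h0 : x.2.2.1 = 0
    · have hne : j' ≠ j := by
        rintro rfl
        exact hm (param_some_mem_rhoTube hr (by simpa [hUV, h0] using hr0))
      refine eq_of_eventually_eq_ne (contDiffAt_loc η hx).continuousAt continuousAt_const h0 ?_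
      filter_upwards [continuous_hUV.continuousAt.eventually_lt_const (u := sqRadius)
        (by simp [hUV, h0, sqRadius] : hUV x < sqRadius)] with p hp hp0
      have hd := mem_domJ_of_hUV (j := j') (b := b) hp
      have hr0 := csqrt_ne hp0
      have hreg := (domJ_up hr0 j' b hp0).1 hd
      rw [loc_up η hp0 hd hr0 (contDiffAt_up' hp0 (csqrt_sq _) j' b).continuousAt]
      refine pb_zero (h _ hreg fun h2 => hne ?_)
      exact orbTube_disjoint (x := up j' b (csqrt p.2.2.1) p)
        (mem_orbTube (g := 1) (p := bl b (csqrt p.2.2.1) p) (one_mem _) (by rwa [radSq_bl hr0]))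
        (orbTube_mono hr h2)
    · have hr0 := csqrt_ne h0
      have hreg := (domJ_up hr0 j' b h0).1 hx
      rw [loc_up η h0 hx hr0 (contDiffAt_up' h0 (csqrt_sq _) j' b).continuousAt]
      refine pb_zero (key _ hreg ?_)
      rwa [param_up hr0 h0]

lemma exists_support_thomForm (j : Fin 10) : ∃ K : Set Resolution, IsCompact K ∧ K ⊆ rho ⁻¹' tube j ∧ ∀ m ∉ K, DiffForm.valueAt (thomForm j) m = 0 := by
  have h1 : (1 : ℝ) / 300 < sqRadius := by norm_num [sqRadius]
  refine ⟨excTube j (1 / 300), isCompact_excTube h1, ?_, fun m hm => ?_⟩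
  · rw [rho_preimage_tube]
    exact excTube_subset h1 le_rfl
  · refine valueAt_eq_zero (j := j) (r := 1 / 300) (by norm_num) h1.le (fun x hx h => ?_)
      fun h => hm (rhoTube_subset h1.le h)
    rw [thomForm, IsGForm.loc_toForm _ hx]
    exact glue_single_eq_zero (tubeInvariant_thom j) (fun p hp => tauForm_zero (by linarith)) h

/-! ### The integral over a fibre -/

lemma fderiv_hUV (hq : q.2.2.1 ≠ 0) (h : DifferentiableAt ℝ hUV q) (b : ℂ) :
    fderiv ℝ hUV q (0, 0, b, 0) = (1 + ‖q.2.2.2‖ ^ 2) * (q.2.2.1.re * b.re + q.2.2.1.im * b.im) / ‖q.2.2.1‖ := by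
  have hn := norm_pos_iff.2 hq
  have e : ∀ p : Space7, hUV p ^ 2 = (p.2.2.1.re ^ 2 + p.2.2.1.im ^ 2) * (1 + (p.2.2.2.re ^ 2 + p.2.2.2.im ^ 2)) ^ 2 := by
    intro p
    rw [hUV, mul_pow, Complex.sq_norm, Complex.sq_norm, normSq_apply, normSq_apply]
    ring
  have hc : HasDerivAt (fun t : ℝ => ((q.1, q.2.1, q.2.2.1 + t * b, q.2.2.2) : Space7)) (0, 0, b, 0) 0 := by
    refine (hasDerivAt_const _ _).prodMk ((hasDerivAt_const _ _).prodMk (HasDerivAt.prodMk ?_ (hasDerivAt_const _ _)))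
    simpa using ((hasDerivAt_id (0 : ℝ)).ofReal_comp.mul_const b).const_add q.2.2.1
  have h1 : HasDerivAt (fun t : ℝ => hUV ((q.1, q.2.1, q.2.2.1 + t * b, q.2.2.2) : Space7))
      (fderiv ℝ hUV q (0, 0, b, 0)) 0 := by
    have h2 : DifferentiableAt ℝ hUV ((q.1, q.2.1, q.2.2.1 + ((0 : ℝ) : ℂ) * b, q.2.2.2) : Space7) := by simpa using h
    have := h2.hasFDerivAt.comp_hasDerivAt (0 : ℝ) hc
    have e0 : ((q.1, q.2.1, q.2.2.1 + ((0 : ℝ) : ℂ) * b, q.2.2.2) : Space7) = q := by simp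
    rw [e0] at this
    exact this
  have h3 := h1.pow 2
  have h4 : HasDerivAt (fun t : ℝ => ((q.2.2.1.re + t * b.re) ^ 2 + (q.2.2.1.im + t * b.im) ^ 2) * (1 + (q.2.2.2.re ^ 2 + q.2.2.2.im ^ 2)) ^ 2)
      (2 * (q.2.2.1.re * b.re + q.2.2.1.im * b.im) * (1 + (q.2.2.2.re ^ 2 + q.2.2.2.im ^ 2)) ^ 2) 0 := by
    have a1 : ∀ x y : ℝ, HasDerivAt (fun t : ℝ => (x + t * y) ^ 2) (2 * (x * y)) 0 := by
      intro x y
      have := (((hasDerivAt_id (0 : ℝ)).mul_const y).const_add x).pow 2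
      refine (HasDerivAt.congr_deriv this ?_ :)
      simp [mul_assoc]
    have := ((a1 q.2.2.1.re b.re).add (a1 q.2.2.1.im b.im)).mul_const ((1 + (q.2.2.2.re ^ 2 + q.2.2.2.im ^ 2)) ^ 2)
    refine this.congr_deriv ?_
    ring
  have h5 := h3.unique (h4.congr_of_eventuallyEq (.of_forall fun t => by simp only [Pi.pow_apply, e]; simp))
  have h6 : ‖q.2.2.2‖ ^ 2 = q.2.2.2.re ^ 2 + q.2.2.2.im ^ 2 := by rw [Complex.sq_norm, normSq_apply]; ring
  simp only [ofReal_zero, zero_mul, add_zero, Nat.cast_ofNat, Nat.add_one_sub_one, pow_one] at h5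
  rw [show ((q.1, q.2.1, q.2.2.1, q.2.2.2) : Space7) = q from rfl, hUV, h6] at h5
  rw [h6, eq_div_iff hn.ne']
  have h7 : (0 : ℝ) < 1 + (q.2.2.2.re ^ 2 + q.2.2.2.im ^ 2) := by positivity
  have h8 := mul_right_cancel₀ (b := 2 * (1 + (q.2.2.2.re ^ 2 + q.2.2.2.im ^ 2))) (by positivity)
    (a := fderiv ℝ hUV q (0, 0, b, 0) * ‖q.2.2.1‖)
    (c := (1 + (q.2.2.2.re ^ 2 + q.2.2.2.im ^ 2)) * (q.2.2.1.re * b.re + q.2.2.1.im * b.im)) (by linarith)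
  exact h8

lemma contDiffAt_hUV (hq : q.2.2.1 ≠ 0) : SmoothAt hUV q := by
  refine ContDiffAt.mul ?_ ?_
  · exact (contDiffAt_norm ℝ hq).comp q projW.contDiff.contDiffAt
  · exact contDiffAt_const.add ((projZ.contDiff.norm_sq ℝ).contDiffAt)

lemma contDiffAt_kapUV (hq : q.2.2.1 ≠ 0) : SmoothAt kapUV q :=
  ((contDiff_bump.contDiffAt.comp q (contDiffAt_hUV hq)).div_const _).neg.smul
    (((contDiffAt_muForm hq).const_smul (1 / 2 : ℝ)).add contDiff_nuForm.contDiffAt)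

lemma extDeriv_kapUV_fibre (hq : q.2.2.1 ≠ 0) : extDeriv (fun p => oneForm (kapUV p)) q ![(0, 0, 1, 0), (0, 0, I, 0)] =
      -((1 + ‖q.2.2.2‖ ^ 2) / (2 * Real.pi)) * deriv bump ((1 + ‖q.2.2.2‖ ^ 2) * ‖q.2.2.1‖) / ‖q.2.2.1‖ := by
  have hn := norm_pos_iff.2 hq
  rw [extDeriv_oneForm (contDiffAt_kapUV hq)]
  have hdh := (contDiffAt_hUV hq).diffAt
  have key : ∀ a b : ℂ, fderiv ℝ (fun y => kapUV y ((0, 0, a, 0) : Space7)) q ((0, 0, b, 0) : Space7) =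
      (-(bump (hUV q) / Real.pi)) * ((1 / 2) * -(q.2.2.1⁻¹ * b * (q.2.2.1⁻¹ * a)).im) +
      (-(deriv bump (hUV q) * fderiv ℝ hUV q (0, 0, b, 0) / Real.pi)) * ((1 / 2) * (q.2.2.1⁻¹ * a).im) := by
    intro a b
    have e : (fun y => kapUV y ((0, 0, a, 0) : Space7)) = fun y => (-(bump (hUV y) / Real.pi)) * ((1 / 2) * muForm y (0, 0, a, 0)) := by
      funext y
      simp [kapUV, nuForm_apply]
    have h1 : DifferentiableAt ℝ (fun y => muForm y ((0, 0, a, 0) : Space7)) q :=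
      ((contDiffAt_muForm hq).diffAt).clm_apply (differentiableAt_const _)
    have h2 : HasFDerivAt (fun y => bump (hUV y)) (deriv bump (hUV q) • fderiv ℝ hUV q) q :=
      ((contDiff_bump.diff).differentiableAt.hasDerivAt.comp_hasFDerivAt q hdh.hasFDerivAt)
    have h3 := ((h2.mul_const (Real.pi⁻¹)).neg).mul (h1.hasFDerivAt.const_mul (1 / 2))
    rw [e]
    simp only [div_eq_mul_inv] at h3 ⊢
    erw [h3.fderiv]
    simp only [add_apply, smul_apply, neg_apply, smul_eq_mul, fderiv_muForm hq]
    simp only [muForm_apply, Pi.neg_apply]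
    ring
  simp only [Matrix.cons_val_zero, Matrix.cons_val_one]
  rw [key, key, fderiv_hUV hq hdh, fderiv_hUV hq hdh]
  have e1 : (q.2.2.1⁻¹ * I).im = q.2.2.1.re / ‖q.2.2.1‖ ^ 2 := by rw [Complex.sq_norm]; simp [Complex.inv_re]
  have e2 : (q.2.2.1⁻¹ * 1).im = -q.2.2.1.im / ‖q.2.2.1‖ ^ 2 := by rw [Complex.sq_norm]; simp [Complex.inv_im]
  rw [e1, e2, mul_comm (q.2.2.1⁻¹ * 1)]
  have e3 : q.2.2.1.re ^ 2 = ‖q.2.2.1‖ ^ 2 - q.2.2.1.im ^ 2 := by rw [Complex.sq_norm, normSq_apply]; ring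
  have e4 : hUV q = (1 + ‖q.2.2.2‖ ^ 2) * ‖q.2.2.1‖ := mul_comm _ _
  rw [e4]
  simp only [one_re, one_im, I_re, I_im, mul_one, mul_zero, add_zero, zero_add]
  field_simp
  ring_nf
  rw [e3]
  ring

lemma deriv_bump_of_lt {h : ℝ} (hh : h < 1 / 1024) : deriv bump h = 0 := by
  have : bump =ᶠ[𝓝 h] fun _ => 1 := by
    filter_upwards [eventually_lt_nhds hh] with y hy
    exact bump_one hy.le
  rw [this.deriv_eq, deriv_const]

lemma deriv_bump_of_gt {h : ℝ} (hh : 1 / 512 < h) : deriv bump h = 0 := by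
  have : bump =ᶠ[𝓝 h] fun _ => 0 := by
    filter_upwards [eventually_gt_nhds hh] with y hy
    exact bump_zero hy.le
  rw [this.deriv_eq, deriv_const]

lemma integral_deriv_bump {κ : ℝ} (hκ : 0 < κ) : ∫ y in Set.Ioi (0 : ℝ), κ * deriv bump (κ * y) = -1 := by
  have hd : ∀ y : ℝ, HasDerivAt (fun y => bump (κ * y)) (κ * deriv bump (κ * y)) y := by
    intro y
    have h1 := (contDiff_bump.diff).differentiableAt.hasDerivAt (x := κ * y)
    have h2 := h1.comp y ((hasDerivAt_id y).const_mul κ)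
    refine h2.congr_deriv ?_
    simp [mul_comm]
  have hc : HasCompactSupport (fun y => κ * deriv bump (κ * y)) := by
    refine HasCompactSupport.of_support_subset_isCompact (K := Set.Icc 0 (1 / 512 / κ)) isCompact_Icc fun y hy => ?_
    by_contra h
    refine hy ?_
    show κ * deriv bump (κ * y) = 0
    rw [Set.mem_Icc, not_and_or, not_le, not_le] at h
    rcases h with h | h
    · rw [deriv_bump_of_lt (by nlinarith), mul_zero]
    · rw [deriv_bump_of_gt (by rw [div_lt_iff₀ hκ] at h; linarith), mul_zero]
  have hcont : Continuous (fun y => κ * deriv bump (κ * y)) :=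
    continuous_const.mul ((contDiff_bump.continuous_deriv (by simp)).comp (continuous_const.mul continuous_id))
  rw [integral_Ioi_of_hasDerivAt_of_tendsto' (f := fun y => bump (κ * y)) (m := 0) (fun y _ => hd y)
    (hcont.integrable_of_hasCompactSupport hc).integrableOn]
  · rw [mul_zero, bump_one (by norm_num)]
    norm_num
  · refine tendsto_const_nhds.congr' ?_
    filter_upwards [Filter.eventually_ge_atTop (1 / 512 / κ)] with y hy
    rw [bump_zero]
    rw [div_le_iff₀ hκ] at hy
    linarith

lemma integral_fibre {κ : ℝ} (hκ : 0 < κ) : ∫ u : ℂ, -(κ / (2 * Real.pi)) * deriv bump (κ * ‖u‖) / ‖u‖ = 1 := by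
  rw [integral_fun_norm_addHaar volume
    (fun y => -(κ / (2 * Real.pi)) * deriv bump (κ * y) / y), Complex.finrank_real_complex]
  have h1 : volume.real (Metric.ball (0 : ℂ) 1) = Real.pi := by simp [measureReal_def, Complex.volume_ball]
  have h2 : ∫ y in Set.Ioi (0 : ℝ), y ^ (2 - 1) • (-(κ / (2 * Real.pi)) * deriv bump (κ * y) / y) =
      ∫ y in Set.Ioi (0 : ℝ), -(1 / (2 * Real.pi)) * (κ * deriv bump (κ * y)) := by
    refine setIntegral_congr_fun measurableSet_Ioi fun y (hy : 0 < y) => ?_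
    simp only [Nat.add_one_sub_one, pow_one, smul_eq_mul]
    field_simp
  rw [h1, h2, integral_const_mul, integral_deriv_bump hκ]
  simp

lemma loc_glue_single {t : 𝓐 k} {j : Fin 10} (ht : TubeInvariant (single j t)) (h : IsGForm (glue (single j t))) {b r} (hp : p.2.2.1 ≠ 0) (hh : hUV p < sqRadius)
    (hr : r ^ 2 = p.2.2.1) : loc h.toForm (some (j, b)) p = pb (bl b r) t p := by
  have hr0 : r ≠ 0 := by
    rintro rfl
    exact hp (by rw [← hr]; simp)
  rw [h.loc_toForm_some (mem_domJ_of_hUV hh), h.extA_eq hp (mem_domJ_of_hUV hh) hr0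
    ((contDiffAt_up' hp hr j b).diffAt), pb_up_glue ht hp hr hh, single_self]

lemma hasFDerivAt_fibre (s c v) (u : ℂ) : HasFDerivAt (fun u : ℂ => ((s, c, u, v) : Space7))
    ((0 : ℂ →L[ℝ] ℝ).prod ((0 : ℂ →L[ℝ] ℂ).prod ((ContinuousLinearMap.id ℝ ℂ).prod 0))) u :=
  (hasFDerivAt_const _ _).prodMk ((hasFDerivAt_const _ _).prodMk ((hasFDerivAt_id u).prodMk (hasFDerivAt_const _ _)))

lemma pullbackAt_fibre (η : 𝓓 2) (j b s c v) {u : ℂ} (hu : hUV (s, c, u, v) < sqRadius) : DiffForm.pullbackAt η (fun u : ℂ => psi j b (s, c, u, v)) u ![1, I] =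
      loc η (some (j, b)) (s, c, u, v) ![(0, 0, 1, 0), (0, 0, I, 0)] := by
  have h1 := pullbackAt_eq η (i := some (j, b)) (f := fun u : ℂ => psi j b (s, c, u, v)) (h := fun u => (s, c, u, v))
    (fun _ => rfl) (mem_domJ_of_hUV hu) (hasFDerivAt_fibre s c v u).differentiableAt
  rw [h1, (hasFDerivAt_fibre s c v u).fderiv]
  rw [ContinuousAlternatingMap.compContinuousLinearMap_apply]
  congr 1
  funext i
  fin_cases i <;> rfl

lemma isThomForm_thomForm (j : Fin 10) : IsThomForm j (thomForm j) := by
  refine ⟨d_thomForm j, exists_support_thomForm j, fun b s c v => ?_⟩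
  have hκ : (0 : ℝ) < 1 + ‖v‖ ^ 2 := by positivity
  have hm : MeasurableSet {u : ℂ | ‖u‖ * (1 + ‖v‖ ^ 2) < sqRadius} :=
    (isOpen_lt (by fun_prop) continuous_const).measurableSet
  refine Eq.trans ?_ (integral_fibre hκ)
  rw [← setIntegral_eq_integral_of_forall_compl_eq_zero
    (f := fun u : ℂ => -((1 + ‖v‖ ^ 2) / (2 * Real.pi)) * deriv bump ((1 + ‖v‖ ^ 2) * ‖u‖) / ‖u‖)
    (s := {u : ℂ | ‖u‖ * (1 + ‖v‖ ^ 2) < sqRadius})]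
  · refine setIntegral_congr_ae hm ?_
    have : ∀ᵐ u : ℂ ∂volume, u ≠ 0 := by
      rw [ae_iff]
      simp
    filter_upwards [this] with u hu hu'
    rw [pullbackAt_fibre _ _ _ _ _ _ (show hUV (s, c, u, v) < sqRadius from hu'), thomForm,
      loc_glue_single (tubeInvariant_thom j) _ (p := (s, c, u, v)) hu hu' (csqrt_sq u), pb_bl_tauForm (q := (s, c, u, v)) hu (csqrt_sq u),
      extDeriv_kapUV_fibre (q := (s, c, u, v)) hu]
  · intro u hu
    have h1 : sqRadius ≤ ‖u‖ * (1 + ‖v‖ ^ 2) := not_lt.1 hu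
    rw [deriv_bump_of_gt]
    · simp
    · rw [sqRadius] at h1
      linarith

end JK

namespace JK
open Complex

variable {k l : ℕ} {a : 𝓐 k}

/-! ### Primitives of closed two-forms with compact support along the fibres -/

/-- Multiplication of the fibre coordinate by a complex number. -/
def usc (ζ : ℂ) : Space7 →L[ℝ] Space7 :=
  (fst ℝ ℝ (ℂ × ℂ × ℂ)).prod (((fst ℝ ℂ (ℂ × ℂ)) ∘L snd ℝ ℝ (ℂ × ℂ × ℂ)).prod
    ((ζ • projW).prod projZ))

lemma usc_apply (ζ : ℂ) (p : Space7) : usc ζ p = (p.1, p.2.1, ζ * p.2.2.1, p.2.2.2) := rfl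

lemma usc_one (p : Space7) : usc 1 p = p := by rw [usc_apply, one_mul]

lemma usc_usc (ζ ξ : ℂ) (p : Space7) : usc ζ (usc ξ p) = usc (ζ * ξ) p := by simp [usc_apply, mul_assoc]

/-- A family of multiplications of the fibre coordinate. -/
def ufam (ζ : ℝ → ℂ) (q : Space7 × ℝ) : Space7 := usc (ζ q.2) q.1

lemma contDiff_ufam {ζ : ℝ → ℂ} (hζ : Smooth ζ) : Smooth (ufam ζ) := by
  have h1 : Smooth fun q : Space7 × ℝ => ζ q.2 := hζ.comp contDiff_snd
  have h2 : Smooth fun q : Space7 × ℝ => q.1.2.2.1 := projW.contDiff.comp contDiff_fst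
  exact (contDiff_fst.comp contDiff_fst).prodMk ((contDiff_fst.comp (contDiff_snd.comp contDiff_fst)).prodMk
    ((h1.mul h2).prodMk (projZ.contDiff.comp contDiff_fst)))

lemma fderiv_ufam_inl {ζ : ℝ → ℂ} (hζ : Smooth ζ) (q : Space7 × ℝ) : fderiv ℝ (ufam ζ) q ∘L inl ℝ Space7 ℝ = usc (ζ q.2) := by
  have h1 := ((contDiff_ufam hζ).diff).differentiableAt (x := q) |>.hasFDerivAt
  have h2 : HasFDerivAt (fun p : Space7 => ((p, q.2) : Space7 × ℝ)) (inl ℝ Space7 ℝ) q.1 :=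
    hasFDerivAt_prodMk_left q.1 q.2
  exact (HasFDerivAt.comp q.1 (f := fun p : Space7 => ((p, q.2) : Space7 × ℝ)) h1 h2).unique (usc (ζ q.2)).hasFDerivAt

lemma fderiv_ufam_param {ζ : ℝ → ℂ} (hζ : Smooth ζ) (q : Space7 × ℝ) : HasDerivAt (fun φ => usc (ζ φ) q.1) (fderiv ℝ (ufam ζ) q (0, 1)) q.2 := by
  have h1 := ((contDiff_ufam hζ).diff).differentiableAt (x := q) |>.hasFDerivAt
  exact h1.comp_hasDerivAt (f := fun φ => ((q.1, φ) : Space7 × ℝ)) q.2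
    ((hasDerivAt_const _ _).prodMk (hasDerivAt_id _))

lemma fderiv_ufam_param_eq {ζ : ℝ → ℂ} (hζ : Smooth ζ) (q : Space7 × ℝ) : fderiv ℝ (ufam ζ) q (0, 1) = (0, 0, deriv ζ q.2 * q.1.2.2.1, 0) := by
  refine (fderiv_ufam_param hζ q).unique ?_
  refine (hasDerivAt_const _ _).prodMk ((hasDerivAt_const _ _).prodMk (HasDerivAt.prodMk ?_ (hasDerivAt_const _ _)))
  exact ((hζ.diff).differentiableAt.hasDerivAt (x := q.2)).mul_const q.1.2.2.1

lemma homPull_ufam {ζ : ℝ → ℂ} (hζ : Smooth ζ) (a : 𝓐 k) (x : Space7) (φ : ℝ) : homPull (ufam ζ) a (x, φ) = pb (usc (ζ φ)) a x := by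
  rw [homPull, fderiv_ufam_inl hζ, pb, (usc (ζ φ)).fderiv]
  rfl

lemma homContract_ufam {ζ : ℝ → ℂ} (hζ : Smooth ζ) (a : 𝓐 (k + 1)) (x : Space7) (φ : ℝ) (v : Fin k → Space7) : homContract (ufam ζ) a (x, φ) v =
      a (usc (ζ φ) x) (Matrix.vecCons (0, 0, deriv ζ φ * x.2.2.1, 0) fun i => usc (ζ φ) (v i)) := by
  rw [homContract, fderiv_ufam_inl hζ, fderiv_ufam_param_eq hζ]
  rfl

lemma contDiff_homOp {A : Space7 × ℝ → Space7} (hA : Smooth A) {a : 𝓐 (k + 1)} (ha : Smooth a) (m n : ℝ) : Smooth (homOp m n A a) := by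
  have := contDiffOn_homOp m n isOpen_univ isOpen_univ ha.contDiffOn hA.contDiffOn (Set.mapsTo_univ _ _)
  rwa [show segDom (Set.univ : Set (Space7 × ℝ)) = Set.univ from Set.eq_univ_of_forall fun x φ _ => trivial, contDiffOn_univ] at this

lemma homOp_apply {A : Space7 × ℝ → Space7} (hA : Smooth A) {a : 𝓐 (k + 1)} (ha : Smooth a) (m n : ℝ) (x : Space7) (v : Fin k → Space7) :
    homOp m n A a x v = ∫ φ in (0 : ℝ)..1, (m * φ + n) * homContract A a (x, φ) v := by
  have h1 := contDiffOn_homContract isOpen_univ isOpen_univ ha.contDiffOn hA.contDiffOn (Set.mapsTo_univ _ _)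
  rw [contDiffOn_univ] at h1
  have h2 : Continuous fun φ : ℝ => (m * φ + n) • homContract A a (x, φ) :=
    (by fun_prop : Continuous fun φ : ℝ => m * φ + n).smul (h1.continuous.comp (by fun_prop))
  exact ((ContinuousAlternatingMap.apply ℝ Space7 ℝ v).intervalIntegral_comp_comm
    (h2.intervalIntegrable 0 1)).symm

lemma extDeriv_homOp_univ {A : Space7 × ℝ → Space7} (hA : Smooth A) {a : 𝓐 (k + 1)}
    (ha : Smooth a) (hd : ∀ x, extDeriv a x = 0) (m n : ℝ) (x : Space7) (v : Fin (k + 1) → Space7) :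
    extDeriv (homOp m n A a) x v = (m + n) * homPull A a (x, 1) v - n * homPull A a (x, 0) v - m * ∫ φ in (0 : ℝ)..1, homPull A a (x, φ) v :=
  extDeriv_homOp m n isOpen_univ isOpen_univ ha.contDiffOn hA.contDiffOn (Set.mapsTo_univ _ _) (fun x _ => hd x)
    (fun _ _ => trivial) v

def rotFun (φ : ℝ) : ℂ := exp (2 * Real.pi * φ * I)
def linFun (φ : ℝ) : ℂ := φ

lemma contDiff_rotFun : Smooth rotFun := by
  have h : Smooth fun φ : ℝ => (2 * Real.pi * (φ : ℂ) * I) :=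
    (contDiff_const.mul ofRealCLM.contDiff).mul contDiff_const
  exact (contDiff_exp (𝕜 := ℂ)).restrict_scalars ℝ |>.comp h

lemma contDiff_linFun : Smooth linFun := ofRealCLM.contDiff

lemma norm_rotFun (φ : ℝ) : ‖rotFun φ‖ = 1 := by rw [rotFun, show (2 * Real.pi * φ * I : ℂ) = ((2 * Real.pi * φ : ℝ) : ℂ) * I by push_cast; ring, norm_exp_ofReal_mul_I]

lemma rotFun_one : rotFun 1 = 1 := by rw [rotFun, ofReal_one, mul_one, exp_two_pi_mul_I]

lemma deriv_linFun (φ : ℝ) : deriv linFun φ = 1 := (hasDerivAt_id φ).ofReal_comp.deriv.trans (by simp)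

/-- The primitive for the rotational average. -/
def lamRot (S : 𝓐 2) : 𝓐 1 := homOp 1 0 (ufam rotFun) S

/-- The rotational average. -/
def avgUV (S : 𝓐 2) (p : Space7) : Alt7 2 := S p - extDeriv (lamRot S) p

def lamCone (S : 𝓐 2) : 𝓐 1 := homOp 0 1 (ufam linFun) (avgUV S)

def lamSum (S : 𝓐 2) (p : Space7) : Alt7 1 := lamRot S p + lamCone S p

/-- The section of the circle bundle of radius `r`. -/
def retr (r : ℝ) (p : Space7) : Space7 := (p.1, p.2.1, ((r / (1 + ‖p.2.2.2‖ ^ 2) : ℝ) : ℂ), p.2.2.2)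

/-- The primitive of a closed form with compact support along the fibres. -/
def lamUV (r : ℝ) (S : 𝓐 2) (p : Space7) : Alt7 1 := lamSum S p - pb (retr r) (lamSum S) p

variable {S : 𝓐 2}

lemma contDiff_extDeriv (h : Smooth a) : Smooth (extDeriv a) :=
  contDiff_iff_contDiffAt.2 fun _ => contDiffAt_extDeriv h.contDiffAt

lemma contDiff_lamRot (hS : Smooth S) : Smooth (lamRot S) :=
  contDiff_homOp (contDiff_ufam contDiff_rotFun) hS 1 0

lemma contDiff_avgUV (hS : Smooth S) : Smooth (avgUV S) :=
  hS.sub (contDiff_extDeriv (contDiff_lamRot hS))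

lemma contDiff_lamCone (hS : Smooth S) : Smooth (lamCone S) :=
  contDiff_homOp (contDiff_ufam contDiff_linFun) (contDiff_avgUV hS) 0 1

lemma contDiff_lamSum (hS : Smooth S) : Smooth (lamSum S) :=
  (contDiff_lamRot hS).add (contDiff_lamCone hS)

lemma contDiff_retr (r : ℝ) : Smooth (retr r) := by
  have h1 : Smooth fun p : Space7 => 1 + ‖p.2.2.2‖ ^ 2 := contDiff_const.add (projZ.contDiff.norm_sq ℝ)
  have h2 : Smooth fun p : Space7 => ((r / (1 + ‖p.2.2.2‖ ^ 2) : ℝ) : ℂ) :=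
    ofRealCLM.contDiff.comp (contDiff_const.div h1 fun p => by positivity)
  exact contDiff_fst.prodMk ((contDiff_fst.comp contDiff_snd).prodMk (h2.prodMk projZ.contDiff))

lemma contDiff_pb {f : Space7 → Space7} (ha : Smooth a) (hf : Smooth f) : Smooth (pb f a) := contDiff_iff_contDiffAt.2 fun _ => contDiffAt_pb ha.contDiffAt hf.contDiffAt

lemma contDiff_lamUV (r : ℝ) (hS : Smooth S) : Smooth (lamUV r S) :=
  (contDiff_lamSum hS).sub (contDiff_pb (contDiff_lamSum hS) (contDiff_retr r))

lemma hUV_retr {r : ℝ} (hr : 0 < r) (p : Space7) : hUV (retr r p) = r := by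
  have : (0 : ℝ) < 1 + ‖p.2.2.2‖ ^ 2 := by positivity
  simp only [hUV, retr, norm_real, Real.norm_eq_abs]
  rw [abs_of_pos (by positivity)]
  field_simp

lemma hUV_usc (ζ : ℂ) (p : Space7) : hUV (usc ζ p) = ‖ζ‖ * hUV p := by
  simp only [hUV, usc_apply, norm_mul]
  ring

lemma extDeriv_add' {a b : 𝓐 k} {x} (ha : DifferentiableAt ℝ a x) (hb : DifferentiableAt ℝ b x) :
    extDeriv (fun y => a y + b y) x = extDeriv a x + extDeriv b x := extDeriv_fun_add ha hb

lemma extDeriv_sub' {a b : 𝓐 k} {x} (ha : DifferentiableAt ℝ a x) (hb : DifferentiableAt ℝ b x) : extDeriv (fun y => a y - b y) x = extDeriv a x - extDeriv b x := by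
  have h := extDeriv_add' (ha.sub hb) hb
  have e : (fun y => (a - b) y + b y) = a := by funext y; simp
  rw [e] at h
  rw [h]
  exact (add_sub_cancel_right _ _).symm

lemma extDeriv_extDeriv_zero (ha : Smooth a) (x) : extDeriv (extDeriv a) x = 0 :=
  extDeriv_extDeriv_apply ha.contDiffAt
    (by rw [minSmoothness_of_isRCLikeNormedField]; exact WithTop.coe_le_coe.2 le_top)

lemma extDeriv_avgUV (hS : Smooth S) (hd : ∀ x, extDeriv S x = 0) (x) : extDeriv (avgUV S) x = 0 := by
  have h1 := contDiff_extDeriv (contDiff_lamRot hS)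
  rw [show avgUV S = fun p => S p - extDeriv (lamRot S) p from rfl, extDeriv_sub' (hS.diff _) (h1.diff _), hd, extDeriv_extDeriv_zero (contDiff_lamRot hS), sub_zero]

lemma pb_usc (ζ : ℂ) (a : 𝓐 k) (x : Space7) (v : Fin k → Space7) : pb (usc ζ) a x v = a (usc ζ x) fun i => usc ζ (v i) := by
  rw [pb, (usc ζ).fderiv]
  rfl

lemma avgUV_apply (hS : Smooth S) (hd : ∀ x, extDeriv S x = 0) (x : Space7) (v : Fin 2 → Space7) :
    avgUV S x v = ∫ φ in (0 : ℝ)..1, S (usc (rotFun φ) x) fun i => usc (rotFun φ) (v i) := by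
  have h := extDeriv_homOp_univ (contDiff_ufam contDiff_rotFun) hS hd 1 0 x v
  rw [homPull_ufam contDiff_rotFun, pb_usc, rotFun_one] at h
  simp only [usc_one, add_zero, one_mul, zero_mul, sub_zero, homPull_ufam contDiff_rotFun, pb_usc] at h
  rw [avgUV, ContinuousAlternatingMap.sub_apply, lamRot, h]
  ring

lemma extDeriv_lamCone (hS : Smooth S) (hd : ∀ x, extDeriv S x = 0) (x : Space7) : extDeriv (lamCone S) x = avgUV S x - pb (usc 0) (avgUV S) x := by
  ext v
  have h := extDeriv_homOp_univ (contDiff_ufam contDiff_linFun) (contDiff_avgUV hS) (extDeriv_avgUV hS hd) 0 1 x v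
  rw [lamCone, h, homPull_ufam contDiff_linFun, homPull_ufam contDiff_linFun, pb_usc]
  simp [linFun, usc_one]

lemma extDeriv_lamSum (hS : Smooth S) (hd : ∀ x, extDeriv S x = 0) (x : Space7) : extDeriv (lamSum S) x = S x - pb (usc 0) (avgUV S) x := by
  rw [show lamSum S = fun p => lamRot S p + lamCone S p from rfl, extDeriv_add' ((contDiff_lamRot hS).diff _) ((contDiff_lamCone hS).diff _), extDeriv_lamCone hS hd, avgUV]
  abel

lemma extDeriv_lamUV (hS : Smooth S) (hd : ∀ x, extDeriv S x = 0) {r₁ r : ℝ} (hr : r₁ < r) (hr0 : 0 < r)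
    (h0 : ∀ p, r₁ ≤ hUV p → S p = 0) (x : Space7) : extDeriv (lamUV r S) x = S x := by
  have hq := contDiff_retr r
  have hL := contDiff_lamSum hS
  rw [show lamUV r S = fun p => lamSum S p - pb (retr r) (lamSum S) p from rfl, extDeriv_sub' (hL.diff _) ((contDiff_pb hL hq).diff _),
    extDeriv_pb (hL.diff _) hq.contDiffAt, extDeriv_lamSum hS hd]
  have h1 : pb (retr r) (extDeriv (lamSum S)) x = - pb (usc 0) (avgUV S) x := by
    have e : pb (retr r) (extDeriv (lamSum S)) x = -pb (retr r) (pb (usc 0) (avgUV S)) x := by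
      rw [pb, extDeriv_lamSum hS hd, h0 _ (by rw [hUV_retr hr0]; exact hr.le), zero_sub]
      rfl
    rw [e, ← pb_comp (usc 0).differentiableAt (hq.diff x)]
    congr 2
    funext y
    simp [retr, usc_apply]
  rw [h1]
  abel

end JK

namespace JK
open Complex

variable {k l : ℕ} {S : 𝓐 2}

/-! ### Vanishing of the primitive outside a tube -/

def uvec (x : ℂ) : Space7 := (0, 0, x, 0)

lemma alt2_add_left (A : Alt7 2) (x y z : Space7) : A ![x + y, z] = A ![x, z] + A ![y, z] := by
  have := A.toMultilinearMap.cons_add ![z] x y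
  exact this

lemma alt2_smul_left (A : Alt7 2) (c : ℝ) (x z : Space7) : A ![c • x, z] = c * A ![x, z] := by
  have := A.toMultilinearMap.cons_smul ![z] c x
  exact this

lemma alt2_swap (A : Alt7 2) (x y : Space7) : A ![x, y] = -A ![y, x] := by
  have h := A.map_swap ![y, x] (i := 0) (j := 1) (by decide)
  have h2 : A (![y, x] ∘ Equiv.swap 0 1) = -A ![y, x] := h
  rw [← h2]
  congr 1
  funext i
  fin_cases i <;> rfl

lemma alt2_self (A : Alt7 2) (x : Space7) : A ![x, x] = 0 :=
  A.map_eq_zero_of_eq ![x, x] (i := 0) (j := 1) rfl (by decide)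

lemma uvec_eq (x : ℂ) : uvec x = x.re • uvec 1 + x.im • uvec I := by simp only [uvec, Prod.smul_mk, Prod.mk_add_mk, smul_zero, add_zero, real_smul, mul_one, re_add_im]

lemma alt2_uvec (A : Alt7 2) (x y : ℂ) : A ![uvec x, uvec y] = (x.re * y.im - x.im * y.re) * A ![uvec 1, uvec I] := by
  have h : ∀ z, A ![uvec z, uvec y] = y.re * A ![uvec z, uvec 1] + y.im * A ![uvec z, uvec I] := by
    intro z
    rw [alt2_swap, uvec_eq y, alt2_add_left, alt2_smul_left, alt2_smul_left, alt2_swap A (uvec 1), alt2_swap A (uvec I)]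
    ring
  rw [uvec_eq x, alt2_add_left, alt2_smul_left, alt2_smul_left, h, h, alt2_self, alt2_self, alt2_swap A (uvec I)]
  ring

/-- The coefficient of a form along the fibres. -/
def flux (S : 𝓐 2) (p : Space7) : ℝ := S p ![uvec 1, uvec I]

lemma continuous_flux (hS : Smooth S) : Continuous (flux S) :=
  (ContinuousAlternatingMap.apply ℝ Space7 ℝ ![uvec 1, uvec I]).continuous.comp hS.continuous

lemma usc_uvec (ζ x : ℂ) : usc ζ (uvec x) = uvec (ζ * x) := by simp [usc_apply, uvec]


lemma flux_avgUV (hS : Smooth S) (hd : ∀ x, extDeriv S x = 0) (p : Space7) : flux (avgUV S) p = ∫ φ in (0 : ℝ)..1, flux S (usc (rotFun φ) p) := by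
  rw [flux, avgUV_apply hS hd]
  refine intervalIntegral.integral_congr fun φ _ => ?_
  have e : (fun i => usc (rotFun φ) ((![uvec 1, uvec I] : Fin 2 → Space7) i)) = ![uvec (rotFun φ * 1), uvec (rotFun φ * I)] := by
    funext i
    fin_cases i <;> simp [usc_uvec]
  have h := norm_rotFun φ
  simp only [e]
  rw [alt2_uvec, flux]
  have h2 : (rotFun φ).re ^ 2 + (rotFun φ).im ^ 2 = 1 := by
    have := Complex.sq_norm (rotFun φ)
    rw [h, normSq_apply] at this
    linarith
  simp only [mul_one, mul_re, mul_im, I_re, I_im, mul_zero, zero_sub, add_zero]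
  rw [show (rotFun φ).re * (rotFun φ).re - (rotFun φ).im * -(rotFun φ).im = 1 by linarith [h2], one_mul]

lemma rotFun_add (φ ψ : ℝ) : rotFun (φ + ψ) = rotFun φ * rotFun ψ := by
  rw [rotFun, rotFun, rotFun, ← exp_add]
  congr 1
  push_cast
  ring

lemma flux_avgUV_usc (hS : Smooth S) (hd : ∀ x, extDeriv S x = 0) (p : Space7) (ψ : ℝ) : flux (avgUV S) (usc (rotFun ψ) p) = flux (avgUV S) p := by
  rw [flux_avgUV hS hd, flux_avgUV hS hd]
  have hp : Function.Periodic (fun φ => flux S (usc (rotFun φ) p)) 1 := by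
    intro φ
    simp only [rotFun_add, rotFun_one, mul_one]
  have h1 := intervalIntegral.integral_comp_add_right (a := 0) (b := 1) (fun φ => flux S (usc (rotFun φ) p)) ψ
  have h2 := hp.intervalIntegral_add_eq ψ 0
  simp only [usc_usc, ← rotFun_add]
  rw [h1, zero_add, add_comm 1 ψ, h2, zero_add]

lemma exists_rotFun (u : ℂ) : ∃ ψ : ℝ, u = rotFun ψ * (‖u‖ : ℂ) := by
  refine ⟨arg u / (2 * Real.pi), ?_⟩
  have h : (2 * Real.pi * ((arg u / (2 * Real.pi) : ℝ) : ℂ) * I : ℂ) = arg u * I := by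
    have := Real.pi_ne_zero
    push_cast
    field_simp
  rw [rotFun, h, mul_comm, norm_mul_exp_arg_mul_I]

lemma flux_avgUV_norm (hS : Smooth S) (hd : ∀ x, extDeriv S x = 0) (s : ℝ) (c u v : ℂ) : flux (avgUV S) (s, c, u, v) = flux (avgUV S) (s, c, (‖u‖ : ℂ), v) := by
  obtain ⟨ψ, h⟩ := exists_rotFun u
  conv_lhs => rw [h]
  exact flux_avgUV_usc hS hd (s, c, (‖u‖ : ℂ), v) ψ

lemma integral_rot (f : ℂ → ℝ) (φ : ℝ) : ∫ u : ℂ, f (rotFun φ * u) = ∫ u, f u := by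
  have h := (rotation (⟨rotFun φ, mem_sphere_zero_iff_norm.2 (norm_rotFun φ)⟩ : Circle)).measurePreserving.integral_comp
    (rotation (⟨rotFun φ, mem_sphere_zero_iff_norm.2 (norm_rotFun φ)⟩ : Circle)).toHomeomorph.measurableEmbedding f
  exact h

lemma integral_flux_avgUV (hS : Smooth S) (hd : ∀ x, extDeriv S x = 0) {r₁ : ℝ} (h0 : ∀ p, r₁ ≤ hUV p → S p = 0) (s : ℝ) (c v : ℂ) (hI : ∫ u : ℂ, flux S (s, c, u, v) = 0) :
    ∫ u : ℂ, flux (avgUV S) (s, c, u, v) = 0 := by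
  have h1 : ∀ u : ℂ, flux (avgUV S) (s, c, u, v) = ∫ φ in Set.Ioc (0 : ℝ) 1, flux S (s, c, rotFun φ * u, v) := by
    intro u
    rw [flux_avgUV hS hd, intervalIntegral.integral_of_le zero_le_one]
    rfl
  simp only [h1]
  have hc : Continuous fun q : ℂ × ℝ => flux S (s, c, rotFun q.2 * q.1, v) :=
    (continuous_flux hS).comp (continuous_const.prodMk (continuous_const.prodMk
      (((contDiff_rotFun.continuous.comp continuous_snd).mul continuous_fst).prodMk continuous_const)))
  rw [integral_integral_swap]
  · have : ∀ φ : ℝ, ∫ u : ℂ, flux S (s, c, rotFun φ * u, v) = 0 := fun φ =>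
      (integral_rot (fun u => flux S (s, c, u, v)) φ).trans hI
    simp only [this, integral_zero]
  · have e : (volume : Measure ℂ).prod
        ((volume : Measure ℝ).restrict (Set.Ioc 0 1)) = ((volume : Measure ℂ).prod (volume : Measure ℝ)).restrict
          (Set.univ ×ˢ Set.Ioc 0 1) := by
      rw [← Measure.prod_restrict, Measure.restrict_univ]
    rw [e]
    have h2 : IntegrableOn (fun q : ℂ × ℝ => flux S (s, c, rotFun q.2 * q.1, v))
        (Metric.closedBall 0 r₁ ×ˢ Set.Icc 0 1) (volume.prod volume) :=
      hc.continuousOn.integrableOn_compact ((isCompact_closedBall _ _).prod isCompact_Icc)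
    refine IntegrableOn.of_forall_sdiff_eq_zero h2 (MeasurableSet.univ.prod measurableSet_Ioc) fun q hq => ?_
    have h3 : r₁ < ‖q.1‖ := by
      by_contra h
      exact hq.2 ⟨by simpa using h, Set.Ioc_subset_Icc_self hq.1.2⟩
    have h4 : S (s, c, rotFun q.2 * q.1, v) = 0 := h0 _ ?_
    · show S (s, c, rotFun q.2 * q.1, v) _ = 0
      rw [h4]; rfl
    · simp only [hUV, norm_mul, norm_rotFun, one_mul]
      nlinarith [norm_nonneg q.1, sq_nonneg ‖v‖]

lemma avgUV_zero (hS : Smooth S) (hd : ∀ x, extDeriv S x = 0) {r₁ : ℝ} (h0 : ∀ p, r₁ ≤ hUV p → S p = 0) {p : Space7} (hp : r₁ ≤ hUV p) : avgUV S p = 0 := by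
  ext v
  rw [avgUV_apply hS hd]
  have : ∀ φ, S (usc (rotFun φ) p) = 0 := fun φ => h0 _ (by rwa [hUV_usc, norm_rotFun, one_mul])
  simp [this]

lemma radial_flux (hS : Smooth S) (hd : ∀ x, extDeriv S x = 0) {r₁ : ℝ}
    (h0 : ∀ p, r₁ ≤ hUV p → S p = 0) (s : ℝ) (c v : ℂ) (hI : ∫ u : ℂ, flux S (s, c, u, v) = 0) {u : ℂ} (hu0 : u ≠ 0)
    (hu : r₁ ≤ hUV (s, c, u, v)) : ∫ φ in (0 : ℝ)..1, φ * flux (avgUV S) (s, c, φ * u, v) = 0 := by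
  have h1 := integral_flux_avgUV hS hd h0 s c v hI
  have h2 : ∀ u : ℂ, flux (avgUV S) (s, c, u, v) = (fun y : ℝ => flux (avgUV S) (s, c, (y : ℂ), v)) ‖u‖ :=
    fun u => flux_avgUV_norm hS hd s c u v
  rw [funext h2, integral_fun_norm_addHaar volume
    (fun y : ℝ => flux (avgUV S) (s, c, (y : ℂ), v)), Complex.finrank_real_complex] at h1
  have h3 : volume.real (Metric.ball (0 : ℂ) 1) = Real.pi := by simp [measureReal_def, Complex.volume_ball]
  rw [h3] at h1
  have h4 : ∫ y in Set.Ioi (0 : ℝ), y * flux (avgUV S) (s, c, (y : ℂ), v) = 0 := by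
    have := Real.pi_ne_zero
    simpa [this] using h1
  have hn := norm_pos_iff.2 hu0
  have h5 : ∫ y in (0 : ℝ)..‖u‖, y * flux (avgUV S) (s, c, (y : ℂ), v) = 0 := by
    rw [intervalIntegral.integral_of_le hn.le]
    refine Eq.trans ?_ h4
    refine setIntegral_eq_of_subset_of_forall_sdiff_eq_zero measurableSet_Ioi
      (fun y hy => hy.1) (fun y hy => ?_) |>.symm
    have h6 : ‖u‖ < y := by
      by_contra h
      exact hy.2 ⟨hy.1, not_lt.1 h⟩
    have h7 : avgUV S (s, c, (y : ℂ), v) = 0 := avgUV_zero hS hd h0 ?_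
    · simp only [flux, h7]; exact mul_zero _
    · refine hu.trans ?_
      simp only [hUV, norm_real, Real.norm_eq_abs]
      rw [abs_of_pos (hn.trans h6)]
      gcongr
  have h7 := intervalIntegral.integral_comp_mul_left (a := 0) (b := 1)
    (fun y => y * flux (avgUV S) (s, c, (y : ℂ), v)) hn.ne'
  rw [mul_zero, mul_one, h5, smul_zero] at h7
  have h8 : ∀ φ : ℝ, φ ∈ Set.uIcc (0 : ℝ) 1 → ‖u‖ * (φ * flux (avgUV S) (s, c, φ * u, v)) = ‖u‖ * φ * flux (avgUV S) (s, c, ((‖u‖ * φ : ℝ) : ℂ), v) := by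
    intro φ hφ
    rw [Set.uIcc_of_le zero_le_one] at hφ
    rw [h2, norm_mul, norm_real, Real.norm_eq_abs, abs_of_nonneg hφ.1]
    simp only [mul_comm φ]
    ring
  rw [← intervalIntegral.integral_congr h8, intervalIntegral.integral_const_mul] at h7
  exact (mul_eq_zero.1 h7).resolve_left hn.ne'

lemma lamRot_zero (hS : Smooth S) {r₁ : ℝ} (h0 : ∀ p, r₁ ≤ hUV p → S p = 0) {p : Space7} (hp : r₁ ≤ hUV p) : lamRot S p = 0 := by
  ext v
  rw [lamRot, homOp_apply (contDiff_ufam contDiff_rotFun) hS]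
  have : ∀ φ, S (usc (rotFun φ) p) = 0 := fun φ => h0 _ (by rwa [hUV_usc, norm_rotFun, one_mul])
  simp [homContract_ufam contDiff_rotFun, this]

lemma lamCone_fibre (hS : Smooth S) (hd : ∀ x, extDeriv S x = 0) {r₁ : ℝ} (h0 : ∀ p, r₁ ≤ hUV p → S p = 0)
    (hI : ∀ (s : ℝ) (c v : ℂ), ∫ u : ℂ, flux S (s, c, u, v) = 0) {p : Space7} (hp : r₁ ≤ hUV p) (hp0 : p.2.2.1 ≠ 0)
    (x : ℂ) : lamCone S p ![uvec x] = 0 := by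
  rw [lamCone, homOp_apply (contDiff_ufam contDiff_linFun) (contDiff_avgUV hS)]
  have h1 : ∀ φ : ℝ, (0 * φ + 1) * homContract (ufam linFun) (avgUV S) (p, φ) ![uvec x] =
      (p.2.2.1.re * x.im - p.2.2.1.im * x.re) * (φ * flux (avgUV S) (p.1, p.2.1, φ * p.2.2.1, p.2.2.2)) := by
    intro φ
    rw [homContract_ufam contDiff_linFun, deriv_linFun]
    have e : (Matrix.vecCons ((0, 0, 1 * p.2.2.1, 0) : Space7) fun i => usc (linFun φ) ((![uvec x] : Fin 1 → Space7) i)) = ![uvec p.2.2.1, uvec (φ * x)] := by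
      funext i
      fin_cases i
      · simp [uvec]
      · simp [usc_uvec, linFun]
    rw [e, alt2_uvec]
    simp only [mul_re, mul_im, ofReal_re, ofReal_im, zero_mul, sub_zero, add_zero, flux, usc_apply, linFun]
    ring
  simp only [h1]
  rw [intervalIntegral.integral_const_mul, radial_flux hS hd h0 _ _ _ (hI _ _ _) hp0 hp, mul_zero]

lemma hUV_pos_ne {p : Space7} (h : 0 < hUV p) : p.2.2.1 ≠ 0 := by
  intro h0
  simp [hUV, h0] at h

lemma differentiable_alt1 {a : 𝓐 1} (ha : Smooth a) (w : Space7) : Differentiable ℝ fun p => a p ![w] :=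
  ((ContinuousAlternatingMap.apply ℝ Space7 ℝ ![w]).contDiff.comp ha).diff

lemma extDeriv_one_apply {a : 𝓐 1} (ha : Smooth a) (p x y : Space7) : extDeriv a p ![x, y] = fderiv ℝ (fun q => a q ![y]) p x - fderiv ℝ (fun q => a q ![x]) p y := by
  have h := ha.diff p
  rw [extDeriv_apply h, Fin.sum_univ_two]
  have e0 : (0 : Fin 2).removeNth ![x, y] = ![y] := by funext i; fin_cases i; rfl
  have e1 : (1 : Fin 2).removeNth ![x, y] = ![x] := by funext i; fin_cases i; rfl
  rw [e0, e1]
  have e2 : ∀ z w : Space7, fderiv ℝ (fun q => a q ![z]) p w = (fderiv ℝ a p w) ![z] := by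
    intro z w
    have := ((ContinuousAlternatingMap.apply ℝ Space7 ℝ ![z]).hasFDerivAt.comp p h.hasFDerivAt).fderiv
    exact congrArg (fun L : Space7 →L[ℝ] ℝ => L w) this
  simp [e2, sub_eq_add_neg]

lemma lamCone_const (hS : Smooth S) (hd : ∀ x, extDeriv S x = 0) {r₁ : ℝ} (hr0 : 0 < r₁) (h0 : ∀ p, r₁ ≤ hUV p → S p = 0)
    (hI : ∀ (s : ℝ) (c v : ℂ), ∫ u : ℂ, flux S (s, c, u, v) = 0) {s : ℝ} {c u u' v : ℂ} (hu : r₁ < hUV (s, c, u, v))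
    (hu' : r₁ < hUV (s, c, u', v)) (w : Space7) : lamCone S (s, c, u, v) ![w] = lamCone S (s, c, u', v) ![w] := by
  have hκ : (0 : ℝ) < 1 + ‖v‖ ^ 2 := by positivity
  have hsm := contDiff_lamCone hS
  have hD : ∀ p, r₁ < hUV p → ∀ x, fderiv ℝ (fun q => lamCone S q ![w]) p (uvec x) = 0 := by
    intro p hp x
    have h1 : extDeriv (lamCone S) p ![uvec x, w] = 0 := by
      rw [extDeriv_lamCone hS hd, avgUV_zero hS hd h0 hp.le, zero_sub]
      show -(pb (usc 0) (avgUV S) p ![uvec x, w]) = 0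
      rw [pb_usc, neg_eq_zero]
      exact (avgUV S _).toMultilinearMap.map_coord_zero 0 (by simp [usc_uvec]; rfl)
    rw [extDeriv_one_apply hsm] at h1
    have h2 : (fun q => lamCone S q ![uvec x]) =ᶠ[𝓝 p] fun _ => 0 := by
      filter_upwards [continuous_hUV.continuousAt.eventually_const_lt hp] with q hq
      exact lamCone_fibre hS hd h0 hI hq.le (hUV_pos_ne (hr0.trans hq)) x
    rw [h2.fderiv_eq] at h1
    simpa using h1
  let H : Set ℂ := {z | Real.log (r₁ / (1 + ‖v‖ ^ 2)) < z.re}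
  have hHo : IsOpen H := isOpen_lt continuous_const continuous_re
  have hHc : Convex ℝ H := convex_halfSpace_re_gt _
  have hin : ∀ z ∈ H, r₁ < hUV (s, c, exp z, v) := by
    intro z hz
    have h1 : r₁ / (1 + ‖v‖ ^ 2) < Real.exp z.re := by
      rw [← Real.exp_log (div_pos hr0 hκ)]
      exact Real.exp_lt_exp.2 hz
    rw [div_lt_iff₀ hκ] at h1
    simpa [hUV, Complex.norm_exp] using h1
  have hlog : ∀ u : ℂ, r₁ < hUV (s, c, u, v) → u ≠ 0 ∧ log u ∈ H := by
    intro u hu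
    have h1 : u ≠ 0 := hUV_pos_ne (hr0.trans hu)
    refine ⟨h1, ?_⟩
    show Real.log _ < (log u).re
    rw [log_re]
    exact Real.log_lt_log (div_pos hr0 hκ) ((div_lt_iff₀ hκ).2 hu)
  have hder : ∀ z ∈ H, HasFDerivAt (fun z => lamCone S (s, c, exp z, v) ![w]) (0 : ℂ →L[ℝ] ℝ) z := by
    intro z hz
    have e1 : HasFDerivAt (fun z : ℂ => ((s, c, exp z, v) : Space7)) ((0 : ℂ →L[ℝ] ℝ).prod ((0 : ℂ →L[ℝ] ℂ).prod
        ((exp z • (1 : ℂ →L[ℝ] ℂ)).prod 0))) z := by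
      refine (hasFDerivAt_const _ _).prodMk ((hasFDerivAt_const _ _).prodMk (HasFDerivAt.prodMk ?_ (hasFDerivAt_const _ _)))
      exact (Complex.hasDerivAt_exp z).complexToReal_fderiv
    have e2 := (differentiable_alt1 hsm w).differentiableAt (x := ((s, c, exp z, v) : Space7)) |>.hasFDerivAt
    have e3 := HasFDerivAt.comp z (f := fun z : ℂ => ((s, c, exp z, v) : Space7)) e2 e1
    refine e3.congr_fderiv ?_
    ext x
    exact hD _ (hin z hz) _
  obtain ⟨hu0, hlu⟩ := hlog u hu
  obtain ⟨hu0', hlu'⟩ := hlog u' hu'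
  have := hHc.is_const_of_fderivWithin_eq_zero (𝕜 := ℝ) (f := fun z => lamCone S (s, c, exp z, v) ![w])
    (fun z hz => (hder z hz).differentiableAt.differentiableWithinAt)
    (fun z hz => ((hder z hz).hasFDerivWithinAt.fderivWithin (hHo.uniqueDiffWithinAt hz))) hlu hlu'
  simpa only [exp_log hu0, exp_log hu0'] using this

lemma alt1_add (A : Alt7 1) (x y : Space7) : A ![x + y] = A ![x] + A ![y] := A.toMultilinearMap.cons_add ![] x y

lemma lamUV_zero (hS : Smooth S) (hd : ∀ x, extDeriv S x = 0) {r₁ r : ℝ} (hr0 : 0 < r₁) (hr : r₁ < r) (h0 : ∀ p, r₁ ≤ hUV p → S p = 0)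
    (hI : ∀ (s : ℝ) (c v : ℂ), ∫ u : ℂ, flux S (s, c, u, v) = 0) {p : Space7} (hp : r₁ < hUV p) : lamUV r S p = 0 := by
  have hq := hUV_retr (hr0.trans hr) p
  ext v
  obtain ⟨w, rfl⟩ : ∃ w, v = ![w] := ⟨v 0, by funext i; fin_cases i; rfl⟩
  have hL : ∀ q, r₁ < hUV q → lamSum S q = lamCone S q := by
    intro q hq
    rw [lamSum, lamRot_zero hS h0 hq.le, zero_add]
  rw [lamUV, hL p hp, ContinuousAlternatingMap.sub_apply]
  have e1 : pb (retr r) (lamSum S) p ![w] = lamCone S (retr r p) ![fderiv ℝ (retr r) p w] := by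
    rw [pb, hL _ (by rw [hq]; exact hr)]
    show lamCone S (retr r p) _ = _
    congr 1
    funext i
    fin_cases i
    rfl
  have e2 : ∃ x, fderiv ℝ (retr r) p w = w + uvec x := by
    have h1 := ((contDiff_retr r).diff p).hasFDerivAt
    have h3 : HasFDerivAt (fun q => usc 0 (retr r q)) (usc 0 ∘L fderiv ℝ (retr r) p) p := (usc 0).hasFDerivAt.comp p h1
    have h4 : (fun q => usc 0 (retr r q)) = fun q => usc 0 q := by funext q; simp [retr, usc_apply]
    rw [h4] at h3
    have h5 := h3.unique (usc 0).hasFDerivAt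
    have h6 := congrArg (fun L : Space7 →L[ℝ] Space7 => L w) h5
    simp only [ContinuousLinearMap.comp_apply, usc_apply, zero_mul, Prod.mk.injEq] at h6
    refine ⟨(fderiv ℝ (retr r) p w).2.2.1 - w.2.2.1, ?_⟩
    refine prod_ext₄ ?_ ?_ ?_ ?_
    · simpa [uvec] using h6.1
    · simpa [uvec] using h6.2.1
    · simp [uvec]
    · simpa [uvec] using h6.2.2.2
  obtain ⟨x, hx⟩ := e2
  have hq' : r₁ < hUV (retr r p) := by rw [hq]; exact hr
  rw [e1, hx, alt1_add, lamCone_fibre hS hd h0 hI hq'.le (hUV_pos_ne (hr0.trans hq')), add_zero]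
  refine sub_eq_zero.2 ?_
  exact lamCone_const hS hd hr0 h0 hI (s := p.1) (c := p.2.1) (v := p.2.2.2) hp hq' w

end JK

namespace JK
open Complex

variable {k l : ℕ} {p : Space7} {e : ℝ} {q : Space7}

/-! ### Naturality of the primitives -/

/-- A partial map of the fibre coordinates which is complex linear along the fibres. -/
structure FibreMap (D : Set Space7) (θ : Space7 → Space7) : Prop where
  isOpen : IsOpen D
  mem : ∀ p ∈ D, ∀ u, (p.1, p.2.1, u, p.2.2.2) ∈ D
  smooth : ∀ p ∈ D, SmoothAt θ p
  comm : ∀ ζ p, θ (usc ζ p) = usc ζ (θ p)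
  hUV_eq : ∀ p ∈ D, hUV (θ p) = hUV p

variable {D : Set Space7} {θ : Space7 → Space7}

lemma FibreMap.homOp (hθ : FibreMap D θ) {ζ : ℝ → ℂ} (hζ : Smooth ζ) {a b : 𝓐 (k + 1)} (ha : Smooth a) (hb : Smooth b) (h : ∀ p ∈ D, a p = pb θ b p) (m n : ℝ) (hp : p ∈ D) :
    homOp m n (ufam ζ) a p = pb θ (_root_.homOp m n (ufam ζ) b) p := by
  ext v
  have e1 : pb θ (_root_.homOp m n (ufam ζ) b) p v = _root_.homOp m n (ufam ζ) b (θ p) fun i => fderiv ℝ θ p (v i) := rfl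
  rw [e1, homOp_apply (contDiff_ufam hζ) ha, homOp_apply (contDiff_ufam hζ) hb]
  refine intervalIntegral.integral_congr fun φ _ => ?_
  have hφ : usc (ζ φ) p ∈ D := hθ.mem p hp _
  rw [homContract_ufam hζ, homContract_ufam hζ, h _ hφ]
  have hd := ((hθ.smooth _ hφ).diffAt).hasFDerivAt
  have hd0 := ((hθ.smooth _ hp).diffAt).hasFDerivAt
  congr 1
  show b (θ (usc (ζ φ) p)) _ = _
  rw [hθ.comm]
  congr 1
  funext i
  refine Fin.cases ?_ (fun i => ?_) i
  · have h1 := fderiv_ufam_param hζ (p, φ)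
    rw [fderiv_ufam_param_eq hζ] at h1
    have h2 := hd.comp_hasDerivAt (f := fun φ => usc (ζ φ) p) φ h1
    have h3 := fderiv_ufam_param hζ (θ p, φ)
    rw [fderiv_ufam_param_eq hζ] at h3
    refine h2.unique (h3.congr_of_eventuallyEq (.of_forall fun t => ?_))
    exact hθ.comm _ _
  · have h2 := HasFDerivAt.comp p hd (usc (ζ φ)).hasFDerivAt
    have h3 := (usc (ζ φ)).hasFDerivAt.comp p hd0
    have h4 := h2.unique (h3.congr_of_eventuallyEq (.of_forall fun t => hθ.comm _ _))
    exact congrArg (fun L : Space7 →L[ℝ] Space7 => L (v i)) h4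

variable {S S' : 𝓐 2}



lemma FibreMap.lamSum (hθ : FibreMap D θ) (hS : Smooth S) (hS' : Smooth S') (h : ∀ p ∈ D, S p = pb θ S' p) (hp : p ∈ D) : lamSum S p = pb θ (JK.lamSum S') p := by
  have h1 : ∀ p ∈ D, lamRot S p = pb θ (lamRot S') p := fun p hp => hθ.homOp contDiff_rotFun hS hS' h 1 0 hp
  have h2 : ∀ p ∈ D, avgUV S p = pb θ (avgUV S') p := by
    intro p hp
    have e : lamRot S =ᶠ[𝓝 p] pb θ (lamRot S') := by
      filter_upwards [hθ.isOpen.mem_nhds hp] with q hq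
      exact h1 q hq
    rw [avgUV, e.extDeriv_eq, extDeriv_pb ((contDiff_lamRot hS').diff _) (hθ.smooth p hp), h p hp]
    rfl
  have h3 : lamCone S p = pb θ (lamCone S') p :=
    hθ.homOp contDiff_linFun (contDiff_avgUV hS) (contDiff_avgUV hS') h2 0 1 hp
  rw [JK.lamSum, h1 p hp, h3]
  rfl

lemma retr_usc (r : ℝ) (ζ : ℂ) (p : Space7) : retr r (usc ζ p) = retr r p := rfl

lemma FibreMap.lamUV (hθ : FibreMap D θ) (hS : Smooth S) (hS' : Smooth S') (h : ∀ p ∈ D, S p = pb θ S' p) {r₁ r : ℝ} (h0 : ∀ p, r₁ < hUV p → lamUV r S p = 0)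
    (h0' : ∀ p, r₁ < hUV p → lamUV r S' p = 0) (hp : p ∈ D) : lamUV r S p = pb θ (JK.lamUV r S') p := by
  have hq := contDiff_retr r
  let δ : 𝓐 1 := fun p => pb (fun y => retr r (θ y)) (JK.lamSum S') p - pb (retr r) (JK.lamSum S) p
  have hδ : ∀ p ∈ D, JK.lamUV r S p - pb θ (JK.lamUV r S') p = δ p := by
    intro p hp
    have e1 : pb θ (JK.lamUV r S') p = pb θ (JK.lamSum S') p - pb (fun y => retr r (θ y)) (JK.lamSum S') p := by
      rw [pb_comp (hq.diff _) ((hθ.smooth p hp).diffAt)]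
      rfl
    rw [e1, JK.lamUV, hθ.lamSum hS hS' h hp]
    show _ = _ - _
    abel
  let t : ℂ := ((‖p.2.2.1‖ + |r₁| + 1 : ℝ) : ℂ)
  let Z : Space7 → Space7 := fun q => q + uvec t
  have hZp : Z p = (p.1, p.2.1, p.2.2.1 + t, p.2.2.2) := by exact Prod.ext (add_zero _) (Prod.ext (add_zero _) (Prod.ext rfl (add_zero _)))
  have hZD : Z p ∈ D := by rw [hZp]; exact hθ.mem p hp _
  have hZd : DifferentiableAt ℝ Z p := by
    show DifferentiableAt ℝ (fun q => q + uvec t) p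
    fun_prop
  have hZr : ∀ q, retr r (Z q) = retr r q := by
    intro q
    rw [← retr_usc r 0 (Z q), ← retr_usc r 0 q, map_add, usc_uvec, zero_mul]
    congr 1
    exact add_zero _
  have hZθ : ∀ q, retr r (θ (Z q)) = retr r (θ q) := by
    intro q
    rw [← retr_usc r 0 (θ (Z q)), ← retr_usc r 0 (θ q), ← hθ.comm, ← hθ.comm, map_add, usc_uvec, zero_mul]
    congr 2
    exact add_zero _
  have hδZ : δ p = pb Z δ p := by
    have e1 : pb (retr r) (JK.lamSum S) p = pb Z (pb (retr r) (JK.lamSum S)) p := by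
      rw [← pb_comp (hq.diff _) hZd]
      exact pb_congr (.of_forall fun q => (hZr q).symm)
    have e2 : pb (fun y => retr r (θ y)) (JK.lamSum S') p = pb Z (pb (fun y => retr r (θ y)) (JK.lamSum S')) p := by
      rw [← pb_comp (f := fun y => retr r (θ y)) ((hq.diff _).comp (Z p)
        ((hθ.smooth _ hZD).diffAt)) hZd]
      exact pb_congr (.of_forall fun q => (hZθ q).symm)
    show _ - _ = _
    rw [e1, e2]
    rfl
  have hbig : r₁ < hUV (Z p) := by
    rw [hZp]
    have h1 : |r₁| + 1 ≤ ‖p.2.2.1 + t‖ := by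
      have h2 := norm_sub_norm_le t (-p.2.2.1)
      rw [sub_neg_eq_add, norm_neg, add_comm t] at h2
      have h3 : ‖t‖ = ‖p.2.2.1‖ + |r₁| + 1 := by rw [norm_real, Real.norm_eq_abs, abs_of_nonneg (by positivity)]
      linarith
    have h2 := le_abs_self r₁
    simp only [hUV]
    nlinarith [sq_nonneg ‖p.2.2.2‖, abs_nonneg r₁]
  rw [← sub_eq_zero, hδ p hp, hδZ]
  refine pb_zero ?_
  rw [← hδ _ hZD, h0 _ hbig, zero_sub, neg_eq_zero]
  exact pb_zero (h0' _ (by rwa [hθ.hUV_eq _ hZD]))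

/-! ### Coordinate changes near an exceptional divisor -/

/-- The change of coordinates between the two charts of the projective line. -/
def flip (p : Space7) : Space7 := (p.1, p.2.1, p.2.2.1 * p.2.2.2 ^ 2, p.2.2.2⁻¹)

lemma fibreMap_flip : FibreMap {p | p.2.2.2 ≠ 0} flip where
  isOpen := isOpen_ne_fun (by fun_prop) continuous_const
  mem _ hp _ := hp
  smooth p hp := by
    have h1 : SmoothAt (fun p : Space7 => p.2.2.2) p := projZ.contDiff.contDiffAt
    have h2 : SmoothAt (fun p : Space7 => p.2.2.1) p := projW.contDiff.contDiffAt
    exact contDiffAt_fst.prodMk ((contDiffAt_fst.comp p contDiffAt_snd).prodMk ((h2.mul (h1.pow 2)).prodMk (h1.inv hp)))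
  comm ζ p := by simp [flip, usc_apply, mul_assoc]
  hUV_eq p hp := by
    have h : ‖p.2.2.2‖ ≠ 0 := norm_ne_zero_iff.2 hp
    simp only [hUV, flip, norm_mul, norm_pow, norm_inv]
    field_simp
    ring

/-- The action on the fibre coordinates of an element of the group that preserves a tube. -/
def signUV (e σ : ℝ) (α : ℂ) (p : Space7) : Space7 := (p.1 + σ, e * p.2.1 + α, p.2.2.1, e * p.2.2.2)

lemma sq_norm_sign (he : e = 1 ∨ e = -1) (v : ℂ) : ‖(e : ℂ) * v‖ = ‖v‖ := by rcases he with rfl | rfl <;> simp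

lemma fibreMap_signUV (he : e = 1 ∨ e = -1) (σ α) : FibreMap Set.univ (signUV e σ α) where
  isOpen := isOpen_univ
  mem _ _ _ := trivial
  smooth p _ := by
    have h1 : Smooth (fun p : Space7 => p.2.2.2) := projZ.contDiff
    have h2 : Smooth (fun p : Space7 => p.2.2.1) := projW.contDiff
    have h3 : Smooth (fun p : Space7 => p.2.1) := contDiff_fst.comp contDiff_snd
    exact ((contDiff_fst.add contDiff_const).prodMk (((contDiff_const.mul h3).add contDiff_const).prodMk
      (h2.prodMk (contDiff_const.mul h1)))).contDiffAt
  comm ζ p := rfl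
  hUV_eq p _ := by simp only [hUV, signUV, sq_norm_sign he]

lemma psiQ_flip (j b) (hp : p.2.2.2 ≠ 0) : psiQ j (!b) (flip p) = psiQ j b p := by
  obtain ⟨s, c, u, v⟩ := p
  have hv : v ≠ 0 := hp
  by_cases hu : u = 0
  · subst hu
    rw [flip, zero_mul, psiQ_zero, psiQ_zero, lnQ, lnQ, line_dir_inv j s c hv]
  · have h := csqrt_sq u
    rw [flip, psiQ_eq (r := csqrt u * v) (mul_ne_zero hu (pow_ne_zero 2 hv)) (by rw [mul_pow, h]), psiQ_eq hu h]
    congr 2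
    cases b <;> simp [blow, dir, hv]

lemma image_line_sign {g : Perm7} {j : Fin 10} {i e σ : ℝ} {α : ℂ} (hi : i = 1 ∨ i = -1) (h : ∀ p, g (tubeMap j p) = tubeMap j (signMap i e σ α p)) (s c w) :
    g '' line j s c w = line j (s + σ) (e * c + α) (w.1, e * w.2) := by
  have hi0 : (i : ℂ) ≠ 0 := by rcases hi with rfl | rfl <;> simp
  rw [← line_smul j (s + σ) (e * c + α) _ hi0, line, line, ← Set.range_comp]
  congr 1
  ext1 l
  simp only [Function.comp_apply, h, signMap]
  rw [show (i : ℂ) * (l * w.1) = l * (i * w.1) by ring, show (i : ℂ) * (e * (l * w.2)) = l * (i * (e * w.2)) by ring]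

lemma line_dir_sign (j s c) {b : Bool} (he : e = 1 ∨ e = -1) (v : ℂ) : line j s c ((dir b v).1, e * (dir b v).2) = line j s c (dir b (e * v)) := by
  have he0 : (e : ℂ) ≠ 0 := by rcases he with rfl | rfl <;> simp
  have he2 : (e : ℂ) * e = 1 := by rcases he with rfl | rfl <;> simp
  cases b
  · simp [dir]
  · rw [← line_smul j s c (dir true (e * v)) he0]
    simp [dir, ← mul_assoc, he2]

lemma psiQ_signUV {g} (hg : g ∈ Gam) {j : Fin 10} {i e σ : ℝ} {α : ℂ} (hi : i = 1 ∨ i = -1) (he : e = 1 ∨ e = -1)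
    (h : ∀ p, g (tubeMap j p) = tubeMap j (signMap i e σ α p)) (b) (p : Space7) : psiQ j b (signUV e σ α p) = psiQ j b p := by
  obtain ⟨s, c, u, v⟩ := p
  have he2 : (e : ℂ) * e = 1 := by rcases he with rfl | rfl <;> simp
  have hi2 : (i : ℂ) ^ 2 = 1 := by rcases hi with rfl | rfl <;> simp
  by_cases hu : u = 0
  · subst hu
    rw [signUV, psiQ_zero, psiQ_zero, eq_comm, lnQ_eq]
    refine ⟨g, hg, ?_, ?_⟩
    · rw [h]; simp [signMap]
    · rw [image_line_sign hi h, line_dir_sign _ _ _ he]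
  · have hr := csqrt_sq u
    rw [signUV, psiQ_eq hu hr, psiQ_eq (r := i * (if b then e else 1) * csqrt u) hu, eq_comm, ptQ_eq]
    · refine ⟨g, hg, ?_⟩
      rw [h]
      rcases hi with rfl | rfl <;> rcases he with rfl | rfl <;> cases b <;> simp [blow, dir, signMap]
    · rw [mul_pow, mul_pow, hi2, hr]
      cases b <;> simp [sq, he2]

/-! ### A form on the resolution near an exceptional divisor -/

/-- A form in the coordinates near an exceptional divisor, extended by zero. -/
def fibreForm (η : 𝓓 k) (j : Fin 10) (b : Bool) (p : Space7) : Alt7 k :=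
  if hUV p < sqRadius then loc η (some (j, b)) p else 0

lemma radSq_eq_of_smul {g} (hg : g ∈ Gam) {j : Fin 10} {p q : Space7} (hp : radSq p < sqRadius)
    (hq : radSq q < sqRadius) (h : g (tubeMap j p) = tubeMap j q) : radSq p = radSq q := by
  obtain ⟨-, i, e, σ, α, hi, he, hh⟩ := Gam_match hg hp hq h
  have h1 : tubeMap j q = tubeMap j (signMap i e σ α p) := by rw [← h]; exact hh _ _ _ _
  rw [← tubeInv_tubeMap j q, h1, tubeInv_tubeMap, radSq_signMap hi he]

/-- The form vanishes on the regular part outside the tube of radius `r` around a divisor. -/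
def SupportedIn (η : 𝓓 k) (j : Fin 10) (r : ℝ) : Prop :=
  ∀ x ∈ regular, x ∉ orbTube j r → loc η none x = 0

variable {η : 𝓓 k} {j : Fin 10} {r : ℝ}

lemma fibreForm_zero (hη : SupportedIn η j r) (hr0 : 0 < r) (hr : r < sqRadius) (b) (hp : r ≤ hUV p) : fibreForm η j b p = 0 := by
  unfold fibreForm
  split_ifs with h
  · have h0 := hUV_pos_ne (hr0.trans_le hp)
    have hd := mem_domJ_of_hUV (j := j) (b := b) h
    have hr0 := csqrt_ne h0
    rw [loc_up η h0 hd hr0 (contDiffAt_up' h0 (csqrt_sq _) j b).continuousAt]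
    refine pb_zero (hη _ ((domJ_up hr0 j b h0).1 hd) ?_)
    rintro ⟨g, hg, q, hq, e⟩
    have e2 : radSq (bl b (csqrt p.2.2.1) p) = hUV p := radSq_bl hr0
    have := radSq_eq_of_smul hg (hq.trans hr) (e2.trans_lt h) (e : g (tubeMap j q) = tubeMap j (bl b _ p))
    linarith
  · rfl

lemma fibreForm_eventuallyEq {b} (h : hUV p < sqRadius) : fibreForm η j b =ᶠ[𝓝 p] loc η (some (j, b)) := by
  filter_upwards [continuous_hUV.continuousAt.eventually_lt_const h] with q hq
  exact if_pos hq

lemma fibreForm_eventually_zero (hη : SupportedIn η j r) (hr0 : 0 < r) (hr : r < sqRadius) {b} {p : Space7} (hp : r < hUV p) : ∀ᶠ q in 𝓝 p, fibreForm η j b q = 0 := by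
  filter_upwards [continuous_hUV.continuousAt.eventually_const_lt hp] with q hq
  exact fibreForm_zero hη hr0 hr b hq.le

lemma contDiff_fibreForm (hη : SupportedIn η j r) (hr0 : 0 < r) (hr : r < sqRadius) (b) : Smooth (fibreForm η j b) := by
  refine contDiff_iff_contDiffAt.2 fun p => ?_
  by_cases h : hUV p < sqRadius
  · exact (contDiffAt_loc η (i := some (j, b)) (mem_domJ_of_hUV h)).congr_of_eventuallyEq (fibreForm_eventuallyEq h)
  · have h1 : fibreForm η j b =ᶠ[𝓝 p] fun _ => 0 := fibreForm_eventually_zero hη hr0 hr (hr.trans_le (not_lt.1 h))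
    exact contDiffAt_const.congr_of_eventuallyEq h1

lemma extDeriv_fibreForm (hη : SupportedIn η j r) (hr0 : 0 < r) (hr : r < sqRadius) (hd : DiffForm.d η = 0) (b) (p) : extDeriv (fibreForm η j b) p = 0 := by
  by_cases h : hUV p < sqRadius
  · rw [(fibreForm_eventuallyEq h).extDeriv_eq, ← loc_d η (i := some (j, b)) (mem_domJ_of_hUV h), hd, loc_zero]
  · exact extDeriv_of_eventually_zero (fibreForm_eventually_zero hη hr0 hr (hr.trans_le (not_lt.1 h)))

lemma fibreForm_natural {θ : Space7 → Space7} {b b' : Bool} {D : Set Space7} (hθ : FibreMap D θ) (h : ∀ p ∈ D, psiQ j b' (θ p) = psiQ j b p) (hp : p ∈ D) :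
    fibreForm η j b p = pb θ (fibreForm η j b') p := by
  have e := hθ.hUV_eq p hp
  by_cases hh : hUV p < sqRadius
  · rw [fibreForm, if_pos hh, loc_lift η (i := some (j, b)) (j := some (j, b')) (g := θ) (mem_domJ_of_hUV hh)
      (hθ.smooth p hp).continuousAt (mem_domJ_of_hUV (by rwa [e]))]
    · exact pb_congr_form (by rw [fibreForm, if_pos (by rwa [e])])
    · filter_upwards [hθ.isOpen.mem_nhds hp] with q hq
      exact congrArg toResolution (h q hq)
  · rw [fibreForm, if_neg hh, pb_zero]
    rw [fibreForm, if_neg (by rwa [e])]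

/-! ### From the fibre coordinates to the tube -/

def wAt (b : Bool) (p : Space7) : ℂ := if b then p.2.2.2 else p.2.2.1

lemma hUV_unblow {b : Bool} (h : wAt b p ≠ 0) : hUV (unblow b p) = radSq p := by
  have := norm_pos_iff.2 h
  cases b
  · have h : (0 : ℝ) < ‖p.2.2.1‖ := this
    simp [hUV, unblow, radSq]; field_simp
  · have h : (0 : ℝ) < ‖p.2.2.2‖ := this
    simp [hUV, unblow, radSq]; field_simp; ring

lemma flip_unblow (h : p.2.2.1 ≠ 0) (h' : p.2.2.2 ≠ 0) : flip (unblow false p) = unblow true p := by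
  simp [flip, unblow]
  field_simp

lemma unblow_signMap {i e : ℝ} (hi : i = 1 ∨ i = -1) (he : e = 1 ∨ e = -1) (σ α b) (p : Space7) : unblow b (signMap i e σ α p) = signUV e σ α (unblow b p) := by
  rcases hi with rfl | rfl <;> rcases he with rfl | rfl <;> cases b <;> simp [unblow, signMap, signUV, neg_div, div_neg]

lemma unblow_bl (b) {r : ℂ} (hr : r ≠ 0) (hq : q.2.2.1 ≠ 0) : unblow b (bl b r q) = q := by rw [bl, branchMap, unblow_blow _ _ _ _ _ (branch_ne hr hq), branch_sq hr]

lemma wAt_bl (b) {r : ℂ} (hr : r ≠ 0) (hq : q.2.2.1 ≠ 0) : wAt b (bl b r q) ≠ 0 := by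
  have := branch_ne hr hq
  cases b <;> simpa [wAt, bl, branchMap, blow, dir] using this

/-- The form in the coordinates of the tube with given expressions in the fibre coordinates. -/
def tubeForm (L : Bool → 𝓐 k) (p : Space7) : Alt7 k :=
  if p.2.2.1 ≠ 0 then pb (unblow false) (L false) p else if p.2.2.2 ≠ 0 then pb (unblow true) (L true) p else 0

lemma tubeForm_eq {L : Bool → 𝓐 k} (hL : ∀ p, p.2.2.2 ≠ 0 → L false p = pb flip (L true) p) {b : Bool} (h : wAt b p ≠ 0) : tubeForm L p = pb (unblow b) (L b) p := by
  unfold tubeForm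
  split_ifs with h1 h1'
  · cases b
    · rfl
    · have h2 : p.2.2.2 ≠ 0 := h
      have h3 : (unblow false p).2.2.2 ≠ 0 := div_ne_zero h2 h1
      rw [pb_congr_form (hL _ h3), ← pb_comp ((fibreMap_flip.smooth _ h3).diffAt)
        ((contDiffAt_unblow (b := false) h1).diffAt)]
      refine pb_congr ?_
      filter_upwards [projW.continuous.continuousAt.eventually_ne h1, projZ.continuous.continuousAt.eventually_ne h2] with q hq hq'
      exact flip_unblow hq hq'
  · cases b
    · exact absurd h h1
    · rfl
  · cases b
    · exact absurd h h1
    · exact absurd h h1'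

lemma continuous_wAt (b) : Continuous (wAt b) := by
  cases b
  · exact projW.continuous
  · exact projZ.continuous

lemma exists_wAt_ne (h : radSq p ≠ 0) : ∃ b, wAt b p ≠ 0 := by
  by_contra h1
  push Not at h1
  have h2 : p.2.2.1 = 0 := h1 false
  have h3 : p.2.2.2 = 0 := h1 true
  exact h (by simp [radSq, h2, h3])

lemma tubeForm_eventuallyEq {L : Bool → 𝓐 k} (hL : ∀ p, p.2.2.2 ≠ 0 → L false p = pb flip (L true) p)
    {b : Bool} (h : wAt b p ≠ 0) : tubeForm L =ᶠ[𝓝 p] pb (unblow b) (L b) := by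
  filter_upwards [(continuous_wAt b).continuousAt.eventually_ne h] with q hq
  exact tubeForm_eq hL hq

lemma pb_bl_tubeForm {L : Bool → 𝓐 k} (hL : ∀ p, p.2.2.2 ≠ 0 → L false p = pb flip (L true) p) {b : Bool} {r : ℂ} (hq : q.2.2.1 ≠ 0) (hr : r ^ 2 = q.2.2.1) :
    pb (bl b r) (tubeForm L) q = L b q := by
  have hr0 : r ≠ 0 := by
    rintro rfl
    exact hq (by rw [← hr]; simp)
  have h := wAt_bl b hr0 hq
  rw [pb_congr_form (tubeForm_eq hL h), ← pb_comp ((contDiffAt_unblow h).diffAt)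
    ((contDiffAt_bl hq hr b).diffAt)]
  refine pb_of_eventuallyEq_id ?_
  filter_upwards [eventually_ne_zero hq] with p hp
  exact unblow_bl b hr0 hp

end JK

namespace JK
open Complex

variable {k l : ℕ} {η : 𝓓 2} {j : Fin 10} {r : ℝ}

/-! ### Uniqueness of the Thom class -/

lemma loc_none_eq_fibreForm (η : 𝓓 k) {g} (hg : g ∈ Gam) {x} (hx : x ∈ regular) (hp : radSq (tubeCo j g x) < sqRadius) {b} (hb : wAt b (tubeCo j g x) ≠ 0) :
    loc η none x = pb (tubeCo j g) (pb (unblow b) (fibreForm η j b)) x := by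
  have h1 := contDiffAt_unblow (b := b) (s := (tubeCo j g x).1) (c := (tubeCo j g x).2.1) (w := (tubeCo j g x).2.2.1)
    (z := (tubeCo j g x).2.2.2) hb
  have hd := (contDiff_tubeCo (j := j) hg).contDiffAt (x := x)
  have hh : hUV (unblow b (tubeCo j g x)) < sqRadius := by rwa [hUV_unblow hb]
  rw [← pb_comp (h1.diffAt) (hd.diffAt), loc_lift η (i := none) (j := some (j, b)) (g := fun y => unblow b (tubeCo j g y)) hx
      (ContinuousAt.comp (g := unblow b) h1.continuousAt hd.continuousAt) (mem_domJ_of_hUV hh)]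
  · exact pb_congr_form (by rw [fibreForm, if_pos hh])
  · filter_upwards [hd.continuousAt.eventually_mem ((isOpen_ne_fun (continuous_wAt b) continuous_const).mem_nhds hb)] with y hy
    refine congrArg toResolution (?_ : psiQ j b _ = ptQ _)
    rw [psiQ_unblow hy, ptQ_eq]
    exact ⟨g, hg, apply_tubeCo j g y⟩

lemma isExact_of_flux (hη : SupportedIn η j r) (hr0 : 0 < r) (hr : r < sqRadius) (hd : DiffForm.d η = 0)
    (hI : ∀ (b : Bool) (s : ℝ) (c v : ℂ), ∫ u : ℂ, flux (fibreForm η j b) (s, c, u, v) = 0) : DiffForm.IsExact η := by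
  let S : Bool → 𝓐 2 := fibreForm η j
  obtain ⟨r', hr', hr''⟩ := exists_between hr
  have hS : ∀ b, Smooth (S b) := contDiff_fibreForm hη hr0 hr
  have hSd : ∀ b p, extDeriv (S b) p = 0 := extDeriv_fibreForm hη hr0 hr hd
  have hS0 : ∀ b p, r ≤ hUV p → S b p = 0 := fun b p hp => fibreForm_zero hη hr0 hr b hp
  let L : Bool → 𝓐 1 := fun b => lamUV r' (S b)
  have hL : ∀ b, Smooth (L b) := fun b => contDiff_lamUV r' (hS b)
  have hLd : ∀ b p, extDeriv (L b) p = S b p := fun b p => extDeriv_lamUV (hS b) (hSd b) hr' (hr0.trans hr') (hS0 b) p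
  have hL0 : ∀ b p, r < hUV p → L b p = 0 := fun b p hp => lamUV_zero (hS b) (hSd b) hr0 hr' (hS0 b) (hI b) hp
  have hflip : ∀ p, p.2.2.2 ≠ 0 → L false p = pb flip (L true) p := fun p hp =>
    fibreMap_flip.lamUV (hS false) (hS true) (fun q hq => fibreForm_natural (b' := true) fibreMap_flip
      (fun p hp => psiQ_flip j false hp) hq) (hL0 false) (hL0 true) hp
  let t := tubeForm L
  have ht0 : ∀ p, r' ≤ radSq p → t p = 0 := by
    intro p hp
    obtain ⟨b, hb⟩ := exists_wAt_ne (p := p) (by linarith)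
    exact (tubeForm_eq hflip hb).trans (pb_zero (hL0 b _ (by rw [hUV_unblow hb]; linarith)))
  have hts : ∀ p, radSq p ≠ 0 → SmoothAt t p := by
    intro p hp
    obtain ⟨b, hb⟩ := exists_wAt_ne hp
    exact (contDiffAt_pb (hL b).contDiffAt (contDiffAt_unblow hb)).congr_of_eventuallyEq (tubeForm_eventuallyEq hflip hb)
  have htd : ∀ p b, wAt b p ≠ 0 → extDeriv t p = pb (unblow b) (S b) p := by
    intro p b hb
    rw [(tubeForm_eventuallyEq hflip hb).extDeriv_eq, extDeriv_pb ((hL b).diff _) (contDiffAt_unblow hb)]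
    exact pb_congr_form (hLd b _)
  have htinv : TubeInvariant (single j t) := by
    intro j' g hg p hp hp'
    by_cases hj : j' = j
    · subst hj
      rw [single_self]
      obtain ⟨i, e, σ, α, hi, he, hh⟩ := exists_tubeAct_eq hg hp hp'
      have h1 : ∀ p, g (tubeMap j' p) = tubeMap j' (signMap i e σ α p) := by
        intro p
        rw [← hh, tubeAct, tubeMap_tubeInv]
      rw [hh]
      by_cases h0 : radSq p = 0
      · have h2 : p.2.2.1 = 0 := by
          have := radSq_eq p
          rw [radSq] at h0
          have h3 : ‖p.2.2.1‖ ^ 2 = 0 := by nlinarith [sq_nonneg ‖p.2.2.1‖, sq_nonneg ‖p.2.2.2‖]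
          simpa using h3
        have h3 : p.2.2.2 = 0 := by
          rw [radSq, h2] at h0
          simpa using h0
        have e1 : ∀ q : Space7, q.2.2.1 = 0 → q.2.2.2 = 0 → t q = 0 := by
          intro q hq hq'
          show tubeForm L q = 0
          rw [tubeForm, if_neg (by simpa using hq), if_neg (by simpa using hq')]
        rw [e1 p h2 h3, pb_zero (e1 _ (by simp [signMap, h2]) (by simp [signMap, h3]))]
      · obtain ⟨b, hb⟩ := exists_wAt_ne h0
        have hb' : wAt b (signMap i e σ α p) ≠ 0 := by rcases hi with rfl | rfl <;> rcases he with rfl | rfl <;> cases b <;> simpa [wAt, signMap] using hb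
        have h2 : L b (unblow b p) = pb (signUV e σ α) (L b) (unblow b p) :=
          (fibreMap_signUV he σ α).lamUV (hS b) (hS b) (fun q hq => fibreForm_natural (fibreMap_signUV he σ α)
            (fun p _ => psiQ_signUV hg hi he h1 b p) hq) (hL0 b) (hL0 b) trivial
        have h3 := (hasFDerivAt_signMap i e σ α p).differentiableAt
        show tubeForm L p = pb _ (tubeForm L) p
        rw [tubeForm_eq hflip hb, pb_congr_form (tubeForm_eq hflip hb'), ← pb_comp ((contDiffAt_unblow hb').diffAt) h3, pb_congr_form h2,
          ← pb_comp (((fibreMap_signUV he σ α).smooth _ trivial).diffAt)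
            ((contDiffAt_unblow hb).diffAt)]
        exact pb_congr (.of_forall fun q => (unblow_signMap hi he σ α b q).symm)
    · rw [single_ne hj]
      rfl
  have hG : IsGForm (glue (single j t)) := by
    refine isGForm_glue htinv hr'' (fun j' p hp => ?_) (fun j' p hp => ?_) fun j' b s c v => ?_
    · by_cases hj : j' = j
      · rw [hj, single_self, ht0 p hp]
      · rw [single_ne hj]; rfl
    · by_cases hj : j' = j
      · rw [hj, single_self]; exact hts p hp
      · rw [single_ne hj]; exact contDiffAt_const
    · by_cases hj : j' = j
      · rw [hj, single_self]
        exact ⟨L b, (hL b).contDiffAt, .of_forall fun q hq r hr => (pb_bl_tubeForm hflip hq hr).symm⟩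
      · rw [single_ne hj]
        exact ⟨0, contDiffAt_const, .of_forall fun q _ r _ => rfl⟩
  refine ⟨hG.toForm, d_toForm_eq hG fun x hx => ?_⟩
  by_cases h : ∃ j', x ∈ orbTube j' sqRadius
  · obtain ⟨j', h⟩ := h
    obtain ⟨g, hg, hp⟩ := exists_tubeCo h
    have hne := radSq_ne_of_regular (j := j') hx hg
    by_cases hj : j' = j
    · subst hj
      obtain ⟨b, hb⟩ := exists_wAt_ne hne
      rw [extDeriv_glue htinv hg hp (by rw [single_self]; exact (hts _ hne).diffAt), single_self, loc_none_eq_fibreForm η hg hx hp hb]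
      exact pb_congr_form (htd _ b hb)
    · rw [extDeriv_glue htinv hg hp (by rw [single_ne hj]; exact differentiableAt_const _), single_ne hj, hη x hx fun h2 => hj (orbTube_disjoint h (orbTube_mono hr.le h2))]
      exact pb_zero (extDeriv_zero_form _)
  · push Not at h
    rw [hη x hx fun h2 => h j (orbTube_mono hr.le h2)]
    refine extDeriv_of_eventually_zero (glue_eventually_zero htinv hr'' (fun j' p hp => ?_) h)
    by_cases hj : j' = j
    · rw [hj, single_self, ht0 p hp]
    · rw [single_ne hj]; rfl

lemma IsThomForm.exists_supportedIn {τ : 𝓓 2} (h : IsThomForm j τ) : ∃ r, 0 < r ∧ r < sqRadius ∧ SupportedIn τ j r := by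
  obtain ⟨-, ⟨K, hK, hKj, h0⟩, -⟩ := h
  rw [rho_preimage_tube] at hKj
  obtain ⟨r, hr0, hr, hKr⟩ := exists_radius hK hKj
  refine ⟨r, hr0, hr, fun x hx hxr => ?_⟩
  rw [← valueAt_param_eq_zero τ (i := none) hx]
  exact h0 _ fun hm => hxr ((param_none_mem_rhoTube hx).1 (hKr hm))

lemma SupportedIn.mono {η : 𝓓 k} {r r'} (h : SupportedIn η j r) (hr : r ≤ r') : SupportedIn η j r' := fun x hx hxr => h x hx fun h' => hxr (orbTube_mono hr h')

lemma SupportedIn.sub {η η' : 𝓓 k} {r} (h : SupportedIn η j r) (h' : SupportedIn η' j r) :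
    SupportedIn (η - η') j r := fun x hx hxr => by rw [loc_sub, h x hx hxr, h' x hx hxr, sub_zero]

lemma integrable_flux {η : 𝓓 2} (hη : SupportedIn η j r) (hr0 : 0 < r) (hr : r < sqRadius)
    (b) (s : ℝ) (c v : ℂ) : Integrable fun u : ℂ => flux (fibreForm η j b) (s, c, u, v) := by
  have hc : Continuous fun u : ℂ => flux (fibreForm η j b) (s, c, u, v) :=
    (continuous_flux (contDiff_fibreForm hη hr0 hr b)).comp (by fun_prop)
  refine hc.integrable_of_hasCompactSupport (HasCompactSupport.of_support_subset_isCompact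
    (isCompact_closedBall (0 : ℂ) r) fun u hu => ?_)
  by_contra h
  refine hu ?_
  have h1 : r < ‖u‖ := by simpa using h
  show fibreForm η j b (s, c, u, v) _ = 0
  rw [fibreForm_zero hη hr0 hr b]
  · rfl
  · simp only [hUV]
    nlinarith [norm_nonneg u, sq_nonneg ‖v‖]

lemma IsThomForm.integral_flux {τ : 𝓓 2} (h : IsThomForm j τ) (b) (s : ℝ) (c v : ℂ) : ∫ u : ℂ, flux (fibreForm τ j b) (s, c, u, v) = 1 := by
  have hm : MeasurableSet {u : ℂ | ‖u‖ * (1 + ‖v‖ ^ 2) < sqRadius} :=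
    (isOpen_lt (by fun_prop) continuous_const).measurableSet
  rw [← h.2.2 b s c v, ← setIntegral_eq_integral_of_forall_compl_eq_zero
    (s := {u : ℂ | ‖u‖ * (1 + ‖v‖ ^ 2) < sqRadius})]
  · refine setIntegral_congr_fun hm fun u hu => ?_
    have hu' : hUV (s, c, u, v) < sqRadius := hu
    rw [pullbackAt_fibre τ j b s c v hu', flux, fibreForm, if_pos hu']
    rfl
  · intro u hu
    have hu' : ¬ hUV (s, c, u, v) < sqRadius := hu
    rw [flux, fibreForm, if_neg hu']
    rfl

lemma IsThomForm.isExact_sub {τ τ' : 𝓓 2} (h : IsThomForm j τ) (h' : IsThomForm j τ') : DiffForm.IsExact (τ - τ') := by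
  obtain ⟨r₁, h10, h1, hs1⟩ := h.exists_supportedIn
  obtain ⟨r₂, h20, h2, hs2⟩ := h'.exists_supportedIn
  have hr0 : 0 < max r₁ r₂ := lt_max_of_lt_left h10
  have hr : max r₁ r₂ < sqRadius := max_lt h1 h2
  have hs1 := hs1.mono (le_max_left r₁ r₂)
  have hs2 := hs2.mono (le_max_right r₁ r₂)
  refine isExact_of_flux (hs1.sub hs2) hr0 hr (by rw [DiffForm.d_sub, h.1, h'.1]; exact sub_zero (0 : 𝓓 3)) fun b s c v => ?_
  have e : ∀ p, flux (fibreForm (τ - τ') j b) p = flux (fibreForm τ j b) p - flux (fibreForm τ' j b) p := by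
    intro p
    unfold flux fibreForm
    split_ifs
    · rw [loc_sub]; rfl
    · simp
  simp only [e]
  rw [integral_sub (integrable_flux hs1 hr0 hr b s c v) (integrable_flux hs2 hr0 hr b s c v), h.integral_flux, h'.integral_flux, sub_self]

end JK

namespace JK
open Complex
variable {k l : ℕ} {h : ℝ}

/-! ### The square of the model Thom form -/

def areaW : Alt7 2 := extDeriv (fun q : Space7 => oneForm (q.2.2.1.re • (imCLM ∘L projW))) 0
def areaZ : Alt7 2 := extDeriv (fun q : Space7 => oneForm (q.2.2.2.re • (imCLM ∘L projZ))) 0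

lemma areaW_apply (v) : areaW v = (v 0).2.2.1.re * (v 1).2.2.1.im - (v 1).2.2.1.re * (v 0).2.2.1.im := by
  have h : ∀ a b : Space7, fderiv ℝ (fun y : Space7 => (y.2.2.1.re • (imCLM ∘L projW)) a) 0 b = b.2.2.1.re * a.2.2.1.im :=
    fun a b => by
      have : HasFDerivAt (fun y : Space7 => y.2.2.1.re * a.2.2.1.im) (a.2.2.1.im • (reCLM ∘L projW)) 0 :=
        (reCLM ∘L projW).hasFDerivAt.mul_const _
      rw [show (fun y : Space7 => (y.2.2.1.re • (imCLM ∘L projW)) a) = fun y => y.2.2.1.re * a.2.2.1.im from rfl, this.fderiv]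
      exact mul_comm _ _
  rw [areaW, extDeriv_oneForm (L := fun q => q.2.2.1.re • (imCLM ∘L projW)) ((contDiff_projW_re.smul contDiff_const).contDiffAt), h, h]

lemma areaZ_apply (v) : areaZ v = (v 0).2.2.2.re * (v 1).2.2.2.im - (v 1).2.2.2.re * (v 0).2.2.2.im := by
  have h : ∀ a b : Space7, fderiv ℝ (fun y : Space7 => (y.2.2.2.re • (imCLM ∘L projZ)) a) 0 b = b.2.2.2.re * a.2.2.2.im :=
    fun a b => by
      have : HasFDerivAt (fun y : Space7 => y.2.2.2.re * a.2.2.2.im) (a.2.2.2.im • (reCLM ∘L projZ)) 0 :=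
        (reCLM ∘L projZ).hasFDerivAt.mul_const _
      rw [show (fun y : Space7 => (y.2.2.2.re • (imCLM ∘L projZ)) a) = fun y => y.2.2.2.re * a.2.2.2.im from rfl, this.fderiv]
      exact mul_comm _ _
  rw [areaZ, extDeriv_oneForm (L := fun q => q.2.2.2.re • (imCLM ∘L projZ)) ((contDiff_projZ_re.smul contDiff_const).contDiffAt), h, h]

/-- The volume form of the normal directions. -/
def vol4 : Alt7 4 := wedgeCLM Space7 2 2 areaW areaZ

/-- The density of the square of the model Thom form. -/
def dens (h : ℝ) : ℝ := 8 * bump h * deriv bump h / (Real.pi ^ 2 * h)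

lemma dens_small (hh : h < 1 / 1024) : dens h = 0 := by simp [dens, deriv_bump_of_lt hh]
lemma dens_large (hh : 1 / 512 ≤ h) : dens h = 0 := by simp [dens, bump_zero hh]

lemma dens_nonpos (h : ℝ) : dens h ≤ 0 := by
  rcases lt_or_ge h (1 / 1024) with hh | hh
  · rw [dens_small hh]
  · have h1 : deriv bump h ≤ 0 := by
      have h2 : Antitone bump := fun a b hab => Real.smoothTransition.monotone (by linarith)
      exact h2.deriv_nonpos
    exact div_nonpos_of_nonpos_of_nonneg (mul_nonpos_of_nonneg_of_nonpos (by have := bump_nonneg h; positivity) h1)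
      (by positivity)

lemma contDiff_dens : Smooth dens := by
  rw [contDiff_iff_contDiffAt]
  intro h
  rcases lt_or_ge h (1 / 1024) with hh | hh
  · refine contDiffAt_const (c := (0 : ℝ)) |>.congr_of_eventuallyEq ?_
    filter_upwards [gt_mem_nhds hh] with y hy using dens_small hy
  · have h1 : Smooth (deriv bump) := (contDiff_infty_iff_deriv.1 contDiff_bump).2
    refine ((contDiffAt_const.mul contDiff_bump.contDiffAt).mul h1.contDiffAt).div (contDiffAt_const.mul contDiffAt_id) ?_
    have : 0 < h := by linarith
    positivity

lemma exists_dens_ne : ∃ h, dens h ≠ 0 := by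
  by_contra! hf
  have h1 : ∀ h, HasDerivAt (fun h => bump h ^ 2) 0 h := by
    intro h
    have h2 := ((contDiff_bump.diff) h).hasDerivAt.pow 2
    suffices h6 : deriv bump h * bump h = 0 by
      refine (h2.congr_deriv ?_)
      rw [Nat.cast_ofNat, show (2 - 1 : ℕ) = 1 from rfl, pow_one, mul_assoc, mul_comm (bump h), h6, mul_zero]
    rcases lt_or_ge h (1 / 1024) with hh | hh
    · simp [deriv_bump_of_lt hh]
    · have h3 := hf h
      have h4 : (0 : ℝ) < h := by linarith
      rw [dens, div_eq_zero_iff, or_iff_left (by positivity)] at h3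
      linarith
  have h2 := is_const_of_deriv_eq_zero (fun h => (h1 h).differentiableAt) (fun h => (h1 h).deriv) 0 1
  simp only [bump_one (h := 0) (by norm_num), bump_zero (h := 1) (by norm_num)] at h2
  norm_num at h2

lemma fderiv_radSq (p a : Space7) : fderiv ℝ radSq p a = 2 * (p.2.2.1.re * a.2.2.1.re + p.2.2.1.im * a.2.2.1.im + (p.2.2.2.re * a.2.2.2.re + p.2.2.2.im * a.2.2.2.im)) := by
  have h1 := ((reCLM ∘L projW).hasFDerivAt (x := p)).pow 2
  have h2 := ((imCLM ∘L projW).hasFDerivAt (x := p)).pow 2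
  have h3 := ((reCLM ∘L projZ).hasFDerivAt (x := p)).pow 2
  have h4 := ((imCLM ∘L projZ).hasFDerivAt (x := p)).pow 2
  have h5 := ((h1.add h2).add (h3.add h4)).congr_of_eventuallyEq (f₁ := radSq)
    (.of_forall fun q => radSq_eq q)
  rw [h5.fderiv]
  simp [projW, projZ]
  ring

lemma tauForm_apply {p : Space7} (hp : radSq p ≠ 0) (v) : tauForm p v =
    deriv gFun (radSq p) * (fderiv ℝ radSq p (v 0) * imForm p (v 1) - fderiv ℝ radSq p (v 1) * imForm p (v 0)) + 2 * gFun (radSq p) * (areaW v + areaZ v) := by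
  have hg := contDiffAt_gFun_radSq hp
  have h : ∀ a b : Space7, fderiv ℝ (fun y => (gFun (radSq y) • imForm y) a) p b = deriv gFun (radSq p) * fderiv ℝ radSq p b * imForm p a + gFun (radSq p) * imForm b a := by
    intro a b
    have h1 : HasFDerivAt (fun y => gFun (radSq y)) (deriv gFun (radSq p) • fderiv ℝ radSq p) p :=
      ((contDiffAt_gFun hp).diffAt).hasDerivAt.comp_hasFDerivAt p
        ((contDiff_radSq.diff) p).hasFDerivAt
    have h2 : HasFDerivAt (fun y => imForm y a) ((a.2.2.1.im • (reCLM ∘L projW) - a.2.2.1.re • (imCLM ∘L projW)) +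
        (a.2.2.2.im • (reCLM ∘L projZ) - a.2.2.2.re • (imCLM ∘L projZ))) p := by
      have e : (fun y => imForm y a) = ((a.2.2.1.im • (reCLM ∘L projW) - a.2.2.1.re • (imCLM ∘L projW)) +
        (a.2.2.2.im • (reCLM ∘L projZ) - a.2.2.2.re • (imCLM ∘L projZ)) : Space7 →L[ℝ] ℝ) := by
        funext y
        simp [imForm, projW, projZ]
        ring
      rw [e]
      exact ContinuousLinearMap.hasFDerivAt _
    have h3 := h1.mul h2
    rw [show (fun y => (gFun (radSq y) • imForm y) a) = (fun y => gFun (radSq y)) * fun y => imForm y a from rfl, HasFDerivAt.fderiv h3]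
    simp [imForm_apply, projW, projZ]
    ring
  rw [tauForm, if_neg hp]
  change extDeriv (fun y => oneForm (gFun (radSq y) • imForm y)) p v = _
  rw [extDeriv_oneForm (L := fun y => gFun (radSq y) • imForm y) (hg.smul contDiff_imForm.contDiffAt), h, h, areaW_apply, areaZ_apply, imForm_apply (v 0), imForm_apply (v 1)]
  ring

lemma dens_eq (hh : h ≠ 0) : dens h = 8 * gFun h * (gFun h + h * deriv gFun h) := by
  have h1 : HasDerivAt gFun ((-(deriv bump h / Real.pi) * h - -(bump h / Real.pi) * 1) / h ^ 2) h :=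
    (((contDiff_bump.diff) h).hasDerivAt.div_const _).neg.div (hasDerivAt_id h) hh
  rw [h1.deriv, dens, gFun]
  field_simp
  ring

lemma tauForm_sq (p : Space7) : wedgeCLM Space7 2 2 (tauForm p) (tauForm p) = dens (radSq p) • vol4 := by
  by_cases hp : radSq p = 0
  · rw [tauForm, if_pos hp, hp, dens_small (by norm_num)]
    simp
  ext v
  rw [dens_eq hp]
  change wedgeAlt (tauForm p) (tauForm p) v = _ * wedgeAlt areaW areaZ v
  rw [wedgeAlt_two_two_apply, wedgeAlt_two_two_apply]
  simp only [tauForm_apply hp, areaW_apply, areaZ_apply, fderiv_radSq, imForm_apply, Matrix.cons_val_zero, Matrix.cons_val_one]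
  generalize deriv gFun (radSq p) = g'
  generalize gFun (radSq p) = g
  rw [radSq_eq]
  ring

end JK

namespace JK
open Complex
variable {k l : ℕ} {y : ℝ} {L : ℝ} {Q : ℝ}

/-! ### Periodized squares of Thom forms -/

/-- The square function, cut off to the constant `1` away from the origin. -/
def capSq (y : ℝ) : ℝ :=
  y ^ 2 * Real.smoothTransition (128 * (1 / 64 - y ^ 2)) + (1 - Real.smoothTransition (128 * (1 / 64 - y ^ 2)))

lemma contDiff_capSq : Smooth capSq := by
  have h : Smooth fun y : ℝ => Real.smoothTransition (128 * (1 / 64 - y ^ 2)) :=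
    Real.smoothTransition.contDiff.comp (by fun_prop)
  exact ((contDiff_id.pow 2).mul h).add (contDiff_const.sub h)

lemma capSq_small (h : y ^ 2 ≤ 1 / 128) : capSq y = y ^ 2 := by rw [capSq, Real.smoothTransition.one_of_one_le (by linarith)]; ring

lemma capSq_large (h : 1 / 8 ≤ |y|) : capSq y = 1 := by
  have : (1 / 8) ^ 2 ≤ y ^ 2 := by rw [← sq_abs y]; gcongr
  rw [capSq, Real.smoothTransition.zero_of_nonpos (by linarith)]; ring

lemma capSq_neg (y : ℝ) : capSq (-y) = capSq y := by simp [capSq]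

lemma capSq_nonneg (y : ℝ) : 0 ≤ capSq y := by
  have h1 := Real.smoothTransition.nonneg (128 * (1 / 64 - y ^ 2))
  have h2 := Real.smoothTransition.le_one (128 * (1 / 64 - y ^ 2))
  rw [capSq]
  have := mul_nonneg (sq_nonneg y) h1
  linarith

lemma sq_lt_of_capSq (h : capSq y < 1 / 512) : y ^ 2 < 1 / 512 := by
  rcases le_or_gt (y ^ 2) 1 with h1 | h1
  · have h2 := Real.smoothTransition.le_one (128 * (1 / 64 - y ^ 2))
    rw [capSq] at h
    nlinarith
  · rw [capSq_large] at h
    · norm_num at h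
    · have : 1 < |y| := by rw [← sq_abs] at h1; nlinarith [abs_nonneg y]
      linarith

/-- The squared distance to `L ℤ` near `L ℤ`. -/
def perSq (L x : ℝ) : ℝ := capSq (x - L * round (x / L))

lemma abs_sub_round_le (hL : 1 / 2 ≤ L) (x : ℝ) : |x - L * round (x / L)| ≤ L / 2 := by
  have h0 : 0 < L := by linarith
  have h := abs_sub_round (x / L)
  have e : x - L * round (x / L) = L * (x / L - round (x / L)) := by field_simp
  rw [e, abs_mul, abs_of_pos h0]
  nlinarith

lemma perSq_eq (hL : 1 / 2 ≤ L) {x : ℝ} (n : ℤ) (h : |x - L * n| < L - 1 / 8) : perSq L x = capSq (x - L * n) := by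
  have h0 : 0 < L := by linarith
  have h1 := abs_sub_round_le hL x
  rw [perSq]
  by_cases hn : round (x / L) = n
  · rw [hn]
  have h2 : (1 : ℝ) ≤ |(round (x / L) : ℝ) - n| := by exact_mod_cast Int.one_le_abs (sub_ne_zero.2 hn)
  have h3 : L ≤ |(x - L * n) - (x - L * round (x / L))| := by
    rw [show (x - L * n) - (x - L * round (x / L)) = L * ((round (x / L) : ℝ) - n) by ring, abs_mul, abs_of_pos h0]
    nlinarith
  have h4 := abs_sub (x - L * n) (x - L * round (x / L))
  rw [capSq_large (by linarith), capSq_large (by linarith)]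

lemma perSq_neg (hL : 1 / 2 ≤ L) (x : ℝ) : perSq L (-x) = perSq L x := by
  have h1 := abs_sub_round_le hL x
  rw [perSq_eq hL (-round (x / L)), perSq, ← capSq_neg]
  · push_cast; ring_nf
  · push_cast
    rw [show -x - L * -(round (x / L) : ℝ) = -(x - L * round (x / L)) by ring, abs_neg]
    linarith

lemma perSq_add (hL : 1 / 2 ≤ L) (x : ℝ) (n : ℤ) : perSq L (x + L * n) = perSq L x := by
  have h0 : L ≠ 0 := by linarith
  rw [perSq, perSq, add_div, mul_div_cancel_left₀ _ h0, round_add_intCast]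
  push_cast; ring_nf

lemma contDiff_perSq (hL : 1 / 2 ≤ L) : Smooth (perSq L) := by
  rw [contDiff_iff_contDiffAt]
  intro x
  have h1 := abs_sub_round_le hL x
  have h2 : ∀ᶠ y in 𝓝 x, |y - L * round (x / L)| < L - 1 / 8 :=
    (by fun_prop : Continuous fun y : ℝ => |y - L * round (x / L)|).continuousAt.eventually_lt_const (by linarith)
  refine ContDiffAt.congr_of_eventuallyEq (f := fun y => capSq (y - L * round (x / L))) ?_ ?_
  · exact (contDiff_capSq.comp (contDiff_id.sub contDiff_const)).contDiffAt
  · filter_upwards [h2] with y hy using perSq_eq hL _ hy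

lemma perSq_nonneg (L x : ℝ) : 0 ≤ perSq L x := capSq_nonneg _

lemma perSq_small (hL : 1 / 2 ≤ L) {x : ℝ} (h : |x| < 1 / 16) : perSq L x = x ^ 2 := by
  have e := perSq_eq hL (x := x) 0 (by rw [Int.cast_zero, mul_zero, sub_zero]; linarith)
  rw [Int.cast_zero, mul_zero, sub_zero] at e
  rw [e, capSq_small]
  have := sq_lt_sq' (neg_lt_of_abs_lt h) (lt_of_abs_lt h)
  linarith

lemma exists_of_perSq_lt {L x : ℝ} (h : perSq L x < 1 / 512) : ∃ n : ℤ, perSq L x = (x - L * n) ^ 2 := by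
  refine ⟨round (x / L), capSq_small ?_⟩
  have := sq_lt_of_capSq h
  linarith

/-- The sum of the squared distances of the normal coordinates to the lattice. -/
def perDist (Q : ℝ) (p : Space7) : ℝ :=
  perSq 4 p.2.2.1.re + perSq (1 / 2) p.2.2.1.im + (perSq Q p.2.2.2.re + perSq Q p.2.2.2.im)

def perDens (Q : ℝ) (p : Space7) : ℝ := dens (perDist Q p)

/-- The periodized square of the model Thom form. -/
def perForm (Q : ℝ) (p : Space7) : Alt7 4 := perDens Q p • vol4

lemma contDiff_perDens (hQ : 1 / 2 ≤ Q) : Smooth (perDens Q) :=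
  contDiff_dens.comp ((((contDiff_perSq (by norm_num)).comp contDiff_projW_re).add
    ((contDiff_perSq le_rfl).comp contDiff_projW_im)).add
    (((contDiff_perSq hQ).comp contDiff_projZ_re).add ((contDiff_perSq hQ).comp contDiff_projZ_im)))

lemma contDiff_perForm (hQ : 1 / 2 ≤ Q) : Smooth (perForm Q) := (contDiff_perDens hQ).smul contDiff_const

/-- The projection to the normal directions. -/
def projN : Space7 →L[ℝ] Space7 := (0 : Space7 →L[ℝ] ℝ).prod ((0 : Space7 →L[ℝ] ℂ).prod (projW.prod projZ))

lemma projN_apply (p : Space7) : projN p = (0, 0, p.2.2.1, p.2.2.2) := rfl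

lemma pb_clm (f : Space7 →L[ℝ] Space7) (a : 𝓐 k) (x : Space7) (v : Fin k → Space7) : pb f a x v = a (f x) fun i => f (v i) := by rw [pb, f.fderiv]; rfl

lemma vol4_congr {u v : Fin 4 → Space7} {σ : ℝ} (hσ : σ * σ = 1) (hw : ∀ i j, areaW ![u i, u j] = σ * areaW ![v i, v j])
    (hz : ∀ i j, areaZ ![u i, u j] = σ * areaZ ![v i, v j]) : vol4 u = vol4 v := by
  change wedgeAlt areaW areaZ u = wedgeAlt areaW areaZ v
  rw [wedgeAlt_two_two_apply, wedgeAlt_two_two_apply]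
  simp only [hw, hz]
  linear_combination (areaW ![v 0, v 1] * areaZ ![v 2, v 3] - areaW ![v 0, v 2] * areaZ ![v 1, v 3] +
      areaW ![v 0, v 3] * areaZ ![v 1, v 2] + areaW ![v 1, v 2] * areaZ ![v 0, v 3] - areaW ![v 1, v 3] * areaZ ![v 0, v 2] + areaW ![v 2, v 3] * areaZ ![v 0, v 1]) * hσ

lemma perForm_projN (Q : ℝ) : pb projN (perForm Q) = perForm Q := by
  funext x; ext v
  rw [pb_clm]
  change perDens Q x * vol4 _ = perDens Q x * vol4 _
  congr 1
  exact vol4_congr (σ := 1) (by norm_num) (fun i j => by rw [areaW_apply, areaW_apply, one_mul]; rfl)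
    (fun i j => by rw [areaZ_apply, areaZ_apply, one_mul]; rfl)

lemma extDeriv_perForm (hQ : 1 / 2 ≤ Q) (x : Space7) : extDeriv (perForm Q) x = 0 := by
  have hd := (contDiff_perForm hQ).diff
  rw [← perForm_projN Q, extDeriv_pb (hd _) projN.contDiff.contDiffAt]
  ext v
  rw [pb_clm]
  let f : Space7 →ₗ[ℝ] ℂ × ℂ := (projW.prod projZ : Space7 →L[ℝ] ℂ × ℂ)
  let i : ℂ × ℂ →ₗ[ℝ] Space7 := LinearMap.prod 0 (LinearMap.prod 0 LinearMap.id)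
  have hn : ¬ LinearIndependent ℝ fun j : Fin 5 => f (v j) := by
    intro h
    have := h.fintype_card_le_finrank
    simp [Module.finrank_prod, Complex.finrank_real_complex] at this
  exact (extDeriv (perForm Q) (projN x)).toAlternatingMap.map_linearDependent _
    (fun h => hn (LinearIndependent.of_comp i h))

/-- Sign changes and translations of the normal coordinates. -/
def flipLin (e : Fin 4 → ℝ) : Space7 →L[ℝ] Space7 :=
  (fst ℝ ℝ (ℂ × ℂ × ℂ)).prod ((fst ℝ ℂ (ℂ × ℂ) ∘L snd ℝ ℝ (ℂ × ℂ × ℂ)).prod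
    (((e 0 • (reCLM ∘L projW)).smulRight (1 : ℂ) + (e 1 • (imCLM ∘L projW)).smulRight I).prod
      ((e 2 • (reCLM ∘L projZ)).smulRight (1 : ℂ) + (e 3 • (imCLM ∘L projZ)).smulRight I)))

def flipMap (e : Fin 4 → ℝ) (a : ℂ × ℂ) (p : Space7) : Space7 := flipLin e p + (0, 0, a.1, a.2)

lemma flipLin_apply (e : Fin 4 → ℝ) (p : Space7) : flipLin e p = (p.1, p.2.1, ⟨e 0 * p.2.2.1.re, e 1 * p.2.2.1.im⟩, ⟨e 2 * p.2.2.2.re, e 3 * p.2.2.2.im⟩) := by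
  refine prod_ext₄ rfl rfl ?_ ?_ <;> refine Complex.ext ?_ ?_ <;> simp [flipLin, projW, projZ]

lemma flipMap_apply (e : Fin 4 → ℝ) (a : ℂ × ℂ) (p : Space7) : flipMap e a p = (p.1, p.2.1, ⟨e 0 * p.2.2.1.re + a.1.re, e 1 * p.2.2.1.im + a.1.im⟩,
    ⟨e 2 * p.2.2.2.re + a.2.re, e 3 * p.2.2.2.im + a.2.im⟩) := by
  rw [flipMap, flipLin_apply]
  refine Prod.ext (add_zero _) (Prod.ext (add_zero _) (Prod.ext ?_ ?_)) <;> rfl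

lemma hasFDerivAt_flipMap (e a x) : HasFDerivAt (flipMap e a) (flipLin e) x := (flipLin e).hasFDerivAt.add_const _

/-- The periods of the periodized forms. -/
def IsPeriod (Q : ℝ) (a : ℂ × ℂ) : Prop :=
  ∃ m n o r : ℤ, a = (⟨4 * m, 1 / 2 * n⟩, ⟨Q * o, Q * r⟩)

/-- Sign changes of determinant one. -/
def IsFlip (e : Fin 4 → ℝ) : Prop := (∀ i, e i = 1 ∨ e i = -1) ∧ e 0 * e 1 = e 2 * e 3

lemma perSq_flip (hL : 1 / 2 ≤ L) {e : ℝ} (he : e = 1 ∨ e = -1) (x : ℝ) (n : ℤ) : perSq L (e * x + L * n) = perSq L x := by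
  rw [perSq_add hL]
  rcases he with rfl | rfl
  · rw [one_mul]
  · rw [neg_one_mul, perSq_neg hL]

lemma perDens_flip (hQ : 1 / 2 ≤ Q) {e a} (he : IsFlip e) (ha : IsPeriod Q a) (p) : perDens Q (flipMap e a p) = perDens Q p := by
  obtain ⟨m, n, o, r, rfl⟩ := ha
  simp only [perDens, perDist, flipMap_apply, perSq_flip (show (1 : ℝ) / 2 ≤ 4 by norm_num) (he.1 0),
    perSq_flip le_rfl (he.1 1), perSq_flip hQ (he.1 2), perSq_flip hQ (he.1 3)]

lemma vol4_flip {e} (he : IsFlip e) (v : Fin 4 → Space7) : (vol4 fun i => flipLin e (v i)) = vol4 v := by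
  refine vol4_congr (σ := e 0 * e 1) ?_ (fun i j => ?_) (fun i j => ?_)
  · rcases he.1 0 with h | h <;> rcases he.1 1 with h' | h' <;> rw [h, h'] <;> norm_num
  · simp only [areaW_apply, flipLin_apply, Matrix.cons_val_zero, Matrix.cons_val_one]; ring
  · rw [he.2]
    simp only [areaZ_apply, flipLin_apply, Matrix.cons_val_zero, Matrix.cons_val_one]; ring

lemma pb_flip_perForm (hQ : 1 / 2 ≤ Q) {e a} (he : IsFlip e) (ha : IsPeriod Q a) : pb (flipMap e a) (perForm Q) = perForm Q := by
  funext p; ext v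
  rw [pb, (hasFDerivAt_flipMap e a p).fderiv]
  change perDens Q _ * (vol4 fun i => flipLin e (v i)) = perDens Q p * vol4 v
  rw [perDens_flip hQ he ha, vol4_flip he]

/-- The normal vector which joins two components of the singular locus. -/
def joinVec : Space7 := (0, 0, ⟨1, 1 / 4⟩, 0)

def joinHom (q : Space7 × ℝ) : Space7 := q.1 - q.2 • joinVec

lemma contDiff_joinHom : Smooth joinHom := contDiff_fst.sub (contDiff_snd.smul contDiff_const)

/-- A primitive of the difference of a periodized form and its translate. -/
def joinForm (Q : ℝ) : 𝓐 3 := homOp 0 (-1) joinHom (perForm Q)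

def joinDens (Q : ℝ) (p : Space7) : ℝ := ∫ φ in (0 : ℝ)..1, perDens Q (p - φ • joinVec)

lemma hasFDerivAt_joinHom (q : Space7 × ℝ) : HasFDerivAt joinHom (fst ℝ Space7 ℝ - (snd ℝ Space7 ℝ).smulRight joinVec) q :=
  (fst ℝ Space7 ℝ - (snd ℝ Space7 ℝ).smulRight joinVec).hasFDerivAt

lemma homPull_joinHom (a : 𝓐 k) (x : Space7) (φ : ℝ) : homPull joinHom a (x, φ) = a (x - φ • joinVec) := by
  rw [homPull, (hasFDerivAt_joinHom _).fderiv]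
  ext v
  change a (x - φ • joinVec) (fun i => v i - (0 : ℝ) • joinVec) = _
  simp only [zero_smul, sub_zero]

lemma joinForm_apply (hQ : 1 / 2 ≤ Q) (p : Space7) (v : Fin 3 → Space7) : joinForm Q p v = joinDens Q p * vol4 (Matrix.vecCons joinVec v) := by
  rw [joinForm, homOp_apply contDiff_joinHom (contDiff_perForm hQ), joinDens, ← intervalIntegral.integral_mul_const]
  refine intervalIntegral.integral_congr fun φ _ => ?_
  have h : homContract joinHom (perForm Q) (p, φ) v = perDens Q (p - φ • joinVec) * vol4 (Matrix.vecCons ((-1 : ℝ) • joinVec) v) := by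
    rw [homContract, (hasFDerivAt_joinHom _).fderiv]
    change perDens Q (p - φ • joinVec) * vol4 (Matrix.vecCons ((0 : Space7) - (1 : ℝ) • joinVec) fun i => v i - (0 : ℝ) • joinVec) = _
    simp only [zero_smul, sub_zero, zero_sub, one_smul, neg_smul]
  have h' := vol4.toMultilinearMap.cons_smul v (-1) joinVec
  have h'' : vol4 (Matrix.vecCons ((-1 : ℝ) • joinVec) v) = (-1 : ℝ) • vol4 (Matrix.vecCons joinVec v) := h'
  change (0 * φ + -1) * _ = _
  rw [h, h'', smul_eq_mul]
  ring

lemma contDiff_joinForm (hQ : 1 / 2 ≤ Q) : Smooth (joinForm Q) :=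
  contDiff_homOp contDiff_joinHom (contDiff_perForm hQ) 0 (-1)

lemma extDeriv_joinForm (hQ : 1 / 2 ≤ Q) (x : Space7) : extDeriv (joinForm Q) x = perForm Q x - perForm Q (x - joinVec) := by
  ext v
  rw [joinForm, extDeriv_homOp_univ contDiff_joinHom (contDiff_perForm hQ) (extDeriv_perForm hQ), homPull_joinHom, homPull_joinHom]
  rw [zero_smul, sub_zero, one_smul]
  change (0 + -1) * _ - -1 * _ - 0 * _ = perForm Q x v - perForm Q (x - joinVec) v
  ring

lemma pb_flip_joinForm (hQ : 1 / 2 ≤ Q) {e a} (he : IsFlip e) (h0 : e 0 = 1) (h1 : e 1 = 1) (ha : IsPeriod Q a) : pb (flipMap e a) (joinForm Q) = joinForm Q := by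
  have hv : flipLin e joinVec = joinVec := by
    rw [flipLin_apply, h0, h1]
    simp [joinVec]
    rfl
  funext p; ext v
  rw [pb, (hasFDerivAt_flipMap e a p).fderiv]
  change joinForm Q _ (fun i => flipLin e (v i)) = _
  rw [joinForm_apply hQ, joinForm_apply hQ, ← vol4_flip he (Matrix.vecCons joinVec v)]
  congr 1
  · refine intervalIntegral.integral_congr fun φ _ => ?_
    rw [← perDens_flip hQ he ha (p - φ • joinVec), flipMap, flipMap, map_sub, map_smul, hv]
    congr 1
    abel
  · congr 1
    funext i
    refine Fin.cases ?_ (fun i => ?_) i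
    · exact hv.symm
    · rfl

end JK

namespace JK
open Complex
variable {k l : ℕ} {g : Perm7} {T : 𝓐 k}

/-! ### Averaging over the group -/

/-- The elements of `Γ` which shift `t` by `k`. -/
def Shift (g : Perm7) (k : ℤ) : Prop := g ∈ Gam ∧ NF g ∧ ∀ x, (g x).1 = x.1 + k

lemma Shift.mul {g h : Perm7} {k l : ℤ} (hg : Shift g k) (hh : Shift h l) : Shift (g * h) (l + k) :=
  ⟨mul_mem hg.1 hh.1, hg.2.1.mul hh.2.1, fun x => by rw [Equiv.Perm.mul_apply, hg.2.2, hh.2.2]; push_cast; ring⟩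

lemma Shift.conj {k : ℤ} (hg : Shift g k) : Shift (kappa * g * kappa) (-k) :=
  ⟨mul_mem (mul_mem mem_k hg.1) mem_k, hg.2.1.conj, fun x => by
    rw [Equiv.Perm.mul_apply, Equiv.Perm.mul_apply]
    change 1 - (g (kappa x)).1 = _
    rw [hg.2.2]
    change 1 - (1 - x.1 + k) = _
    push_cast; ring⟩

lemma deckF_zpow (k : ℤ) (x : Space7) : (deckF ^ k) x = (x.1 + k, I ^ k * x.2.1, I ^ k * x.2.2.1, (-1) ^ k * x.2.2.2) := by
  induction k using Int.induction_on generalizing x with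
  | zero => simp
  | succ n ih =>
    rw [zpow_add_one, Equiv.Perm.mul_apply, ih]
    simp only [deckF, Equiv.coe_fn_mk, zpow_add_one₀ I_ne_zero, zpow_add_one₀ (show (-1 : ℂ) ≠ 0 by norm_num)]
    refine prod_ext₄ ?_ ?_ ?_ ?_ <;> simp <;> ring
  | pred n ih =>
    rw [zpow_sub_one, Equiv.Perm.mul_apply, ih]
    change (x.1 - 1 + _, _ * (-I * _), _ * (-I * _), _ * -_) = _
    rw [zpow_sub_one₀ I_ne_zero, zpow_sub_one₀ (show (-1 : ℂ) ≠ 0 by norm_num), inv_I]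
    refine prod_ext₄ ?_ ?_ ?_ ?_ <;> simp <;> ring

lemma shift_deckF (k : ℤ) : Shift (deckF ^ k) k :=
  ⟨zpow_mem mem_F k, ⟨k, 0, 0, 0, 0, fun x => by rw [deckF_zpow]; simp [gauss]⟩, fun x => by rw [deckF_zpow]⟩

lemma NF.exists_shift (hg : g ∈ Gam) (h : NF g) : ∃ k, Shift g k :=
  let ⟨k, _, _, _, _, hk⟩ := h
  ⟨k, hg, h, fun x => by rw [hk]⟩

lemma Shift.formula {n : ℤ} (hg : Shift g (4 * n)) : ∃ (p q : ℤ) (a b : ℤ × ℤ), ∀ x, g x =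
    (x.1 + 4 * n, (-1) ^ (p + q) * x.2.1 + gauss a, (-1) ^ (p + q) * x.2.2.1 + gauss b, x.2.2.2 + (p + q * I) / 2) := by
  obtain ⟨-, ⟨k, p, q, a, b, h⟩, h1⟩ := hg
  have hk : k = 4 * n := by
    have := h1 0
    rw [h] at this
    simp only [add_right_inj] at this
    exact_mod_cast this
  subst hk
  refine ⟨p, q, a, b, fun x => ?_⟩
  rw [h, zpow_mul, zpow_mul, show (I : ℂ) ^ (4 : ℤ) = 1 from I_pow_four, show (-1 : ℂ) ^ (4 : ℤ) = 1 by norm_num, one_zpow, one_mul, one_mul]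
  push_cast
  rfl

lemma pb_perm_mul {g h : Perm7} (hg : g ∈ Gam) (hh : h ∈ Gam) (a : 𝓐 k) : pb (g * h : Perm7) a = pb h (pb g a) := funext fun _ =>
  pb_comp ((Gam_smooth hg).1.diff _) ((Gam_smooth hh).1.diff _)

lemma pb_id (a : 𝓐 k) : pb (1 : Perm7) a = a :=
  funext fun _ => pb_of_eventuallyEq_id (Filter.EventuallyEq.refl _ _)

/-- A form invariant under the elements of `Γ` which shift `t` by a multiple of `4`. -/
def ShiftInv (T : 𝓐 k) : Prop := ∀ g n, Shift g (4 * n) → pb g T = T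

def deckPull (T : 𝓐 k) (m : ℤ) : 𝓐 k := pb (deckF ^ m : Perm7) T

def deckSum (T : 𝓐 k) (j : ℤ) (x : Space7) : Alt7 k :=
  deckPull T j x + deckPull T (j + 1) x + deckPull T (j + 2) x + deckPull T (j + 3) x

lemma pb_deckPull (hT : ShiftInv T) {g j} (hg : Shift g j) (m : ℤ) : pb g (deckPull T m) = deckPull T (m + j) := by
  have h1 : Shift (deckF ^ m * g * deckF ^ (-(j + m))) (4 * 0) := by
    have := ((shift_deckF m).mul hg).mul (shift_deckF (-(j + m)))
    rwa [neg_add_cancel] at this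
  have h2 : deckF ^ m * g = (deckF ^ m * g * deckF ^ (-(j + m))) * deckF ^ (m + j) := by
    rw [mul_assoc (deckF ^ m * g), ← zpow_add, neg_add_eq_sub, add_comm m j, sub_self, zpow_zero, mul_one]
  rw [deckPull, ← pb_perm_mul (zpow_mem mem_F m) hg.1, h2, pb_perm_mul h1.1 (zpow_mem mem_F _), hT _ _ h1]
  rfl

lemma deckPull_periodic (hT : ShiftInv T) (m : ℤ) : deckPull T (m + 4) = deckPull T m := by
  rw [deckPull, add_comm, zpow_add, pb_perm_mul (zpow_mem mem_F _) (zpow_mem mem_F _), hT (deckF ^ (4 : ℤ)) 1 (shift_deckF 4)]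
  rfl

lemma deckSum_eq (hT : ShiftInv T) (j : ℤ) : deckSum T j = deckSum T 0 := by
  have h : ∀ i, deckSum T (i + 1) = deckSum T i := fun i => by
    funext x
    simp only [deckSum]
    rw [show i + 1 + 3 = i + 4 by ring, deckPull_periodic hT, show i + 1 + 1 = i + 2 by ring, show i + 1 + 2 = i + 3 by ring]
    abel
  induction j using Int.induction_on with
  | zero => rfl
  | succ n ih => rw [h, ih]
  | pred n ih => rw [← h, sub_add_cancel, ih]

lemma pb_deckSum (hT : ShiftInv T) {g j} (hg : Shift g j) : pb g (deckSum T 0) = deckSum T 0 := by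
  rw [← deckSum_eq hT j]
  conv_lhs => rw [deckSum_eq hT]
  funext x
  change pb g (deckPull T 0) x + pb g (deckPull T (0 + 1)) x + pb g (deckPull T (0 + 2)) x + pb g (deckPull T (0 + 3)) x = _
  simp only [pb_deckPull hT hg, deckSum]
  ring_nf

lemma pb_kappa_deckSum (hT : ShiftInv T) {m : ℤ} (h : pb kappa T = deckPull T m) : pb kappa (deckSum T 0) = deckSum T 0 := by
  have h1 : ∀ j, pb kappa (deckPull T j) = deckPull T (m - j) := fun j => by
    have h2 : deckF ^ j * kappa = kappa * (kappa * deckF ^ j * kappa) := by rw [← mul_assoc, ← mul_assoc, kappa_kappa, one_mul]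
    rw [deckPull, ← pb_perm_mul (zpow_mem mem_F _) mem_k, h2, pb_perm_mul mem_k (shift_deckF j).conj.1, h, pb_deckPull hT (shift_deckF j).conj]
    rfl
  rw [← deckSum_eq hT (m - 3)]
  conv_lhs => rw [deckSum_eq hT]
  funext x
  change pb kappa (deckPull T 0) x + pb kappa (deckPull T (0 + 1)) x + pb kappa (deckPull T (0 + 2)) x + pb kappa (deckPull T (0 + 3)) x = _
  simp only [h1, deckSum]
  rw [show m - 3 + 1 = m - (0 + 2) by ring, show m - 3 + 2 = m - (0 + 1) by ring, show m - 3 + 3 = m - 0 by ring, show m - 3 = m - (0 + 3) by ring]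
  abel

lemma pb_Gam_of (h : ∀ g j, Shift g j → pb g T = T) (hk : pb kappa T = T) {g} (hg : g ∈ Gam) : pb g T = T := by
  rcases NF_or hg with h1 | h1
  · obtain ⟨j, hj⟩ := h1.exists_shift hg
    exact h g j hj
  · obtain ⟨j, hj⟩ := h1.exists_shift (mul_mem hg mem_k)
    have e : g = g * kappa * kappa := by rw [mul_assoc, kappa_kappa, mul_one]
    rw [e, pb_perm_mul hj.1 mem_k, h _ j hj, hk]

/-- The average of `T` and its image under `κ`. -/
def kapAvg (T : 𝓐 k) (x : Space7) : Alt7 k := (1 / 2 : ℝ) • (T x + pb kappa T x)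

lemma pb_kapAvg (h : ∀ g j, Shift g j → pb g T = T) {g} (hg : g ∈ Gam) : pb g (kapAvg T) = kapAvg T := by
  have hlin : ∀ g : Perm7, pb g (kapAvg T) = fun x => (1 / 2 : ℝ) • (pb g T x + pb g (pb kappa T) x) := fun _ => rfl
  refine pb_Gam_of (fun g j hg => ?_) ?_ hg
  · have h2 : kappa * g = (kappa * g * kappa) * kappa := by rw [mul_assoc _ kappa, kappa_kappa, mul_one]
    rw [hlin, h g j hg, ← pb_perm_mul mem_k hg.1, h2, pb_perm_mul hg.conj.1 mem_k, h _ _ hg.conj]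
    rfl
  · rw [hlin, ← pb_perm_mul mem_k mem_k, kappa_kappa, pb_id]
    funext x
    rw [add_comm]
    rfl

lemma contDiff_deckPull (hT : Smooth T) (m) : Smooth (deckPull T m) :=
  contDiff_pb hT (Gam_smooth (zpow_mem mem_F m)).1

lemma contDiff_deckSum (hT : Smooth T) (m) : Smooth (deckSum T m) :=
  (((contDiff_deckPull hT _).add (contDiff_deckPull hT _)).add (contDiff_deckPull hT _)).add (contDiff_deckPull hT _)

lemma contDiff_kapAvg (hT : Smooth T) : Smooth (kapAvg T) :=
  (contDiff_const (c := (1 / 2 : ℝ))).smul (hT.add (contDiff_pb hT (Gam_smooth mem_k).1))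

lemma extDeriv_deckSum (hT : Smooth T) (m) : extDeriv (deckSum T m) = deckSum (extDeriv T) m := by
  have h1 : ∀ j, Differentiable ℝ (deckPull T j) := fun j => (contDiff_deckPull hT j).diff
  have h2 : ∀ j x, extDeriv (deckPull T j) x = deckPull (extDeriv T) j x := fun j x =>
    extDeriv_pb (hT.diff _) (Gam_smooth (zpow_mem mem_F j)).1.contDiffAt
  funext x
  have e1 := extDeriv_add' (x := x) (h1 m x) (h1 (m + 1) x)
  have e2 := extDeriv_add' (x := x) ((h1 m x).add (h1 (m + 1) x)) (h1 (m + 2) x)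
  have e3 := extDeriv_add' (x := x) (((h1 m x).add (h1 (m + 1) x)).add (h1 (m + 2) x)) (h1 (m + 3) x)
  refine e3.trans ?_
  rw [show (deckPull T m + deckPull T (m + 1) + deckPull T (m + 2)) = fun y => (deckPull T m + deckPull T (m + 1)) y + deckPull T (m + 2) y from rfl,
    e2, show (deckPull T m + deckPull T (m + 1)) = fun y => deckPull T m y + deckPull T (m + 1) y from rfl, e1, h2, h2, h2, h2]
  rfl

lemma extDeriv_kapAvg (hT : Smooth T) : extDeriv (kapAvg T) = kapAvg (extDeriv T) := by
  have h1 : Differentiable ℝ T := hT.diff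
  have h2 : Differentiable ℝ (pb kappa T) := (contDiff_pb hT (Gam_smooth mem_k).1).diff
  funext x
  have e1 := extDeriv_add' (x := x) (h1 x) (h2 x)
  have e2 : extDeriv (kapAvg T) x = (1 / 2 : ℝ) • extDeriv (fun y => T y + pb kappa T y) x :=
    extDeriv_fun_smul _ _
  rw [e2, e1, extDeriv_pb (h1 _) (Gam_smooth mem_k).1.contDiffAt]
  rfl

end JK

namespace JK
open Complex
variable {k l : ℕ} {p : Space7}

/-! ### Normal coordinates on all of `ℝ⁷` -/

/-- Affine normal coordinates of a component of the singular locus. -/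
def nrm (l c : ℝ) (ξ ν : ℂ) (s : ℝ) (x : Space7) : Space7 :=
  (0, 0, ⟨x.1 - l, (ξ * x.2.2.2).re + c⟩, ⟨(ν * x.2.1).re, s * (ν * x.2.2.1).re⟩)

def nrmLin (ξ ν : ℂ) (s : ℝ) : Space7 →L[ℝ] Space7 :=
  LinearMap.toContinuousLinearMap
    { toFun := nrm 0 0 ξ ν s
      map_add' := fun x y => by refine Prod.ext (by simp [nrm]) (Prod.ext (by simp [nrm]) (Prod.ext (Complex.ext ?_ ?_) (Complex.ext ?_ ?_))) <;> simp [nrm] <;> ring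
      map_smul' := fun r x => by refine Prod.ext (by simp [nrm]) (Prod.ext (by simp [nrm]) (Prod.ext (Complex.ext ?_ ?_) (Complex.ext ?_ ?_))) <;> simp [nrm] <;> ring }

lemma nrmLin_apply (ξ ν : ℂ) (s : ℝ) (x) : nrmLin ξ ν s x = nrm 0 0 ξ ν s x := rfl

lemma hasFDerivAt_nrm (l c ξ ν s x) : HasFDerivAt (nrm l c ξ ν s) (nrmLin ξ ν s) x := by
  have e : nrm l c ξ ν s = fun x => nrmLin ξ ν s x + (0, 0, ⟨-l, c⟩, 0) := by
    funext x
    refine Prod.ext (by simp [nrm, nrmLin_apply]) (Prod.ext (by simp [nrm, nrmLin_apply])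
      (Prod.ext (Complex.ext ?_ ?_) (Complex.ext ?_ ?_))) <;> simp [nrm, nrmLin_apply]
    ring
  rw [e]
  exact (nrmLin ξ ν s).hasFDerivAt.add_const _

lemma contDiff_nrm (l c ξ ν s) : Smooth (nrm l c ξ ν s) := by
  refine contDiff_infty_iff_fderiv.2 ⟨fun x => (hasFDerivAt_nrm l c ξ ν s x).differentiableAt, ?_⟩
  rw [show fderiv ℝ (nrm l c ξ ν s) = fun _ => nrmLin ξ ν s from funext fun x => (hasFDerivAt_nrm l c ξ ν s x).fderiv]
  exact contDiff_const

/-- Compatibility of normal coordinates with the lattice. -/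
structure Frame (Q : ℝ) (ξ ν : ℂ) (s : ℝ) : Prop where
  le : 1 / 2 ≤ Q
  sgn : s = 1 ∨ s = -1
  int_ξ : ∀ p q : ℤ, ∃ n : ℤ, (ξ * (p + q * I)).re = n
  surj_ξ : ∀ n : ℤ, ∃ p q : ℤ, (ξ * (p + q * I)).re = n
  int_ν : ∀ a, ∃ n : ℤ, (ν * gauss a).re = Q * n
  surj_ν : ∀ n : ℤ, ∃ a, (ν * gauss a).re = Q * n


lemma nrm_affine {Q ξ ν s} {l c : ℝ} {g : Space7 → Space7} {n : ℤ} {d β γ : ℂ} {e : ℝ} {x : Space7}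
    (hg : g x = (x.1 + 4 * n, e * x.2.1 + β, e * x.2.2.1 + γ, x.2.2.2 + d / 2)) {n₁ n₂ n₃ : ℤ} (h1 : (ξ * d).re = n₁)
    (h2 : (ν * β).re = Q * n₂) (h3 : (ν * γ).re = Q * n₃) : nrm l c ξ ν s (g x) = ((0 : ℝ), (0 : ℂ), (⟨(x.1 - l) + 4 * n, ((ξ * x.2.2.2).re + c) + 1 / 2 * n₁⟩ : ℂ),
      (⟨e * (ν * x.2.1).re + Q * n₂, e * (s * (ν * x.2.2.1).re) + s * (Q * n₃)⟩ : ℂ)) := by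
  rw [hg]
  simp only [nrm, mul_add, add_re]
  rw [h2, h3, show ξ * (d / 2) = ((1 / 2 : ℝ) : ℂ) * (ξ * d) by push_cast; ring, re_ofReal_mul, h1,
    show ν * ((e : ℂ) * x.2.1) = (e : ℂ) * (ν * x.2.1) by ring, show ν * ((e : ℂ) * x.2.2.1) = (e : ℂ) * (ν * x.2.2.1) by ring, re_ofReal_mul, re_ofReal_mul]
  refine Prod.ext rfl (Prod.ext rfl (Prod.ext (Complex.ext ?_ ?_) (Complex.ext ?_ ?_))) <;> dsimp <;> ring

lemma Frame.nrm_shift {Q ξ ν s} (hF : Frame Q ξ ν s) (l c) {g n} (hg : Shift g (4 * n)) :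
    ∃ e a, IsFlip e ∧ e 0 = 1 ∧ e 1 = 1 ∧ IsPeriod Q a ∧ ∀ x, nrm l c ξ ν s (g x) = flipMap e a (nrm l c ξ ν s x) := by
  obtain ⟨p, q, a, b, h⟩ := hg.formula
  obtain ⟨ε, hε, hε'⟩ := sign_real (p + q)
  obtain ⟨n₁, h1⟩ := hF.int_ξ p q
  obtain ⟨n₂, h2⟩ := hF.int_ν a
  obtain ⟨n₃, h3⟩ := hF.int_ν b
  obtain ⟨n₄, h4⟩ : ∃ n₄ : ℤ, s * n₃ = n₄ := by
    rcases hF.sgn with h | h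
    · exact ⟨n₃, by rw [h, one_mul]⟩
    · exact ⟨-n₃, by rw [h]; push_cast; ring⟩
  refine ⟨![1, 1, ε, ε], (⟨4 * n, 1 / 2 * n₁⟩, ⟨Q * n₂, Q * n₄⟩), ⟨fun i => by fin_cases i <;> simp [hε], ?_⟩, rfl, rfl, ⟨n, n₁, n₂, n₄, rfl⟩, fun x => ?_⟩
  · rcases hε with h | h <;> simp [h]
  · rw [nrm_affine (e := ε) (by rw [h, hε']) h1 h2 h3, flipMap_apply]
    refine Prod.ext rfl (Prod.ext rfl (Prod.ext (Complex.ext ?_ ?_) (Complex.ext ?_ ?_))) <;> simp [nrm]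
    rw [← h4]; ring

lemma Frame.pb_nrm {Q ξ ν s} (hF : Frame Q ξ ν s) {b : 𝓐 k} (h : ∀ e a, IsFlip e → e 0 = 1 → e 1 = 1 → IsPeriod Q a → pb (flipMap e a) b = b) (l c) :
    ShiftInv (pb (nrm l c ξ ν s) b) := by
  intro g n hg
  obtain ⟨e, a, he, h0, h1, ha, hN⟩ := hF.nrm_shift l c hg
  funext x
  rw [← pb_comp (hasFDerivAt_nrm _ _ _ _ _ _).differentiableAt ((Gam_smooth hg.1).1.diff _),
    show (fun y => nrm l c ξ ν s (g y)) = fun y => flipMap e a (nrm l c ξ ν s y) from funext hN,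
    pb_comp (hasFDerivAt_flipMap _ _ _).differentiableAt (hasFDerivAt_nrm _ _ _ _ _ _).differentiableAt, h e a he h0 h1 ha]

/-- The periodized square of the Thom form, on `ℝ⁷`. -/
def nrmForm (Q l c : ℝ) (ξ ν : ℂ) (s : ℝ) : 𝓐 4 := pb (nrm l c ξ ν s) (perForm Q)

lemma Frame.shiftInv_nrmForm {Q ξ ν s} (hF : Frame Q ξ ν s) (l c) : ShiftInv (nrmForm Q l c ξ ν s) :=
  hF.pb_nrm (fun _ _ he _ _ ha => pb_flip_perForm hF.le he ha) l c

lemma Frame.contDiff_nrmForm {Q ξ ν s} (hF : Frame Q ξ ν s) (l c) : Smooth (nrmForm Q l c ξ ν s) :=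
  contDiff_pb (contDiff_perForm hF.le) (contDiff_nrm _ _ _ _ _)

lemma exists_formula (n p q : ℤ) (a b : ℤ × ℤ) : ∃ g ∈ Gam, ∀ x, g x =
    (x.1 + 4 * n, (-1) ^ (p + q) * x.2.1 + gauss a, (-1) ^ (p + q) * x.2.2.1 + gauss b, x.2.2.2 + (p + q * I) / 2) := by
  have key : ∀ (f : Perm7) (d : ℂ), (∀ x, f x = (x.1, -x.2.1, -x.2.2.1, x.2.2.2 + d)) → ∀ (m : ℤ) x,
      (f ^ m) x = (x.1, (-1) ^ m * x.2.1, (-1) ^ m * x.2.2.1, x.2.2.2 + m * d) := by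
    intro f d hf m
    have hf' : ∀ x, f⁻¹ x = (x.1, -x.2.1, -x.2.2.1, x.2.2.2 - d) := fun x => by rw [Equiv.Perm.inv_eq_iff_eq, hf]; simp
    induction m using Int.induction_on with
    | zero => intro x; simp
    | succ n ih =>
      intro x
      rw [zpow_add_one, Equiv.Perm.mul_apply, ih, hf, zpow_add_one₀ (by norm_num)]
      refine prod_ext₄ rfl ?_ ?_ ?_ <;> push_cast <;> ring
    | pred n ih =>
      intro x
      rw [zpow_sub_one, Equiv.Perm.mul_apply, ih, hf', zpow_sub_one₀ (by norm_num), inv_neg_one]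
      refine prod_ext₄ rfl ?_ ?_ ?_ <;> push_cast <;> ring
  refine ⟨translation a b 0 * (iota₁ ^ p * (iota₂ ^ q * deckF ^ (4 * n))),
    mul_mem (mem_t _ _ _) (mul_mem (zpow_mem mem_i1 _) (mul_mem (zpow_mem mem_i2 _) (zpow_mem mem_F _))), fun x => ?_⟩
  rw [Equiv.Perm.mul_apply, Equiv.Perm.mul_apply, Equiv.Perm.mul_apply, key iota₁ (1 / 2) (fun _ => rfl),
    key iota₂ (I / 2) (fun _ => rfl), deckF_zpow, zpow_mul, zpow_mul, show (I : ℂ) ^ (4 : ℤ) = 1 from I_pow_four,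
    show (-1 : ℂ) ^ (4 : ℤ) = 1 by norm_num, one_zpow, zpow_add₀ (by norm_num)]
  simp only [translation, Equiv.coe_fn_mk]
  refine prod_ext₄ ?_ ?_ ?_ ?_ <;> simp [gauss] <;> ring

lemma Frame.exists_near {Q ξ ν s} (hF : Frame Q ξ ν s) (l c) {x} (h : perDens Q (nrm l c ξ ν s x) ≠ 0) : ∃ g ∈ Gam, radSq (nrm l c ξ ν s (g x)) < 1 / 512 := by
  have h0 : perDist Q (nrm l c ξ ν s x) < 1 / 512 := by
    by_contra hc
    exact h (dens_large (not_lt.1 hc))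
  set N := nrm l c ξ ν s x with hN
  have p1 := perSq_nonneg 4 N.2.2.1.re
  have p2 := perSq_nonneg (1 / 2) N.2.2.1.im
  have p3 := perSq_nonneg Q N.2.2.2.re
  have p4 := perSq_nonneg Q N.2.2.2.im
  rw [perDist] at h0
  obtain ⟨n₁, h1⟩ := exists_of_perSq_lt (L := 4) (x := N.2.2.1.re) (by linarith)
  obtain ⟨n₂, h2⟩ := exists_of_perSq_lt (L := 1 / 2) (x := N.2.2.1.im) (by linarith)
  obtain ⟨n₃, h3⟩ := exists_of_perSq_lt (L := Q) (x := N.2.2.2.re) (by linarith)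
  obtain ⟨n₄, h4⟩ := exists_of_perSq_lt (L := Q) (x := N.2.2.2.im) (by linarith)
  rw [h1, h2, h3, h4] at h0
  obtain ⟨p, q, hpq⟩ := hF.surj_ξ (-n₂)
  obtain ⟨ε, hε, hε'⟩ := sign_real (p + q)
  have hu : ∀ (u : ℝ) (n : ℤ), u = 1 ∨ u = -1 → ∃ n' : ℤ, (n' : ℝ) = u * n := by
    rintro u n (rfl | rfl)
    · exact ⟨n, (one_mul _).symm⟩
    · exact ⟨-n, by push_cast; ring⟩
  obtain ⟨n₃', h3'⟩ := hu ε (-n₃) hε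
  obtain ⟨n₄', h4'⟩ := hu (ε * s) (-n₄) (by rcases hε with h | h <;> rcases hF.sgn with h' | h' <;> simp [h, h'])
  obtain ⟨a, ha⟩ := hF.surj_ν n₃'
  obtain ⟨b, hb⟩ := hF.surj_ν n₄'
  obtain ⟨g, hg, hgx⟩ := exists_formula (-n₁) p q a b
  refine ⟨g, hg, lt_of_eq_of_lt ?_ h0⟩
  have hs : s * s = 1 := by rcases hF.sgn with h | h <;> simp [h]
  have hs' : ε ^ 2 = 1 := by rcases hε with h | h <;> simp [h]
  rw [nrm_affine (e := ε) (by rw [hgx, hε']) hpq ha hb, radSq_eq, h3', h4']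
  simp only [hN, nrm]
  push_cast
  linear_combination (((ν * x.2.1).re - Q * n₃) ^ 2 + (s * (ν * x.2.2.1).re - Q * n₄) ^ 2) * hs' +
    (2 * ε ^ 2 * (s * (ν * x.2.2.1).re - Q * n₄) * (-Q * n₄) + ε ^ 2 * Q ^ 2 * n₄ ^ 2 * (s * s - 1)) * hs

/-- Normal coordinates which agree with those of the component with index `j`, up to signs. -/
structure FrameAt (j : Fin 10) (Q l c : ℝ) (ξ ν : ℂ) (s : ℝ) : Prop extends Frame Q ξ ν s where
  level_eq : level j = l
  tube : ∃ e, IsFlip e ∧ ∀ p, nrm l c ξ ν s (tubeMap j p) = flipMap e 0 (projN p)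
  kap : ∃ (e : _) (a : _) (m : ℤ), IsFlip e ∧ IsPeriod Q a ∧ ∀ x, nrm l c ξ ν s (kappa x) = flipMap e a (nrm l c ξ ν s ((deckF ^ m) x))

namespace FrameAt
variable {j : Fin 10} {Q l c s : ℝ} {ξ ν : ℂ} (h : FrameAt j Q l c ξ ν s)
include h

lemma pb_kappa : ∃ m, pb kappa (nrmForm Q l c ξ ν s) = deckPull (nrmForm Q l c ξ ν s) m := by
  obtain ⟨e, a, m, he, ha, hN⟩ := h.kap
  have hF := (Gam_smooth (zpow_mem mem_F m)).1.diff
  refine ⟨m, funext fun x => ?_⟩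
  have hd := fun y => (hasFDerivAt_nrm l c ξ ν s y).differentiableAt
  rw [nrmForm, ← pb_comp (hd _) ((Gam_smooth mem_k).1.diff _), show (fun y => nrm l c ξ ν s (kappa y)) = fun y => flipMap e a (nrm l c ξ ν s ((deckF ^ m) y)) from funext hN,
    pb_comp (g := fun y => nrm l c ξ ν s ((deckF ^ m) y)) (hasFDerivAt_flipMap _ _ _).differentiableAt ((hd _).comp x (hF _)), pb_flip_perForm h.le he ha, pb_comp (hd _) (hF _)]
  rfl

lemma pb_Gam {g} (hg : g ∈ Gam) : pb g (deckSum (nrmForm Q l c ξ ν s) 0) = deckSum (nrmForm Q l c ξ ν s) 0 :=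
  pb_Gam_of (fun _ _ hg => pb_deckSum (h.shiftInv_nrmForm l c) hg)
    (pb_kappa_deckSum (h.shiftInv_nrmForm l c) h.pb_kappa.choose_spec) hg

lemma radSq_nrm (x) : radSq (nrm l c ξ ν s x) = radSq (tubeInv j x) := by
  obtain ⟨e, he, hN⟩ := h.tube
  have h1 : ∀ i, e i ^ 2 = 1 := fun i => by rcases he.1 i with h | h <;> simp [h]
  conv_lhs => rw [← tubeMap_tubeInv j x, hN]
  rw [radSq_eq, radSq_eq, flipMap_apply, projN_apply]
  simp only [Prod.fst_zero, Prod.snd_zero, zero_re, zero_im, add_zero, mul_pow, h1, one_mul]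

lemma perDens_nrm (hp : radSq p < sqRadius) : perDens Q (nrm l c ξ ν s (tubeMap j p)) = dens (radSq p) := by
  obtain ⟨e, he, hN⟩ := h.tube
  obtain ⟨h1, h2, h3, h4⟩ := coord_lt_of_radSq hp
  rw [hN, perDens_flip h.le he ⟨0, 0, 0, 0, by simp [Prod.ext_iff, Complex.ext_iff]⟩, perDens, perDist, projN_apply, radSq_eq, perSq_small (by norm_num) h1,
    perSq_small le_rfl h2, perSq_small h.le h3, perSq_small h.le h4]

lemma perDens_deck (hp : radSq p < sqRadius) {m : ℤ} (hm : ∀ n : ℤ, m ≠ 4 * n) : perDens Q (nrm l c ξ ν s ((deckF ^ m) (tubeMap j p))) = 0 := by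
  by_contra hc
  have h0 : perDist Q (nrm l c ξ ν s ((deckF ^ m) (tubeMap j p))) < 1 / 512 := by
    by_contra h'
    exact hc (dens_large (not_lt.1 h'))
  set N := nrm l c ξ ν s ((deckF ^ m) (tubeMap j p)) with hN
  have p1 := perSq_nonneg 4 N.2.2.1.re
  have p2 := perSq_nonneg (1 / 2) N.2.2.1.im
  have p3 := perSq_nonneg Q N.2.2.2.re
  have p4 := perSq_nonneg Q N.2.2.2.im
  rw [perDist] at h0
  obtain ⟨n, h1⟩ := exists_of_perSq_lt (L := 4) (x := N.2.2.1.re) (by linarith)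
  have h2 : (N.2.2.1.re - 4 * n) ^ 2 < 1 / 512 := by rw [← h1]; linarith
  have h3 : N.2.2.1.re = p.2.2.1.re + m := by
    rw [hN, deckF_zpow]
    simp only [nrm, tubeMap, h.level_eq]
    ring
  have h4 : |N.2.2.1.re - 4 * n| < 1 / 16 := abs_lt_of_sq_lt_sq (by linarith) (by norm_num)
  have h5 := (coord_lt_of_radSq hp).1
  rw [h3] at h4
  refine hm n ?_
  have h6 : |((m - 4 * n : ℤ) : ℝ)| < 1 := by
    push_cast
    have := abs_sub (p.2.2.1.re + m - 4 * n) p.2.2.1.re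
    rw [show p.2.2.1.re + m - 4 * n - p.2.2.1.re = m - 4 * n by ring] at this
    linarith
  have h7 : |m - 4 * n| < 1 := by exact_mod_cast h6
  rw [Int.abs_lt_one_iff] at h7
  linarith

lemma deckPull_tube (hp : radSq p < sqRadius) {m : ℤ} (hm : ∀ n : ℤ, m ≠ 4 * n) : deckPull (nrmForm Q l c ξ ν s) m (tubeMap j p) = 0 :=
  pb_zero (pb_zero (by rw [perForm, h.perDens_deck hp hm, zero_smul]))

lemma deckSum_tube (hp : radSq p < sqRadius) : deckSum (nrmForm Q l c ξ ν s) 0 (tubeMap j p) = nrmForm Q l c ξ ν s (tubeMap j p) := by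
  rw [deckSum, h.deckPull_tube (m := 0 + 1) hp (by omega), h.deckPull_tube (m := 0 + 2) hp (by omega),
    h.deckPull_tube (m := 0 + 3) hp (by omega), add_zero, add_zero, add_zero, deckPull, zpow_zero, pb_id]

lemma deckSum_eq_sq (x) : deckSum (nrmForm Q l c ξ ν s) 0 x = wedgeCLM Space7 2 2 (glue (single j tauForm) x) (glue (single j tauForm) x) := by
  by_cases hx : x ∈ orbTube j sqRadius
  · obtain ⟨g, hg, hp⟩ := exists_tubeCo hx
    set p := tubeCo j g x with hpdef
    have hco := (contDiff_tubeCo hg (j := j)).diff x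
    have hd := (contDiff_smul_tubeMap hg (j := j)).diff
    rw [glue_eq (tubeInvariant_thom j) hg hp, single_self, ← pb_wedge]
    have h1 : ∀ a : 𝓐 4, a x = pb (tubeCo j g) (pb (fun p => g (tubeMap j p)) a) x := fun a => by
      rw [← pb_comp (hd _) hco]
      exact (pb_of_eventuallyEq_id (.of_forall fun y => apply_tubeCo j g y)).symm
    rw [h1 (deckSum _ 0)]
    refine pb_congr_form ?_
    obtain ⟨e, he, hN⟩ := h.tube
    have hT := (contDiff_tubeMap j).diff p
    rw [← hpdef, tauForm_sq, pb_comp ((Gam_smooth hg).1.diff _) hT, h.pb_Gam hg,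
      pb_congr_form (h.deckSum_tube hp), nrmForm, ← pb_comp (hasFDerivAt_nrm _ _ _ _ _ _).differentiableAt hT,
      show (fun y => nrm l c ξ ν s (tubeMap j y)) = fun y => flipMap e 0 (projN y) from funext hN, pb_comp (hasFDerivAt_flipMap _ _ _).differentiableAt projN.differentiableAt,
      pb_flip_perForm h.le he ⟨0, 0, 0, 0, by simp [Prod.ext_iff, Complex.ext_iff]⟩, perForm_projN, perForm, ← h.perDens_nrm hp, hN,
      perDens_flip h.le he ⟨0, 0, 0, 0, by simp [Prod.ext_iff, Complex.ext_iff]⟩]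
    rfl
  · have h1 : glue (single j tauForm) x = 0 :=
      glue_single_eq_zero (tubeInvariant_thom j) (r := sqRadius) (fun p hp => tauForm_zero (lt_of_lt_of_le (by norm_num [sqRadius]) hp)) hx
    have h2 : ∀ m, deckPull (nrmForm Q l c ξ ν s) m x = 0 := fun m => by
      refine pb_zero (pb_zero ?_)
      rw [perForm]
      by_contra hc
      obtain ⟨g, hg, hr⟩ := h.exists_near l c (fun h0 => hc (by rw [h0, zero_smul]))
      rw [h.radSq_nrm] at hr
      refine hx ?_
      rw [← smul_mem_orbTube (zpow_mem mem_F m), ← smul_mem_orbTube hg, ← tubeMap_tubeInv j (g _)]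
      exact mem_orbTube (one_mem Gam) (hr.trans (by norm_num [sqRadius]))
    rw [h1, deckSum, h2, h2, h2, h2]
    simp

end FrameAt

end JK

namespace JK
open Complex
variable {k l : ℕ} {P : 𝓐 k}

/-! ### Descent of flat forms to the resolution -/

/-- A cutoff function which vanishes near the singular locus. -/
def ctrCut (h : ℝ) : ℝ := Real.smoothTransition (4096 * h - 1)

lemma contDiff_ctrCut : Smooth ctrCut := Real.smoothTransition.contDiff.comp (by fun_prop)
lemma ctrCut_zero {h : ℝ} (hh : h < 1 / 4096) : ctrCut h = 0 := Real.smoothTransition.zero_of_nonpos (by linarith)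
lemma ctrCut_one {h : ℝ} (hh : 1 / 2048 < h) : ctrCut h = 1 := Real.smoothTransition.one_of_one_le (by linarith)

/-- A contraction of the tubes to their cores. -/
def ctr (p : Space7) : Space7 := (p.1, p.2.1, ctrCut (radSq p) * p.2.2.1, ctrCut (radSq p) * p.2.2.2)

lemma contDiff_ctr : Smooth ctr := by
  have h1 : Smooth fun p : Space7 => (ctrCut (radSq p) : ℂ) :=
    ofRealCLM.contDiff.comp (contDiff_ctrCut.comp contDiff_radSq)
  have h2 : Smooth fun p : Space7 => p.2.1 := by fun_prop
  exact contDiff_fst.prodMk (h2.prodMk ((h1.mul projW.contDiff).prodMk (h1.mul projZ.contDiff)))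

lemma radSq_ctr (p : Space7) : radSq (ctr p) ≤ radSq p := by
  have h0 : 0 ≤ ctrCut (radSq p) := Real.smoothTransition.nonneg _
  have h1 : ctrCut (radSq p) ^ 2 ≤ 1 := pow_le_one₀ h0 (Real.smoothTransition.le_one _)
  have h2 : radSq (ctr p) = ctrCut (radSq p) ^ 2 * radSq p := by
    conv_lhs => rw [radSq, ctr]
    simp only [norm_mul, norm_real, Real.norm_of_nonneg h0]
    rw [radSq]; ring
  rw [h2]
  exact mul_le_of_le_one_left (radSq_nonneg p) h1

lemma ctr_eventuallyEq {p : Space7} (h : 1 / 2048 < radSq p) : ctr =ᶠ[𝓝 p] id := by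
  filter_upwards [contDiff_radSq.continuous.continuousAt.eventually_const_lt h] with q hq
  simp [ctr, ctrCut_one hq]

/-- The correction which makes a flat form constant along the fibres near the singular locus. -/
def ctrDiff (P : 𝓐 k) (j : Fin 10) (p : Space7) : Alt7 k :=
  pb (fun q => tubeMap j (ctr q)) P p - pb (tubeMap j) P p

lemma contDiff_tubeCtr (j) : Smooth fun q => tubeMap j (ctr q) := (contDiff_tubeMap j).comp contDiff_ctr

lemma contDiff_ctrDiff (hP : Smooth P) (j) : Smooth (ctrDiff P j) :=
  (contDiff_pb hP (contDiff_tubeCtr j)).sub (contDiff_pb hP (contDiff_tubeMap j))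

lemma ctrDiff_zero (P : 𝓐 k) (j) {p} (h : 1 / 2048 < radSq p) : ctrDiff P j p = 0 := by exact sub_eq_zero.2 (pb_congr ((ctr_eventuallyEq h).fun_comp (tubeMap j)))

lemma tubeInvariant_ctrDiff (hP : ∀ g ∈ Gam, pb g P = P) : TubeInvariant (ctrDiff P) := by
  intro j g hg p hp hp'
  obtain ⟨i, e, σ, α, hi, he, hs⟩ := exists_tubeAct_eq hg hp hp'
  have h1 : ∀ q, tubeMap j (tubeAct j g q) = g (tubeMap j q) := fun q => tubeMap_tubeInv j _
  have h2 : ∀ q, ctr (tubeAct j g q) = tubeAct j g (ctr q) := fun q => by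
    rw [hs, ctr, radSq_signMap hi he]
    simp only [signMap, ctr]
    refine prod_ext₄ rfl rfl ?_ ?_ <;> dsimp <;> ring
  have hd := fun q => (contDiff_tubeAct hg (j := j)).diff q
  have hgd := (Gam_smooth hg).1.diff
  have ht := fun q => (contDiff_tubeMap j).diff q
  have hc := fun q => (contDiff_tubeCtr j).diff q
  have e : pb (tubeAct j g) (ctrDiff P j) p = pb (tubeAct j g) (pb (fun q => tubeMap j (ctr q)) P) p - pb (tubeAct j g) (pb (tubeMap j) P) p := rfl
  rw [e, ← pb_comp (hc _) (hd _), ← pb_comp (ht _) (hd _)]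
  simp only [h2, h1]
  rw [pb_comp (g := fun q => tubeMap j (ctr q)) (hgd _) (hc _), pb_comp (hgd _) (ht _), hP g hg]
  rfl

lemma isGForm_descend (hs : Smooth P) (hP : ∀ g ∈ Gam, pb g P = P) : IsGForm fun x => P x + glue (ctrDiff P) x where
  inv g hg x _ := by exact congrArg₂ (· + ·) (congrFun (hP g hg) x).symm (glue_invariant (tubeInvariant_ctrDiff hP) hg x)
  smooth x _ := hs.contDiffAt.add (contDiffAt_glue (tubeInvariant_ctrDiff hP) (r := 1 / 1024) (by norm_num [sqRadius])
    (fun j p hp => ctrDiff_zero P j (by linarith)) fun j g _ _ => (contDiff_ctrDiff hs j).contDiffAt)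
  ext j b s c v := by
    have hk : Smooth fun q : Space7 => tubeMap j (q.1, q.2.1, 0, 0) := (contDiff_tubeMap j).comp (by fun_prop)
    refine ⟨pb (fun q => tubeMap j (q.1, q.2.1, 0, 0)) P, (contDiff_pb hs hk).contDiffAt, ?_⟩
    have h0 : ∀ᶠ p in 𝓝 ((s, c, 0, v) : Space7), hUV p < 1 / 4096 :=
      continuous_hUV.continuousAt.eventually_lt_const (by simp [hUV])
    filter_upwards [h0] with p hh hp r hr
    have hr0 : r ≠ 0 := fun h => hp (by rw [← hr, h]; simp)
    have hb := (contDiffAt_bl hp hr b).diffAt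
    have e : pb (up j b r) (fun x => P x + glue (ctrDiff P) x) p = pb (up j b r) P p + pb (up j b r) (glue (ctrDiff P)) p := rfl
    have e1 : pb (bl b r) (ctrDiff P j) p = pb (bl b r) (pb (fun q => tubeMap j (ctr q)) P) p - pb (bl b r) (pb (tubeMap j) P) p := rfl
    have e2 : pb (up j b r) P p = pb (bl b r) (pb (tubeMap j) P) p :=
      pb_comp (f := tubeMap j) (g := bl b r) ((contDiff_tubeMap j).diff _) hb
    rw [e, pb_up_glue (tubeInvariant_ctrDiff hP) hp hr (hh.trans (by norm_num [sqRadius])), e1, e2, add_sub_cancel, ← pb_comp ((contDiff_tubeCtr j).diff _) hb]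
    refine pb_congr ?_
    filter_upwards [continuous_hUV.continuousAt.eventually_lt_const hh] with q hq
    simp only [ctr, radSq_bl hr0, ctrCut_zero hq, ofReal_zero, zero_mul]
    rfl

/-- The form on the resolution given by a flat form. -/
def descend (hs : Smooth P) (hP : ∀ g ∈ Gam, pb g P = P) : 𝓓 k :=
  (isGForm_descend hs hP).toForm

lemma loc_descend (hs : Smooth P) (hP : ∀ g ∈ Gam, pb g P = P) {x} (hx : x ∈ regular) (h : ∀ j, x ∉ orbTube j (1 / 1024)) : loc (descend hs hP) none x = P x := by
  rw [descend, (isGForm_descend hs hP).loc_toForm hx]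
  refine (congrArg (P x + ·) ?_).trans (add_zero _)
  by_cases h1 : ∃ j, x ∈ orbTube j sqRadius
  · obtain ⟨j, hj⟩ := h1
    obtain ⟨g, hg, hp⟩ := exists_tubeCo hj
    rw [glue_eq (tubeInvariant_ctrDiff hP) hg hp]
    refine pb_zero (ctrDiff_zero P j ?_)
    by_contra hc
    exact h j (mem_orbTube_of_tubeCo hg (by linarith))
  · push Not at h1
    exact glue_eq_zero h1

lemma d_descend (hs : Smooth P) (hP : ∀ g ∈ Gam, pb g P = P) (h0 : ∀ j, ∀ x ∈ orbTube j (1 / 1024), extDeriv P x = 0) {η : 𝓓 (k + 1)}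
    (hη : ∀ x ∈ regular, loc η none x = extDeriv P x) : DiffForm.d (descend hs hP) = η := by
  refine d_toForm_eq _ fun x hx => ?_
  have hg := tubeInvariant_ctrDiff hP
  have hz : ∀ j p, (1 / 1024 : ℝ) ≤ radSq p → ctrDiff P j p = 0 := fun j p hp => ctrDiff_zero P j (by linarith)
  have hsm := contDiffAt_glue hg (r := 1 / 1024) (x := x) (by norm_num [sqRadius]) hz
    fun j g _ _ => (contDiff_ctrDiff hs j).contDiffAt
  have hPd := hs.diff
  rw [extDeriv_add' (hPd x) (hsm.diffAt), hη x hx, add_eq_left]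
  by_cases h1 : ∃ j, x ∈ orbTube j sqRadius
  · obtain ⟨j, hj⟩ := h1
    obtain ⟨g, hg', hp⟩ := exists_tubeCo hj
    rw [extDeriv_glue hg hg' hp ((contDiff_ctrDiff hs j).diff _)]
    refine pb_zero ?_
    rcases le_or_gt (1 / 1024) (radSq (tubeCo j g x)) with hr | hr
    · refine extDeriv_of_eventually_zero ?_
      filter_upwards [contDiff_radSq.continuous.continuousAt.eventually_const_lt
        (show (1 / 2048 : ℝ) < _ by linarith)] with q hq using ctrDiff_zero P j hq
    · have h2 := fun q => (contDiff_pb hs (contDiff_tubeCtr j)).diff q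
      have h3 := fun q => (contDiff_pb hs (contDiff_tubeMap j)).diff q
      have h4 : ∀ q, radSq q < 1 / 1024 → extDeriv P (tubeMap j q) = 0 := fun q hq =>
        h0 j _ (mem_orbTube (g := 1) (one_mem Gam) hq)
      rw [show ctrDiff P j = fun q => pb (fun q => tubeMap j (ctr q)) P q - pb (tubeMap j) P q from rfl,
        extDeriv_sub' (h2 _) (h3 _), extDeriv_pb (hPd _) (contDiff_tubeCtr j).contDiffAt, extDeriv_pb (hPd _) (contDiff_tubeMap j).contDiffAt, pb_zero (h4 _ hr), sub_zero]
      exact pb_zero (h4 _ ((radSq_ctr _).trans_lt hr))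
  · push Not at h1
    exact extDeriv_of_eventually_zero (glue_eventually_zero hg (by norm_num [sqRadius]) hz h1)

/-! ### A primitive of the difference of two squares of Thom forms -/

/-- The periodized primitive on `ℝ⁷`. -/
def nrmJoin (Q l c : ℝ) (ξ ν : ℂ) (s : ℝ) : 𝓐 3 := pb (nrm l c ξ ν s) (joinForm Q)

lemma Frame.shiftInv_nrmJoin {Q ξ ν s} (hF : Frame Q ξ ν s) (l c) : ShiftInv (nrmJoin Q l c ξ ν s) :=
  hF.pb_nrm (fun _ _ he h0 h1 ha => pb_flip_joinForm hF.le he h0 h1 ha) l c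

lemma Frame.contDiff_nrmJoin {Q ξ ν s} (hF : Frame Q ξ ν s) (l c) : Smooth (nrmJoin Q l c ξ ν s) :=
  contDiff_pb (contDiff_joinForm hF.le) (contDiff_nrm _ _ _ _ _)

/-- The normal coordinates of the second component continue those of the first. -/
def Joined (l c : ℝ) (ξ ν : ℂ) (s l' c' : ℝ) (ξ' ν' : ℂ) (s' : ℝ) : Prop :=
  ∃ e, IsFlip e ∧ ∀ x, nrm l' c' ξ' ν' s' ((deckF ^ (-1 : ℤ)) x) = flipMap e 0 (nrm l c ξ ν s x - joinVec)

section
variable {j j' : Fin 10} {Q l c s l' c' s' : ℝ} {ξ ν ξ' ν' : ℂ}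

lemma isPeriod_zero (Q : ℝ) : IsPeriod Q 0 := ⟨0, 0, 0, 0, by simp [Prod.ext_iff, Complex.ext_iff]⟩

lemma extDeriv_nrmJoin (h : FrameAt j Q l c ξ ν s) (hJ : Joined l c ξ ν s l' c' ξ' ν' s') :
    extDeriv (nrmJoin Q l c ξ ν s) = fun x => nrmForm Q l c ξ ν s x - deckPull (nrmForm Q l' c' ξ' ν' s') (-1) x := by
  obtain ⟨e, he, hN⟩ := hJ
  funext x
  have hd := fun y => (hasFDerivAt_nrm l c ξ ν s y).differentiableAt
  have hd' := fun y => (hasFDerivAt_nrm l' c' ξ' ν' s' y).differentiableAt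
  have hsub : ∀ y, DifferentiableAt ℝ (fun p : Space7 => p - joinVec) y := fun y => by fun_prop
  have h1 : deckPull (nrmForm Q l' c' ξ' ν' s') (-1) x = pb (nrm l c ξ ν s) (fun p => perForm Q (p - joinVec)) x := by
    rw [deckPull, nrmForm, ← pb_comp (hd' _) ((Gam_smooth (zpow_mem mem_F _)).1.diff _),
      show (fun y => nrm l' c' ξ' ν' s' ((deckF ^ (-1 : ℤ)) y)) = fun y => flipMap e 0 (nrm l c ξ ν s y - joinVec) from funext hN,
      pb_comp (g := fun y => nrm l c ξ ν s y - joinVec) (hasFDerivAt_flipMap _ _ _).differentiableAt ((hd _).sub_const _),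
      pb_flip_perForm h.le he (isPeriod_zero Q), pb_comp (hsub _) (hd _)]
    refine pb_congr_form ?_
    rw [pb, (hasFDerivAt_sub_const _).fderiv]
    rfl
  rw [h1, nrmJoin, extDeriv_pb ((contDiff_joinForm h.le).diff _) (contDiff_nrm _ _ _ _ _).contDiffAt,
    show extDeriv (joinForm Q) = fun y => perForm Q y - perForm Q (y - joinVec) from funext (extDeriv_joinForm h.le)]
  rfl

/-- The `Γ`-invariant primitive on `ℝ⁷`. -/
def flatPrim (Q l c : ℝ) (ξ ν : ℂ) (s : ℝ) : 𝓐 3 := kapAvg (deckSum (nrmJoin Q l c ξ ν s) 0)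

lemma contDiff_flatPrim (h : FrameAt j Q l c ξ ν s) : Smooth (flatPrim Q l c ξ ν s) :=
  contDiff_kapAvg (contDiff_deckSum (h.contDiff_nrmJoin l c) 0)

lemma pb_flatPrim (h : FrameAt j Q l c ξ ν s) : ∀ g ∈ Gam, pb g (flatPrim Q l c ξ ν s) = flatPrim Q l c ξ ν s :=
  fun _ hg => pb_kapAvg (fun _ _ hg => pb_deckSum (h.shiftInv_nrmJoin l c) hg) hg

lemma extDeriv_flatPrim (h : FrameAt j Q l c ξ ν s) (h' : FrameAt j' Q l' c' ξ' ν' s') (hJ : Joined l c ξ ν s l' c' ξ' ν' s') (x) :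
    extDeriv (flatPrim Q l c ξ ν s) x = wedgeCLM Space7 2 2 (glue (single j tauForm) x) (glue (single j tauForm) x) -
      wedgeCLM Space7 2 2 (glue (single j' tauForm) x) (glue (single j' tauForm) x) := by
  have hc := h.contDiff_nrmJoin l c
  have e1 : deckSum (fun x => nrmForm Q l c ξ ν s x - deckPull (nrmForm Q l' c' ξ' ν' s') (-1) x) 0 =
      fun x => deckSum (nrmForm Q l c ξ ν s) 0 x - deckSum (nrmForm Q l' c' ξ' ν' s') 0 x := by
    rw [← deckSum_eq (h'.shiftInv_nrmForm l' c') (-1)]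
    have h1 : ∀ m y, deckPull (fun x => nrmForm Q l c ξ ν s x - deckPull (nrmForm Q l' c' ξ' ν' s') (-1) x) m y =
        deckPull (nrmForm Q l c ξ ν s) m y - deckPull (nrmForm Q l' c' ξ' ν' s') (-1 + m) y := fun m y => by
      rw [← pb_deckPull (h'.shiftInv_nrmForm l' c') (shift_deckF m)]
      rfl
    funext y
    simp only [deckSum, h1]
    ring_nf
    abel
  have e2 : ∀ T T' : 𝓐 4, pb kappa T = T → pb kappa T' = T' → kapAvg (fun x => T x - T' x) x = T x - T' x := by
    intro T T' hT hT'
    have e : pb kappa (fun x => T x - T' x) x = pb kappa T x - pb kappa T' x := rfl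
    rw [kapAvg, e, hT, hT', ← two_smul ℝ (T x - T' x), smul_smul]
    norm_num
  rw [flatPrim, extDeriv_kapAvg (contDiff_deckSum hc 0), extDeriv_deckSum hc, extDeriv_nrmJoin h hJ, e1,
    e2 _ _ (h.pb_Gam mem_k) (h'.pb_Gam mem_k), h.deckSum_eq_sq, h'.deckSum_eq_sq]

lemma sq_glue_single (j : Fin 10) {i : Fin 10} {x} (hx : x ∈ orbTube i (1 / 1024)) : wedgeCLM Space7 2 2 (glue (single j tauForm) x) (glue (single j tauForm) x) = 0 := by
  obtain ⟨g, hg, hp⟩ := exists_tubeCo hx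
  rw [glue_eq (tubeInvariant_thom j) hg (hp.trans (by norm_num [sqRadius])), ← pb_wedge]
  refine pb_zero ?_
  by_cases hi : i = j
  · rw [hi, single_self, tauForm_sq, ← hi, dens_small hp, zero_smul]
  · rw [single_ne hi]
    simp

/-- A primitive of the difference of the squares of two Thom forms. -/
def sqPrim (h : FrameAt j Q l c ξ ν s) : 𝓓 3 := descend (contDiff_flatPrim h) (pb_flatPrim h)

lemma d_sqPrim (h : FrameAt j Q l c ξ ν s) (h' : FrameAt j' Q l' c' ξ' ν' s') (hJ : Joined l c ξ ν s l' c' ξ' ν' s') :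
    DiffForm.d (sqPrim h) = DiffForm.wedge (thomForm j) (thomForm j) - DiffForm.wedge (thomForm j') (thomForm j') := by
  refine d_descend _ _ (fun i x hx => ?_) fun x hx => ?_
  · rw [extDeriv_flatPrim h h' hJ, sq_glue_single j hx, sq_glue_single j' hx, sub_zero]
  · rw [extDeriv_flatPrim h h' hJ, loc_sub, loc_wedge, loc_wedge, thomForm, thomForm, (isGForm_thom j).loc_toForm hx, (isGForm_thom j').loc_toForm hx]

end

end JK

namespace JK
open Complex
variable {k l : ℕ}

/-! ### The four components -/

lemma space7_ext {p q : Space7} (h1 : p.1 = q.1) (h2 : p.2.1 = q.2.1) (h3 : p.2.2.1.re = q.2.2.1.re)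
    (h4 : p.2.2.1.im = q.2.2.1.im) (h5 : p.2.2.2.re = q.2.2.2.re) (h6 : p.2.2.2.im = q.2.2.2.im) : p = q :=
  Prod.ext h1 (Prod.ext h2 (Prod.ext (Complex.ext h3 h4) (Complex.ext h5 h6)))

lemma deckF_neg_one (x : Space7) : (deckF ^ (-1 : ℤ)) x = (x.1 - 1, -I * x.2.1, -I * x.2.2.1, -x.2.2.2) := rfl

lemma frame_six : Frame 1 (-I) 1 (-1) where
  le := by norm_num
  sgn := Or.inr rfl
  int_ξ p q := ⟨q, by simp⟩
  surj_ξ n := ⟨0, n, by simp⟩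
  int_ν a := ⟨a.1, by simp [gauss]⟩
  surj_ν n := ⟨(n, 0), by simp [gauss]⟩

lemma frame_two : Frame 1 (-I) (-I) 1 where
  le := by norm_num
  sgn := Or.inl rfl
  int_ξ p q := ⟨q, by simp⟩
  surj_ξ n := ⟨0, n, by simp⟩
  int_ν a := ⟨a.2, by simp [gauss]⟩
  surj_ν n := ⟨(0, n), by simp [gauss]⟩

lemma frame_zero : Frame (1 / 2) 1 ((1 - I) / 2) (-1) where
  le := by norm_num
  sgn := Or.inr rfl
  int_ξ p q := ⟨p, by simp⟩
  surj_ξ n := ⟨n, 0, by simp⟩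
  int_ν a := ⟨a.1 + a.2, by simp [gauss]; ring⟩
  surj_ν n := ⟨(n, 0), by simp [gauss]⟩

lemma frame_one : Frame (1 / 2) 1 (-(1 + I) / 2) 1 where
  le := by norm_num
  sgn := Or.inl rfl
  int_ξ p q := ⟨p, by simp⟩
  surj_ξ n := ⟨n, 0, by simp⟩
  int_ν a := ⟨a.2 - a.1, by simp [gauss]; ring⟩
  surj_ν n := ⟨(0, n), by simp [gauss]; ring⟩

lemma isFlip_mk {a b c d : ℝ} (ha : a = 1 ∨ a = -1 := by simp) (hb : b = 1 ∨ b = -1 := by simp)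
    (hc : c = 1 ∨ c = -1 := by simp) (hd : d = 1 ∨ d = -1 := by simp) (h : a * b = c * d := by norm_num) : IsFlip ![a, b, c, d] :=
  ⟨fun i => by fin_cases i <;> assumption, h⟩

lemma frameAt_six : FrameAt 6 1 (1 / 2) (1 / 4) (-I) 1 (-1) where
  toFrame := frame_six
  level_eq := by simp [level]
  tube := ⟨![1, -1, -1, 1], isFlip_mk, fun p => by
    apply space7_ext <;> simp [nrm, tubeMap, level, base₁, base₂, base₃, eta, theta, JK.sgn, flipMap_apply, projN_apply] <;> norm_num⟩
  kap := ⟨![-1, -1, 1, 1], (⟨4 * (0 : ℤ), 1 / 2 * (1 : ℤ)⟩, ⟨1 * (0 : ℤ), 1 * (0 : ℤ)⟩), 0, isFlip_mk, ⟨_, _, _, _, rfl⟩, fun x => by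
    apply space7_ext <;> simp [nrm, kappa, flipMap_apply] <;> ring⟩

lemma frameAt_two : FrameAt 2 1 (1 / 2) 0 (-I) (-I) 1 where
  toFrame := frame_two
  level_eq := by simp [level]
  tube := ⟨![1, -1, 1, -1], isFlip_mk, fun p => by apply space7_ext <;> simp [nrm, tubeMap, level, base₁, base₂, base₃, eta, theta, JK.sgn, flipMap_apply, projN_apply]⟩
  kap := ⟨![-1, -1, -1, -1], 0, 0, isFlip_mk, isPeriod_zero _, fun x => by apply space7_ext <;> simp [nrm, kappa, flipMap_apply] <;> ring⟩

lemma frameAt_zero : FrameAt 0 (1 / 2) 0 0 1 ((1 - I) / 2) (-1) where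
  toFrame := frame_zero
  level_eq := by simp [level]
  tube := ⟨![1, 1, 1, 1], isFlip_mk, fun p => by apply space7_ext <;> simp [nrm, tubeMap, level, base₁, base₂, base₃, eta, theta, JK.sgn, flipMap_apply, projN_apply] <;> ring⟩
  kap := ⟨![-1, -1, -1, -1], 0, -1, isFlip_mk, isPeriod_zero _, fun x => by
    rw [deckF_neg_one]
    apply space7_ext <;> simp [nrm, kappa, flipMap_apply] <;> ring⟩

lemma frameAt_one : FrameAt 1 (1 / 2) 0 (1 / 4) 1 (-(1 + I) / 2) 1 where
  toFrame := frame_one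
  level_eq := by simp [level]
  tube := ⟨![1, 1, 1, 1], isFlip_mk, fun p => by apply space7_ext <;> simp [nrm, tubeMap, level, base₁, base₂, base₃, eta, theta, JK.sgn, flipMap_apply, projN_apply] <;> ring⟩
  kap := ⟨![-1, -1, 1, 1], (⟨4 * (0 : ℤ), 1 / 2 * (1 : ℤ)⟩, ⟨1 / 2 * (0 : ℤ), 1 / 2 * (0 : ℤ)⟩), -1, isFlip_mk, ⟨_, _, _, _, rfl⟩, fun x => by
    rw [deckF_neg_one]
    apply space7_ext <;> simp [nrm, kappa, flipMap_apply] <;> ring⟩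

lemma joined_six_two : Joined (1 / 2) (1 / 4) (-I) 1 (-1) (1 / 2) 0 (-I) (-I) 1 :=
  ⟨![1, -1, -1, 1], isFlip_mk, fun x => by
    rw [deckF_neg_one]
    apply space7_ext <;> simp [nrm, flipMap_apply, joinVec] <;> ring⟩

lemma joined_zero_one : Joined 0 0 1 ((1 - I) / 2) (-1) 0 (1 / 4) 1 (-(1 + I) / 2) 1 :=
  ⟨![1, -1, -1, 1], isFlip_mk, fun x => by
    rw [deckF_neg_one]
    apply space7_ext <;> simp [nrm, flipMap_apply, joinVec] <;> ring⟩

lemma d_sqPrim_six_two : DiffForm.d (sqPrim frameAt_six) = DiffForm.wedge (thomForm 6) (thomForm 6) - DiffForm.wedge (thomForm 2) (thomForm 2) :=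
  d_sqPrim frameAt_six frameAt_two joined_six_two

lemma d_sqPrim_zero_one : DiffForm.d (sqPrim frameAt_zero) = DiffForm.wedge (thomForm 0) (thomForm 0) - DiffForm.wedge (thomForm 1) (thomForm 1) :=
  d_sqPrim frameAt_zero frameAt_one joined_zero_one

end JK

namespace JK
open Complex
variable {k l : ℕ}

/-! ### The volume of the tubes -/

lemma norm_comp_le {x : Space7} {R : ℝ} (h : ‖x‖ ≤ R) : |x.1| ≤ R ∧ ‖x.2.1‖ ≤ R ∧ ‖x.2.2.1‖ ≤ R ∧ ‖x.2.2.2‖ ≤ R :=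
  ⟨(norm_fst_le x).trans h, (norm_fst_le x.2).trans ((norm_snd_le x).trans h), (norm_fst_le x.2.2).trans ((norm_snd_le x.2).trans ((norm_snd_le x).trans h)),
    (norm_snd_le x.2.2).trans ((norm_snd_le x.2).trans ((norm_snd_le x).trans h))⟩

lemma int_mem_of_abs_le {n : ℤ} {R : ℝ} (h : |(n : ℝ)| ≤ R) : n ∈ Set.Icc (-⌈R⌉) ⌈R⌉ := by
  have h1 := abs_le.1 (h.trans (Int.le_ceil R))
  exact ⟨by exact_mod_cast h1.1, by exact_mod_cast h1.2⟩

lemma finite_NF (R : ℝ) : {g : Perm7 | NF g ∧ ∃ x, ‖x‖ ≤ R ∧ ‖g x‖ ≤ R}.Finite := by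
  set B : Set ℤ := Set.Icc (-⌈4 * R⌉) ⌈4 * R⌉ with hB
  have hBf : B.Finite := Set.finite_Icc _ _
  refine ((hBf.prod (hBf.prod (hBf.prod ((hBf.prod hBf).prod (hBf.prod hBf))))).biUnion
    (t := fun t => {g : Perm7 | ∀ x : Space7, g x = (x.1 + (t.1 : ℤ), I ^ (t.1 : ℤ) * (-1) ^ (t.2.1 + t.2.2.1) * x.2.1 + gauss t.2.2.2.1,
      I ^ (t.1 : ℤ) * (-1) ^ (t.2.1 + t.2.2.1) * x.2.2.1 + gauss t.2.2.2.2, (-1) ^ (t.1 : ℤ) * x.2.2.2 + (t.2.1 + t.2.2.1 * I) / 2)})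
    fun t _ => Set.Subsingleton.finite fun g hg h hh => Equiv.ext fun x => (hg x).trans (hh x).symm).subset ?_
  rintro g ⟨⟨k, p, q, a, b, hg⟩, x, hx, hgx⟩
  have hR : 0 ≤ R := (norm_nonneg _).trans hx
  obtain ⟨h1, h2, h3, h4⟩ := norm_comp_le hx
  obtain ⟨g1, g2, g3, g4⟩ := norm_comp_le hgx
  rw [hg] at g1 g2 g3 g4
  have key : ∀ {u z d : ℂ}, ‖u‖ = 1 → ‖z‖ ≤ R → ‖u * z + d‖ ≤ R → ‖d‖ ≤ 2 * R := by
    intro u z d hu hz h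
    have := norm_sub_le (u * z + d) (u * z)
    rw [add_sub_cancel_left, norm_mul, hu] at this
    linarith
  have hu : ‖I ^ k * (-1 : ℂ) ^ (p + q)‖ = 1 := by simp
  have k2 := key hu h2 g2
  have k3 := key hu h3 g3
  have k4 := key (show ‖(-1 : ℂ) ^ k‖ = 1 by simp) h4 g4
  rw [norm_div, Complex.norm_ofNat] at k4
  have hk : |(k : ℝ)| ≤ 4 * R := by
    have := abs_sub (x.1 + k) x.1
    rw [add_sub_cancel_left] at this
    dsimp only at g1
    linarith
  have e1 : ∀ a : ℤ × ℤ, ‖gauss a‖ ≤ 4 * R → a ∈ B ×ˢ B := fun a ha => by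
    have h1 := (abs_re_le_norm (gauss a)).trans ha
    have h2 := (abs_im_le_norm (gauss a)).trans ha
    simp only [gauss, add_re, intCast_re, mul_re, I_re, mul_zero, intCast_im, I_im, mul_one, sub_self, add_zero, add_im, mul_im, zero_add] at h1 h2
    exact ⟨int_mem_of_abs_le h1, int_mem_of_abs_le h2⟩
  have hpq := e1 (p, q) (by
    change ‖(p : ℂ) + q * I‖ ≤ _
    linarith)
  exact Set.mem_biUnion (show (k, p, q, a, b) ∈ _ from
    ⟨int_mem_of_abs_le hk, hpq.1, hpq.2, e1 a (by linarith), e1 b (by linarith)⟩) hg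

lemma finite_Gam (R : ℝ) : {g : Perm7 | g ∈ Gam ∧ ∃ x, ‖x‖ ≤ R ∧ ‖g x‖ ≤ R}.Finite := by
  refine ((finite_NF R).union ((finite_NF (R + 1)).image (· * kappa))).subset ?_
  rintro g ⟨hg, x, hx, hgx⟩
  rcases NF_or hg with h | h
  · exact Or.inl ⟨h, x, hx, hgx⟩
  · refine Or.inr ⟨g * kappa, ⟨h, kappa x, ?_, ?_⟩, by dsimp only; rw [mul_assoc, kappa_kappa, mul_one]⟩
    · obtain ⟨h1, h2, h3, h4⟩ := norm_comp_le hx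
      have : |1 - x.1| ≤ R + 1 := (abs_sub _ _).trans (by rw [abs_one]; linarith)
      have hc : ∀ z : ℂ, ‖z‖ ≤ R → ‖conj z‖ ≤ R + 1 := fun z hz => by rw [norm_conj]; linarith
      exact norm_prod_le_iff.2 ⟨this, norm_prod_le_iff.2 ⟨hc _ h2, norm_prod_le_iff.2 ⟨hc _ h3, hc _ h4⟩⟩⟩
    · have : (g * kappa) (kappa x) = g x := by
        rw [Equiv.Perm.mul_apply, ← Equiv.Perm.mul_apply kappa, kappa_kappa]; rfl
      rw [this]; linarith

/-- Real coordinates on `ℝ⁷`. -/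
def coordEquiv : (Fin 7 → ℝ) ≃ₗ[ℝ] Space7 where
  toFun y := (y 0, ⟨y 1, y 2⟩, ⟨y 3, y 4⟩, ⟨y 5, y 6⟩)
  invFun x := ![x.1, x.2.1.re, x.2.1.im, x.2.2.1.re, x.2.2.1.im, x.2.2.2.re, x.2.2.2.im]
  left_inv y := by ext i; fin_cases i <;> rfl
  right_inv x := rfl
  map_add' _ _ := rfl
  map_smul' r y := by refine prod_ext₄ rfl ?_ ?_ ?_ <;> refine Complex.ext ?_ ?_ <;> simp

def coord : (Fin 7 → ℝ) ≃L[ℝ] Space7 := coordEquiv.toContinuousLinearEquiv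

/-- A box of periods. -/
def cell : Set (Fin 7 → ℝ) := Set.Icc 0 ![4, 1, 1, 1, 1, 1, 1]

def tubeCube (δ : ℝ) : Set (Fin 7 → ℝ) := Set.Icc ![-2, -2, -2, -√δ, -√δ, -√δ, -√δ] ![2, 2, 2, √δ, √δ, √δ, √δ]

lemma exists_tubeCube {j δ x} (hx : x ∈ orbTube j δ) : ∃ g ∈ Gam, ∃ q ∈ tubeCube δ, g (tubeMap j (coord q)) = x := by
  obtain ⟨g, hg, hp⟩ := exists_tubeCo hx
  obtain ⟨h, hh, σ, α, hT, hs, hc⟩ := exists_translate_bounded j (tubeCo j g x).1 (tubeCo j g x).2.1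
  have hb : ∀ y : ℝ, y ^ 2 < δ → -√δ ≤ y ∧ y ≤ √δ := fun y hy => abs_le.1 (Real.abs_le_sqrt hy.le)
  rw [radSq_eq] at hp
  set p := tubeCo j g x with hpd
  refine ⟨g * h⁻¹, mul_mem hg (inv_mem hh), coord.symm (p.1 + σ, (1 : ℝ) * p.2.1 + α, p.2.2.1, (1 : ℝ) * p.2.2.2), ?_, ?_⟩
  · have h1 := (abs_re_le_norm _).trans hc
    have h2 := (abs_im_le_norm _).trans hc
    rw [abs_le] at h1 h2
    obtain ⟨a1, b1⟩ := hb p.2.2.1.re (by nlinarith [sq_nonneg p.2.2.1.im, sq_nonneg p.2.2.2.re, sq_nonneg p.2.2.2.im])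
    obtain ⟨a2, b2⟩ := hb p.2.2.1.im (by nlinarith [sq_nonneg p.2.2.1.re, sq_nonneg p.2.2.2.re, sq_nonneg p.2.2.2.im])
    obtain ⟨a3, b3⟩ := hb p.2.2.2.re (by nlinarith [sq_nonneg p.2.2.1.im, sq_nonneg p.2.2.1.re, sq_nonneg p.2.2.2.im])
    obtain ⟨a4, b4⟩ := hb p.2.2.2.im (by nlinarith [sq_nonneg p.2.2.1.im, sq_nonneg p.2.2.2.re, sq_nonneg p.2.2.1.re])
    simp only [ofReal_one, one_mul]
    refine ⟨fun i => ?_, fun i => ?_⟩ <;> fin_cases i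
    exacts [by change (-2 : ℝ) ≤ p.1 + σ; linarith [hs.1], h1.1, h2.1, a1, a2, a3, a4, by change p.1 + σ ≤ (2 : ℝ); linarith [hs.2], h1.2, h2.2, b1, b2, b3, b4]
  · rw [ContinuousLinearEquiv.apply_symm_apply, ← hT]
    exact (congrArg g (h.symm_apply_apply _)).trans (apply_tubeCo j g x)

lemma volume_tubeCube {δ : ℝ} (hδ : 0 ≤ δ) : volume (tubeCube δ) = ENNReal.ofReal (1024 * δ ^ 2) := by
  have h0 := Real.sqrt_nonneg δ
  rw [tubeCube, Real.volume_Icc_pi, ← ENNReal.ofReal_prod_of_nonneg]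
  · congr 1
    rw [Fin.prod_univ_seven]
    change (2 - -2) * (2 - -2) * (2 - -2) * (√δ - -√δ) * (√δ - -√δ) * (√δ - -√δ) * (√δ - -√δ) = _
    have := Real.sq_sqrt hδ
    linear_combination (1024 * (√δ ^ 2 + δ)) * this
  · intro i _
    fin_cases i
    exacts [(by norm_num : (0 : ℝ) ≤ 2 - -2), (by norm_num : (0 : ℝ) ≤ 2 - -2), (by norm_num : (0 : ℝ) ≤ 2 - -2),
      (by linarith : 0 ≤ √δ - -√δ), (by linarith : 0 ≤ √δ - -√δ), (by linarith : 0 ≤ √δ - -√δ), (by linarith : 0 ≤ √δ - -√δ)]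

lemma isCompact_cell : IsCompact cell := isCompact_Icc

lemma isCompact_tubeCube (δ : ℝ) : IsCompact (tubeCube δ) := isCompact_Icc

lemma tubeCube_subset {δ : ℝ} (h : δ ≤ 1) : tubeCube δ ⊆ tubeCube 1 := by
  have := Real.sqrt_le_sqrt h
  refine Set.Icc_subset_Icc ?_ ?_ <;> simp only [Pi.le_def, Fin.forall_fin_succ, Fin.forall_fin_zero_pi, Matrix.cons_val_zero, Matrix.cons_val_succ,
    le_refl, true_and, neg_le_neg_iff, this, IsEmpty.forall_iff, and_self]

lemma volume_image_tubeCube {f : (Fin 7 → ℝ) → Fin 7 → ℝ} {K : NNReal} (hf : LipschitzOnWith K f (tubeCube 1)) {δ : ℝ}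
    (h0 : 0 ≤ δ) (h1 : δ ≤ 1) : volume (f '' tubeCube δ) ≤ ENNReal.ofReal ((K : ℝ) ^ 7 * 1024 * δ ^ 2) := by
  have h3 := (hf.mono (tubeCube_subset h1)).hausdorffMeasure_image_le (d := 7) (by norm_num)
  have h4 := hausdorffMeasure_pi_real (ι := Fin 7)
  rw [Fintype.card_fin, show ((7 : ℕ) : ℝ) = 7 by norm_num] at h4
  rw [h4, volume_tubeCube h0] at h3
  refine h3.trans (le_of_eq ?_)
  rw [mul_assoc ((K : ℝ) ^ 7), ENNReal.ofReal_mul (p := (K : ℝ) ^ 7) (by positivity), ENNReal.ofReal_pow (by positivity) 7, ENNReal.ofReal_coe_nnreal (p := K)]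
  norm_num

lemma exists_volume_tube (j : Fin 10) : ∃ C : ℝ, 0 ≤ C ∧ ∀ δ, 0 ≤ δ → δ ≤ 1 → volume {y ∈ cell | coord y ∈ orbTube j δ} ≤ ENNReal.ofReal (C * δ ^ 2) := by
  have hK1 := isCompact_tubeCube 1
  have hc1 : Continuous fun q => tubeMap j (coord q) := (contDiff_tubeMap j).continuous.comp coord.continuous
  obtain ⟨R₁, hR₁⟩ := (hK1.image hc1).isBounded.exists_norm_le
  obtain ⟨R₂, hR₂⟩ := (isCompact_cell.image coord.continuous).isBounded.exists_norm_le
  have hF := finite_Gam (max R₁ R₂)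
  set F := {g : Perm7 | g ∈ Gam ∧ ∃ x, ‖x‖ ≤ max R₁ R₂ ∧ ‖g x‖ ≤ max R₁ R₂} with hFd
  have hL : ∃ K : NNReal, LipschitzOnWith K (fun q => tubeMap j (coord q)) (tubeCube 1) :=
    (((contDiff_tubeMap j).comp coord.contDiff).of_le (by simp : (1 : WithTop ℕ∞) ≤ ∞)).locallyLipschitz.locallyLipschitzOn.exists_lipschitzOnWith_of_compact hK1
  obtain ⟨K, hK⟩ := hL
  set K' : NNReal := ‖(coord.symm : Space7 →L[ℝ] (Fin 7 → ℝ))‖₊ * (1 * K) with hK'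
  refine ⟨hF.toFinset.card * ((K' : ℝ) ^ 7 * 1024), by positivity, fun δ h0 h1 => ?_⟩
  have hcov : {y ∈ cell | coord y ∈ orbTube j δ} ⊆ ⋃ g ∈ hF.toFinset, (fun q => coord.symm (g (tubeMap j (coord q)))) '' tubeCube δ := by
    rintro y ⟨hy, hyt⟩
    obtain ⟨g, hg, q, hq, e⟩ := exists_tubeCube hyt
    refine Set.mem_biUnion (x := g) ?_ ⟨q, hq, by dsimp only; rw [e, ContinuousLinearEquiv.symm_apply_apply]⟩
    rw [Set.Finite.coe_toFinset]
    exact ⟨hg, _, (hR₁ _ ⟨q, tubeCube_subset h1 hq, rfl⟩).trans (le_max_left _ _), by rw [e]; exact (hR₂ _ ⟨y, hy, rfl⟩).trans (le_max_right _ _)⟩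
  have him : ∀ g ∈ hF.toFinset, volume ((fun q => coord.symm (g (tubeMap j (coord q)))) '' tubeCube δ) ≤ ENNReal.ofReal ((K' : ℝ) ^ 7 * 1024 * δ ^ 2) := by
    intro g hg
    have hgL := (Gam_smooth ((hF.mem_toFinset.1 hg).1)).2.lipschitz
    exact volume_image_tubeCube ((coord.symm : Space7 →L[ℝ] (Fin 7 → ℝ)).lipschitz.comp_lipschitzOnWith (hgL.comp_lipschitzOnWith hK)) h0 h1
  refine (measure_mono hcov).trans ((measure_biUnion_finset_le _ _).trans ((Finset.sum_le_sum him).trans ?_))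
  rw [Finset.sum_const, nsmul_eq_mul, ← ENNReal.ofReal_natCast, ← ENNReal.ofReal_mul (by positivity)]
  exact ENNReal.ofReal_le_ofReal (le_of_eq (by ring))

end JK

namespace JK
open Complex
variable {k l : ℕ}

/-! ### The singular points -/

lemma space7_ext_re {p q : Space7} (h1 : p.1 = q.1) (h2 : p.2.1.re = q.2.1.re) (h2' : p.2.1.im = q.2.1.im)
    (h3 : p.2.2.1.re = q.2.2.1.re) (h4 : p.2.2.1.im = q.2.2.1.im) (h5 : p.2.2.2.re = q.2.2.2.re) (h6 : p.2.2.2.im = q.2.2.2.im) :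
    p = q := space7_ext h1 (Complex.ext h2 h2') h3 h4 h5 h6

lemma core_of_half {t : ℝ} {z₁ z₂ z₃ : ℂ} {k p q : ℤ} {a b : ℤ × ℤ} (ht : t = 1 / 2)
    (h : ((1 - t) + k, I ^ k * (-1) ^ (p + q) * conj z₁ + gauss a, I ^ k * (-1) ^ (p + q) * conj z₂ + gauss b, (-1) ^ k * conj z₃ + (p + q * I) / 2) = (t, z₁, z₂, z₃)) :
    ∃ j, ∃ g ∈ Gam, ∃ s c, g (t, z₁, z₂, z₃) = tubeMap j (s, c, 0, 0) := by
  simp only [Prod.mk.injEq] at h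
  obtain ⟨h1, h2, h3, h4⟩ := h
  obtain rfl : k = 0 := by
    have : (k : ℝ) = 0 := by linarith
    exact_mod_cast this
  have e1 := congrArg re h4
  have e2 := congrArg im h4
  simp at e1 e2
  obtain rfl : p = 0 := by exact_mod_cast e1
  obtain ⟨q, rfl | rfl⟩ := Int.even_or_odd' q
  · rw [zpow_zero, zero_add, (even_two_mul q).neg_one_zpow] at h2 h3
    have f1 := congrArg im h2
    have f2 := congrArg im h3
    obtain ⟨a₁, a₂⟩ := a
    obtain ⟨b₁, b₂⟩ := b
    simp [gauss] at f1 f2 e2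
    obtain ⟨a', ha⟩ := Int.even_or_odd' a₂
    obtain ⟨b', hb⟩ := Int.even_or_odd' b₂
    obtain ⟨g, hg, hgx⟩ := exists_formula 0 q (-q) (0, -a') (0, -b')
    rcases ha with rfl | rfl <;> rcases hb with rfl | rfl <;> push_cast at f1 f2
    on_goal 1 => refine ⟨2, g, hg, z₃.re + q / 2, ⟨z₁.re, z₂.re⟩, ?_⟩
    on_goal 2 => refine ⟨3, g, hg, z₃.re + q / 2, ⟨z₁.re, z₂.re⟩, ?_⟩
    on_goal 3 => refine ⟨4, g, hg, z₃.re + q / 2, ⟨z₁.re, z₂.re⟩, ?_⟩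
    on_goal 4 => refine ⟨5, g, hg, z₃.re + q / 2, ⟨z₁.re, z₂.re⟩, ?_⟩
    all_goals
      rw [hgx]
      apply space7_ext_re <;> simp [gauss, tubeMap, level, base₁, base₂, base₃, eta, theta] <;> linarith
  · rw [zpow_zero, zero_add, (odd_two_mul_add_one q).neg_one_zpow] at h2 h3
    have f1 := congrArg re h2
    have f2 := congrArg re h3
    obtain ⟨a₁, a₂⟩ := a
    obtain ⟨b₁, b₂⟩ := b
    simp [gauss] at f1 f2 e2
    obtain ⟨a', ha⟩ := Int.even_or_odd' a₁
    obtain ⟨b', hb⟩ := Int.even_or_odd' b₁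
    obtain ⟨g, hg, hgx⟩ := exists_formula 0 (q + 1) (-(q + 1)) (-a', 0) (-b', 0)
    rcases ha with rfl | rfl <;> rcases hb with rfl | rfl <;> push_cast at f1 f2
    on_goal 1 => refine ⟨6, g, hg, z₃.re + (q + 1) / 2, ⟨z₁.im, z₂.im⟩, ?_⟩
    on_goal 2 => refine ⟨7, g, hg, z₃.re + (q + 1) / 2, ⟨z₁.im, z₂.im⟩, ?_⟩
    on_goal 3 => refine ⟨8, g, hg, z₃.re + (q + 1) / 2, ⟨z₁.im, z₂.im⟩, ?_⟩
    on_goal 4 => refine ⟨9, g, hg, z₃.re + (q + 1) / 2, ⟨z₁.im, z₂.im⟩, ?_⟩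
    all_goals
      rw [hgx]
      apply space7_ext_re <;> simp [gauss, tubeMap, level, base₁, base₂, base₃, eta, theta] <;> linarith

lemma core_of_zero {t : ℝ} {z₁ z₂ z₃ : ℂ} {k p q : ℤ} {a b : ℤ × ℤ} (ht : t = 0)
    (h : ((1 - t) + k, I ^ k * (-1) ^ (p + q) * conj z₁ + gauss a, I ^ k * (-1) ^ (p + q) * conj z₂ + gauss b, (-1) ^ k * conj z₃ + (p + q * I) / 2) = (t, z₁, z₂, z₃)) :
    ∃ j, ∃ g ∈ Gam, ∃ s c, g (t, z₁, z₂, z₃) = tubeMap j (s, c, 0, 0) := by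
  simp only [Prod.mk.injEq] at h
  obtain ⟨h1, h2, h3, h4⟩ := h
  obtain rfl : k = -1 := by
    have : (k : ℝ) = -1 := by linarith
    exact_mod_cast this
  rw [zpow_neg_one, show ((-1 : ℂ))⁻¹ = -1 by norm_num] at h4
  have e1 := congrArg re h4
  have e2 := congrArg im h4
  simp at e1 e2
  obtain rfl : q = 0 := by exact_mod_cast e2
  obtain ⟨a₁, a₂⟩ := a
  obtain ⟨b₁, b₂⟩ := b
  obtain ⟨p, rfl | rfl⟩ := Int.even_or_odd' p
  · rw [zpow_neg_one, add_zero, (even_two_mul p).neg_one_zpow] at h2 h3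
    have f1 := congrArg re h2
    have f2 := congrArg re h3
    simp [gauss] at f1 f2 e1
    obtain ⟨g, hg, hgx⟩ := exists_formula 0 (-p) p (-a₁, 0) (-b₁, 0)
    refine ⟨0, g, hg, z₃.im + p / 2, ⟨-z₁.im, -z₂.im⟩, ?_⟩
    rw [hgx]
    apply space7_ext_re <;> simp [gauss, tubeMap, level, base₁, base₂, base₃, eta, theta] <;> linarith
  · rw [zpow_neg_one, add_zero, (odd_two_mul_add_one p).neg_one_zpow] at h2 h3
    have f1 := congrArg re h2
    have f2 := congrArg re h3
    simp [gauss] at f1 f2 e1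
    obtain ⟨g, hg, hgx⟩ := exists_formula 0 (-(p + 1)) (p + 1) (-a₁, 0) (-b₁, 0)
    refine ⟨1, g, hg, z₃.im + (p + 1) / 2, ⟨z₁.im, z₂.im⟩, ?_⟩
    rw [hgx]
    apply space7_ext_re <;> simp [gauss, tubeMap, level, base₁, base₂, base₃, eta, theta] <;> linarith

lemma exists_core {x : Space7} (hx : x ∉ regular) : ∃ j, ∃ g ∈ Gam, ∃ s c, g (tubeMap j (s, c, 0, 0)) = x := by
  have key : ∀ {x : Space7}, x ∉ regular → ∃ (k p q : ℤ) (a b : ℤ × ℤ),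
      ((1 - x.1) + (k : ℝ), I ^ k * (-1) ^ (p + q) * conj x.2.1 + gauss a, I ^ k * (-1) ^ (p + q) * conj x.2.2.1 + gauss b,
      (-1) ^ k * conj x.2.2.2 + (p + q * I) / 2) = x := by
    intro x hx
    obtain ⟨g, hg, hgx, hg1⟩ : ∃ g ∈ Gam, g x = x ∧ g ≠ 1 := by
      simp only [regular, Set.mem_ofPred_eq, not_forall] at hx
      obtain ⟨g, hg, h1, h2⟩ := hx
      exact ⟨g, hg, h1, h2⟩
    obtain ⟨k, p, q, a, b, h⟩ := (NF_or hg).resolve_left fun h => hg1 (NF_fix h hgx)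
    refine ⟨k, p, q, a, b, ?_⟩
    have h1 : (g * kappa) (kappa x) = x := by rw [Equiv.Perm.mul_apply, ← Equiv.Perm.mul_apply kappa, kappa_kappa]; exact hgx
    rw [h] at h1
    exact h1
  obtain ⟨k, p, q, a, b, h⟩ := key hx
  have ht : x.1 = (1 + k) / 2 := by
    have := congrArg Prod.fst h
    dsimp only at this
    linarith
  obtain ⟨m, hm⟩ : ∃ m : ℤ, x.1 + m = 0 ∨ x.1 + m = 1 / 2 := by
    obtain ⟨n, rfl | rfl⟩ := Int.even_or_odd' k
    · exact ⟨-n, Or.inr (by rw [ht]; push_cast; ring)⟩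
    · exact ⟨-(n + 1), Or.inl (by rw [ht]; push_cast; ring)⟩
  have hy : (deckF ^ m) x ∉ regular := fun h => hx (by
    have := regular_smul (inv_mem (zpow_mem mem_F m)) h
    rwa [← Equiv.Perm.mul_apply, inv_mul_cancel] at this)
  obtain ⟨k', p', q', a', b', h'⟩ := key hy
  have hy1 : ((deckF ^ m) x).1 = x.1 + m := by rw [deckF_zpow]
  obtain ⟨j, g, hg, s, c, e⟩ : ∃ j, ∃ g ∈ Gam, ∃ s c, g ((deckF ^ m) x) = tubeMap j (s, c, 0, 0) := by
    rcases hm with hm | hm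
    · exact core_of_zero (hy1.trans hm) h'
    · exact core_of_half (hy1.trans hm) h'
  refine ⟨j, (g * deckF ^ m)⁻¹, inv_mem (mul_mem hg (zpow_mem mem_F m)), s, c, ?_⟩
  rw [← e, Equiv.Perm.inv_eq_iff_eq]
  rfl

/-! ### Forms of top degree -/

def stdB : Module.Basis (Fin 7) ℝ Space7 := (Pi.basisFun ℝ (Fin 7)).map coordEquiv

lemma stdB_apply (i) : stdB i = coord (Pi.single i 1) := by rw [stdB, Module.Basis.map_apply, Pi.basisFun_apply]; rfl

lemma top_apply (A : Alt7 7) (v : Fin 7 → Space7) : A v = A stdB * stdB.det v :=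
  congrArg (fun f : Space7 [⋀^Fin 7]→ₗ[ℝ] ℝ => f v) (A.toAlternatingMap.eq_smul_basis_det stdB)

lemma top_comp (A : Alt7 7) (L : Space7 →L[ℝ] Space7) : A.compContinuousLinearMap L stdB = LinearMap.det (L : Space7 →ₗ[ℝ] Space7) * A stdB := by
  change A (fun i => L (stdB i)) = _
  rw [top_apply, show (fun i => L (stdB i)) = (L : Space7 →ₗ[ℝ] Space7) ∘ stdB from rfl, Module.Basis.det_comp, Module.Basis.det_self, mul_one, mul_comm]

lemma exists_top_le : ∃ K : ℝ, 0 ≤ K ∧ ∀ (A : Alt7 7) (v : Fin 7 → Space7) (m : ℝ), (∀ i, ‖v i‖ ≤ m) →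
    |A v| ≤ K * m ^ 7 * |A stdB| := by
  set N := ‖(coord.symm : Space7 →L[ℝ] (Fin 7 → ℝ))‖
  refine ⟨Nat.factorial 7 * N ^ 7, by positivity, fun A v m hv => ?_⟩
  have h : |stdB.det v| ≤ Nat.factorial 7 * N ^ 7 * m ^ 7 := by
    rw [Module.Basis.det_apply]
    have h1 : ∀ i j, |(stdB.toMatrix v) i j| ≤ N * m := fun i j => by
      have : (stdB.toMatrix v) i j = coord.symm (v j) i := rfl
      rw [this]
      exact (norm_le_pi_norm (coord.symm (v j)) i).trans (((coord.symm : Space7 →L[ℝ] (Fin 7 → ℝ)).le_opNorm (v j)).trans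
        (mul_le_mul_of_nonneg_left (hv j) (norm_nonneg _)))
    have := Matrix.det_le (abv := AbsoluteValue.abs) h1
    rw [Fintype.card_fin, nsmul_eq_mul, mul_pow, ← mul_assoc] at this
    exact this
  rw [top_apply, abs_mul, mul_comm]
  exact mul_le_mul_of_nonneg_right h (abs_nonneg _)

/-! ### The divergence theorem for periodic forms -/

def cellTop : Fin 7 → ℝ := ![4, 1, 1, 1, 1, 1, 1]

lemma cellTop_nonneg : 0 ≤ cellTop := fun i => by fin_cases i <;> simp [cellTop]

lemma integral_periodic {Z : 𝓐 6} (hZ : Smooth Z) (hp : ∀ i x, Z (x + coord (Pi.single i (cellTop i))) = Z x) : ∫ y in cell, extDeriv Z (coord y) stdB = 0 := by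
  have hd : ∀ i : Fin 7, Smooth fun x => Z x (i.removeNth stdB) := fun i =>
    (ContinuousAlternatingMap.apply ℝ Space7 ℝ (i.removeNth stdB)).contDiff.comp hZ
  have hF : ∀ (i : Fin 7) y, HasFDerivAt (fun y : Fin 7 → ℝ => (-1 : ℝ) ^ (i : ℕ) * Z (coord y) (i.removeNth stdB))
      ((-1 : ℝ) ^ (i : ℕ) • (fderiv ℝ (fun x => Z x (i.removeNth stdB)) (coord y) ∘L (coord : (Fin 7 → ℝ) →L[ℝ] Space7))) y :=
    fun i y => (((hd i).diff (coord y)).hasFDerivAt.comp y coord.hasFDerivAt).const_mul _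
  have hdc : Continuous fun y => ∑ i : Fin 7, ((-1 : ℝ) ^ (i : ℕ) • (fderiv ℝ (fun x => Z x (i.removeNth stdB)) (coord y) ∘L
      (coord : (Fin 7 → ℝ) →L[ℝ] Space7))) (Pi.single i 1) := by
    refine continuous_finsetSum _ fun i _ => Continuous.const_smul ?_ ((-1 : ℝ) ^ (i : ℕ))
    exact (((hd i).continuous_fderiv (by simp)).comp coord.continuous).clm_apply continuous_const
  have h := integral_divergence_of_hasFDerivAt_off_countable' 0 cellTop cellTop_nonneg
    (fun i y => (-1 : ℝ) ^ (i : ℕ) * Z (coord y) (i.removeNth stdB)) _ ∅ Set.countable_empty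
    (fun i => (continuous_const.mul ((hd i).continuous.comp coord.continuous)).continuousOn) (fun y _ i => hF i y)
    (hdc.continuousOn.integrableOn_compact isCompact_cell)
  have e : ∀ y, extDeriv Z (coord y) stdB = ∑ i : Fin 7, ((-1 : ℝ) ^ (i : ℕ) • (fderiv ℝ (fun x => Z x (i.removeNth stdB)) (coord y) ∘L
      (coord : (Fin 7 → ℝ) →L[ℝ] Space7))) (Pi.single i 1) := fun y => by
    rw [extDeriv_apply (hZ.diff _)]
    refine Finset.sum_congr rfl fun i _ => ?_
    simp [stdB_apply]
  simp only [e]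
  refine h.trans (Finset.sum_eq_zero fun i _ => sub_eq_zero.2 ?_)
  congr 1
  funext y
  have h1 : (i.insertNth (cellTop i) y : Fin 7 → ℝ) = i.insertNth ((0 : Fin 7 → ℝ) i) y + Pi.single i (cellTop i) := by
    ext m
    refine Fin.succAboveCases i ?_ (fun m => ?_) m <;> simp
  rw [h1, map_add, hp]

lemma periodic_of_invariant {Z : 𝓐 k} (h : ∀ g ∈ Gam, ∀ x, Z x = pb g Z x) (i x) : Z (x + coord (Pi.single i (cellTop i))) = Z x := by
  obtain ⟨g, hg, hgx⟩ : ∃ g ∈ Gam, ∀ x, g x = x + coord (Pi.single i (cellTop i)) := by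
    have key : ∀ (n p q : ℤ) (a b : ℤ × ℤ), (∀ x : Space7, (x.1 + 4 * (n : ℝ), (-1) ^ (p + q) * x.2.1 + gauss a, (-1) ^ (p + q) * x.2.2.1 + gauss b,
        x.2.2.2 + (p + q * I) / 2) = x + coord (Pi.single i (cellTop i))) → ∃ g ∈ Gam, ∀ x, g x = x + coord (Pi.single i (cellTop i)) :=
      fun n p q a b hh => let ⟨g, hg, e⟩ := exists_formula n p q a b; ⟨g, hg, fun x => (e x).trans (hh x)⟩
    have hc : ∀ y, coord y = (y 0, ⟨y 1, y 2⟩, ⟨y 3, y 4⟩, ⟨y 5, y 6⟩) := fun _ => rfl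
    simp only [hc] at key ⊢
    fin_cases i
    · refine key 1 0 0 0 0 fun x => ?_
      apply space7_ext_re <;> simp [cellTop, gauss]
    · refine key 0 0 0 (1, 0) 0 fun x => ?_
      apply space7_ext_re <;> simp [cellTop, gauss]
    · refine key 0 0 0 (0, 1) 0 fun x => ?_
      apply space7_ext_re <;> simp [cellTop, gauss]
    · refine key 0 0 0 0 (1, 0) fun x => ?_
      apply space7_ext_re <;> simp [cellTop, gauss]
    · refine key 0 0 0 0 (0, 1) fun x => ?_
      apply space7_ext_re <;> simp [cellTop, gauss]
    · refine key 0 2 0 0 0 fun x => ?_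
      apply space7_ext_re <;> simp [cellTop, gauss]
    · refine key 0 0 2 0 0 fun x => ?_
      apply space7_ext_re <;> simp [cellTop, gauss]
  have h1 : fderiv ℝ g x = ContinuousLinearMap.id ℝ Space7 := by
    rw [show (g : Space7 → Space7) = fun x => x + coord (Pi.single i (cellTop i)) from funext hgx, fderiv_add_const]
    exact fderiv_id
  rw [h g hg x, pb, h1, hgx]
  exact ContinuousAlternatingMap.ext fun v => rfl

end JK

namespace JK
open Complex
variable {k l : ℕ} {δ : ℝ}

/-! ### The determinant of the blow-up -/

/-- A linear map acting on the normal coordinates of the tubes by a complex matrix. -/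
def normLin (a b c d : ℂ) : Space7 →ₗ[ℝ] Space7 where
  toFun x := (x.1, x.2.1, a * x.2.2.1 + b * x.2.2.2, c * x.2.2.1 + d * x.2.2.2)
  map_add' x y := by refine prod_ext₄ rfl rfl ?_ ?_ <;> simp <;> ring
  map_smul' t x := by refine prod_ext₄ rfl rfl ?_ ?_ <;> simp <;> ring

lemma normLin_apply (a b c d : ℂ) (x : Space7) : normLin a b c d x = (x.1, x.2.1, a * x.2.2.1 + b * x.2.2.2, c * x.2.2.1 + d * x.2.2.2) := rfl

lemma normLin_mul (a b c d a' b' c' d' : ℂ) : normLin a b c d ∘ₗ normLin a' b' c' d' = normLin (a * a' + b * c') (a * b' + b * d') (c * a' + d * c') (c * b' + d * d') := by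
  refine LinearMap.ext fun x => ?_
  refine prod_ext₄ rfl rfl ?_ ?_ <;> simp [normLin_apply] <;> ring

lemma normLin_one : normLin 1 0 0 1 = LinearMap.id := by
  refine LinearMap.ext fun x => ?_
  simp [normLin_apply]

lemma det_normLin_mul (a b c d a' b' c' d' : ℂ) : LinearMap.det (normLin a b c d) * LinearMap.det (normLin a' b' c' d') =
    LinearMap.det (normLin (a * a' + b * c') (a * b' + b * d') (c * a' + d * c') (c * b' + d * d')) := by
  rw [← normLin_mul, LinearMap.det_comp]

lemma det_normLin_one : LinearMap.det (normLin 1 0 0 1) = 1 := by rw [normLin_one, LinearMap.det_id]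

def halfDet : ℝ := LinearMap.det (normLin (1 / 2) 0 0 (1 / 2))

lemma halfDet_ne : halfDet ≠ 0 := by
  have h := det_normLin_mul (1 / 2) 0 0 (1 / 2) 2 0 0 2
  norm_num [det_normLin_one] at h
  intro h0
  rw [halfDet] at h0
  norm_num at h0
  rw [h0, zero_mul] at h
  exact zero_ne_one h

lemma det_blow_sq {r : ℂ} (hr : r ≠ 0) (v : ℂ) : LinearMap.det (normLin (1 / (2 * r)) 0 (v / (2 * r)) r) ^ 2 = halfDet ∧
    LinearMap.det (normLin (v / (2 * r)) r (1 / (2 * r)) 0) ^ 2 = halfDet := by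
  have hN := det_normLin_mul 0 1 1 0 0 1 1 0
  have hR := det_normLin_mul 1 0 0 (-1) 1 0 0 (-1)
  have hSR := det_normLin_mul 1 0 v 1 1 0 0 (-1)
  have hSR2 := det_normLin_mul 1 0 v (-1) 1 0 v (-1)
  have hTN := det_normLin_mul (1 / (2 * r)) 0 0 r 0 1 1 0
  have hTN2 := det_normLin_mul 0 (1 / (2 * r)) r 0 0 (1 / (2 * r)) r 0
  have hST := det_normLin_mul 1 0 v 1 (1 / (2 * r)) 0 0 r
  have hNST := det_normLin_mul 0 1 1 0 (1 / (2 * r)) 0 (v / (2 * r)) r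
  have e : 1 / (2 * r) * r = 1 / 2 := by field_simp
  have e' : r * (1 / (2 * r)) = 1 / 2 := by field_simp
  have e2 : v * (1 / (2 * r)) = v / (2 * r) := by ring
  simp only [mul_zero, zero_mul, add_zero, zero_add, mul_one, one_mul, mul_neg, neg_mul, neg_neg, neg_zero, add_neg_cancel, e, e', e2,
    det_normLin_one] at hN hR hSR hSR2 hTN hTN2 hST hNST
  change _ = halfDet at hTN2
  have h1 : LinearMap.det (normLin (1 / (2 * r)) 0 (v / (2 * r)) r) ^ 2 = halfDet := by
    rw [← hST, ← hTN2, ← hTN]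
    have hS : LinearMap.det (normLin 1 0 v 1) * LinearMap.det (normLin 1 0 v 1) = 1 := by
      rw [← hSR] at hSR2
      linear_combination hSR2 - LinearMap.det (normLin 1 0 v 1) * LinearMap.det (normLin 1 0 v 1) * hR
    linear_combination (LinearMap.det (normLin (1 / (2 * r)) 0 0 r)) ^ 2 * (hS - hN)
  refine ⟨h1, ?_⟩
  rw [← hNST]
  linear_combination h1 + LinearMap.det (normLin (1 / (2 * r)) 0 (v / (2 * r)) r) ^ 2 * hN

lemma det_fderiv_bl {b : Bool} {r : ℂ} {q : Space7} (hq : q.2.2.1 ≠ 0) (h : r ^ 2 = q.2.2.1) : LinearMap.det (fderiv ℝ (bl b r) q : Space7 →ₗ[ℝ] Space7) ^ 2 = halfDet := by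
  have hr : r ≠ 0 := fun h0 => hq (by rw [← h, h0]; simp)
  have hB := differentiableAt_branch ((contDiffAt_bl hq h b).diffAt)
  have hbr : branch r q.2.2.1 = r := by rw [← h, branch_self hr]
  have h1 : HasFDerivAt (fun q : Space7 => branch r q.2.2.1) (fderiv ℝ (branch r) q.2.2.1 ∘L projW) q :=
    HasFDerivAt.comp (g := branch r) (f := fun q : Space7 => q.2.2.1) q hB.hasFDerivAt projW.hasFDerivAt
  have h2 : HasFDerivAt (fun q : Space7 => q.2.2.2) projZ q := projZ.hasFDerivAt
  have h3 : HasFDerivAt (fun q : Space7 => branch r q.2.2.1 * q.2.2.2) _ q := h1.mul h2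
  have hs : HasFDerivAt (fun q : Space7 => q.1) (fst ℝ ℝ (ℂ × ℂ × ℂ)) q := hasFDerivAt_fst
  have hc : HasFDerivAt (fun q : Space7 => q.2.1) (fst ℝ ℂ (ℂ × ℂ) ∘L snd ℝ ℝ (ℂ × ℂ × ℂ)) q :=
    (fst ℝ ℂ (ℂ × ℂ) ∘L snd ℝ ℝ (ℂ × ℂ × ℂ)).hasFDerivAt
  have hρ : ∀ a, fderiv ℝ (branch r) q.2.2.1 a = 1 / (2 * r) * a := fun a => by
    have := fderiv_branch hr hB a
    rw [hbr] at this
    field_simp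
    linear_combination this
  cases b
  · have hD := hs.prodMk (hc.prodMk (h1.prodMk h3))
    have e : bl false r = fun q : Space7 => (q.1, q.2.1, branch r q.2.2.1, branch r q.2.2.1 * q.2.2.2) := by funext q; simp [bl, blow, branchMap, dir]
    rw [e, hD.fderiv, ← (det_blow_sq hr q.2.2.2).1]
    congr 2
    refine LinearMap.ext fun x => ?_
    refine prod_ext₄ rfl rfl ?_ ?_ <;> simp [normLin_apply, hρ, hbr, projW, projZ] <;> ring
  · have hD := hs.prodMk (hc.prodMk (h3.prodMk h1))
    have e : bl true r = fun q : Space7 => (q.1, q.2.1, branch r q.2.2.1 * q.2.2.2, branch r q.2.2.1) := by funext q; simp [bl, blow, branchMap, dir]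
    rw [e, hD.fderiv, ← (det_blow_sq hr q.2.2.2).2]
    congr 2
    refine LinearMap.ext fun x => ?_
    refine prod_ext₄ rfl rfl ?_ ?_ <;> simp [normLin_apply, hρ, hbr, projW, projZ] <;> ring

lemma exists_bl {p : Space7} (hp : radSq p ≠ 0) : ∃ b r q, bl b r q = p ∧ q.2.2.1 ≠ 0 ∧ r ^ 2 = q.2.2.1 ∧ ‖q.2.2.2‖ ≤ 1 ∧ q.1 = p.1 ∧ q.2.1 = p.2.1 ∧ hUV q = radSq p := by
  obtain ⟨s, c, w, z⟩ := p
  have key : ∀ b r (v : ℂ), r ≠ 0 → ‖v‖ ≤ 1 → blow b (s, c, r, v) = (s, c, w, z) → ∃ b r q, bl b r q = (s, c, w, z) ∧ q.2.2.1 ≠ 0 ∧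
      r ^ 2 = q.2.2.1 ∧ ‖q.2.2.2‖ ≤ 1 ∧ q.1 = s ∧ q.2.1 = c ∧ hUV q = radSq (s, c, w, z) := fun b r v hr hv h => by
    have e : bl b r (s, c, r ^ 2, v) = (s, c, w, z) := by rw [bl, branchMap_self hr, h]
    exact ⟨b, r, (s, c, r ^ 2, v), e, pow_ne_zero 2 hr, rfl, hv, rfl, rfl, by rw [← radSq_bl hr (b := b), e]⟩
  by_cases hwz : ‖z‖ ≤ ‖w‖
  · have hw : w ≠ 0 := by
      rintro rfl
      have : z = 0 := norm_le_zero_iff.1 (by simpa using hwz)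
      exact hp (by simp [radSq, this])
    exact key false w (z / w) hw (by rw [norm_div]; exact div_le_one_of_le₀ hwz (norm_nonneg _)) (by
      simp only [blow, dir]; simp; field_simp)
  · have hz : z ≠ 0 := by rintro rfl; simp at hwz
    exact key true z (w / z) hz (by rw [norm_div]; exact div_le_one_of_le₀ (le_of_not_ge hwz) (norm_nonneg _)) (by
      simp only [blow, dir]; simp; field_simp)

/-! ### Cutting off a form near the exceptional divisors -/

def cut (h : ℝ) : ℝ := Real.smoothTransition (2 - h)

lemma contDiff_cut : Smooth cut := Real.smoothTransition.contDiff.comp (contDiff_const.sub contDiff_id)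
lemma cut_one {h : ℝ} (hh : h ≤ 1) : cut h = 1 := Real.smoothTransition.one_of_one_le (by linarith)
lemma cut_zero {h : ℝ} (hh : 2 ≤ h) : cut h = 0 := Real.smoothTransition.zero_of_nonpos (by linarith)

/-- The restriction of a form to the tubes, cut off to the radius `δ`. -/
def cutForm (ζ : 𝓓 k) (δ : ℝ) (j : Fin 10) (p : Space7) : Alt7 k :=
  cut (radSq p / δ) • pb (tubeMap j) (loc ζ none) p

lemma loc_singular (ζ : 𝓓 k) {x} (hx : x ∉ regular) : loc ζ none x = 0 := by rw [loc, dif_neg]; exact hx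

lemma loc_invariant (ζ : 𝓓 k) {g} (hg : g ∈ Gam) (x) : loc ζ none x = pb g (loc ζ none) x := by
  by_cases hx : x ∈ regular
  · exact loc_smul_Gam ζ hg hx
  · have h1 : g x ∉ regular := fun h => hx (by simpa using regular_smul (inv_mem hg) h)
    rw [loc_singular ζ hx, pb_zero (loc_singular ζ h1)]

lemma tubeInvariant_cutForm (ζ : 𝓓 k) (δ : ℝ) : TubeInvariant (cutForm ζ δ) := by
  intro j g hg p hp hp'
  have e1 : g (tubeMap j p) = tubeMap j (tubeAct j g p) := by rw [tubeAct, tubeMap_tubeInv]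
  have e2 := radSq_eq_of_smul hg hp hp' e1
  have e3 : pb (tubeAct j g) (pb (tubeMap j) (loc ζ none)) p = pb (tubeMap j) (loc ζ none) p := by
    rw [← pb_comp ((contDiff_tubeMap j).diff _) ((contDiff_tubeAct hg).diff _)]
    have : (fun y => tubeMap j (tubeAct j g y)) = fun y => g (tubeMap j y) := funext fun y => by rw [tubeAct, tubeMap_tubeInv]
    rw [this, pb_comp ((Gam_smooth hg).1.diff _) ((contDiff_tubeMap j).diff _)]
    exact pb_congr_form (loc_invariant ζ hg _).symm
  calc cutForm ζ δ j p = cut (radSq p / δ) • pb (tubeAct j g) (pb (tubeMap j) (loc ζ none)) p := by rw [e3]; rfl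
    _ = cut (radSq (tubeAct j g p) / δ) • pb (tubeAct j g) (pb (tubeMap j) (loc ζ none)) p := by rw [e2]
    _ = pb (tubeAct j g) (cutForm ζ δ j) p := rfl


/-- The form cut off near the singular locus, on `ℝ⁷`. -/
def offForm (ζ : 𝓓 k) (δ : ℝ) (x : Space7) : Alt7 k := loc ζ none x - glue (cutForm ζ δ) x

lemma contDiffAt_cutForm (ζ : 𝓓 k) (δ : ℝ) {j p} (hp : tubeMap j p ∈ regular) : SmoothAt (cutForm ζ δ j) p :=
  (contDiff_cut.comp (contDiff_radSq.div_const δ)).contDiffAt.smul (contDiffAt_pb (contDiffAt_loc ζ hp) (contDiff_tubeMap j).contDiffAt)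

lemma tubeCo_regular {j g x} (hg : g ∈ Gam) (hx : x ∈ regular) : tubeMap j (tubeCo j g x) ∈ regular := by
  rw [tubeCo, tubeMap_tubeInv]
  exact regular_smul (inv_mem hg) hx

lemma cutForm_zero (ζ : 𝓓 k) (hδ : 0 < δ) (j p) (h : 2 * δ ≤ radSq p) : cutForm ζ δ j p = 0 := by rw [cutForm, cut_zero ((le_div_iff₀ hδ).2 h), zero_smul]

lemma contDiffAt_glue_cutForm (ζ : 𝓓 k) (hδ : 0 < δ) (hδ' : 2 * δ < sqRadius) {x} (hx : x ∈ regular) : SmoothAt (glue (cutForm ζ δ)) x :=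
  contDiffAt_glue (tubeInvariant_cutForm ζ δ) hδ' (cutForm_zero ζ hδ) fun _ _ hg _ => contDiffAt_cutForm ζ δ (tubeCo_regular hg hx)

lemma offForm_zero (ζ : 𝓓 k) (hδ : 0 < δ) (hδ' : 2 * δ < sqRadius) {j x} (hx : x ∈ orbTube j δ) : offForm ζ δ x = 0 := by
  obtain ⟨g, hg, h⟩ := exists_tubeCo hx
  have e1 : cutForm ζ δ j (tubeCo j g x) = pb (tubeMap j) (loc ζ none) (tubeCo j g x) := by rw [cutForm, cut_one ((div_le_one hδ).2 h.le), one_smul]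
  have e2 : (fun y => tubeMap j (tubeCo j g y)) = ⇑g⁻¹ := funext fun y => by rw [tubeCo, tubeMap_tubeInv]
  rw [offForm, glue_eq (tubeInvariant_cutForm ζ δ) hg (by linarith), pb_congr_form e1, ← pb_comp ((contDiff_tubeMap j).diff _) ((contDiff_tubeCo hg).diff _), e2,
    ← loc_invariant ζ (inv_mem hg), sub_self]

lemma mem_orbTube_of_singular {x} (hx : x ∉ regular) (hδ : 0 < δ) : ∃ j, x ∈ orbTube j δ := by
  obtain ⟨j, g, hg, s, c, rfl⟩ := exists_core hx
  exact ⟨j, mem_orbTube hg (by simpa [radSq] using hδ)⟩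

lemma contDiff_offForm (ζ : 𝓓 k) (hδ : 0 < δ) (hδ' : 2 * δ < sqRadius) : Smooth (offForm ζ δ) := by
  refine contDiff_iff_contDiffAt.2 fun x => ?_
  by_cases hx : x ∈ regular
  · exact (contDiffAt_loc ζ hx).sub (contDiffAt_glue_cutForm ζ hδ hδ' hx)
  · obtain ⟨j, hj⟩ := mem_orbTube_of_singular hx hδ
    refine (contDiffAt_const (c := (0 : Alt7 k))).congr_of_eventuallyEq ?_
    filter_upwards [(isOpen_orbTube j δ).mem_nhds hj] with y hy using offForm_zero ζ hδ hδ' hy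

lemma offForm_invariant (ζ : 𝓓 k) (δ : ℝ) {g} (hg : g ∈ Gam) (x) : offForm ζ δ x = pb g (offForm ζ δ) x := by
  rw [offForm, loc_invariant ζ hg, glue_invariant (tubeInvariant_cutForm ζ δ) hg]
  rfl

lemma d_sub_offForm (ζ : 𝓓 k) (hδ : 0 < δ) (hδ' : 2 * δ < sqRadius) {x} (hx : x ∈ regular) :
    loc (DiffForm.d ζ) none x - extDeriv (offForm ζ δ) x = extDeriv (glue (cutForm ζ δ)) x := by
  have h := extDeriv_sub' ((contDiffAt_loc ζ (i := none) hx).diffAt)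
    ((contDiffAt_glue_cutForm ζ hδ hδ' hx).diffAt)
  rw [loc_d ζ (i := none) hx]
  exact sub_eq_of_eq_add' (by rw [show offForm ζ δ = fun x => loc ζ none x - glue (cutForm ζ δ) x from rfl, h]; abel)

lemma d_sub_offForm_zero (ζ : 𝓓 k) (hδ : 0 < δ) (hδ' : 2 * δ < sqRadius) {x} (hx : ∀ j, x ∉ orbTube j (3 * δ)) : loc (DiffForm.d ζ) none x - extDeriv (offForm ζ δ) x = 0 := by
  have hr : x ∈ regular := by
    by_contra h
    obtain ⟨j, hj⟩ := mem_orbTube_of_singular h (δ := 3 * δ) (by linarith)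
    exact hx j hj
  rw [d_sub_offForm ζ hδ hδ' hr]
  refine extDeriv_of_eventually_zero ?_
  filter_upwards [Filter.eventually_all.2 fun j => eventually_notMem_orbTube (show 2 * δ < 3 * δ by linarith) (hx j)] with y hy
  by_cases h : ∃ j, y ∈ orbTube j sqRadius
  · obtain ⟨j, hj⟩ := h
    obtain ⟨g, hg, h1⟩ := exists_tubeCo hj
    rw [glue_eq (tubeInvariant_cutForm ζ δ) hg h1]
    exact pb_zero (cutForm_zero ζ hδ j _ (not_lt.1 fun h2 => hy j (mem_orbTube_of_tubeCo hg h2)))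
  · exact glue_eq_zero (not_exists.1 h)

end JK

namespace JK
open Complex
variable {k l : ℕ}

/-! ### Stokes' theorem on the resolution -/

lemma exists_hUV_deriv (r : ℝ) : ∃ K : ℝ, 0 ≤ K ∧ ∀ q ∈ boxUV r, q.2.2.1 ≠ 0 → ∃ L : Space7 →L[ℝ] ℝ, HasFDerivAt hUV L q ∧ ‖L‖ ≤ K := by
  have hg : Smooth fun q : Space7 => 1 + ‖q.2.2.2‖ ^ 2 :=
    contDiff_const.add ((by fun_prop : Smooth fun q : Space7 => q.2.2.2).norm_sq ℝ)
  obtain ⟨K, hK⟩ := (isCompact_boxUV r).exists_bound_of_continuousOn (hg.continuous_fderiv (by simp)).continuousOn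
  refine ⟨|r| * |K| + 2, by positivity, fun q hq hu => ?_⟩
  have hf : DifferentiableAt ℝ (fun q : Space7 => ‖q.2.2.1‖) q :=
    DifferentiableAt.norm ℝ (by fun_prop : DifferentiableAt ℝ (fun q : Space7 => q.2.2.1) q) hu
  refine ⟨_, hf.hasFDerivAt.mul (hg.diff q).hasFDerivAt, (norm_add_le _ _).trans ?_⟩
  have h1 : ‖fderiv ℝ (fun q : Space7 => ‖q.2.2.1‖) q‖ ≤ 1 := by
    have : LipschitzWith 1 fun q : Space7 => ‖q.2.2.1‖ := LipschitzWith.of_dist_le_mul fun x y => by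
      rw [NNReal.coe_one, one_mul, Real.dist_eq]
      refine (abs_norm_sub_norm_le _ _).trans ?_
      rw [dist_eq_norm]
      exact (norm_fst_le (x - y).2.2).trans ((norm_snd_le (x - y).2).trans (norm_snd_le (x - y)))
    simpa using norm_fderiv_le_of_lipschitz ℝ this
  have h2 := hK q hq
  obtain ⟨-, -, h3, h4, -⟩ := hq
  rw [norm_smul, norm_smul, norm_norm, Real.norm_of_nonneg (by positivity)]
  have h5 : ‖q.2.2.1‖ * ‖fderiv ℝ (fun q : Space7 => 1 + ‖q.2.2.2‖ ^ 2) q‖ ≤ |r| * |K| :=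
    mul_le_mul (h3.trans (le_abs_self r)) (h2.trans (le_abs_self K)) (norm_nonneg _) (abs_nonneg _)
  have h6 : ‖q.2.2.2‖ ^ 2 ≤ 1 := pow_le_one₀ (norm_nonneg _) h4
  have h7 : (1 + ‖q.2.2.2‖ ^ 2) * ‖fderiv ℝ (fun q : Space7 => ‖q.2.2.1‖) q‖ ≤ 2 * 1 :=
    mul_le_mul (by linarith) h1 (norm_nonneg _) (by norm_num)
  linarith

lemma exists_chart_bound (ζ : 𝓓 k) (j : Fin 10) (b : Bool) : ∃ C : ℝ, 0 ≤ C ∧ ∀ δ : ℝ, 0 < δ → δ ≤ 1 → ∀ q ∈ boxUV (sqRadius / 2), q.2.2.1 ≠ 0 → hUV q ≤ 3 * δ →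
      ‖extDeriv (fun q => cut (hUV q / δ) • loc ζ (some (j, b)) q) q‖ ≤ C / δ := by
  have hr : (0 : ℝ) < sqRadius := by norm_num [sqRadius]
  have hdom : ∀ q ∈ boxUV (sqRadius / 2), SmoothAt (loc ζ (some (j, b))) q := fun q hq =>
    contDiffAt_loc ζ (mem_domJ_of_hUV (hq.2.2.2.2.trans_lt (by linarith)))
  have hbox := isCompact_boxUV (sqRadius / 2)
  obtain ⟨K₀, hK₀⟩ := hbox.exists_bound_of_continuousOn fun q hq => (hdom q hq).continuousAt.continuousWithinAt
  obtain ⟨K₁, hK₁⟩ := hbox.exists_bound_of_continuousOn (f := fderiv ℝ (loc ζ (some (j, b)))) fun q hq =>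
    ((hdom q hq).continuousAt_fderiv (by simp)).continuousWithinAt
  obtain ⟨K₂, h2, hK₂⟩ := exists_hUV_deriv (sqRadius / 2)
  obtain ⟨K₃, hK₃⟩ := (isCompact_Icc (a := (0 : ℝ)) (b := 3)).exists_bound_of_continuousOn
    (contDiff_cut.continuous_deriv (by simp)).continuousOn
  refine ⟨(k + 1 : ℕ) * (|K₁| + |K₃| * K₂ * |K₀|), by positivity, fun δ h0 h1 q hq hu hqδ => ?_⟩
  obtain ⟨L, hL, hLn⟩ := hK₂ q hq hu
  have hh : 0 ≤ hUV q := by unfold hUV; positivity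
  have hc : HasFDerivAt (fun q => cut (hUV q / δ)) (deriv cut (hUV q / δ) • (δ⁻¹ • L)) q :=
    HasDerivAt.comp_hasFDerivAt (h₂ := cut) (f := fun q => hUV q / δ) q (contDiff_cut.diff (hUV q / δ)).hasDerivAt
      (by simpa [div_eq_inv_mul] using hL.const_mul δ⁻¹)
  have hF : HasFDerivAt (fun q => cut (hUV q / δ) • loc ζ (some (j, b)) q) _ q := hc.smul ((hdom q hq).diffAt).hasFDerivAt
  have e1 := hK₁ q hq
  have e0 := hK₀ q hq
  have e3 := hK₃ (hUV q / δ) ⟨by positivity, (div_le_iff₀ h0).2 hqδ⟩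
  have hcut : ‖cut (hUV q / δ)‖ ≤ 1 := by rw [cut, Real.norm_of_nonneg (Real.smoothTransition.nonneg _)]; exact Real.smoothTransition.le_one _
  have hn : ‖fderiv ℝ (fun q => cut (hUV q / δ) • loc ζ (some (j, b)) q) q‖ ≤ (|K₁| + |K₃| * K₂ * |K₀|) / δ := by
    rw [hF.fderiv]
    refine (norm_add_le (cut (hUV q / δ) • fderiv ℝ (loc ζ (some (j, b))) q)
      ((deriv cut (hUV q / δ) • δ⁻¹ • L).smulRight (loc ζ (some (j, b)) q))).trans ?_
    have t0 : ‖deriv cut (hUV q / δ) • δ⁻¹ • L‖ = ‖deriv cut (hUV q / δ)‖ * (δ⁻¹ * ‖L‖) := by rw [norm_smul, norm_smul, norm_inv, Real.norm_of_nonneg h0.le]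
    rw [ContinuousLinearMap.norm_smulRight_apply, t0]
    have t1 : ‖cut (hUV q / δ) • fderiv ℝ (loc ζ (some (j, b))) q‖ ≤ 1 * |K₁| :=
      (ContinuousLinearMap.opNorm_smul_le _ _).trans
        (mul_le_mul hcut (e1.trans (le_abs_self _)) (ContinuousLinearMap.opNorm_nonneg _) (by norm_num))
    have t2 : ‖deriv cut (hUV q / δ)‖ * (δ⁻¹ * ‖L‖) * ‖loc ζ (some (j, b)) q‖ ≤ |K₃| * (δ⁻¹ * K₂) * |K₀| := by
      gcongr
      · exact e3.trans (le_abs_self _)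
      · exact e0.trans (le_abs_self _)
    have t3 : |K₁| ≤ |K₁| / δ := le_div_self (abs_nonneg _) h0 h1
    calc _ ≤ 1 * |K₁| + |K₃| * (δ⁻¹ * K₂) * |K₀| := add_le_add t1 t2
      _ ≤ |K₁| / δ + |K₃| * (δ⁻¹ * K₂) * |K₀| := by linarith
      _ = _ := by field_simp
  refine (ContinuousAlternatingMap.norm_alternatizeUncurryFin_le _).trans ?_
  rw [mul_div_assoc]
  push_cast
  exact mul_le_mul_of_nonneg_left hn (by positivity)

lemma pb_bl_cutForm (ζ : 𝓓 k) (δ : ℝ) {j b r} {q : Space7} (hq : q.2.2.1 ≠ 0) (h : r ^ 2 = q.2.2.1) (hh : hUV q < sqRadius) :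
    pb (bl b r) (cutForm ζ δ j) =ᶠ[𝓝 q] fun q => cut (hUV q / δ) • loc ζ (some (j, b)) q := by
  have hr : r ≠ 0 := fun h0 => hq (by rw [← h, h0]; simp)
  filter_upwards [eventually_ne_zero hq, continuous_hUV.continuousAt.eventually_lt_const hh,
    eventually_differentiableAt (contDiffAt_bl hq h b), eventually_differentiableAt (contDiffAt_up' hq h j b)] with y h1 h2 h3 h4
  have e1 : pb (up j b r) (loc ζ none) y = pb (bl b r) (pb (tubeMap j) (loc ζ none)) y :=
    pb_comp ((contDiff_tubeMap j).diff _) h3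
  rw [loc_up ζ h1 (mem_domJ_of_hUV h2) hr h4.continuousAt, e1, ← radSq_bl hr (b := b)]
  rfl

lemma exists_glue_bound (ζ : 𝓓 6) (j : Fin 10) : ∃ C : ℝ, 0 ≤ C ∧ ∀ δ : ℝ, 0 < δ → 3 * δ ≤ sqRadius / 2 →
    ∀ x ∈ regular, x ∈ orbTube j (3 * δ) → |extDeriv (glue (cutForm ζ δ)) x stdB| ≤ C / δ := by
  have hs : sqRadius < 1 := by norm_num [sqRadius]
  obtain ⟨K, hK, hKt⟩ := exists_top_le
  obtain ⟨M, hM, hMt⟩ := exists_lipschitz_tubeInv j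
  have hC : ∃ C : ℝ, 0 ≤ C ∧ ∀ b : Bool, ∀ δ : ℝ, 0 < δ → δ ≤ 1 → ∀ q ∈ boxUV (sqRadius / 2), q.2.2.1 ≠ 0 → hUV q ≤ 3 * δ →
        ‖extDeriv (fun q => cut (hUV q / δ) • loc ζ (some (j, b)) q) q‖ ≤ C / δ := by
    obtain ⟨C₀, h₀, hC₀⟩ := exists_chart_bound ζ j false
    obtain ⟨C₁, h₁, hC₁⟩ := exists_chart_bound ζ j true
    refine ⟨C₀ + C₁, by positivity, fun b δ h0 h1 q hq hu hqδ => ?_⟩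
    cases b
    · exact (hC₀ δ h0 h1 q hq hu hqδ).trans (by gcongr; linarith)
    · exact (hC₁ δ h0 h1 q hq hu hqδ).trans (by gcongr; linarith)
  obtain ⟨C, hC0, hC⟩ := hC
  set m : ℝ := ∑ i, ‖stdB i‖ with hm
  have hmi : ∀ i, ‖stdB i‖ ≤ m := fun i => Finset.single_le_sum (f := fun i => ‖stdB i‖) (fun _ _ => norm_nonneg _) (Finset.mem_univ i)
  have hm0 : 0 ≤ m := Finset.sum_nonneg fun _ _ => norm_nonneg _
  have hd : 0 < √|halfDet| := Real.sqrt_pos.2 (abs_pos.2 halfDet_ne)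
  refine ⟨K * (M * m) ^ 7 * (C * m ^ 7 / √|halfDet|), by positivity, fun δ h0 h3 x hx hxj => ?_⟩
  have hδ' : 2 * δ < sqRadius := by linarith
  obtain ⟨g₀, hg₀, hp₀⟩ := exists_tubeCo hxj
  obtain ⟨h, hh, σ, α, hT, hs1, hc1⟩ := exists_translate_bounded j (tubeCo j g₀ x).1 (tubeCo j g₀ x).2.1
  have hg : g₀ * h⁻¹ ∈ Gam := mul_mem hg₀ (inv_mem hh)
  set g := g₀ * h⁻¹ with hgd
  have hpe : tubeCo j g x = ((tubeCo j g₀ x).1 + σ, (1 : ℝ) * (tubeCo j g₀ x).2.1 + α, (tubeCo j g₀ x).2.2.1, (1 : ℝ) * (tubeCo j g₀ x).2.2.2) := by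
    rw [← tubeInv_tubeMap j (_, _, _, _), ← hT]
    have : g⁻¹ x = h (tubeMap j (tubeCo j g₀ x)) := by
      rw [hgd, mul_inv_rev, inv_inv, Equiv.Perm.mul_apply]
      congr 1
      rw [tubeCo, tubeMap_tubeInv]
    rw [tubeCo, this]
  have hrad : radSq (tubeCo j g x) = radSq (tubeCo j g₀ x) := by rw [hpe]; simp [radSq]
  have hp1 : (tubeCo j g x).1 ∈ Set.Icc (0 : ℝ) 1 := by rw [hpe]; exact hs1
  have hp2 : ‖(tubeCo j g x).2.1‖ ≤ 2 := by rw [hpe]; simpa using hc1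
  rw [← hrad] at hp₀
  set p := tubeCo j g x with hp
  obtain ⟨b, r, q, hqp, hu, hru, hv, hq1, hq2, hqr⟩ := exists_bl (radSq_ne_of_regular hx hg)
  have hr : r ≠ 0 := fun h0 => hu (by rw [← hru, h0]; simp)
  have hqs : hUV q < sqRadius := by rw [hqr]; linarith
  have hqbox : q ∈ boxUV (sqRadius / 2) := by
    have h5 : hUV q ≤ sqRadius / 2 := by rw [hqr]; linarith
    refine ⟨hq1 ▸ hp1, hq2 ▸ hp2, ?_, hv, h5⟩
    refine le_trans ?_ h5
    exact le_mul_of_one_le_right (norm_nonneg _) (by nlinarith [sq_nonneg ‖q.2.2.2‖])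
  have hda : DifferentiableAt ℝ (cutForm ζ δ j) p := (contDiffAt_cutForm ζ δ (tubeCo_regular hg hx)).diffAt
  have e1 := hC b δ h0 (by linarith) q hqbox hu (by rw [hqr]; linarith)
  have e2 : extDeriv (fun q => cut (hUV q / δ) • loc ζ (some (j, b)) q) q = pb (bl b r) (extDeriv (cutForm ζ δ j)) q := by
    rw [← (pb_bl_cutForm ζ δ hu hru hqs).extDeriv_eq, extDeriv_pb (by rw [hqp]; exact hda) (contDiffAt_bl hu hru b)]
  have e3 : |LinearMap.det (fderiv ℝ (bl b r) q : Space7 →ₗ[ℝ] Space7)| = √|halfDet| := by rw [← det_fderiv_bl (b := b) hu hru, abs_sq, Real.sqrt_sq_eq_abs]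
  have e4 : √|halfDet| * |extDeriv (cutForm ζ δ j) p stdB| ≤ C / δ * m ^ 7 := by
    rw [← e3, ← abs_mul, show p = bl b r q from hqp.symm, ← top_comp, ← Real.norm_eq_abs]
    change ‖pb (bl b r) (extDeriv (cutForm ζ δ j)) q stdB‖ ≤ _
    rw [← e2]
    refine (ContinuousAlternatingMap.le_opNorm _ _).trans (mul_le_mul e1 ?_ (Finset.prod_nonneg fun _ _ => norm_nonneg _) (by positivity))
    have := Finset.prod_le_prod (s := Finset.univ) (fun i _ => norm_nonneg (stdB i)) fun i _ => hmi i
    simpa using this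
  have e5 : ‖fderiv ℝ (tubeCo j g) x‖ ≤ M := by
    have hL : LipschitzWith M.toNNReal (tubeCo j g) := LipschitzWith.of_dist_le_mul fun y z => by
      rw [Real.coe_toNNReal _ hM.le]
      exact (hMt _ _).trans (by rw [(Gam_smooth (inv_mem hg)).2.dist_eq])
    have := norm_fderiv_le_of_lipschitz ℝ hL (x₀ := x)
    rwa [Real.coe_toNNReal _ hM.le] at this
  rw [extDeriv_glue (tubeInvariant_cutForm ζ δ) hg (show radSq p < sqRadius by rw [← hqr]; exact hqs) hda]
  have e6 := hKt (extDeriv (cutForm ζ δ j) p) (fun i => fderiv ℝ (tubeCo j g) x (stdB i)) (M * m) fun i =>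
    (ContinuousLinearMap.le_opNorm _ _).trans (mul_le_mul e5 (hmi i) (norm_nonneg _) hM.le)
  refine e6.trans ?_
  rw [mul_div_assoc]
  refine mul_le_mul_of_nonneg_left ?_ (by positivity)
  rw [div_div, le_div_iff₀ (by positivity)]
  rw [div_mul_eq_mul_div, le_div_iff₀ h0] at e4
  linarith

lemma d_sub_offForm_singular (ζ : 𝓓 k) {δ : ℝ} (hδ : 0 < δ) (hδ' : 2 * δ < sqRadius) {x} (hx : x ∉ regular) : loc (DiffForm.d ζ) none x - extDeriv (offForm ζ δ) x = 0 := by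
  obtain ⟨j, hj⟩ := mem_orbTube_of_singular hx hδ
  rw [loc_singular _ hx, zero_sub, neg_eq_zero]
  exact extDeriv_of_eventually_zero (((isOpen_orbTube j δ).mem_nhds hj |> fun h => Filter.Eventually.mono h
    fun y hy => offForm_zero ζ hδ hδ' hy))

open MeasureTheory in
lemma stokes (ζ : 𝓓 6) : ∫ y in cell, loc (DiffForm.d ζ) none (coord y) stdB = 0 := by
  by_cases hint : IntegrableOn (fun y => loc (DiffForm.d ζ) none (coord y) stdB) cell
  swap
  · exact integral_undef hint
  choose C hC hCb using exists_glue_bound ζ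
  choose V hV hVb using exists_volume_tube
  have hs : sqRadius = 1 / 256 := rfl
  have main : ∀ δ : ℝ, 0 < δ → 3 * δ ≤ sqRadius / 2 →
      |∫ y in cell, loc (DiffForm.d ζ) none (coord y) stdB| ≤ (∑ j, C j) * (∑ j, V j) * 9 * δ := by
    intro δ h0 h3
    have hδ' : 2 * δ < sqRadius := by linarith
    have hZ := contDiff_offForm ζ h0 hδ'
    have hD := integral_periodic hZ fun i x => periodic_of_invariant (fun g hg x => offForm_invariant ζ δ hg x) i x
    have hDi : IntegrableOn (fun y => extDeriv (offForm ζ δ) (coord y) stdB) cell := by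
      have : Continuous fun y => extDeriv (offForm ζ δ) (coord y) stdB :=
        (ContinuousAlternatingMap.apply ℝ Space7 ℝ stdB).continuous.comp ((contDiff_extDeriv hZ).continuous.comp coord.continuous)
      exact this.continuousOn.integrableOn_compact isCompact_cell
    have e : ∫ y in cell, loc (DiffForm.d ζ) none (coord y) stdB = ∫ y in cell, (loc (DiffForm.d ζ) none (coord y) - extDeriv (offForm ζ δ) (coord y)) stdB := by
      have := integral_sub hint hDi
      rw [hD, sub_zero] at this
      exact this.symm
    set S : Set (Fin 7 → ℝ) := ⋃ j, {y ∈ cell | coord y ∈ orbTube j (3 * δ)} with hS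
    have hSm : MeasurableSet S := MeasurableSet.iUnion fun j =>
      isCompact_cell.isClosed.measurableSet.inter ((isOpen_orbTube j (3 * δ)).preimage coord.continuous).measurableSet
    have hSc : S ⊆ cell := Set.iUnion_subset fun j y hy => hy.1
    have hSv : volume S ≤ ENNReal.ofReal ((∑ j, V j) * (3 * δ) ^ 2) := by
      refine (measure_iUnion_le _).trans ?_
      rw [tsum_fintype]
      refine (Finset.sum_le_sum fun j _ => hVb j (3 * δ) (by positivity) (by linarith)).trans ?_
      rw [← ENNReal.ofReal_sum_of_nonneg fun j _ => mul_nonneg (hV j) (sq_nonneg _), Finset.sum_mul]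
    rw [e, setIntegral_eq_of_subset_of_forall_sdiff_eq_zero isCompact_cell.isClosed.measurableSet hSc ?_]
    · have hb : ∀ y ∈ S, ‖(loc (DiffForm.d ζ) none (coord y) - extDeriv (offForm ζ δ) (coord y)) stdB‖ ≤ (∑ j, C j) / δ := by
        intro y hy
        obtain ⟨j, hj⟩ := Set.mem_iUnion.1 hy
        by_cases hr : coord y ∈ regular
        · rw [d_sub_offForm ζ h0 hδ' hr]
          refine (hCb j δ h0 h3 _ hr hj.2).trans (div_le_div_of_nonneg_right ?_ h0.le)
          exact Finset.single_le_sum (f := C) (fun j _ => hC j) (Finset.mem_univ j)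
        · rw [d_sub_offForm_singular ζ h0 hδ' hr]
          simpa using div_nonneg (Finset.sum_nonneg fun j _ => hC j) h0.le
      have h := norm_setIntegral_le_of_norm_le_const (hSv.trans_lt ENNReal.ofReal_lt_top) hb
      rw [Real.norm_eq_abs] at h
      have hVn : 0 ≤ (∑ j, V j) * (3 * δ) ^ 2 := mul_nonneg (Finset.sum_nonneg fun j _ => hV j) (sq_nonneg _)
      have hr := ENNReal.toReal_mono ENNReal.ofReal_ne_top hSv
      rw [ENNReal.toReal_ofReal hVn] at hr
      refine h.trans ((mul_le_mul_of_nonneg_left hr (div_nonneg (Finset.sum_nonneg fun j _ => hC j) h0.le)).trans (le_of_eq ?_))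
      field_simp
      ring
    · intro y hy
      rw [d_sub_offForm_zero ζ h0 hδ' fun j hj => hy.2 (Set.mem_iUnion.2 ⟨j, hy.1, hj⟩)]
      rfl
  by_contra hne
  set A := |∫ y in cell, loc (DiffForm.d ζ) none (coord y) stdB| with hA
  have hA0 : 0 < A := abs_pos.2 hne
  set B := (∑ j, C j) * (∑ j, V j) * 9
  have hB : 0 ≤ B := mul_nonneg (mul_nonneg (Finset.sum_nonneg fun j _ => hC j) (Finset.sum_nonneg fun j _ => hV j)) (by norm_num)
  have h1 := main (min (1 / 2048) (A / (2 * (B + 1)))) (lt_min (by norm_num) (by positivity))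
    (by have := min_le_left (1 / 2048 : ℝ) (A / (2 * (B + 1))); rw [hs]; linarith)
  have h2 : B * min (1 / 2048) (A / (2 * (B + 1))) ≤ B * (A / (2 * (B + 1))) := mul_le_mul_of_nonneg_left (min_le_right _ _) hB
  have h3 : B * (A / (2 * (B + 1))) < A := by
    rw [mul_div_assoc', div_lt_iff₀ (by positivity)]
    nlinarith
  linarith

end JK

namespace JK
open Complex
variable {k l : ℕ} {Q : ℝ} {p : Space7} {x : Space7}

/-! ### The wedge product of a form with a form which vanishes on its kernel -/

lemma wedgeAlt_kernel {E : Type*} [NormedAddCommGroup E] [NormedSpace ℝ E] (a : 𝓛 E k) (b : 𝓛 E l)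
    (v : Fin (k + l) → E) (ha : ∀ w : Fin k → E, ∀ i m, w m = v (Fin.natAdd k i) → a w = 0) : wedgeAlt a b v = a (v ∘ Fin.castAdd l) * b (v ∘ Fin.natAdd k) := by
  have h : wedgeAlg a b v = ∑ σ : Equiv.Perm.ModSumCongr (Fin k) (Fin l),
      LinearMap.mul' ℝ ℝ (AlternatingMap.domCoprod.summand a.toAlternatingMap b.toAlternatingMap σ (v ∘ finSumFinEquiv)) := by
    simp [wedgeAlg, AlternatingMap.domCoprod_apply, Function.comp_def]
  change wedgeAlg a b v = _
  refine h.trans ((Finset.sum_eq_single (Quotient.mk'' 1) ?_ ?_).trans ?_)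
  · intro σ _ hσ
    induction σ using Quotient.inductionOn' with | _ σ
    rw [AlternatingMap.domCoprod.summand_mk'']
    have h1 : ∃ m i, σ (Sum.inl m) = Sum.inr i := by
      by_contra! hc
      apply hσ
      refine Quotient.sound' ?_
      have : σ ∈ (Equiv.Perm.sumCongrHom (Fin k) (Fin l)).range := Equiv.Perm.mem_sumCongrHom_range_of_perm_mapsTo_inl (by
        rintro _ ⟨m, rfl⟩
        rcases hs : σ (Sum.inl m) with i | i
        · exact ⟨i, rfl⟩
        · exact absurd hs (hc m i))
      rw [QuotientGroup.leftRel_apply, mul_one]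
      exact inv_mem this
    obtain ⟨m, i, hmi⟩ := h1
    have h2 : a (fun m => v (finSumFinEquiv (σ (Sum.inl m)))) = 0 := ha _ i m (by rw [hmi, finSumFinEquiv_apply_right])
    have h3 : (LinearMap.mul' ℝ ℝ) ((a.toMultilinearMap.domCoprod b.toMultilinearMap).domDomCongr σ (v ∘ finSumFinEquiv)) = 0 := by
      change a (fun m => v (finSumFinEquiv (σ (Sum.inl m)))) * _ = 0
      rw [h2, zero_mul]
    rcases Int.units_eq_one_or (Equiv.Perm.sign σ) with e | e
    · rw [e, one_smul]; exact h3
    · rw [e, _root_.smul_apply, Units.neg_smul, one_smul, map_neg, neg_eq_zero]; exact h3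
  · exact fun h => absurd (Finset.mem_univ _) h
  · rw [AlternatingMap.domCoprod.summand_mk'']
    simp [Function.comp_def]

/-- The derivative of a power of the monodromy. -/
def deckLin (a b : ℂ) : Space7 →L[ℝ] Space7 :=
  LinearMap.toContinuousLinearMap
    { toFun := fun x => (x.1, a * x.2.1, a * x.2.2.1, b * x.2.2.2)
      map_add' := fun x y => by refine prod_ext₄ rfl ?_ ?_ ?_ <;> simp [mul_add]
      map_smul' := fun t x => by refine prod_ext₄ rfl ?_ ?_ ?_ <;> simp <;> ring }

lemma deckLin_apply (a b : ℂ) (x) : deckLin a b x = (x.1, a * x.2.1, a * x.2.2.1, b * x.2.2.2) := rfl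

lemma fderiv_deckF_zpow (m : ℤ) (x : Space7) : fderiv ℝ (deckF ^ m : Perm7) x = deckLin (I ^ m) ((-1) ^ m) := by
  have e : ((deckF ^ m : Perm7) : Space7 → Space7) = fun x => deckLin (I ^ m) ((-1) ^ m) x + ((m : ℝ), 0, 0, 0) := by
    funext x
    rw [deckF_zpow]
    simp [deckLin_apply]
  rw [e, fderiv_add_const, ContinuousLinearMap.fderiv]

lemma det_deckF_nonneg (m : ℤ) (x : Space7) : 0 ≤ LinearMap.det (fderiv ℝ (deckF ^ m : Perm7) x : Space7 →ₗ[ℝ] Space7) := by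
  obtain ⟨a, ha⟩ : ∃ a : ℂ, a ^ 2 = I ^ m := ⟨csqrt _, csqrt_sq _⟩
  obtain ⟨b, hb⟩ : ∃ b : ℂ, b ^ 2 = (-1) ^ m := ⟨csqrt _, csqrt_sq _⟩
  have e2 : (deckLin (I ^ m) ((-1) ^ m) : Space7 →ₗ[ℝ] Space7) = (deckLin a b : Space7 →ₗ[ℝ] Space7) ∘ₗ deckLin a b := by
    refine LinearMap.ext fun x => prod_ext₄ rfl ?_ ?_ ?_
    · change I ^ m * _ = a * (a * _); rw [← ha]; ring
    · change I ^ m * _ = a * (a * _); rw [← ha]; ring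
    · change (-1) ^ m * _ = b * (b * _); rw [← hb]; ring
  rw [fderiv_deckF_zpow, e2, LinearMap.det_comp]
  exact mul_self_nonneg _

def kapLin : Space7 →L[ℝ] Space7 :=
  LinearMap.toContinuousLinearMap
    { toFun := fun x => (-x.1, conj x.2.1, conj x.2.2.1, conj x.2.2.2)
      map_add' := fun x y => by refine prod_ext₄ ?_ ?_ ?_ ?_ <;> simp <;> ring
      map_smul' := fun t x => by refine prod_ext₄ ?_ ?_ ?_ ?_ <;> simp }

lemma kapLin_apply (x) : kapLin x = (-x.1, conj x.2.1, conj x.2.2.1, conj x.2.2.2) := rfl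

lemma fderiv_kappa (x : Space7) : fderiv ℝ kappa x = kapLin := by
  have e : (kappa : Space7 → Space7) = fun x => kapLin x + (1, 0, 0, 0) := by
    funext x
    refine prod_ext₄ ?_ ?_ ?_ ?_ <;> simp [kapLin_apply, kappa]
    ring
  rw [e, fderiv_add_const, ContinuousLinearMap.fderiv]

/-! ### Supports -/

lemma joinDens_nonpos (Q : ℝ) (p) : joinDens Q p ≤ 0 := by
  rw [← neg_nonneg, joinDens, ← intervalIntegral.integral_neg]
  exact intervalIntegral.integral_nonneg zero_le_one fun _ _ => neg_nonneg.2 (dens_nonpos _)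

lemma joinDens_ne (hQ : 1 / 2 ≤ Q) (h : perDens Q (p - (1 / 2 : ℝ) • joinVec) ≠ 0) : joinDens Q p ≠ 0 := by
  have hc : Continuous fun φ : ℝ => -perDens Q (p - φ • joinVec) :=
    ((contDiff_perDens hQ).continuous.comp (by fun_prop)).neg
  have := intervalIntegral.integral_pos zero_lt_one hc.continuousOn (fun _ _ => neg_nonneg.2 (dens_nonpos _))
    ⟨1 / 2, by norm_num, neg_pos.2 (lt_of_le_of_ne (dens_nonpos _) h)⟩
  rw [intervalIntegral.integral_neg, neg_pos] at this
  exact this.ne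

lemma re_of_perDens (h : perDens Q p ≠ 0) : ∃ n : ℤ, |p.2.2.1.re - 4 * n| < 1 / 16 := by
  have h0 : perDist Q p < 1 / 512 := by
    by_contra h'
    exact h (dens_large (not_lt.1 h'))
  have p2 := perSq_nonneg (1 / 2) p.2.2.1.im
  have p3 := perSq_nonneg Q p.2.2.2.re
  have p4 := perSq_nonneg Q p.2.2.2.im
  rw [perDist] at h0
  have h1 : perSq 4 p.2.2.1.re < 1 / 512 := by linarith
  obtain ⟨n, hn⟩ := exists_of_perSq_lt h1
  refine ⟨n, abs_lt_of_sq_lt_sq (by rw [← hn]; linarith) (by norm_num)⟩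

lemma re_of_joinDens (h : joinDens Q p ≠ 0) : ∃ φ : ℝ, 0 ≤ φ ∧ φ ≤ 1 ∧ ∃ n : ℤ, |p.2.2.1.re - φ - 4 * n| < 1 / 16 := by
  by_contra! hc
  apply h
  rw [joinDens, intervalIntegral.integral_congr (g := fun _ => 0)]
  · simp
  · intro φ hφ
    rw [Set.uIcc_of_le zero_le_one] at hφ
    by_contra h0
    obtain ⟨n, hn⟩ := re_of_perDens h0
    have e : (p - φ • joinVec).2.2.1.re = p.2.2.1.re - φ := by simp [joinVec]
    rw [e] at hn
    exact absurd hn (not_lt.2 (hc φ hφ.1 hφ.2 n))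

/-! ### The sign of the integrand -/

def sqZero : 𝓐 4 := nrmForm (1 / 2) 0 0 1 ((1 - I) / 2) (-1)
def sqOne : 𝓐 4 := nrmForm (1 / 2) 0 (1 / 4) 1 (-(1 + I) / 2) 1
def joinSix : 𝓐 3 := nrmJoin 1 (1 / 2) (1 / 4) (-I) 1 (-1)
def primSix : 𝓐 3 := flatPrim 1 (1 / 2) (1 / 4) (-I) 1 (-1)

lemma pb_nrm_apply (l c ξ ν s) (b : 𝓐 k) (x) (v) : pb (nrm l c ξ ν s) b x v = b (nrm l c ξ ν s x) fun i => nrmLin ξ ν s (v i) := by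
  rw [pb, (hasFDerivAt_nrm l c ξ ν s x).fderiv]; rfl

lemma joinSix_apply (x v) : joinSix x v = joinDens 1 (nrm (1 / 2) (1 / 4) (-I) 1 (-1) x) * vol4 (Matrix.vecCons joinVec fun i => nrmLin (-I) 1 (-1) (v i)) := by
  rw [joinSix, nrmJoin, pb_nrm_apply, joinForm_apply (by norm_num)]

lemma joinSix_zero {m : ℤ} (h : 4 * m + 25 / 16 ≤ x.1) (h' : x.1 ≤ 4 * m + 71 / 16) : joinSix x = 0 := by
  ext v
  rw [joinSix_apply]
  have : joinDens 1 (nrm (1 / 2) (1 / 4) (-I) 1 (-1) x) = 0 := by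
    by_contra hc
    obtain ⟨φ, h0, h1, n, hn⟩ := re_of_joinDens hc
    obtain ⟨h2, h3⟩ := abs_lt.1 hn
    simp only [nrm] at h2 h3
    have h4 : m < n := by
      by_contra hmn
      have : (n : ℝ) ≤ m := by exact_mod_cast not_lt.1 hmn
      linarith
    have h5 : (m : ℝ) + 1 ≤ n := by exact_mod_cast h4
    linarith
  rw [this, zero_mul]; rfl

/-- The density of the primitive near the wall `t = 0`. -/
def primDens (x : Space7) : ℝ := (1 / 2) * (joinDens 1 (nrm (1 / 2) (1 / 4) (-I) 1 (-1) ((deckF ^ (1 : ℤ)) x)) + joinDens 1 (nrm (1 / 2) (1 / 4) (-I) 1 (-1) (kappa x)))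

lemma primSix_near {n : ℤ} (h : |x.1 - 4 * n| < 1 / 16) (v) : primSix x v = (1 / 2) *
    (joinSix ((deckF ^ (1 : ℤ)) x) (fun i => deckLin I (-1) (v i)) + joinSix (kappa x) (fun i => kapLin (v i))) := by
  obtain ⟨h1, h2⟩ := abs_lt.1 h
  have z : ∀ (m : ℤ) (N : ℤ) (y : Space7), 4 * N + 25 / 16 ≤ y.1 + m → y.1 + m ≤ 4 * N + 71 / 16 → deckPull joinSix m y = 0 :=
    fun m N y h h' => pb_zero (joinSix_zero (m := N) (by rw [deckF_zpow]; exact h) (by rw [deckF_zpow]; exact h'))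
  have hk : (kappa x).1 = 1 - x.1 := rfl
  have e1 : deckSum joinSix 0 x = deckPull joinSix 1 x := by
    rw [deckSum, z 0 (n - 1) x (by push_cast; linarith) (by push_cast; linarith), z (0 + 2) n x (by push_cast; linarith) (by push_cast; linarith),
      z (0 + 3) n x (by push_cast; linarith) (by push_cast; linarith)]
    simp
  have e2 : deckSum joinSix 0 (kappa x) = joinSix (kappa x) := by
    rw [deckSum, z (0 + 1) (-n) _ (by rw [hk]; push_cast; linarith) (by rw [hk]; push_cast; linarith),
      z (0 + 2) (-n) _ (by rw [hk]; push_cast; linarith) (by rw [hk]; push_cast; linarith),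
      z (0 + 3) (-n) _ (by rw [hk]; push_cast; linarith) (by rw [hk]; push_cast; linarith), deckPull, zpow_zero, pb_id]
    simp
  change (1 / 2 : ℝ) * (deckSum joinSix 0 x v + deckSum joinSix 0 (kappa x) fun i => fderiv ℝ kappa x (v i)) = _
  rw [e1, e2, fderiv_kappa]
  change _ * (joinSix _ (fun i => fderiv ℝ (deckF ^ (1 : ℤ) : Perm7) x (v i)) + _) = _
  rw [fderiv_deckF_zpow, zpow_one, zpow_one, zpow_one]

/-- Vectors adapted to the component with index `0`, and to the one with index `1`. -/
def wallVec (σ : ℝ) : Fin 7 → Space7 :=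
  ![(1, 0, 0, 0), (0, 0, 0, 1), (0, ⟨1, σ⟩, 0, 0), (0, 0, ⟨1, σ⟩, 0), (0, 0, 0, I), (0, ⟨1, -σ⟩, 0, 0), (0, 0, ⟨1, -σ⟩, 0)]

lemma vol4_apply (v) : vol4 v = areaW ![v 0, v 1] * areaZ ![v 2, v 3] - areaW ![v 0, v 2] * areaZ ![v 1, v 3] +
      areaW ![v 0, v 3] * areaZ ![v 1, v 2] + areaW ![v 1, v 2] * areaZ ![v 0, v 3] -
      areaW ![v 1, v 3] * areaZ ![v 0, v 2] + areaW ![v 2, v 3] * areaZ ![v 0, v 1] := wedgeAlt_two_two_apply _ _ _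

lemma primSix_wallVec {n : ℤ} (h : |x.1 - 4 * n| < 1 / 16) {σ : ℝ} (hσ : σ = 1 ∨ σ = -1) : primSix x (wallVec σ ∘ Fin.natAdd 4) = primDens x := by
  rw [primSix_near h, joinSix_apply, joinSix_apply, primDens, vol4_apply, vol4_apply]
  simp only [areaW_apply, areaZ_apply]
  rcases hσ with rfl | rfl <;> simp [wallVec, nrmLin_apply, nrm, deckLin_apply, kapLin_apply, joinVec, Fin.natAdd] 

lemma sqZero_apply (x v) : sqZero x v = perDens (1 / 2) (nrm 0 0 1 ((1 - I) / 2) (-1) x) * vol4 fun i => nrmLin 1 ((1 - I) / 2) (-1) (v i) :=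
  pb_nrm_apply _ _ _ _ _ _ _ _
lemma sqOne_apply (x v) : sqOne x v = perDens (1 / 2) (nrm 0 (1 / 4) 1 (-(1 + I) / 2) 1 x) * vol4 fun i => nrmLin 1 (-(1 + I) / 2) 1 (v i) :=
  pb_nrm_apply _ _ _ _ _ _ _ _

lemma sqZero_wallVec (x) : sqZero x (wallVec 1 ∘ Fin.castAdd 3) = -perDens (1 / 2) (nrm 0 0 1 ((1 - I) / 2) (-1) x) := by
  rw [sqZero_apply, vol4_apply]
  simp only [areaW_apply, areaZ_apply]
  simp [wallVec, nrmLin_apply, nrm, Fin.castAdd, Fin.castLE]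
  norm_num

lemma sqOne_wallVec (x) : sqOne x (wallVec (-1) ∘ Fin.castAdd 3) = perDens (1 / 2) (nrm 0 (1 / 4) 1 (-(1 + I) / 2) 1 x) := by
  rw [sqOne_apply, vol4_apply]
  simp only [areaW_apply, areaZ_apply]
  simp [wallVec, nrmLin_apply, nrm, Fin.castAdd, Fin.castLE]


lemma primDens_nonpos (x) : primDens x ≤ 0 :=
  mul_nonpos_of_nonneg_of_nonpos (by norm_num) (add_nonpos (joinDens_nonpos _ _) (joinDens_nonpos _ _))

/-- The density of the difference of squares. -/
def wallDens (x : Space7) : ℝ := -(perDens (1 / 2) (nrm 0 0 1 ((1 - I) / 2) (-1) x) + perDens (1 / 2) (nrm 0 (1 / 4) 1 (-(1 + I) / 2) 1 x))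

lemma wedge_primSix_apply (x) : wedgeCLM Space7 4 3 (sqZero x - sqOne x) (primSix x) (wallVec 1) = wallDens x * primDens x := by
  have h0 : wedgeAlt (sqZero x) (primSix x) (wallVec 1) = sqZero x (wallVec 1 ∘ Fin.castAdd 3) * primSix x (wallVec 1 ∘ Fin.natAdd 4) := by
    refine wedgeAlt_kernel _ _ _ fun w i m hw => ?_
    rw [sqZero_apply, vol4.map_coord_zero m, mul_zero]
    rw [hw, nrmLin_apply]
    fin_cases i <;> apply space7_ext <;> simp [nrm, wallVec, Fin.natAdd] <;> norm_num
  have h1 : wedgeAlt (sqOne x) (primSix x) (wallVec (-1)) = sqOne x (wallVec (-1) ∘ Fin.castAdd 3) * primSix x (wallVec (-1) ∘ Fin.natAdd 4) := by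
    refine wedgeAlt_kernel _ _ _ fun w i m hw => ?_
    rw [sqOne_apply, vol4.map_coord_zero m, mul_zero]
    rw [hw, nrmLin_apply]
    fin_cases i <;> apply space7_ext <;> simp [nrm, wallVec, Fin.natAdd]
  have h2 : wedgeAlt (sqOne x) (primSix x) (wallVec 1) = wedgeAlt (sqOne x) (primSix x) (wallVec (-1)) := by
    have e : (wallVec (-1) : Fin 7 → Space7) = wallVec 1 ∘ (Equiv.swap (2 : Fin 7) 5 * Equiv.swap (3 : Fin 7) 6 : Equiv.Perm (Fin 7)) := by
      funext i
      fin_cases i <;> simp [wallVec, Equiv.swap_apply_def]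
    rw [e]
    exact (alternating_comp_perm_of_sign (n := 7) _ _ (by rw [Equiv.Perm.sign_mul, Equiv.Perm.sign_swap (by decide), Equiv.Perm.sign_swap (by decide)]; rfl) _).symm
  have e : wedgeCLM Space7 4 3 (sqZero x - sqOne x) (primSix x) (wallVec 1) = wedgeAlt (sqZero x) (primSix x) (wallVec 1) - wedgeAlt (sqOne x) (primSix x) (wallVec 1) := by
    rw [map_sub]; rfl
  rw [e, h2, h0, h1, sqZero_wallVec, sqOne_wallVec, wallDens]
  have hp : ∀ {Q l c ξ ν s}, l = 0 → perDens Q (nrm l c ξ ν s x) = 0 ∨ ∃ n : ℤ, |x.1 - 4 * n| < 1 / 16 := by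
    rintro Q l c ξ ν s rfl
    by_contra! hc
    obtain ⟨n, hn⟩ := re_of_perDens hc.1
    refine absurd hn (not_lt.2 ?_)
    simpa [nrm] using hc.2 n
  by_cases hn : ∃ n : ℤ, |x.1 - 4 * n| < 1 / 16
  · obtain ⟨n, hn⟩ := hn
    rw [primSix_wallVec hn (.inl rfl), primSix_wallVec hn (.inr rfl)]
    ring
  · rw [(hp rfl).resolve_right hn, (hp rfl).resolve_right hn]
    ring

lemma wallDens_nonneg (x) : 0 ≤ wallDens x := neg_nonneg.2 (add_nonpos (dens_nonpos _) (dens_nonpos _))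

/-- The integrand which detects the Massey product. -/
def detector (x : Space7) : Alt7 7 :=
  wedgeCLM Space7 4 3 (deckSum sqZero 0 x - deckSum sqOne 0 x) (primSix x)

lemma continuous_detector : Continuous detector := by
  have h1 := (contDiff_deckSum (frame_zero.contDiff_nrmForm 0 0) 0).sub (contDiff_deckSum (frame_one.contDiff_nrmForm 0 (1 / 4)) 0)
  exact ((wedgeCLM Space7 4 3).continuous.comp h1.continuous).clm_apply (contDiff_flatPrim frameAt_six).continuous

lemma detector_eq (x) : detector x stdB = ∑ m ∈ Finset.range 4, LinearMap.det (fderiv ℝ (deckF ^ (m : ℤ) : Perm7) x : Space7 →ₗ[ℝ] Space7) *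
      wedgeCLM Space7 4 3 (sqZero ((deckF ^ (m : ℤ)) x) - sqOne ((deckF ^ (m : ℤ)) x)) (primSix ((deckF ^ (m : ℤ)) x)) stdB := by
  have h : ∀ m : ℤ, wedgeCLM Space7 4 3 (deckPull sqZero m x - deckPull sqOne m x) (primSix x) stdB = LinearMap.det (fderiv ℝ (deckF ^ m : Perm7) x : Space7 →ₗ[ℝ] Space7) *
      wedgeCLM Space7 4 3 (sqZero ((deckF ^ m) x) - sqOne ((deckF ^ m) x)) (primSix ((deckF ^ m) x)) stdB := fun m => by
    rw [← top_comp]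
    conv_lhs => rw [show primSix = pb (deckF ^ m : Perm7) primSix from (pb_flatPrim frameAt_six _ (zpow_mem mem_F m)).symm]
    have := pb_wedge (f := (deckF ^ m : Perm7)) (a := fun y => sqZero y - sqOne y) (b := primSix) (x := x)
    exact (congrArg (fun A : Alt7 7 => A stdB) this).symm
  have e : deckSum sqZero 0 x - deckSum sqOne 0 x = (deckPull sqZero 0 x - deckPull sqOne 0 x) + (deckPull sqZero 1 x - deckPull sqOne 1 x) +
      (deckPull sqZero 2 x - deckPull sqOne 2 x) + (deckPull sqZero 3 x - deckPull sqOne 3 x) := by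
    simp only [deckSum, zero_add]; abel
  simp only [Finset.sum_range_succ, Finset.sum_range_zero, zero_add]
  rw [detector, e, map_add, map_add, map_add]
  exact congrArg₂ (· + ·) (congrArg₂ (· + ·) (congrArg₂ (· + ·) (h 0) (h 1)) (h 2)) (h 3)

lemma det_detector (x) : stdB.det (wallVec 1) * detector x stdB = ∑ m ∈ Finset.range 4, LinearMap.det (fderiv ℝ (deckF ^ (m : ℤ) : Perm7) x : Space7 →ₗ[ℝ] Space7) *
      (wallDens ((deckF ^ (m : ℤ)) x) * primDens ((deckF ^ (m : ℤ)) x)) := by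
  rw [detector_eq, Finset.mul_sum]
  refine Finset.sum_congr rfl fun m _ => ?_
  rw [mul_left_comm, mul_comm (stdB.det _)]
  exact congrArg _ ((top_apply _ _).symm.trans (wedge_primSix_apply _))

lemma det_detector_term (m : ℤ) (x) : LinearMap.det (fderiv ℝ (deckF ^ m : Perm7) x : Space7 →ₗ[ℝ] Space7) * (wallDens ((deckF ^ m) x) * primDens ((deckF ^ m) x)) ≤ 0 :=
  mul_nonpos_of_nonneg_of_nonpos (det_deckF_nonneg m x) (mul_nonpos_of_nonneg_of_nonpos (wallDens_nonneg _) (primDens_nonpos _))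

lemma det_detector_nonpos (x) : stdB.det (wallVec 1) * detector x stdB ≤ 0 := by
  rw [det_detector]
  exact Finset.sum_nonpos fun m _ => det_detector_term m x

lemma det_detector_neg : ∃ y ∈ cell, stdB.det (wallVec 1) * detector (coord y) stdB < 0 := by
  obtain ⟨h, hh⟩ := exists_dens_ne
  have h1 : 1 / 1024 ≤ h := by
    by_contra hc
    exact hh (dens_small (not_le.1 hc))
  have h2 : h < 1 / 512 := by
    by_contra hc
    exact hh (dens_large (not_lt.1 hc))
  have h0 : 0 ≤ h := by linarith
  have hs := Real.sq_sqrt h0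
  have hb : |√h| < 1 / 16 := abs_lt_of_sq_lt_sq (by rw [hs]; linarith) (by norm_num)
  have hb' := abs_lt.1 hb
  have hd : dens h < 0 := lt_of_le_of_ne (dens_nonpos _) hh
  set x : Space7 := (√h, 0, 0, ⟨0, 1 / 8⟩) with hx
  refine ⟨![√h, 0, 0, 0, 0, 0, 1 / 8], ⟨fun i => ?_, fun i => ?_⟩, ?_⟩
  · fin_cases i <;> simp
  · fin_cases i <;> simp <;> linarith
  change stdB.det (wallVec 1) * detector x stdB < 0
  have hq : ∀ {Q : ℝ}, 1 / 2 ≤ Q → ∀ p : Space7, p.2.2.1 = (√h : ℝ) → p.2.2.2 = 0 → perDens Q p = dens h := fun {Q} hQ p e1 e2 => by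
    have hz : |(0 : ℝ)| < 1 / 16 := by norm_num
    rw [perDens, perDist, e1, e2, ofReal_re, ofReal_im, zero_re, zero_im, perSq_small (by norm_num) hb, perSq_small le_rfl hz, perSq_small hQ hz, hs]
    simp
  have hw : 0 < wallDens x := by
    rw [wallDens, hq le_rfl _ (by apply Complex.ext <;> simp [nrm, hx]) (by apply Complex.ext <;> simp [nrm, hx])]
    have : perDens (1 / 2) (nrm 0 (1 / 4) 1 (-(1 + I) / 2) 1 x) ≤ 0 := dens_nonpos _
    linarith
  have hp : primDens x < 0 := by
    refine mul_neg_of_pos_of_neg (by norm_num) (add_neg_of_neg_of_nonpos (lt_of_le_of_ne (joinDens_nonpos _ _) (joinDens_ne (by norm_num) ?_))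
      (joinDens_nonpos _ _))
    rw [hq (by norm_num) _ ?_ ?_]
    · exact hh
    · rw [deckF_zpow]
      apply Complex.ext <;> simp [nrm, hx, joinVec] <;> ring
    · rw [deckF_zpow]
      apply Complex.ext <;> simp [nrm, hx, joinVec]
  rw [det_detector]
  refine Finset.sum_neg' (fun m _ => det_detector_term m x) ⟨0, by simp, ?_⟩
  have hdet : LinearMap.det (fderiv ℝ (deckF ^ ((0 : ℕ) : ℤ) : Perm7) x : Space7 →ₗ[ℝ] Space7) = 1 := by
    rw [fderiv_deckF_zpow, ← LinearMap.det_id (M := Space7) (A := ℝ)]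
    congr 1
    ext v <;> simp [deckLin_apply]
  rw [hdet, one_mul]
  exact mul_neg_of_pos_of_neg hw hp

open MeasureTheory in
lemma integral_detector_ne : ∫ y in cell, detector (coord y) stdB ≠ 0 := by
  set f : (Fin 7 → ℝ) → ℝ := fun y => -(stdB.det (wallVec 1) * detector (coord y) stdB) with hf
  have hc : Continuous f := (((ContinuousAlternatingMap.apply ℝ Space7 ℝ stdB).continuous.comp
    (continuous_detector.comp coord.continuous)).const_mul _).neg
  have hn : ∀ y, 0 ≤ f y := fun y => neg_nonneg.2 (det_detector_nonpos _)
  have hpos : 0 < ∫ y in cell, f y := by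
    refine (setIntegral_pos_iff_support_of_nonneg_ae (.of_forall hn) (hc.continuousOn.integrableOn_compact isCompact_cell)).2 ?_
    obtain ⟨y, hy, hy'⟩ := det_detector_neg
    set U : Set (Fin 7 → ℝ) := Set.univ.pi fun i => Set.Ioo 0 ((![4, 1, 1, 1, 1, 1, 1] : Fin 7 → ℝ) i)
    have hU : IsOpen U := isOpen_set_pi Set.finite_univ fun i _ => isOpen_Ioo
    have hyU : y ∈ closure U := by
      rw [closure_pi_set]
      intro i _
      have hT : (0 : ℝ) < (![4, 1, 1, 1, 1, 1, 1] : Fin 7 → ℝ) i := by fin_cases i <;> simp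
      refine (Set.ext_iff.1 (closure_Ioo hT.ne) _).2 ?_
      exact ⟨hy.1 i, hy.2 i⟩
    have hV : IsOpen (Function.support f) := hc.isOpen_support
    have hne : (Function.support f ∩ U).Nonempty := mem_closure_iff.1 hyU _ hV (neg_pos.2 hy').ne'
    exact ((hV.inter hU).measure_pos volume hne).trans_le (measure_mono (Set.inter_subset_inter_right _ fun z hz =>
      ⟨fun i => (hz i trivial).1.le, fun i => (hz i trivial).2.le⟩))
  intro h
  rw [hf, integral_neg, integral_const_mul, h, mul_zero, neg_zero] at hpos
  exact hpos.false

lemma loc_detector (x) : loc (DiffForm.wedge (DiffForm.wedge (thomForm 0) (thomForm 0) - DiffForm.wedge (thomForm 1) (thomForm 1))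
    (sqPrim frameAt_six)) none x = detector x := by
  rw [loc_wedge, loc_sub, loc_wedge, loc_wedge, detector, sqZero, sqOne, frameAt_zero.deckSum_eq_sq, frameAt_one.deckSum_eq_sq]
  by_cases h : ∃ j, x ∈ orbTube j (1 / 1024)
  · obtain ⟨j, hj⟩ := h
    rw [sq_glue_single 0 hj, sq_glue_single 1 hj]
    have e : ∀ j, wedgeCLM Space7 2 2 (loc (thomForm j) none x) (loc (thomForm j) none x) = 0 := fun j => by
      by_cases hx : x ∈ regular
      · rw [thomForm, (isGForm_thom j).loc_toForm hx, sq_glue_single j hj]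
      · rw [loc_singular _ hx, map_zero]
    rw [e, e, sub_zero, map_zero]
    rfl
  · have hx : x ∈ regular := by
      by_contra hx
      exact h (mem_orbTube_of_singular hx (by norm_num))
    rw [thomForm, thomForm, (isGForm_thom 0).loc_toForm hx, (isGForm_thom 1).loc_toForm hx, sqPrim, loc_descend _ _ hx (not_exists.1 h)]
    rfl

lemma d_ne_detector (ζ : 𝓓 6) : DiffForm.d ζ ≠ DiffForm.wedge (DiffForm.wedge (thomForm 0) (thomForm 0) - DiffForm.wedge (thomForm 1) (thomForm 1)) (sqPrim frameAt_six) := by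
  intro hζ
  refine integral_detector_ne ?_
  have h := stokes ζ
  simp only [hζ] at h
  exact (integral_congr_ae (.of_forall fun y =>
    congrArg (fun A : Alt7 7 => A stdB) (loc_detector (coord y)).symm)).trans h

end JK

namespace JK
open Complex Equiv
variable {k l : ℕ}

section Wedge
variable {E : Type*} [NormedAddCommGroup E] [NormedSpace ℝ E]

lemma finAddFlip_symm_four_three (i : Fin (3 + 4)) : (finAddFlip.symm i : Fin (4 + 3)) =
    Fin.cast rfl (((finRotate (3 + 4) * finRotate (3 + 4)) * (finRotate (3 + 4) * finRotate (3 + 4))) i) := by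
  revert i; decide

lemma wedgeAlt_comm_four_three (a : 𝓛 E 4) (b : 𝓛 E 3) : (wedgeAlt (k := 4) (l := 3) a b : 𝓛 E 7) = wedgeAlt (k := 3) (l := 4) b a := by
  ext v
  exact wedgeAlt_comm_of_perm (k := 4) (l := 3) (by rfl) _ (by rw [Perm.sign_mul, sign_finRotate_sq, one_mul])
    finAddFlip_symm_four_three a b v

end Wedge
end JK

namespace DiffForm
variable {E : Type*} [NormedAddCommGroup E] [NormedSpace ℝ E] {M : Type*} [TopologicalSpace M] [ChartedSpace E M]

lemma wedge_comm_four_three (α : DiffForm E M 4) (β : DiffForm E M 3) : 𝓦 4 3 α β = (𝓦 3 4 β α : DiffForm E M 7) :=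
  Subtype.ext (funext fun _ => funext fun _ => JK.wedgeAlt_comm_four_three _ _)

/-! ### A Massey product of sums and differences -/

variable {T₀ T₁ T₂ T₆ : DiffForm E M 2}

lemma wedge_add_sub (h : wedge T₀ T₁ = 0) : wedge (T₀ + T₁) (T₀ - T₁) = wedge T₀ T₀ - wedge T₁ T₁ := by
  rw [wedge_add_left, wedge_sub_right, wedge_sub_right, h, wedge_comm_two_two T₁ T₀, h]
  module

variable [IsManifold 𝓘(ℝ, E) ∞ M]

lemma masseyDefined_add_sub (c₀ : d T₀ = 0) (c₁ : d T₁ = 0) (c₂ : d T₂ = 0) (c₆ : d T₆ = 0) (h₀₂ : wedge T₀ T₂ = 0)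
    (h₀₆ : wedge T₀ T₆ = 0) (h₁₂ : wedge T₁ T₂ = 0) (h₁₆ : wedge T₁ T₆ = 0) (h₆₂ : wedge T₆ T₂ = 0)
    {Ψ : DiffForm E M 3} (hΨ : d Ψ = wedge T₆ T₆ - wedge T₂ T₂) : MasseyDefined (T₀ + T₁) (T₆ + T₂) (T₆ - T₂) := by
  refine ⟨⟨by rw [map_add, c₀, c₁, add_zero], by rw [map_add, c₆, c₂, add_zero], by rw [d_sub, c₆, c₂]; module⟩, ⟨(0 : DiffForm E M 3), ?_⟩, ⟨Ψ, ?_⟩⟩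
  · rw [wedge_add_left, wedge_add_right, wedge_add_right, h₀₂, h₀₆, h₁₂, h₁₆, add_zero, add_zero]
    exact map_zero _
  · rw [wedge_add_sub h₆₂, ← hΨ]

lemma exists_d_of_masseyVanishes (c₀ : d T₀ = 0) (c₁ : d T₁ = 0) (h₀₁ : wedge T₀ T₁ = 0) (h₀₂ : wedge T₀ T₂ = 0)
    (h₀₆ : wedge T₀ T₆ = 0) (h₁₂ : wedge T₁ T₂ = 0) (h₁₆ : wedge T₁ T₆ = 0) (h₆₂ : wedge T₆ T₂ = 0)
    {Ψ Ψ' : DiffForm E M 3} (hΨ : d Ψ = wedge T₆ T₆ - wedge T₂ T₂) (hΨ' : d Ψ' = wedge T₀ T₀ - wedge T₁ T₁)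
    (h : MasseyVanishes (T₀ + T₁) (T₆ + T₂) (T₆ - T₂)) : ∃ ζ : DiffForm E M 6, d ζ = 𝓦 4 3 (wedge T₀ T₀ - wedge T₁ T₁) Ψ := by
  obtain ⟨ξ, ζ, -, hζ, β, γ, hβ, -, ⟨η, hη⟩⟩ := h
  have z : wedge (T₆ - T₂) (T₀ - T₁) = 0 := by rw [wedge_comm_two_two, wedge_sub_left, wedge_sub_right, wedge_sub_right, h₀₂, h₀₆, h₁₂, h₁₆]; module
  have s : wedge (T₀ + T₁) (T₀ - T₁) = d Ψ' := by rw [wedge_add_sub h₀₁, hΨ']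
  have cb : d (T₀ - T₁) = 0 := by rw [d_sub, c₀, c₁]; module
  have h1 : d (k := 6) (𝓦 4 2 η (T₀ - T₁)) = -𝓦 3 4 (ζ + β) (d Ψ') := by
    rw [d_wedge_four_two, cb, wedge_zero_right]
    refine (add_zero (𝓦 5 2 (d η) (T₀ - T₁))).trans ?_
    rw [hη, masseyCocycle, wedge_comm_two_three]
    have e : ∀ (a : DiffForm E M 3) (b : DiffForm E M 2), 𝓦 5 2 (𝓦 3 2 a b) (T₀ - T₁) =
      (𝓦 3 4 a (𝓦 2 2 b (T₀ - T₁)) : DiffForm E M 7) := fun a b => wedge_assoc_three_two_two a b _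
    rw [wedge_sub_left (k := 5) (l := 2), wedge_sub_left (k := 5) (l := 2), wedge_add_left (k := 5) (l := 2), e, e, e, e, z, s,
      wedge_zero_right (k := 3) (l := 4), wedge_zero_right (k := 3) (l := 4), wedge_add_left (k := 3) (l := 4)]
    abel
  have h2 : d (k := 6) (𝓦 3 3 (ζ + β - Ψ) Ψ') = -𝓦 3 4 (ζ + β - Ψ) (d Ψ') := by
    have e : d (ζ + β - Ψ) = 0 := by rw [d_sub, map_add, hζ, hβ, wedge_add_sub h₆₂, hΨ]; module
    rw [d_wedge_three_three, e, wedge_zero_left (k := 4) (l := 3)]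
    exact zero_sub (𝓦 3 4 (ζ + β - Ψ) (d Ψ'))
  refine ⟨𝓦 3 3 (ζ + β - Ψ) Ψ' - 𝓦 4 2 η (T₀ - T₁), ?_⟩
  rw [d_sub, h1, h2, ← hΨ', wedge_comm_four_three, wedge_sub_left (k := 3) (l := 4)]
  module

end DiffForm

namespace JK
open Complex
variable {k l : ℕ}

lemma wedge_thomForm {i j : Fin 10} (h : i ≠ j) : DiffForm.wedge (thomForm i) (thomForm j) = 0 := by
  refine ext_regular fun x hx => ?_
  rw [loc_wedge, thomForm, thomForm, (isGForm_thom i).loc_toForm hx, (isGForm_thom j).loc_toForm hx]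
  change _ = loc (0 : 𝓓 4) none x
  rw [loc_zero]
  by_cases hk : ∃ k, x ∈ orbTube k sqRadius
  · obtain ⟨k, hk⟩ := hk
    obtain ⟨g, hg, hp⟩ := exists_tubeCo hk
    rw [glue_eq (tubeInvariant_thom i) hg hp, glue_eq (tubeInvariant_thom j) hg hp, ← pb_wedge]
    refine pb_zero ?_
    by_cases hki : k = i
    · rw [single_ne (j := k) (j₀ := j) fun hkj => h (hki.symm.trans hkj)]
      exact map_zero _
    · rw [single_ne hki]
      simp
  · rw [glue_eq_zero (not_exists.1 hk), map_zero]
    rfl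

lemma massey_of_isThomForm (τ₁ τ₂ τ₃ τ₇ : 𝓓 2)
      (t₁ : IsThomForm 0 τ₁) (t₂ : IsThomForm 1 τ₂) (t₃ : IsThomForm 2 τ₃) (t₇ : IsThomForm 6 τ₇) : DiffForm.MasseyDefined (τ₁ + τ₂) (τ₇ + τ₃) (τ₇ - τ₃) ∧
        ¬ DiffForm.MasseyVanishes (τ₁ + τ₂) (τ₇ + τ₃) (τ₇ - τ₃) := by
  have c : ∀ j, DiffForm.d (thomForm j) = 0 := fun j => (isThomForm_thomForm j).1
  have w : ∀ {i j : Fin 10}, i ≠ j → DiffForm.wedge (thomForm i) (thomForm j) = 0 := wedge_thomForm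
  have hd := DiffForm.masseyDefined_add_sub (c 0) (c 1) (c 2) (c 6) (w (by decide)) (w (by decide)) (w (by decide)) (w (by decide))
    (w (by decide)) d_sqPrim_six_two
  have hv : ¬ DiffForm.MasseyVanishes (thomForm 0 + thomForm 1) (thomForm 6 + thomForm 2) (thomForm 6 - thomForm 2) := fun h =>
    let ⟨ζ, hζ⟩ := DiffForm.exists_d_of_masseyVanishes (c 0) (c 1) (w (by decide)) (w (by decide)) (w (by decide)) (w (by decide))
      (w (by decide)) (w (by decide)) d_sqPrim_six_two d_sqPrim_zero_one h
    d_ne_detector ζ hζ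
  have e : ∀ {j τ}, IsThomForm j τ → ∃ η : 𝓓 1, τ = thomForm j + DiffForm.d η := fun {j τ} h => by
    obtain ⟨η, hη⟩ := h.isExact_sub (isThomForm_thomForm j)
    exact ⟨η, by rw [hη]; module⟩
  obtain ⟨a, rfl⟩ := e t₁
  obtain ⟨b, rfl⟩ := e t₂
  obtain ⟨p, rfl⟩ := e t₃
  obtain ⟨q, rfl⟩ := e t₇
  have e1 : thomForm 0 + DiffForm.d a + (thomForm 1 + DiffForm.d b) = thomForm 0 + thomForm 1 + DiffForm.d (a + b) := by rw [map_add]; abel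
  have e2 : thomForm 6 + DiffForm.d q + (thomForm 2 + DiffForm.d p) = thomForm 6 + thomForm 2 + DiffForm.d (q + p) := by rw [map_add]; abel
  have e3 : thomForm 6 + DiffForm.d q - (thomForm 2 + DiffForm.d p) = thomForm 6 - thomForm 2 + DiffForm.d (q - p) := by rw [DiffForm.d_sub]; module
  rw [e1, e2, e3]
  have hd' := hd.congr (a + b) (q + p) (q - p)
  refine ⟨hd', fun h => hv ?_⟩
  have := h.congr (-(a + b)) (-(q + p)) (-(q - p)) hd'.1.1 hd'.1.2.1 hd'.1.2.2
  have f : ∀ (A : 𝓓 2) (x : 𝓓 1), A + DiffForm.d x + DiffForm.d (-x) = A := fun A x => by rw [DiffForm.d_neg]; module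
  rwa [f, f, f] at this

end JK

end


theorem mainTheorem4 :
    -- every exceptional divisor has a Thom form
    (∀ j : Fin 10, ∃ τ : DiffForm Space7 JK.Resolution 2, JK.IsThomForm j τ) ∧
    -- the Massey product `⟨[τ₁ + τ₂], [τ₇ + τ₃], [τ₇ - τ₃]⟩` is defined and does not vanish
    (∀ τ₁ τ₂ τ₃ τ₇ : DiffForm Space7 JK.Resolution 2,
      JK.IsThomForm 0 τ₁ → JK.IsThomForm 1 τ₂ → JK.IsThomForm 2 τ₃ → JK.IsThomForm 6 τ₇ →
        DiffForm.MasseyDefined (τ₁ + τ₂) (τ₇ + τ₃) (τ₇ - τ₃) ∧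
        ¬ DiffForm.MasseyVanishes (τ₁ + τ₂) (τ₇ + τ₃) (τ₇ - τ₃)) ∧
    ¬ IsFormal Space7 JK.Resolution := by
  refine ⟨fun j => ⟨_, JK.isThomForm_thomForm j⟩, fun _ _ _ _ h₁ h₂ h₃ h₇ => JK.massey_of_isThomForm _ _ _ _ h₁ h₂ h₃ h₇, fun hf => ?_⟩
  have h := JK.massey_of_isThomForm _ _ _ _ (JK.isThomForm_thomForm 0) (JK.isThomForm_thomForm 1) (JK.isThomForm_thomForm 2)
    (JK.isThomForm_thomForm 6)
  exact h.2 (DiffForm.masseyVanishes_of_isFormal hf h.1)
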